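/- Proposition 2 (Gentle tomography). Let $d\ge 2$ and $0<s<1/2$ be fixed, let $\{\sigma_k\}_{k=1}^{d^2-1}$ be an orthonormal ($\operatorname{tr}\sigma_j\sigma_k=\delta_{jk}$) basis of the traceless Hermitian $d\times d$ matrices, and for each $k$ let $\{|v^{(k)}_i\rangle\}_{i=1}^d$ be an orthonormal eigenbasis of $\sigma_k$. Consider the following procedure on $n$ qudits of dimension $d$. Put $l=\lfloor n/(d(d^2-1))\rfloor$ and $m=\lceil l^s\rceil$, and choose $d(d^2-1)$ disjoint blocks of $l$ qudits each, indexed by the pairs $(i,k)$. For each block, independently, draw $m-1$ independent uniform cut points from $\{0,\dots,l\}$ and sort them to boundaries $0=b_0\le b_1\le\dots\le b_{m-1}\le b_m=l+1$ (if $l=0$ there are no cut points, and there is one bin). With $\phi=v^{(k)}_i$, let $M_t$ be the projector of the block onto $\phi$ occurring exactly $t$ times, that is, $M_t=\sum_{x\in\{0,1\}^l,\,|x|=t}\bigotimes_{q}\bigl(x_q|\phi\rangle\langle\phi|+(1-x_q)(I-|\phi\rangle\langle\phi|)\bigr)$, and perform the projective measurement with projectors $M'_j=\sum_{b_{j-1}\le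 t<b_j}M_t$. Finally find, as a solution of a semidefinite program, a density matrix $\tilde\rho$ that is consistent with all measured bins: $b_{j-1}\le l\,\langle\phi|\tilde\rho|\phi\rangle\le b_j$ for the bin $[b_{j-1},b_j)$ measured on each block. When the procedure is applied to $\rho^{\otimes n}$ with a density matrix $\rho$, say that it succeeds if for each block, with $\alpha=\langle\phi|\rho|\phi\rangle$, (i) no cut point is within $l^{1/2}\ln l$ of $l\alpha$; (ii) there are boundaries (among $b_0,\dots,b_m$) in $[l\alpha-l^{1-s}\ln l,\ l\alpha]$ and in $(l\alpha,\ l\alpha+l^{1-s}\ln l]$; (iii) the measured bin $[b_{j-1},b_j)$ contains $l\alpha$. Otherwise it fails. There are a constant $C>0$ and a polynomial $p$, depending only on $d$ and $s$, such that for every such choice of the $\sigma_k$ and $v^{(k)}_i$: (a) Running time. There is a program which, given $n$ and $m$, performs the procedure in time at most $p(n)$ for every $n$, using at most $p(n)$ work qudits that start in the state $|0\rangle$ and are returned to it: each choice of cut points and each combination of measured bins is reported by the program, with exactly the probability and the post-measurement state (also for inputs entangled with a reference) that the procedure prescribes, and whenever the procedure succeeds, the program outputs a density matrix $\tilde\rho$,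 as a matrix of integers over a common denominator, that solves the semidefinite program. Here a program is a random access program of constant size, charged for the lengths of the numbers involved, that can draw uniform integers, apply classical reversible gates to a constant number of qudits, possibly controlled by another qudit being in one of the states $|v_i^{(k)}\rangle$, and measure single qudits in the computational basis. The coordinates of the $v_i^{(k)}$ are available to it to any precision $1/q$, charged by the lengths of $q$ and of the answer. (b) Failure. For all $n\ge2$ and all density matrices $\rho$, the procedure applied to $\rho^{\otimes n}$ fails with probability at most $C\,n^{s-1/2}\ln n$. (c) Success. For all $n\ge2$ and all density matrices $\rho$, whenever the procedure succeeds, the disturbance is at most $C\,n^{-2}$, a density matrix $\tilde\rho$ consistent with all measured bins exists, and every such $\tilde\rho$ satisfies $\|\rho-\tilde\rho\|_1\le C\,n^{-s}\ln n$. Here the disturbance is $1-|\langle\varphi|\varphi'\rangle|$ for an arbitrary purification $|\varphi\rangle$ of $\rho^{\otimes n}$, where $|\varphi'\rangle=\pi|\varphi\rangle/\|\pi|\varphi\rangle\|$ and $\pi$ is the product of the projectors $M'_j$ of the measured bins. -/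

import Mathlib

open scoped BigOperators Matrix ComplexOrder

noncomputable section

namespace GentleTomography

/-! ### States and product operators on qudits -/

/-- Operators on `n` qudits of dimension `d`, as matrices in the computational basis. -/
abbrev Op (d n : ℕ) := Matrix (Fin n → Fin d) (Fin n → Fin d) ℂ

/-- Density matrices. -/
def IsState {d : ℕ} (ρ : Matrix (Fin d) (Fin d) ℂ) : Prop :=
  ρ.PosSemidef ∧ ρ.trace = 1

/-- The tensor product `A 0 ⊗ A 1 ⊗ ⋯ ⊗ A (n-1)`. -/
def prodOp {d n : ℕ} (A : Fin n → Matrix (Fin d) (Fin d) ℂ) : Op d n :=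
  Matrix.of fun x y => ∏ q, A q (x q) (y q)

/-- `ρ^{⊗ n}`. -/
def tensorPower {d : ℕ} (ρ : Matrix (Fin d) (Fin d) ℂ) (n : ℕ) : Op d n :=
  prodOp fun _ => ρ

/-- `|φ⟩⟨φ|`. -/
def ketbra {d : ℕ} (φ : Fin d → ℂ) : Matrix (Fin d) (Fin d) ℂ :=
  Matrix.vecMulVec φ (star φ)

/-- `⟨φ|ρ|φ⟩` (real for Hermitian `ρ`). -/
def expect {d : ℕ} (φ : Fin d → ℂ) (ρ : Matrix (Fin d) (Fin d) ℂ) : ℝ :=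
  (star φ ⬝ᵥ (ρ *ᵥ φ)).re

/-- The trace norm: the sum of the singular values. -/
def traceNorm {d : ℕ} (A : Matrix (Fin d) (Fin d) ℂ) : ℝ :=
  ∑ i, Real.sqrt ((Matrix.isHermitian_conjTranspose_mul_self A).eigenvalues i)

/-- An orthonormal (for `tr σ τ`) basis `σ 0, …, σ (d ^ 2 - 2)` of the traceless Hermitian
`d × d` matrices, together with a diagonalization of every one of its elements. -/
structure TomographyBasis (d : ℕ) where
  σ : Fin (d ^ 2 - 1) → Matrix (Fin d) (Fin d) ℂ
  hermitian : ∀ k, (σ k).IsHermitian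
  traceless : ∀ k, (σ k).trace = 0
  orthonormal : ∀ j k, (σ j * σ k).trace = if j = k then 1 else 0
  eig : Fin (d ^ 2 - 1) → Fin d → ℝ
  vec : Fin (d ^ 2 - 1) → Fin d → Fin d → ℂ
  vec_orthonormal : ∀ k i j, star (vec k i) ⬝ᵥ vec k j = if i = j then 1 else 0
  spectral : ∀ k, σ k = ∑ i, (eig k i : ℂ) • ketbra (vec k i)

/-! ### Blocks, bins, and the gentle measurement -/

/-- The number of blocks, one for each eigenvector of each basis element. -/
abbrev numBlocks (d : ℕ) : ℕ := d * (d ^ 2 - 1)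

/-- The length of a block. -/
def blockLen (d n : ℕ) : ℕ := n / numBlocks d

/-- The eigenvector that is measured on block `β`; `β` enumerates the pairs `(i, k)`. -/
def TomographyBasis.phi {d : ℕ} (B : TomographyBasis d) (β : Fin (numBlocks d)) : Fin d → ℂ :=
  B.vec (finProdFinEquiv.symm β).2 (finProdFinEquiv.symm β).1

/-- The positions of block `β` among the `n` qudits (the remainder is in no block). -/
def block (d n : ℕ) (β : Fin (numBlocks d)) : Finset (Fin n) :=
  Finset.univ.filter fun q =>
    (β : ℕ) * blockLen d n ≤ (q : ℕ) ∧ (q : ℕ) < ((β : ℕ) + 1) * blockLen d n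

/-- The number `m` of bins for a block of length `l`: `l ^ s`, rounded up. -/
def numBins (s : ℝ) (l : ℕ) : ℕ := ⌈(l : ℝ) ^ s⌉₊

/-- The boundaries `0 = b_0 ≤ b_1 ≤ ⋯ ≤ b_r ≤ b_{r+1} = l + 1` obtained by sorting the `r`
sampled cut points. There are `r + 1` bins. -/
def boundary {l r : ℕ} (b : Fin r → Fin (l + 1)) : Fin (r + 2) → ℕ :=
  Fin.cons (α := fun _ => ℕ) 0
    (Fin.snoc (α := fun _ => ℕ) (fun i : Fin r => ((b (Tuple.sort b i) : Fin (l + 1)) : ℕ)) (l + 1))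

/-- Lower end of bin `j` (the bin is `{k | binLo b j ≤ k < binHi b j}`). -/
def binLo {l r : ℕ} (b : Fin r → Fin (l + 1)) (j : Fin (r + 1)) : ℕ := boundary b j.castSucc

/-- Upper end of bin `j`. -/
def binHi {l r : ℕ} (b : Fin r → Fin (l + 1)) (j : Fin (r + 1)) : ℕ := boundary b j.succ

/-- The projector onto `φ` occurring exactly `k` times at the positions in `S`. -/
def countProj {d n : ℕ} (S : Finset (Fin n)) (φ : Fin d → ℂ) (k : ℕ) : Op d n :=
  ∑ T ∈ S.powersetCard k,
    prodOp fun q => if q ∈ T then ketbra φ else if q ∈ S then 1 - ketbra φ else 1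

/-- The gentle measurement: the projector onto bin `j`. -/
def binProj {d n l r : ℕ} (S : Finset (Fin n)) (φ : Fin d → ℂ)
    (b : Fin r → Fin (l + 1)) (j : Fin (r + 1)) : Op d n :=
  ∑ k ∈ Finset.Ico (binLo b j) (binHi b j), countProj S φ k

/-- `r` cut points in `{0, …, l}` for each block. -/
abbrev Cuts (d n r : ℕ) := Fin (numBlocks d) → Fin r → Fin (blockLen d n + 1)

/-- A measured bin for each block. -/
abbrev Outcomes (d r : ℕ) := Fin (numBlocks d) → Fin (r + 1)

/-- The projector for measuring all the blocks with outcomes `j` (the factors act on different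
blocks, so they commute). -/
def outcomeProj {d n r : ℕ} (B : TomographyBasis d) (b : Cuts d n r) (j : Outcomes d r) :
    Op d n :=
  ((List.finRange (numBlocks d)).map fun β =>
    binProj (block d n β) (B.phi β) (b β) (j β)).prod

/-- Success of the gentle measurement of one block of length `l` with cut points `b` and measured
bin `j`, where `a = ⟨φ|ρ|φ⟩`:
no cut point is within `√l ln l` of `l a`; on either side of `l a` there is a boundary within
`l ^ (1 - s) ln l`; the measured bin contains `l a`. -/
def BlockSuccess (s a : ℝ) {l r : ℕ} (b : Fin r → Fin (l + 1)) (j : Fin (r + 1)) : Prop :=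
  (∀ i, Real.sqrt l * Real.log l < |((b i : ℕ) : ℝ) - l * a|) ∧
  (∃ i, (boundary b i : ℝ) ≤ l * a ∧
    l * a - (l : ℝ) ^ (1 - s) * Real.log l ≤ (boundary b i : ℝ)) ∧
  (∃ i, l * a < (boundary b i : ℝ) ∧
    (boundary b i : ℝ) ≤ l * a + (l : ℝ) ^ (1 - s) * Real.log l) ∧
  ((binLo b j : ℝ) ≤ l * a ∧ l * a < (binHi b j : ℝ))

/-- The tomography succeeds when the measurement of every block does. -/
def Success {d n r : ℕ} (B : TomographyBasis d) (s : ℝ) (ρ : Matrix (Fin d) (Fin d) ℂ)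
    (b : Cuts d n r) (j : Outcomes d r) : Prop :=
  ∀ β, BlockSuccess s (expect (B.phi β) ρ) (b β) (j β)

open Classical in
/-- The probability of failure on `ρ^{⊗ n}`, when all cut points are independent and uniform and
the outcomes follow the Born rule. -/
def failureProb {d : ℕ} (B : TomographyBasis d) (s : ℝ) (n r : ℕ)
    (ρ : Matrix (Fin d) (Fin d) ℂ) : ℝ :=
  ∑ b : Cuts d n r, (1 / (Fintype.card (Cuts d n r) : ℝ)) *
    ∑ j : Outcomes d r, if Success B s ρ b j then 0
      else (outcomeProj B b j * tensorPower ρ n).trace.re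

/-- A bipartite pure state is given by its matrix of coefficients `Φ` (rows: the system `A`,
columns: the reference `R`). This is the normalized state after `A` was projected by `π`. -/
def postMeasurement {d n e : ℕ} (π : Op d n) (Φ : Matrix (Fin n → Fin d) (Fin e) ℂ) :
    Matrix (Fin n → Fin d) (Fin e) ℂ :=
  (((Real.sqrt ((π * Φ)ᴴ * (π * Φ)).trace.re)⁻¹ : ℝ) : ℂ) • (π * Φ)

/-- `Φ` is a purification of `X`: tracing out the reference leaves `X`. -/
def IsPurification {d n e : ℕ} (Φ : Matrix (Fin n → Fin d) (Fin e) ℂ) (X : Op d n) : Prop :=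
  Φ * Φᴴ = X

/-- The disturbance `1 - |⟨Φ|Φ'⟩|`, with `Φ'` the normalized state after the measurement. -/
def disturbance {d n e : ℕ} (π : Op d n) (Φ : Matrix (Fin n → Fin d) (Fin e) ℂ) : ℝ :=
  1 - ‖(Φᴴ * postMeasurement π Φ).trace‖

/-- `τ` solves the semidefinite program: it is a density matrix consistent with all
measured bins. -/
def SolvesSDP {d n r : ℕ} (B : TomographyBasis d) (b : Cuts d n r) (j : Outcomes d r)
    (τ : Matrix (Fin d) (Fin d) ℂ) : Prop :=
  IsState τ ∧ ∀ β, (binLo (b β) (j β) : ℝ) ≤ blockLen d n * expect (B.phi β) τ ∧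
    blockLen d n * expect (B.phi β) τ ≤ (binHi (b β) (j β) : ℝ)

/-! ### The machine model

A random access machine with logarithmic cost, working on natural numbers stored in arrays, that
can sample uniformly, apply elementary quantum gates to an array of qudits, and measure
single qudits. Programs are finite objects, with loops whose number of iterations is computed
when the loop is entered. -/

/-- Arithmetic operations (subtraction is truncated). -/
inductive BinOp where
  | add | sub | mul | div | mod

/-- Evaluation of an arithmetic operation. -/
def BinOp.eval : BinOp → ℕ → ℕ → ℕ
  | .add, x, y => x + y
  | .sub, x, y => x - y
  | .mul, x, y => x * y
  | .div, x, y => x / y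
  | .mod, x, y => x % y

/-- Expressions: literals, array cells, arithmetic, and approximations to the `i`-th of the
given real constants with precision `1 / q`. -/
inductive Expr where
  | lit (c : ℕ)
  | load (a : ℕ) (idx : Expr)
  | bin (o : BinOp) (x y : Expr)
  | const (i q : Expr)

/-- Classical memory: array name, index, content. -/
abbrev Mem := ℕ → ℕ → ℕ

/-- Number of binary digits, plus one. -/
def bits (x : ℕ) : ℕ := Nat.size x + 1

/-- The value of an expression; `o i q` approximates `q` times the `i`-th constant. -/
def Expr.eval (o : ℕ → ℕ → ℕ) (M : Mem) : Expr → ℕ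
  | .lit c => c
  | .load a idx => M a (idx.eval o M)
  | .bin f x y => f.eval (x.eval o M) (y.eval o M)
  | .const i q => o (i.eval o M) (q.eval o M)

/-- The cost of evaluating an expression, in terms of the lengths of the numbers involved. -/
def Expr.cost (o : ℕ → ℕ → ℕ) (M : Mem) : Expr → ℕ
  | .lit c => bits c
  | .load a idx => idx.cost o M + bits (idx.eval o M) + bits (M a (idx.eval o M))
  | .bin _ x y => x.cost o M + y.cost o M + bits (x.eval o M) * bits (y.eval o M)
  | .const i q => i.cost o M + q.cost o M + bits (i.eval o M) + bits (q.eval o M) +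
      bits (o (i.eval o M) (q.eval o M))

/-- Programs. The quantum gates are the classical reversible gates `perm`, on any constant number
`k` of qudits, and these gates controlled by a qudit being in the state `|φ⟩`, where `φ` is the
eigenvector measured on block `β`. -/
inductive Prog (d : ℕ) where
  | skip
  | assign (a : ℕ) (idx val : Expr)
  | seq (P Q : Prog d)
  | ite (c : Expr) (P Q : Prog d)
  | loop (c : Expr) (P : Prog d)
  | rand (a : ℕ) (idx bound : Expr)
  | measure (a : ℕ) (idx qudit : Expr)
  | perm (k : ℕ) (g : Equiv.Perm (Fin k → Fin d)) (target : Fin k → Expr)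
  | ctrl (β : Fin (numBlocks d)) (k : ℕ) (g : Equiv.Perm (Fin k → Fin d))
      (control : Expr) (target : Fin k → Expr)

/-- The unitary of a classical reversible gate. -/
def permGate {d k : ℕ} (g : Equiv.Perm (Fin k → Fin d)) : Op d k :=
  Matrix.of fun x y => if x = g y then 1 else 0

/-- The controlled gate `|φ⟩⟨φ| ⊗ g + (1 - |φ⟩⟨φ|) ⊗ 1`; the control is the first qudit. -/
def ctrlGate {d k : ℕ} (φ : Fin d → ℂ) (g : Equiv.Perm (Fin k → Fin d)) : Op d (k + 1) :=
  Matrix.of fun x y =>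
    ketbra φ (x 0) (y 0) * permGate g (Fin.tail x) (Fin.tail y) +
      (1 - ketbra φ) (x 0) (y 0) * (1 : Op d k) (Fin.tail x) (Fin.tail y)

open Classical in
/-- A `k`-qudit operator applied to the qudits `t 0, …, t (k - 1)` of `N`. Nothing happens if
these are not `k` different existing qudits. -/
def applyAt {d k : ℕ} (N : ℕ) (U : Op d k) (t : Fin k → ℕ) : Op d N :=
  if h : Function.Injective t ∧ ∀ i, t i < N then
    Matrix.of fun x y =>
      if ∀ q : Fin N, (∀ i, t i ≠ (q : ℕ)) → x q = y q then
        U (fun i => x ⟨t i, h.2 i⟩) (fun i => y ⟨t i, h.2 i⟩)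
      else 0
  else 1

/-- The projector onto qudit `q` being in the computational basis state `v`. -/
def readProj {d N : ℕ} (q : Fin N) (v : Fin d) : Op d N :=
  Matrix.diagonal fun x => if x q = v then 1 else 0

/-- A branch of the computation on `N` qudits: the classical memory, the time used so far, the
probability of the random samples drawn so far, and the product `op` of the gates and projectors
applied so far. It occurs with probability `prob * tr (op X op†)` on the initial state `X`, and
leaves the state `op X op†`, up to normalization. -/
structure Branch (d N : ℕ) where
  mem : Mem
  time : ℕ
  prob : ℝ
  op : Op d N

/-- Add to the time. -/
def Branch.tick {d N : ℕ} (c : Branch d N) (t : ℕ) : Branch d N :=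
  { c with time := c.time + t }

/-- Write to the memory. -/
def Branch.write {d N : ℕ} (c : Branch d N) (a i v : ℕ) : Branch d N :=
  { c with mem := Function.update c.mem a (Function.update (c.mem a) i v) }

/-- Act on the qudits. -/
def Branch.act {d N : ℕ} (c : Branch d N) (U : Op d N) : Branch d N :=
  { c with op := U * c.op }

/-- The branches that result from running a program. -/
def exec {d N : ℕ} (B : TomographyBasis d) (o : ℕ → ℕ → ℕ) :
    Prog d → Branch d N → List (Branch d N)
  | .skip, c => [c.tick 1]
  | .assign a idx val, c =>
      let i := idx.eval o c.mem
      let v := val.eval o c.mem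
      [(c.write a i v).tick (idx.cost o c.mem + val.cost o c.mem + bits i + bits v)]
  | .seq P Q, c => (exec B o P c).flatMap (exec B o Q)
  | .ite e P Q, c =>
      let c' := c.tick (1 + e.cost o c.mem)
      if e.eval o c.mem ≠ 0 then exec B o P c' else exec B o Q c'
  | .loop e P, c =>
      (fun L : List (Branch d N) => L.flatMap fun c' => exec B o P (c'.tick 1))^[e.eval o c.mem]
        [c.tick (1 + e.cost o c.mem)]
  | .rand a idx bound, c =>
      let i := idx.eval o c.mem
      let u := bound.eval o c.mem
      (List.range (u + 1)).map fun v =>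
        { (c.write a i v).tick (idx.cost o c.mem + bound.cost o c.mem + bits i + bits u) with
          prob := c.prob / (u + 1) }
  | .measure a idx qudit, c =>
      let i := idx.eval o c.mem
      let q := qudit.eval o c.mem
      let c' := c.tick (idx.cost o c.mem + qudit.cost o c.mem + bits i + bits q)
      if h : q < N then
        (List.finRange d).map fun v : Fin d => (c'.write a i (v : ℕ)).act (readProj ⟨q, h⟩ v)
      else [c']
  | .perm _ g t, c =>
      [(c.act (applyAt N (permGate g) fun i => (t i).eval o c.mem)).tick
        (1 + ∑ i, ((t i).cost o c.mem + bits ((t i).eval o c.mem)))]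
  | .ctrl β _ g e t, c =>
      [(c.act (applyAt N (ctrlGate (B.phi β) g)
          (Fin.cons (α := fun _ => ℕ) (e.eval o c.mem) fun i => (t i).eval o c.mem))).tick
        (1 + e.cost o c.mem + bits (e.eval o c.mem) +
          ∑ i, ((t i).cost o c.mem + bits ((t i).eval o c.mem)))]

/-- The start: cells `0` and `1` of array `0` hold `n` and the number `m` of bins. -/
def start (d N n m : ℕ) : Branch d N where
  mem := fun a i => if a = 0 ∧ i = 0 then n else if a = 0 ∧ i = 1 then m else 0
  time := 0
  prob := 1
  op := 1

/-- `X ⊗ |0 ⋯ 0⟩⟨0 ⋯ 0|` with `w` work qudits. -/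
def withWork {d n : ℕ} (w : ℕ) (X : Op d n) : Op d (n + w) :=
  Matrix.of fun x y =>
    if ∀ i : Fin w, (x (Fin.natAdd n i) : ℕ) = 0 ∧ (y (Fin.natAdd n i) : ℕ) = 0 then
      X (fun q => x (Fin.castAdd w q)) (fun q => y (Fin.castAdd w q))
    else 0

/-- The constants available to a program are the coordinates of the eigenvectors: `o` answers
queries for `q (1 + Re z)` (even numbers) and `q (1 + Im z)` (odd numbers), with an error of
at most `1`, where `z` is coordinate `a` of the eigenvector measured on block `β`. -/
def Approximates {d : ℕ} (o : ℕ → ℕ → ℕ) (B : TomographyBasis d) : Prop :=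
  ∀ (β : Fin (numBlocks d)) (a : Fin d) (q : ℕ),
    |(o (2 * ((β : ℕ) * d + a)) q : ℝ) - q * (1 + (B.phi β a).re)| ≤ 1 ∧
    |(o (2 * ((β : ℕ) * d + a) + 1) q : ℝ) - q * (1 + (B.phi β a).im)| ≤ 1

/-- The final memory reports the cut points `b` (in array `1`) and the measured bins `j` (in
array `2`). -/
def Reports {d n r : ℕ} (M : Mem) (b : Cuts d n r) (j : Outcomes d r) : Prop :=
  (∀ (β : Fin (numBlocks d)) (i : Fin r), M 1 ((β : ℕ) * r + i) = (b β i : ℕ)) ∧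
    ∀ β : Fin (numBlocks d), M 2 (β : ℕ) = (j β : ℕ)

/-- The estimate in the final memory: arrays `3, 4` hold the real parts (positive and negative
part), arrays `5, 6` the imaginary parts, and cell `0` of array `7` the common denominator. -/
def estimate (d : ℕ) (M : Mem) : Matrix (Fin d) (Fin d) ℂ :=
  Matrix.of fun a c =>
    let i := (a : ℕ) * d + c
    (((M 3 i : ℂ) - M 4 i) + ((M 5 i : ℂ) - M 6 i) * Complex.I) / (M 7 0 : ℂ)

open Classical in
/-- On `n` qudits and with `m` bins for each block, the program `P` performs gentle tomography
within time `T`, using `T` work qudits that start in state `0`: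
* all branches end within time `T`;
* for all cut points `b` and measured bins `j`, the branches reporting `b` and `j` together act
  on the `n` qudits (and on whatever these are entangled with) as drawing `b` uniformly
  and projecting by `outcomeProj B b j`, and they return the work qudits to state `0`;
* on success, the estimate is a solution of the semidefinite program. -/
structure Performs {d : ℕ} (B : TomographyBasis d) (s : ℝ) (o : ℕ → ℕ → ℕ) (P : Prog d)
    (n m T : ℕ) : Prop where
  halts : ∀ c ∈ exec B o P (start d (n + T) n m), c.time ≤ T
  measures : ∀ (b : Cuts d n (m - 1)) (j : Outcomes d (m - 1)) (X : Op d n),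
    (((exec B o P (start d (n + T) n m)).filter fun c => Reports c.mem b j).map fun c =>
        (c.prob : ℂ) • (c.op * withWork T X * c.opᴴ)).sum =
      (1 / (Fintype.card (Cuts d n (m - 1)) : ℂ)) •
        withWork T (outcomeProj B b j * X * (outcomeProj B b j)ᴴ)
  estimates : ∀ (b : Cuts d n (m - 1)) (j : Outcomes d (m - 1)) (ρ : Matrix (Fin d) (Fin d) ℂ),
    IsState ρ → Success B s ρ b j →
    ∀ c ∈ exec B o P (start d (n + T) n m), Reports c.mem b j →
      c.op * withWork T (1 : Op d n) ≠ 0 → SolvesSDP B b j (estimate d c.mem)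

end GentleTomography

end

noncomputable section

namespace GentleTomography

/-! ### Product operators -/

/-! Everything the measurement does is diagonal in one commuting family. Test every qudit of a block
for the vector of that block. The joint projectors `bitProj` of these tests resolve the identity,
and each `outcomeProj` is the sum of those `bitProj` whose numbers of hits fall in the bins
(`outcomeProj_mul_bitProj`, `outcomeProj_eq_sum`). On `ρ^{⊗ n}` the tests are independent Bernoulli
trials, so failure and disturbance become classical statements about binomial counts with mean `l
α`.

A Chernoff bound (`deviation_le`) keeps the count within `√l ln l` of `l α` except with probability
`O(l⁻²)`. If all cut points are farther away than that, none separates the count from `l α`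
(`mem_bin_iff_of_close`). So under success the measured bins had probability `p ≥ 1 - O(n⁻²)`, and
the disturbance is `1 - √p ≤ 1 - p`. For the failure bound, a union bound over blocks and causes
(`failureProb_le_sum`) suffices: about `l ^ s` cut points hit a window of relative size `ln l / √l`,
which gives the rate `l ^ (s - 1/2) ln l`, while a window of `l ^ (1 - s) ln l` integers is missed
by all cut points with probability `O(1/l)` only. For accuracy, the measured bin lies within `l ^ (1
- s) ln l` of `l α` and contains the mean for every solution `τ`. So `ρ` and `τ` have nearly the
same expectations on all eigenvectors, and expanding `ρ - τ` in the `σ k` bounds its trace norm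
(`traceNorm_le_of_expect`).

The program must measure the bin and nothing finer. It counts the hits in a one-hot counter of work
qudits, which is shifted under control of the qudits of the block. It copies the rank of the count
among the cut points into one-hot flags, uncomputes the counter, and measures the flags
(`flagBlock_spec`, `readout_spec`). On each `bitProj` all these gates act classically on the work
qudits, hence the bookkeeping by `superpose`. Random draws and measurements are followed by sums
over branches that every step of a loop conserves (`branchSum_forLoop`).

Since `d` is fixed, the semidefinite program can be solved by exhaustive search over `A A†`,
normalized, with `A` a Gaussian integer matrix with entries of order `l`. Success leaves a margin
`√l ln l ≥ 3/4` between `l α` and the cut points. Rounding a square root of `ρ` costs `1/4`,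
approximating the eigenvectors costs `1/4`, and the remaining `1/4` makes the approximate test sound
(`exists_passes`, `solvesSDP_of_passes`). The time is polynomial because all cells that are ever
read stay below a polynomial bound, enforced by clamping (`exec_time_le`). -/

lemma prodOp_mul {d n : ℕ} (A C : Fin n → Matrix (Fin d) (Fin d) ℂ) :
    prodOp A * prodOp C = prodOp fun q => A q * C q := by
  ext x y
  simp only [prodOp, Matrix.mul_apply, Matrix.of_apply, ← Finset.prod_mul_distrib]
  rw [Finset.prod_univ_sum]
  simp

lemma prodOp_one {d n : ℕ} : prodOp (fun _ : Fin n => (1 : Matrix (Fin d) (Fin d) ℂ)) = 1 := by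
  ext x y
  simp only [prodOp, Matrix.of_apply, Matrix.one_apply]
  by_cases h : x = y
  · subst h; simp
  · rw [if_neg h]
    obtain ⟨q, hq⟩ := Function.ne_iff.mp h
    exact Finset.prod_eq_zero (Finset.mem_univ q) (if_neg hq)

lemma prodOp_conjTranspose {d n : ℕ} (A : Fin n → Matrix (Fin d) (Fin d) ℂ) :
    (prodOp A)ᴴ = prodOp fun q => (A q)ᴴ := by
  ext x y
  simp [prodOp, Matrix.conjTranspose_apply]

lemma trace_prodOp {d n : ℕ} (A : Fin n → Matrix (Fin d) (Fin d) ℂ) :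
    (prodOp A).trace = ∏ q, (A q).trace := by
  simp only [prodOp, Matrix.trace, Matrix.diag_apply, Matrix.of_apply]
  rw [Finset.prod_univ_sum]
  simp

lemma prodOp_eq_zero {d n : ℕ} (A : Fin n → Matrix (Fin d) (Fin d) ℂ) (q : Fin n) (h : A q = 0) :
    prodOp A = 0 := by
  ext x y
  exact Finset.prod_eq_zero (Finset.mem_univ q) (by simp [h])

lemma ketbra_isHermitian {d : ℕ} (φ : Fin d → ℂ) : (ketbra φ)ᴴ = ketbra φ := by
  simp [ketbra, Matrix.conjTranspose_vecMulVec]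

lemma ketbra_mul_self {d : ℕ} {φ : Fin d → ℂ} (h : star φ ⬝ᵥ φ = 1) :
    ketbra φ * ketbra φ = ketbra φ := by
  simp [ketbra, Matrix.vecMulVec_mul_vecMulVec, h]

lemma trace_ketbra_mul {d : ℕ} (φ : Fin d → ℂ) (A : Matrix (Fin d) (Fin d) ℂ) :
    (ketbra φ * A).trace = star φ ⬝ᵥ (A *ᵥ φ) := by
  rw [ketbra, Matrix.vecMulVec_mul, Matrix.trace_vecMulVec, Matrix.dotProduct_mulVec,
    dotProduct_comm]

lemma trace_ketbra_mul_isHermitian {d : ℕ} (φ : Fin d → ℂ) {A : Matrix (Fin d) (Fin d) ℂ}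
    (hA : A.IsHermitian) : (ketbra φ * A).trace = (expect φ A : ℂ) := by
  rw [trace_ketbra_mul, expect]
  refine (Complex.conj_eq_iff_re.mp ?_).symm
  rw [← trace_ketbra_mul, starRingEnd_apply, ← Matrix.trace_conjTranspose,
    Matrix.conjTranspose_mul, ketbra_isHermitian, hA.eq, Matrix.trace_mul_comm]

/-! ### The joint projectors of all the single-qudit tests -/

/-- The projector of a single-qudit test for `φ`. -/
def bitFactor {d : ℕ} (φ : Fin d → ℂ) (b : Bool) : Matrix (Fin d) (Fin d) ℂ :=
  if b then ketbra φ else 1 - ketbra φ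

/-- Qudit `q` is tested for `Φ q`, with result `x q`. -/
def bitProj {d n : ℕ} (Φ : Fin n → Fin d → ℂ) (x : Fin n → Bool) : Op d n :=
  prodOp fun q => bitFactor (Φ q) (x q)

/-- `ketbra φ` is a projector. -/
def IsTest {d : ℕ} (φ : Fin d → ℂ) : Prop := ketbra φ * ketbra φ = ketbra φ

lemma bitFactor_mul {d : ℕ} {φ : Fin d → ℂ} (h : IsTest φ) (b c : Bool) :
    bitFactor φ b * bitFactor φ c = if b = c then bitFactor φ b else 0 := by
  have h' : ketbra φ * ketbra φ = ketbra φ := h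
  cases b <;> cases c <;> simp [bitFactor, mul_sub, sub_mul, h']

lemma bitFactor_isHermitian {d : ℕ} (φ : Fin d → ℂ) (b : Bool) :
    (bitFactor φ b)ᴴ = bitFactor φ b := by
  cases b <;> simp [bitFactor, ketbra_isHermitian]

lemma bitProj_isHermitian {d n : ℕ} (Φ : Fin n → Fin d → ℂ) (x : Fin n → Bool) :
    (bitProj Φ x)ᴴ = bitProj Φ x := by
  simp [bitProj, prodOp_conjTranspose, bitFactor_isHermitian]

/-- Multiply out the product of the factors `1 = bitFactor true + bitFactor false`. -/
lemma sum_bitProj {d n : ℕ} (Φ : Fin n → Fin d → ℂ) : ∑ x, bitProj Φ x = 1 := by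
  have h : ∀ q, ∑ b, bitFactor (Φ q) b = 1 := fun q => by simp [bitFactor]
  rw [← prodOp_one]
  ext y z
  simp only [bitProj, prodOp, Matrix.sum_apply, Matrix.of_apply]
  rw [← Fintype.piFinset_univ, ← Finset.prod_univ_sum (fun _ => Finset.univ)
    (fun q b => bitFactor (Φ q) b (y q) (z q))]
  refine Finset.prod_congr rfl fun q _ => ?_
  rw [← h q, Matrix.sum_apply]

/-- One site with the complementary factor annihilates the whole tensor product. -/
lemma prodOp_mul_bitProj_eq_zero {d n : ℕ} {Φ : Fin n → Fin d → ℂ} (hΦ : ∀ q, IsTest (Φ q))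
    (A : Fin n → Matrix (Fin d) (Fin d) ℂ) (x : Fin n → Bool) (q : Fin n)
    (h : A q = bitFactor (Φ q) (!x q)) : prodOp A * bitProj Φ x = 0 := by
  rw [bitProj, prodOp_mul]
  refine prodOp_eq_zero _ q ?_
  simp only [h, bitFactor_mul (hΦ q)]
  simp

lemma prodOp_mul_bitProj_eq_self {d n : ℕ} {Φ : Fin n → Fin d → ℂ} (hΦ : ∀ q, IsTest (Φ q))
    (A : Fin n → Matrix (Fin d) (Fin d) ℂ) (x : Fin n → Bool)
    (h : ∀ q, A q = 1 ∨ A q = bitFactor (Φ q) (x q)) : prodOp A * bitProj Φ x = bitProj Φ x := by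
  rw [bitProj, prodOp_mul]
  congr 1
  funext q
  rcases h q with h | h <;> simp [h, bitFactor_mul (hΦ q)]

/-- The number of positive tests in `S`. -/
def hits {n : ℕ} (S : Finset (Fin n)) (x : Fin n → Bool) : ℕ := (S.filter fun q => x q).card

lemma hits_le {n : ℕ} (S : Finset (Fin n)) (x : Fin n → Bool) : hits S x ≤ S.card :=
  Finset.card_filter_le _ _

/-- Of all the sets `T` in `countProj`, only the set of positive tests of `x` inside `S` survives;
any other `T` disagrees with `x` at some site of `S`. -/
lemma countProj_mul_bitProj {d n : ℕ} {Φ : Fin n → Fin d → ℂ} (hΦ : ∀ q, IsTest (Φ q))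
    (S : Finset (Fin n)) (φ : Fin d → ℂ) (hS : ∀ q ∈ S, Φ q = φ) (k : ℕ) (x : Fin n → Bool) :
    countProj S φ k * bitProj Φ x = if hits S x = k then bitProj Φ x else 0 := by
  have key : ∀ T ∈ S.powersetCard k,
      prodOp (fun q => if q ∈ T then ketbra φ else if q ∈ S then 1 - ketbra φ else 1) *
        bitProj Φ x = if T = S.filter (fun q => x q) then bitProj Φ x else 0 := by
    intro T hT
    have hTS := (Finset.mem_powersetCard.mp hT).1
    split_ifs with h
    · refine prodOp_mul_bitProj_eq_self hΦ _ _ fun q => ?_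
      by_cases hq : q ∈ S
      · right
        cases hx : x q <;> simp [h, hq, hx, bitFactor, hS q hq]
      · left
        simp [h, hq]
    · obtain ⟨q, hq⟩ : ∃ q, ¬ (q ∈ T ↔ q ∈ S.filter (fun q => x q)) := by
        by_contra hcon
        push Not at hcon
        exact h (Finset.ext hcon)
      refine prodOp_mul_bitProj_eq_zero hΦ _ _ q ?_
      by_cases hqT : q ∈ T
      · have hqS := hTS hqT
        cases hx : x q <;> simp_all [bitFactor]
      · have : q ∈ S ∧ x q = true := by simpa [hqT] using hq
        simp [hqT, this.1, this.2, bitFactor, hS q this.1]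
  rw [countProj, Finset.sum_mul, Finset.sum_congr rfl key, Finset.sum_ite_eq']
  simp only [Finset.mem_powersetCard, Finset.filter_subset, true_and, hits]
  congr

lemma binProj_mul_bitProj {d n l r : ℕ} {Φ : Fin n → Fin d → ℂ} (hΦ : ∀ q, IsTest (Φ q))
    (S : Finset (Fin n)) (φ : Fin d → ℂ) (hS : ∀ q ∈ S, Φ q = φ) (b : Fin r → Fin (l + 1))
    (j : Fin (r + 1)) (x : Fin n → Bool) :
    binProj S φ b j * bitProj Φ x =
      if binLo b j ≤ hits S x ∧ hits S x < binHi b j then bitProj Φ x else 0 := by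
  rw [binProj, Finset.sum_mul,
    Finset.sum_congr rfl fun k _ => countProj_mul_bitProj hΦ S φ hS k x, Finset.sum_ite_eq]
  simp

/-! ### Blocks -/

/-- The vector that qudit `q` is tested for (`0` outside all the blocks). -/
def TomographyBasis.siteVec {d : ℕ} (B : TomographyBasis d) (n : ℕ) (q : Fin n) : Fin d → ℂ :=
  if h : (q : ℕ) / blockLen d n < numBlocks d then B.phi ⟨_, h⟩ else 0

lemma TomographyBasis.phi_unit {d : ℕ} (B : TomographyBasis d) (β : Fin (numBlocks d)) :
    star (B.phi β) ⬝ᵥ B.phi β = 1 := by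
  simp [TomographyBasis.phi, B.vec_orthonormal]

/-- The default vector `0` outside of the blocks does no harm: `ketbra 0 = 0` is a projector, and
the test is always negative there. -/
lemma TomographyBasis.isTest_siteVec {d : ℕ} (B : TomographyBasis d) (n : ℕ) (q : Fin n) :
    IsTest (B.siteVec n q) := by
  unfold TomographyBasis.siteVec
  split_ifs
  · exact ketbra_mul_self (B.phi_unit _)
  · simp [IsTest, ketbra]

lemma mem_block {d n : ℕ} {β : Fin (numBlocks d)} {q : Fin n} :
    q ∈ block d n β ↔
      (β : ℕ) * blockLen d n ≤ (q : ℕ) ∧ (q : ℕ) < ((β : ℕ) + 1) * blockLen d n := by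
  simp [block]

lemma div_of_mem_block {d n : ℕ} {β : Fin (numBlocks d)} {q : Fin n} (h : q ∈ block d n β) :
    (q : ℕ) / blockLen d n = β :=
  Nat.div_eq_of_lt_le (mem_block.mp h).1 (mem_block.mp h).2

lemma TomographyBasis.siteVec_of_mem {d n : ℕ} (B : TomographyBasis d) {β : Fin (numBlocks d)}
    {q : Fin n} (h : q ∈ block d n β) : B.siteVec n q = B.phi β := by
  have := div_of_mem_block h
  unfold TomographyBasis.siteVec
  rw [dif_pos (by rw [this]; exact β.2)]
  congr 1
  exact Fin.ext this

lemma numBlocks_mul_blockLen_le (d n : ℕ) : numBlocks d * blockLen d n ≤ n :=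
  Nat.mul_div_le n _

lemma succ_mul_blockLen_le {d : ℕ} (n : ℕ) (β : Fin (numBlocks d)) :
    ((β : ℕ) + 1) * blockLen d n ≤ n :=
  (Nat.mul_le_mul_right _ β.2).trans (numBlocks_mul_blockLen_le d n)

lemma card_block {d n : ℕ} (β : Fin (numBlocks d)) : (block d n β).card = blockLen d n := by
  have h := succ_mul_blockLen_le n β
  rw [← Finset.card_map Fin.valEmbedding]
  have : (block d n β).map Fin.valEmbedding =
      Finset.Ico ((β : ℕ) * blockLen d n) (((β : ℕ) + 1) * blockLen d n) := by
    ext k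
    simp only [Finset.mem_map, mem_block, Fin.valEmbedding_apply, Finset.mem_Ico]
    constructor
    · rintro ⟨q, hq, rfl⟩; exact hq
    · intro hk; exact ⟨⟨k, by omega⟩, hk, rfl⟩
  rw [this, Nat.card_Ico, Nat.add_mul, one_mul, Nat.add_sub_cancel_left]

/-- The test results `x` fall in the bins `j`. -/
def InBins {d n r : ℕ} (b : Cuts d n r) (j : Outcomes d r) (x : Fin n → Bool) : Prop :=
  ∀ β, binLo (b β) (j β) ≤ hits (block d n β) x ∧ hits (block d n β) x < binHi (b β) (j β)

instance {d n r : ℕ} (b : Cuts d n r) (j : Outcomes d r) (x : Fin n → Bool) :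
    Decidable (InBins b j x) := by unfold InBins; infer_instance

lemma binProj_block_mul_bitProj {d n r : ℕ} (B : TomographyBasis d) (b : Cuts d n r)
    (j : Outcomes d r) (β : Fin (numBlocks d)) (x : Fin n → Bool) :
    binProj (block d n β) (B.phi β) (b β) (j β) * bitProj (B.siteVec n) x =
      if binLo (b β) (j β) ≤ hits (block d n β) x ∧ hits (block d n β) x < binHi (b β) (j β) then
        bitProj (B.siteVec n) x else 0 :=
  binProj_mul_bitProj (B.isTest_siteVec n) _ _ (fun _ h => B.siteVec_of_mem h) _ _ _

/-- Every bin projector multiplies a joint projector by `0` or `1`, so the product over the blocks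
multiplies it by the conjunction. -/
lemma outcomeProj_mul_bitProj {d n r : ℕ} (B : TomographyBasis d) (b : Cuts d n r)
    (j : Outcomes d r) (x : Fin n → Bool) :
    outcomeProj B b j * bitProj (B.siteVec n) x =
      if InBins b j x then bitProj (B.siteVec n) x else 0 := by
  have key : ∀ L : List (Fin (numBlocks d)),
      (L.map fun β => binProj (block d n β) (B.phi β) (b β) (j β)).prod *
        bitProj (B.siteVec n) x =
      if ∀ β ∈ L, binLo (b β) (j β) ≤ hits (block d n β) x ∧
        hits (block d n β) x < binHi (b β) (j β) then bitProj (B.siteVec n) x else 0 := by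
    intro L
    induction L with
    | nil => simp
    | cons β L ih =>
      rw [List.map_cons, List.prod_cons, mul_assoc, ih]
      simp only [List.forall_mem_cons]
      split_ifs with h1 h2 h2 <;>
        simp_all [binProj_block_mul_bitProj]
  rw [outcomeProj, key]
  simp [InBins]

/-- Multiplication by the resolution of the identity `sum_bitProj` makes `outcomeProj` a sum of
joint projectors; its being a projector follows from this form. -/
lemma outcomeProj_eq_sum {d n r : ℕ} (B : TomographyBasis d) (b : Cuts d n r)
    (j : Outcomes d r) :
    outcomeProj B b j = ∑ x, if InBins b j x then bitProj (B.siteVec n) x else 0 := by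
  rw [← mul_one (outcomeProj B b j), ← sum_bitProj (B.siteVec n), Finset.mul_sum]
  simp [outcomeProj_mul_bitProj]

lemma outcomeProj_isHermitian {d n r : ℕ} (B : TomographyBasis d) (b : Cuts d n r)
    (j : Outcomes d r) : (outcomeProj B b j)ᴴ = outcomeProj B b j := by
  rw [outcomeProj_eq_sum, Matrix.conjTranspose_sum]
  refine Finset.sum_congr rfl fun x _ => ?_
  split_ifs <;> simp [bitProj_isHermitian]

lemma outcomeProj_mul_self {d n r : ℕ} (B : TomographyBasis d) (b : Cuts d n r)
    (j : Outcomes d r) : outcomeProj B b j * outcomeProj B b j = outcomeProj B b j := by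
  conv_lhs => lhs; rw [outcomeProj_eq_sum B b j]
  rw [Finset.sum_mul]
  conv_rhs => rw [outcomeProj_eq_sum B b j]
  refine Finset.sum_congr rfl fun x _ => ?_
  -- Taking adjoints turns the action from the left into the action from the right.
  have h := congrArg Matrix.conjTranspose (outcomeProj_mul_bitProj B b j x)
  rw [Matrix.conjTranspose_mul, bitProj_isHermitian, outcomeProj_isHermitian] at h
  split_ifs with hx
  · rw [h, if_pos hx, bitProj_isHermitian]
  · simp

/-! ### Boundaries and ranks -/

/-- The number of cut points that are at most `t`. -/
def rank {l r : ℕ} (b : Fin r → Fin (l + 1)) (t : ℕ) : ℕ :=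
  (Finset.univ.filter fun i => ((b i : Fin (l + 1)) : ℕ) ≤ t).card

lemma rank_le {l r : ℕ} (b : Fin r → Fin (l + 1)) (t : ℕ) : rank b t ≤ r := by
  simpa [rank] using Finset.card_filter_le (Finset.univ : Finset (Fin r)) fun i => ((b i) : ℕ) ≤ t

/-- Sorting does not change how many cut points are at most `t`, and in a sorted sequence these come
first. -/
lemma lt_rank_iff {l r : ℕ} (b : Fin r → Fin (l + 1)) (t : ℕ) (i : Fin r) :
    (i : ℕ) < rank b t ↔ ((b (Tuple.sort b i) : Fin (l + 1)) : ℕ) ≤ t := by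
  have hm : Monotone fun i => ((b (Tuple.sort b i) : Fin (l + 1)) : ℕ) :=
    fun i j hij => Tuple.monotone_sort b hij
  rw [← Tuple.lt_card_le_iff_apply_le_of_monotone hm]
  have : rank b t = Fintype.card {i // ((b (Tuple.sort b i) : Fin (l + 1)) : ℕ) ≤ t} := by
    rw [rank, ← Fintype.card_subtype]
    exact (Fintype.card_congr ((Tuple.sort b).subtypeEquiv fun i => Iff.rfl)).symm
  rw [this, Fintype.card_subtype]

lemma boundary_zero {l r : ℕ} (b : Fin r → Fin (l + 1)) : boundary b 0 = 0 := rfl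

lemma boundary_last {l r : ℕ} (b : Fin r → Fin (l + 1)) :
    boundary b (Fin.last (r + 1)) = l + 1 := by
  rw [boundary, ← Fin.succ_last, Fin.cons_succ, Fin.snoc_last]

lemma boundary_mid {l r : ℕ} (b : Fin r → Fin (l + 1)) (i : Fin r) :
    boundary b i.castSucc.succ = (b (Tuple.sort b i) : Fin (l + 1)) := by
  rw [boundary, Fin.cons_succ, Fin.snoc_castSucc]

/-- Boundary `i + 1` is the sorted cut point `i`, which turns `i < rank` into `i + 1 ≤ rank`. The
last boundary `l + 1` exceeds `t` because of `t ≤ l`, and its index `r + 1` exceeds every rank. -/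
lemma boundary_le_iff {l r : ℕ} (b : Fin r → Fin (l + 1)) (i : Fin (r + 2)) {t : ℕ} (ht : t ≤ l) :
    boundary b i ≤ t ↔ (i : ℕ) ≤ rank b t := by
  refine Fin.cases ?_ (fun i => ?_) i
  · simp [boundary_zero]
  · refine Fin.lastCases ?_ (fun i => ?_) i
    · have := rank_le b t
      rw [Fin.succ_last, boundary_last]
      simp only [Fin.val_last]
      omega
    · rw [boundary_mid, ← lt_rank_iff]
      simp

lemma boundary_le {l r : ℕ} (b : Fin r → Fin (l + 1)) (i : Fin (r + 2)) :
    boundary b i ≤ l + 1 := by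
  refine Fin.cases ?_ (fun i => ?_) i
  · simp [boundary_zero]
  · refine Fin.lastCases ?_ (fun i => ?_) i
    · rw [Fin.succ_last, boundary_last]
    · rw [boundary_mid]; omega

lemma boundary_mono {l r : ℕ} (b : Fin r → Fin (l + 1)) : Monotone (boundary b) := by
  intro i j hij
  by_cases h : boundary b j ≤ l
  · rw [boundary_le_iff b i h]
    exact (Fin.val_fin_le.mpr hij).trans ((boundary_le_iff b j h).mp le_rfl)
  · have := boundary_le b i
    omega

/-- This lets the program find the ends of a bin by counting in its table of ranks, without sorting.
-/
lemma boundary_eq_card {l r : ℕ} (b : Fin r → Fin (l + 1)) (i : Fin (r + 2)) :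
    boundary b i = ((Finset.range (l + 1)).filter fun t => rank b t < i).card := by
  have : (Finset.range (l + 1)).filter (fun t => rank b t < i) = Finset.range (boundary b i) := by
    ext t
    have hb := boundary_le b i
    simp only [Finset.mem_filter, Finset.mem_range]
    constructor
    · rintro ⟨ht, h⟩
      have := boundary_le_iff b i (t := t) (by omega)
      omega
    · intro ht
      have := boundary_le_iff b i (t := t) (by omega)
      omega
  rw [this, Finset.card_range]

/-- The bins are the level sets of the rank, hence disjoint and exhaustive on `{0, …, l}`. The
proofs work with ranks from here on. -/
lemma mem_bin_iff {l r : ℕ} (b : Fin r → Fin (l + 1)) (j : Fin (r + 1)) {t : ℕ} (ht : t ≤ l) :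
    binLo b j ≤ t ∧ t < binHi b j ↔ rank b t = j := by
  have h1 := boundary_le_iff b j.castSucc ht
  have h2 := boundary_le_iff b j.succ ht
  simp only [Fin.val_castSucc, Fin.val_succ] at h1 h2
  unfold binLo binHi
  omega

lemma binLo_eq_zero_or {l r : ℕ} (b : Fin r → Fin (l + 1)) (j : Fin (r + 1)) :
    binLo b j = 0 ∨ ∃ i, binLo b j = b i := by
  unfold binLo
  refine Fin.cases ?_ (fun i => ?_) j
  · left; exact boundary_zero b
  · right
    exact ⟨_, by rw [← Fin.succ_castSucc, boundary_mid]⟩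

lemma binHi_eq_last_or {l r : ℕ} (b : Fin r → Fin (l + 1)) (j : Fin (r + 1)) :
    binHi b j = l + 1 ∨ ∃ i, binHi b j = b i := by
  unfold binHi
  refine Fin.lastCases ?_ (fun i => ?_) j
  · left; rw [Fin.succ_last, boundary_last]
  · right
    exact ⟨_, boundary_mid b i⟩

/-! ### Outcome statistics -/

/-- The probability of the result `b` of a test that is positive with probability `a`. -/
def bitWeight (a : ℝ) (b : Bool) : ℝ := if b then a else 1 - a

lemma expect_nonneg {d : ℕ} (φ : Fin d → ℂ) {ρ : Matrix (Fin d) (Fin d) ℂ} (hρ : ρ.PosSemidef) :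
    0 ≤ expect φ ρ := by
  have := hρ.dotProduct_mulVec_nonneg φ
  exact (Complex.le_def.mp this).1

lemma IsTest.isHermitian_compl {d : ℕ} (φ : Fin d → ℂ) : (1 - ketbra φ)ᴴ = 1 - ketbra φ := by
  simp [ketbra_isHermitian]

/-- For a projector `P`, cyclicity gives `tr (P ρ) = tr (P ρ P†)`. -/
lemma trace_test_compl_nonneg {d : ℕ} {φ : Fin d → ℂ} (hφ : IsTest φ)
    {ρ : Matrix (Fin d) (Fin d) ℂ} (hρ : ρ.PosSemidef) : 0 ≤ ((1 - ketbra φ) * ρ).trace := by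
  have h1 : (1 - ketbra φ) * (1 - ketbra φ) = 1 - ketbra φ := by
    have := bitFactor_mul hφ false false
    simpa [bitFactor] using this
  have h2 := (hρ.mul_mul_conjTranspose_same (1 - ketbra φ)).trace_nonneg
  rw [IsTest.isHermitian_compl, Matrix.trace_mul_comm, ← mul_assoc, h1] at h2
  exact h2

lemma expect_le_one {d : ℕ} {φ : Fin d → ℂ} (hφ : IsTest φ) {ρ : Matrix (Fin d) (Fin d) ℂ}
    (hρ : IsState ρ) : expect φ ρ ≤ 1 := by
  have h := trace_test_compl_nonneg hφ hρ.1
  rw [sub_mul, Matrix.trace_sub, one_mul, hρ.2, trace_ketbra_mul_isHermitian φ hρ.1.1] at h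
  have := (Complex.le_def.mp h).1
  simpa using this

lemma trace_bitFactor_mul {d : ℕ} (φ : Fin d → ℂ) {ρ : Matrix (Fin d) (Fin d) ℂ}
    (hρ : IsState ρ) (b : Bool) :
    (bitFactor φ b * ρ).trace = (bitWeight (expect φ ρ) b : ℂ) := by
  cases b
  · simp [bitFactor, bitWeight, sub_mul, hρ.2, trace_ketbra_mul_isHermitian φ hρ.1.1]
  · simp [bitFactor, bitWeight, trace_ketbra_mul_isHermitian φ hρ.1.1]

/-- The probability of the test results `x` on `ρ^{⊗ n}`. -/
def weight {n : ℕ} (a : Fin n → ℝ) (x : Fin n → Bool) : ℝ := ∏ q, bitWeight (a q) (x q)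

lemma trace_bitProj_mul {d n : ℕ} (Φ : Fin n → Fin d → ℂ) {ρ : Matrix (Fin d) (Fin d) ℂ}
    (hρ : IsState ρ) (x : Fin n → Bool) :
    (bitProj Φ x * tensorPower ρ n).trace = (weight (fun q => expect (Φ q) ρ) x : ℂ) := by
  rw [bitProj, tensorPower, prodOp_mul, trace_prodOp, weight, Complex.ofReal_prod]
  exact Finset.prod_congr rfl fun q _ => trace_bitFactor_mul _ hρ _

lemma weight_nonneg {n : ℕ} {a : Fin n → ℝ} (h0 : ∀ q, 0 ≤ a q) (h1 : ∀ q, a q ≤ 1)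
    (x : Fin n → Bool) : 0 ≤ weight a x := by
  refine Finset.prod_nonneg fun q _ => ?_
  unfold bitWeight
  split_ifs
  · exact h0 q
  · linarith [h1 q]

/-- Independence: the expectation of a product over the sites factorizes. -/
lemma sum_weight_mul {n : ℕ} (a : Fin n → ℝ) (f : Fin n → Bool → ℝ) :
    ∑ x, weight a x * ∏ q, f q (x q) = ∏ q, (a q * f q true + (1 - a q) * f q false) := by
  simp only [weight, ← Finset.prod_mul_distrib]
  rw [← Fintype.piFinset_univ, ← Finset.prod_univ_sum (fun _ => Finset.univ)
    (fun q b => bitWeight (a q) b * f q b)]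
  simp [bitWeight]

/-! ### Exponential moments and tail bounds for independent tests. -/

lemma sum_weight {n : ℕ} (a : Fin n → ℝ) : ∑ x, weight a x = 1 := by
  simpa using sum_weight_mul a fun _ _ => 1

/-- Use `exp x ≤ 1 + x + x ^ 2` for `|x| ≤ 1`. The variable is centred, so the linear terms cancel,
and the variance is `a (1 - a) ≤ 1 / 4`. -/
lemma bernoulli_mgf_le {a t : ℝ} (h0 : 0 ≤ a) (h1 : a ≤ 1) (ht : |t| ≤ 1) :
    a * Real.exp (t * (1 - a)) + (1 - a) * Real.exp (t * (0 - a)) ≤ Real.exp (t ^ 2 / 4) := by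
  have key : ∀ x : ℝ, |x| ≤ 1 → Real.exp x ≤ 1 + x + x ^ 2 := fun x hx => by
    have := (abs_le.mp (Real.abs_exp_sub_one_sub_id_le hx)).2
    linarith
  have e1 := key (t * (1 - a)) (by
    rw [abs_mul, abs_of_nonneg (by linarith : 0 ≤ 1 - a)]
    nlinarith [abs_nonneg t])
  have e2 := key (t * (0 - a)) (by
    rw [abs_mul, zero_sub, abs_neg, abs_of_nonneg h0]
    nlinarith [abs_nonneg t])
  have e3 := Real.add_one_le_exp (t ^ 2 / 4)
  have e4 := mul_le_mul_of_nonneg_left e1 h0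
  have e5 := mul_le_mul_of_nonneg_left e2 (by linarith : 0 ≤ 1 - a)
  nlinarith [mul_nonneg (sq_nonneg t) (sq_nonneg (2 * a - 1))]

lemma hits_eq_sum {n : ℕ} (S : Finset (Fin n)) (x : Fin n → Bool) :
    (hits S x : ℝ) = ∑ q ∈ S, if x q then (1 : ℝ) else 0 := by
  rw [hits, Finset.card_filter]
  push_cast
  rfl

lemma sum_weight_exp_le {n : ℕ} {a : Fin n → ℝ} (S : Finset (Fin n)) {α t : ℝ}
    (hS : ∀ q ∈ S, a q = α) (h0 : 0 ≤ α) (h1 : α ≤ 1) (ht : |t| ≤ 1) :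
    ∑ x, weight a x * Real.exp (t * (hits S x - S.card * α)) ≤
      Real.exp (S.card * (t ^ 2 / 4)) := by
  have h : ∀ x, Real.exp (t * (hits S x - S.card * α)) =
      ∏ q, (fun b : Bool => if q ∈ S then Real.exp (t * ((if b then 1 else 0) - α)) else 1) (x q) := by
    intro x
    rw [Finset.prod_ite_mem, Finset.univ_inter, ← Real.exp_sum, hits_eq_sum, ← Finset.mul_sum,
      Finset.sum_sub_distrib]
    simp
  rw [Finset.sum_congr rfl fun x _ => by rw [h x],
    sum_weight_mul a fun q b => if q ∈ S then Real.exp (t * ((if b then 1 else 0) - α)) else 1]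
  have h2 : ∀ q, (a q * (if q ∈ S then Real.exp (t * ((if (true : Bool) then 1 else 0) - α)) else 1) +
      (1 - a q) * (if q ∈ S then Real.exp (t * ((if (false : Bool) then 1 else 0) - α)) else 1)) =
      if q ∈ S then α * Real.exp (t * (1 - α)) + (1 - α) * Real.exp (t * (0 - α)) else 1 := by
    intro q
    by_cases hq : q ∈ S
    · simp [hq, hS q hq]
    · simp [hq]
  rw [Finset.prod_congr rfl fun q _ => h2 q, Finset.prod_ite_mem, Finset.univ_inter,
    Finset.prod_const, Real.exp_nat_mul]
  have : 0 ≤ 1 - α := by linarith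
  exact pow_le_pow_left₀ (by positivity) (bernoulli_mgf_le h0 h1 ht) _

/-- Markov's inequality for the exponential moments with parameters `t` and `-t`, one for each tail.
-/
lemma chernoff {n : ℕ} {a : Fin n → ℝ} (h0 : ∀ q, 0 ≤ a q) (h1 : ∀ q, a q ≤ 1)
    (S : Finset (Fin n)) {α t δ : ℝ} (hS : ∀ q ∈ S, a q = α) (hα0 : 0 ≤ α) (hα1 : α ≤ 1)
    (ht0 : 0 ≤ t) (ht : t ≤ 1) :
    (∑ x, weight a x * if δ ≤ |hits S x - S.card * α| then 1 else 0) ≤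
      2 * Real.exp (S.card * (t ^ 2 / 4) - t * δ) := by
  have e1 := sum_weight_exp_le S hS hα0 hα1 (t := t) (by rwa [abs_of_nonneg ht0])
  have e2 := sum_weight_exp_le S hS hα0 hα1 (t := -t) (by rwa [abs_neg, abs_of_nonneg ht0])
  have key : ∀ x, (weight a x * if δ ≤ |hits S x - S.card * α| then 1 else 0) ≤
      (weight a x * Real.exp (t * (hits S x - S.card * α)) +
        weight a x * Real.exp (-t * (hits S x - S.card * α))) * Real.exp (-(t * δ)) := by
    intro x
    rw [← mul_add, mul_assoc]
    refine mul_le_mul_of_nonneg_left ?_ (weight_nonneg h0 h1 x)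
    rw [add_mul, ← Real.exp_add, ← Real.exp_add]
    split_ifs with h
    · rcases le_abs'.mp h with h | h
      · have : 1 ≤ Real.exp (-t * (hits S x - S.card * α) + -(t * δ)) :=
          Real.one_le_exp (by nlinarith)
        linarith [Real.exp_pos (t * (hits S x - S.card * α) + -(t * δ))]
      · have : 1 ≤ Real.exp (t * (hits S x - S.card * α) + -(t * δ)) :=
          Real.one_le_exp (by nlinarith)
        linarith [Real.exp_pos (-t * (hits S x - S.card * α) + -(t * δ))]
    · positivity
  refine (Finset.sum_le_sum fun x _ => key x).trans ?_
  rw [← Finset.sum_mul, Finset.sum_add_distrib, sub_eq_add_neg, Real.exp_add]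
  rw [neg_sq] at e2
  nlinarith [Real.exp_pos (-(t * δ))]

/-- It makes `t = ln l / √l` an admissible parameter in `chernoff`. Apply `ln y ≤ y - 1` to `y = √x
/ 2`; what is lost, `2 ln 2 - 2`, is negative. -/
lemma log_le_sqrt {x : ℝ} (hx : 0 < x) : Real.log x ≤ Real.sqrt x := by
  have hs : 0 < Real.sqrt x := Real.sqrt_pos.mpr hx
  have h1 : Real.log x = 2 * Real.log (Real.sqrt x) := by rw [Real.log_sqrt hx.le]; ring
  have h2 := Real.log_le_sub_one_of_pos (show 0 < Real.sqrt x / 2 by positivity)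
  rw [Real.log_div hs.ne' two_ne_zero] at h2
  have := Real.log_two_lt_d9
  rw [h1]
  linarith

/-- The bound for the probability of a deviation by `√l ln l`. -/
lemma deviation_le {n : ℕ} {a : Fin n → ℝ} (h0 : ∀ q, 0 ≤ a q) (h1 : ∀ q, a q ≤ 1)
    (S : Finset (Fin n)) {α : ℝ} (hS : ∀ q ∈ S, a q = α) (hα0 : 0 ≤ α) (hα1 : α ≤ 1)
    {l : ℕ} (hl : S.card = l) (hl1 : 1 ≤ l) :
    (∑ x, weight a x * if Real.sqrt l * Real.log l ≤ |hits S x - l * α| then 1 else 0) ≤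
      2 * Real.exp (4 / 3) * ((l : ℝ) ^ 2)⁻¹ := by
  have hl1' : (1 : ℝ) ≤ l := by exact_mod_cast hl1
  have hlp : (0 : ℝ) < l := by linarith
  have hlog : 0 ≤ Real.log l := Real.log_nonneg hl1'
  have hs : 0 < Real.sqrt l := Real.sqrt_pos.mpr hlp
  have hss : Real.sqrt l ^ 2 = l := Real.sq_sqrt hlp.le
  have h := chernoff h0 h1 S (t := Real.log l / Real.sqrt l) (δ := Real.sqrt l * Real.log l) hS
    hα0 hα1 (by positivity) ((div_le_one hs).mpr (log_le_sqrt hlp))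
  rw [hl] at h
  refine h.trans ?_
  rw [mul_assoc]
  refine mul_le_mul_of_nonneg_left ?_ (by norm_num)
  -- With this `t` and `δ` the exponent is `(ln l)² / 4 - (ln l)²`.
  have e : (l : ℝ) * ((Real.log l / Real.sqrt l) ^ 2 / 4) -
      Real.log l / Real.sqrt l * (Real.sqrt l * Real.log l) = -(3 / 4) * Real.log l ^ 2 := by
    rw [div_pow, hss]
    field_simp
    ring
  have e2 : ((l : ℝ) ^ 2)⁻¹ = Real.exp (-(2 * Real.log l)) := by
    rw [Real.exp_neg, two_mul, Real.exp_add, Real.exp_log hlp, sq]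
  rw [e, e2, ← Real.exp_add]
  -- Completing the square, `-(3/4) L² ≤ 4/3 - 2 L` for `L = ln l`; this is the origin of the
  -- constant `exp (4 / 3)`.
  exact Real.exp_le_exp.mpr (by nlinarith [sq_nonneg (Real.log l - 4 / 3)])

/-! ### The test results on the blocks of a product state. -/

lemma expect_siteVec_of_mem {d n : ℕ} (B : TomographyBasis d) (ρ : Matrix (Fin d) (Fin d) ℂ)
    (β : Fin (numBlocks d)) : ∀ q ∈ block d n β,
      (fun q => expect (B.siteVec n q) ρ) q = expect (B.phi β) ρ := fun q hq => by
  simp only [B.siteVec_of_mem hq]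

lemma isTest_phi {d : ℕ} (B : TomographyBasis d) (β : Fin (numBlocks d)) : IsTest (B.phi β) :=
  ketbra_mul_self (B.phi_unit β)

/-- The deviation of the test results `x` on block `β` from their expectation is large. -/
def Deviates {d n : ℕ} (B : TomographyBasis d) (ρ : Matrix (Fin d) (Fin d) ℂ)
    (β : Fin (numBlocks d)) (x : Fin n → Bool) : Prop :=
  Real.sqrt (blockLen d n) * Real.log (blockLen d n) ≤
    |hits (block d n β) x - blockLen d n * expect (B.phi β) ρ|

/-- The distribution of the test results on `ρ^{⊗ n}`. -/
def resultWeight {d n : ℕ} (B : TomographyBasis d) (ρ : Matrix (Fin d) (Fin d) ℂ)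
    (x : Fin n → Bool) : ℝ := weight (fun q => expect (B.siteVec n q) ρ) x

lemma resultWeight_nonneg {d n : ℕ} (B : TomographyBasis d) {ρ : Matrix (Fin d) (Fin d) ℂ}
    (hρ : IsState ρ) (x : Fin n → Bool) : 0 ≤ resultWeight B ρ x :=
  weight_nonneg (fun _ => expect_nonneg _ hρ.1)
    (fun _ => expect_le_one (B.isTest_siteVec n _) hρ) x

lemma sum_resultWeight {d n : ℕ} (B : TomographyBasis d) (ρ : Matrix (Fin d) (Fin d) ℂ) :
    ∑ x : Fin n → Bool, resultWeight B ρ x = 1 := sum_weight _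

open Classical in
lemma sum_deviates_le {d n : ℕ} (B : TomographyBasis d) {ρ : Matrix (Fin d) (Fin d) ℂ}
    (hρ : IsState ρ) (β : Fin (numBlocks d)) (hl : 1 ≤ blockLen d n) :
    (∑ x : Fin n → Bool, resultWeight B ρ x * if Deviates B ρ β x then 1 else 0) ≤
      2 * Real.exp (4 / 3) * ((blockLen d n : ℝ) ^ 2)⁻¹ := by
  have h := deviation_le (fun q => expect_nonneg (B.siteVec n q) hρ.1)
    (fun q => expect_le_one (B.isTest_siteVec n q) hρ) (block d n β)
    (expect_siteVec_of_mem B ρ β) (expect_nonneg _ hρ.1) (expect_le_one (isTest_phi B β) hρ)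
    (card_block β) hl
  refine le_trans (le_of_eq (Finset.sum_congr rfl fun x _ => ?_)) h
  unfold Deviates resultWeight
  congr

lemma trace_outcomeProj {d n r : ℕ} (B : TomographyBasis d) {ρ : Matrix (Fin d) (Fin d) ℂ}
    (hρ : IsState ρ) (b : Cuts d n r) (j : Outcomes d r) :
    (outcomeProj B b j * tensorPower ρ n).trace.re =
      ∑ x, if InBins b j x then resultWeight B ρ x else 0 := by
  rw [outcomeProj_eq_sum, Finset.sum_mul, Matrix.trace_sum, Complex.re_sum]
  refine Finset.sum_congr rfl fun x _ => ?_
  split_ifs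
  · rw [trace_bitProj_mul _ hρ, Complex.ofReal_re]; rfl
  · simp

/-- All cut points are farther from `l a` than `t` is, so none of them separates `t` from `l a`. The
outermost boundaries `0` and `l + 1` never do. -/
lemma mem_bin_iff_of_close {l r : ℕ} {a : ℝ} (h1 : a ≤ 1) (h0 : 0 ≤ a)
    (b : Fin r → Fin (l + 1)) (j : Fin (r + 1)) {t : ℕ} (ht : t ≤ l) {δ : ℝ}
    (hb : ∀ i, δ < |((b i : ℕ) : ℝ) - l * a|) (hd : |(t : ℝ) - l * a| ≤ δ) :
    (binLo b j ≤ t ∧ t < binHi b j) ↔ ((binLo b j : ℝ) ≤ l * a ∧ l * a < (binHi b j : ℝ)) := by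
  have hla : (l : ℝ) * a ≤ l := by nlinarith [(Nat.cast_nonneg l : (0 : ℝ) ≤ l)]
  obtain ⟨d1, d2⟩ := abs_le.mp hd
  refine and_congr ?_ ?_
  · rcases binLo_eq_zero_or b j with h | ⟨i, h⟩
    · simp only [h]; simp; positivity
    · rw [h, ← Nat.cast_le (α := ℝ)]
      rcases lt_abs.mp (hb i) with h | h <;> constructor <;> intro _ <;> linarith
  · rcases binHi_eq_last_or b j with h | ⟨i, h⟩
    · simp only [h]
      refine iff_of_true (by omega) ?_
      push_cast; linarith
    · rw [h, ← Nat.cast_lt (α := ℝ)]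
      rcases lt_abs.mp (hb i) with h | h <;> constructor <;> intro _ <;> linarith

/-- Each vector of test results is compatible with exactly one outcome, the one given by the ranks
of its numbers of hits. -/
lemma inBins_iff {d n r : ℕ} (b : Cuts d n r) (j : Outcomes d r) (x : Fin n → Bool) :
    InBins b j x ↔ j = fun β => ⟨rank (b β) (hits (block d n β) x),
      Nat.lt_succ_of_le (rank_le _ _)⟩ := by
  rw [funext_iff]
  refine forall_congr' fun β => ?_
  rw [mem_bin_iff _ _ ((hits_le _ _).trans (card_block β).le), Fin.ext_iff]
  exact eq_comm

/-- An average over the outcomes by the Born rule thus becomes a classical average over test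
results. -/
lemma sum_trace_outcomeProj {d n r : ℕ} (B : TomographyBasis d) {ρ : Matrix (Fin d) (Fin d) ℂ}
    (hρ : IsState ρ) (b : Cuts d n r) (f : Outcomes d r → ℝ) :
    ∑ j, f j * (outcomeProj B b j * tensorPower ρ n).trace.re =
      ∑ x, resultWeight B ρ x * f fun β => ⟨rank (b β) (hits (block d n β) x),
        Nat.lt_succ_of_le (rank_le _ _)⟩ := by
  simp only [trace_outcomeProj B hρ, Finset.mul_sum]
  rw [Finset.sum_comm]
  refine Finset.sum_congr rfl fun x _ => ?_
  simp only [inBins_iff, mul_ite, mul_zero]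
  rw [Finset.sum_ite_eq']
  simp [mul_comm]

/-! ### Uniform cut points -/

/-- Write `G (b k)` as a product with factor `1` at all other coordinates; the sum over `b` then
factorizes. -/
lemma average_marginal {κ V : Type*} [Fintype κ] [DecidableEq κ] [Fintype V] [Nonempty V]
    (k : κ) (G : V → ℝ) :
    (1 / (Fintype.card (κ → V) : ℝ)) * ∑ b : κ → V, G (b k) =
      (1 / (Fintype.card V : ℝ)) * ∑ v, G v := by
  have h : ∀ b : κ → V, G (b k) = ∏ k', (fun v => if k' = k then G v else 1) (b k') := fun b => by
    simp
  rw [Finset.sum_congr rfl fun b _ => h b, ← Fintype.piFinset_univ,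
    ← Finset.prod_univ_sum (fun _ => Finset.univ) (fun k' v => if k' = k then G v else 1)]
  have hV : (Fintype.card V : ℝ) ≠ 0 := by exact_mod_cast Fintype.card_ne_zero
  have h2 : ∀ k', (∑ v : V, if k' = k then G v else 1) =
      (Fintype.card V : ℝ) * if k' = k then (1 / (Fintype.card V : ℝ)) * ∑ v, G v else 1 := by
    intro k'
    split_ifs
    · field_simp
    · simp
  rw [Finset.prod_congr rfl fun k' _ => h2 k', Finset.prod_mul_distrib, Finset.prod_ite_eq']
  simp only [Finset.prod_const, Finset.card_univ, Fintype.card_fun, Finset.mem_univ, if_true]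
  push_cast
  field_simp

/-- The coordinates are independent, and each avoids `W` with probability `1 - |W| / N`. -/
lemma average_forall_notMem {r N : ℕ} (hN : 0 < N) (W : Finset (Fin N)) :
    (1 / (Fintype.card (Fin r → Fin N) : ℝ)) *
      (∑ c : Fin r → Fin N, if ∀ i, c i ∉ W then (1 : ℝ) else 0) =
      (1 - W.card / N) ^ r := by
  have h : ∀ c : Fin r → Fin N, (if ∀ i, c i ∉ W then (1 : ℝ) else 0) =
      ∏ i, (fun v => if v ∉ W then (1 : ℝ) else 0) (c i) := fun c => by
    split_ifs with hc
    · simp [hc]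
    · push Not at hc
      obtain ⟨i, hi⟩ := hc
      exact (Finset.prod_eq_zero (Finset.mem_univ i) (by simp [hi])).symm
  rw [Finset.sum_congr rfl fun c _ => h c, ← Fintype.piFinset_univ,
    ← Finset.prod_univ_sum (fun _ => Finset.univ) (fun _ v => if v ∉ W then (1 : ℝ) else 0)]
  have hW : W.card ≤ N := by simpa using Finset.card_le_univ W
  have h2 : (∑ v : Fin N, if v ∉ W then (1 : ℝ) else 0) = N - W.card := by
    rw [Finset.sum_ite, Finset.sum_const_zero, add_zero, Finset.sum_const, nsmul_eq_mul, mul_one,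
      ← Finset.compl_filter, Finset.card_compl]
    simp [Nat.cast_sub hW]
  simp only [h2, Finset.prod_const, Finset.card_univ, Fintype.card_fun, Fintype.card_fin]
  have : (N : ℝ) ≠ 0 := by positivity
  push_cast
  rw [one_div, ← inv_pow, ← mul_pow]
  congr 1
  field_simp

/-- From `1 - x ≤ exp (-x)`. Real lower bounds `R` and `u` replace the integers because the number
of cut points and the size of the window are known only up to rounding. -/
lemma average_forall_notMem_le {r N : ℕ} (hN : 0 < N) (W : Finset (Fin N)) {R u : ℝ}
    (hR : 0 ≤ R) (hr : R ≤ r) (hu : u ≤ W.card) :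
    (1 / (Fintype.card (Fin r → Fin N) : ℝ)) *
      (∑ c : Fin r → Fin N, if ∀ i, c i ∉ W then (1 : ℝ) else 0) ≤ Real.exp (-(R * u / N)) := by
  rw [average_forall_notMem hN]
  have hNp : (0 : ℝ) < N := by exact_mod_cast hN
  have hW : (W.card : ℝ) ≤ N := by
    have : W.card ≤ N := by simpa using Finset.card_le_univ W
    exact_mod_cast this
  have h1 : (1 - W.card / N : ℝ) ≤ Real.exp (-(W.card / N)) := by
    have := Real.add_one_le_exp (-(W.card / N : ℝ))
    linarith
  have h0 : (0 : ℝ) ≤ 1 - W.card / N := by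
    rw [sub_nonneg, div_le_one hNp]; exact hW
  refine (pow_le_pow_left₀ h0 h1 r).trans ?_
  rw [← Real.exp_nat_mul]
  refine Real.exp_le_exp.mpr ?_
  rw [mul_neg, neg_le_neg_iff, mul_div_assoc', div_le_div_iff_of_pos_right hNp]
  exact (mul_le_mul_of_nonneg_left hu hR).trans (mul_le_mul_of_nonneg_right hr (by positivity))

open Classical in
lemma card_close_le (l : ℕ) (y δ : ℝ) (hδ : 0 ≤ δ) :
    (((Finset.univ : Finset (Fin (l + 1))).filter
      fun v : Fin (l + 1) => |((v : ℕ) : ℝ) - y| ≤ δ).card : ℝ) ≤ 2 * δ + 1 := by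
  have h : ((Finset.univ : Finset (Fin (l + 1))).filter
      fun v : Fin (l + 1) => |((v : ℕ) : ℝ) - y| ≤ δ).card ≤ (Finset.Icc ⌈y - δ⌉ ⌊y + δ⌋).card := by
    refine Finset.card_le_card_of_injOn (fun v => ((v : ℕ) : ℤ)) ?_ ?_
    · intro v hv
      have := abs_le.mp (Finset.mem_filter.mp hv).2
      simp only [Finset.coe_Icc, Set.mem_Icc, Int.ceil_le, Int.le_floor]
      push_cast
      constructor <;> linarith
    · intro v _ w _ hvw
      simpa [Fin.ext_iff] using hvw
  rw [Int.card_Icc] at h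
  have h1 := Int.le_ceil (y - δ)
  have h2 := Int.floor_le (y + δ)
  -- If no integer lies in the interval, `toNat` truncates a negative number and the count is `0`.
  rcases le_total 0 (⌊y + δ⌋ + 1 - ⌈y - δ⌉) with h3 | h3
  · have h4 : ((⌊y + δ⌋ + 1 - ⌈y - δ⌉).toNat : ℝ) = ((⌊y + δ⌋ + 1 - ⌈y - δ⌉ : ℤ) : ℝ) := by
      exact_mod_cast Int.toNat_of_nonneg h3
    have h5 : (((Finset.univ : Finset (Fin (l + 1))).filter
      fun v : Fin (l + 1) => |((v : ℕ) : ℝ) - y| ≤ δ).card : ℝ) ≤ ((⌊y + δ⌋ + 1 - ⌈y - δ⌉).toNat : ℝ) := by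
      exact_mod_cast h
    rw [h4] at h5
    push_cast at h5
    linarith
  · rw [Int.toNat_of_nonpos h3] at h
    have : (((Finset.univ : Finset (Fin (l + 1))).filter
      fun v : Fin (l + 1) => |((v : ℕ) : ℝ) - y| ≤ δ).card : ℝ) ≤ 0 := by exact_mod_cast h
    linarith

open Classical in
-- The window is given by integers so that floors and ceilings of real endpoints can be inserted;
-- for `q < p` the bound is trivial.
lemma le_card_window (l : ℕ) (p q : ℤ) (h0 : 0 ≤ p) (hq : q ≤ l) (P : Fin (l + 1) → Prop)
    (hP : ∀ v : Fin (l + 1), p ≤ ((v : ℕ) : ℤ) → ((v : ℕ) : ℤ) ≤ q → P v) :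
    ((q : ℝ) + 1 - p) ≤ (Finset.univ.filter P).card := by
  have h : (Finset.Icc p q).card ≤ (Finset.univ.filter P).card := by
    refine Finset.card_le_card_of_injOn (fun z => Fin.ofNat (l + 1) z.toNat) ?_ ?_
    · intro z hz
      have hz := Finset.mem_Icc.mp hz
      have : ((Fin.ofNat (l + 1) z.toNat : Fin (l + 1)) : ℕ) = z.toNat := by
        simp only [Fin.ofNat]
        exact Nat.mod_eq_of_lt (by omega)
      simp only [Finset.coe_filter, Finset.mem_univ, true_and, Set.mem_ofPred_eq]
      exact hP _ (by rw [this]; omega) (by rw [this]; omega)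
    · intro z hz w hw hzw
      have hz := Finset.mem_Icc.mp hz
      have hw := Finset.mem_Icc.mp hw
      have h := congrArg Fin.val hzw
      simp only [Fin.ofNat] at h
      rw [Nat.mod_eq_of_lt (by omega), Nat.mod_eq_of_lt (by omega)] at h
      omega
  rw [Int.card_Icc] at h
  have h2 : (q + 1 - p : ℤ) ≤ ((Finset.univ.filter P).card : ℤ) :=
    (Int.self_le_toNat _).trans (by exact_mod_cast h)
  exact_mod_cast h2

/-! ### The failure probability -/

/-- Some cut point is close to `l a`. -/
def NearCut (a : ℝ) {l r : ℕ} (c : Fin r → Fin (l + 1)) : Prop :=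
  ∃ i, |((c i : ℕ) : ℝ) - l * a| ≤ Real.sqrt l * Real.log l

/-- There is no boundary slightly below `l a`. -/
def GapBelow (s a : ℝ) {l r : ℕ} (c : Fin r → Fin (l + 1)) : Prop :=
  ¬ ∃ i, (boundary c i : ℝ) ≤ l * a ∧
    l * a - (l : ℝ) ^ (1 - s) * Real.log l ≤ (boundary c i : ℝ)

/-- There is no boundary slightly above `l a`. -/
def GapAbove (s a : ℝ) {l r : ℕ} (c : Fin r → Fin (l + 1)) : Prop :=
  ¬ ∃ i, l * a < (boundary c i : ℝ) ∧
    (boundary c i : ℝ) ≤ l * a + (l : ℝ) ^ (1 - s) * Real.log l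

lemma exists_boundary_eq {l r : ℕ} (c : Fin r → Fin (l + 1)) (i : Fin r) :
    ∃ i', boundary c i' = c i :=
  ⟨_, by rw [boundary_mid c ((Tuple.sort c).symm i), Equiv.apply_symm_apply]⟩

open Classical in
-- Union bound over the `r` cut points, each of which is uniform by `average_marginal`.
lemma average_nearCut_le {l r : ℕ} (hl : 1 ≤ l) (a : ℝ) :
    (1 / (Fintype.card (Fin r → Fin (l + 1)) : ℝ)) *
      (∑ c : Fin r → Fin (l + 1), if NearCut a c then (1 : ℝ) else 0) ≤
      r * ((2 * (Real.sqrt l * Real.log l) + 1) / (l + 1)) := by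
  set δ := Real.sqrt l * Real.log l
  have hδ : 0 ≤ δ := mul_nonneg (Real.sqrt_nonneg _) (Real.log_nonneg (by exact_mod_cast hl))
  have h1 : ∀ c : Fin r → Fin (l + 1), (if NearCut a c then (1 : ℝ) else 0) ≤
      ∑ i, if |((c i : ℕ) : ℝ) - l * a| ≤ δ then (1 : ℝ) else 0 := by
    intro c
    have hnn : ∀ i ∈ Finset.univ, (0 : ℝ) ≤ if |((c i : ℕ) : ℝ) - l * a| ≤ δ then (1 : ℝ) else 0 :=
      fun i _ => by split_ifs <;> norm_num
    split_ifs with h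
    · obtain ⟨i, hi⟩ := h
      refine le_trans ?_ (Finset.single_le_sum hnn (Finset.mem_univ i))
      rw [if_pos hi]
    · exact Finset.sum_nonneg hnn
  have h2 : (1 / (Fintype.card (Fin r → Fin (l + 1)) : ℝ)) *
      (∑ c : Fin r → Fin (l + 1), if NearCut a c then (1 : ℝ) else 0) ≤
      ∑ i : Fin r, (1 / (Fintype.card (Fin r → Fin (l + 1)) : ℝ)) *
        ∑ c : Fin r → Fin (l + 1), if |((c i : ℕ) : ℝ) - l * a| ≤ δ then (1 : ℝ) else 0 := by
    rw [← Finset.mul_sum, Finset.sum_comm]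
    exact mul_le_mul_of_nonneg_left (Finset.sum_le_sum fun c _ => h1 c) (by positivity)
  refine h2.trans ?_
  have h3 : ∀ i : Fin r, (1 / (Fintype.card (Fin r → Fin (l + 1)) : ℝ)) *
      (∑ c : Fin r → Fin (l + 1), if |((c i : ℕ) : ℝ) - l * a| ≤ δ then (1 : ℝ) else 0) ≤
      (2 * δ + 1) / (l + 1) := by
    intro i
    rw [average_marginal i fun v : Fin (l + 1) => if |((v : ℕ) : ℝ) - l * a| ≤ δ then (1 : ℝ) else 0,
      ← Finset.sum_filter, Finset.sum_const, nsmul_eq_mul, mul_one, Fintype.card_fin, one_div,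
      inv_mul_eq_div]
    push_cast
    exact div_le_div_of_nonneg_right (card_close_le l _ δ hδ) (by positivity)
  refine (Finset.sum_le_sum fun i _ => h3 i).trans ?_
  simp

open Classical in
-- A gap means that all cut points avoid the window `W`.
lemma average_gap_le {l r : ℕ} (Q : (Fin r → Fin (l + 1)) → Prop) (W : Fin (l + 1) → Prop)
    (hQ : ∀ c, Q c → ∀ i, ¬ W (c i)) {R u : ℝ} (hR : 0 ≤ R) (hr : R ≤ r)
    (hu : u ≤ (Finset.univ.filter W).card) :
    (1 / (Fintype.card (Fin r → Fin (l + 1)) : ℝ)) *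
      (∑ c : Fin r → Fin (l + 1), if Q c then (1 : ℝ) else 0) ≤
      Real.exp (-(R * u / (l + 1))) := by
  have h := average_forall_notMem_le (N := l + 1) (Nat.succ_pos l) (Finset.univ.filter W) hR hr hu
  push_cast at h
  refine le_trans (mul_le_mul_of_nonneg_left (Finset.sum_le_sum fun c _ => ?_) (by positivity)) h
  by_cases hc : Q c
  · rw [if_pos hc, if_pos fun i => by simpa using hQ c hc i]
  · rw [if_neg hc]; split_ifs <;> norm_num

open Classical in
lemma average_gapBelow_le {l r : ℕ} {s a : ℝ} (ha0 : 0 ≤ a) (ha1 : a ≤ 1) {R : ℝ} (hR : 0 ≤ R)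
    (hr : R ≤ r) :
    (1 / (Fintype.card (Fin r → Fin (l + 1)) : ℝ)) *
      (∑ c : Fin r → Fin (l + 1), if GapBelow s a c then (1 : ℝ) else 0) ≤
      Real.exp (-(R * ((l : ℝ) ^ (1 - s) * Real.log l - 1) / (l + 1))) := by
  set w := (l : ℝ) ^ (1 - s) * Real.log l with hw
  have hla : (l : ℝ) * a ≤ l := by nlinarith [(Nat.cast_nonneg l : (0 : ℝ) ≤ l)]
  have h0 : 0 ≤ l * a := by positivity
  rcases le_or_gt (l * a - w) 0 with h | h
  -- If the window reaches down to `0`, the boundary `0` lies in it.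
  · have : ∀ c : Fin r → Fin (l + 1), ¬ GapBelow s a c := fun c hc =>
      hc ⟨0, by simpa [boundary_zero] using h0, by simpa [boundary_zero] using h⟩
    simp only [this, if_false, Finset.sum_const_zero, mul_zero]
    positivity
  · refine average_gap_le _ (fun v => ((v : ℕ) : ℝ) ≤ l * a ∧ l * a - w ≤ ((v : ℕ) : ℝ)) ?_ hR hr ?_
    · intro c hc i hi
      obtain ⟨i', hi'⟩ := exists_boundary_eq c i
      exact hc ⟨i', by rw [hi']; exact hi⟩
    -- Otherwise the whole window lies in `{0, …, l}` and contains at least `w - 1` integers.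
    · have := le_card_window l ⌈l * a - w⌉ ⌊l * a⌋ (Int.ceil_nonneg h.le)
        (Int.floor_le_iff.mpr (by push_cast; linarith))
        (fun v => ((v : ℕ) : ℝ) ≤ l * a ∧ l * a - w ≤ ((v : ℕ) : ℝ))
        (fun v h1 h2 => ⟨by exact_mod_cast Int.le_floor.mp h2, by exact_mod_cast Int.ceil_le.mp h1⟩)
      have e1 := Int.ceil_lt_add_one (l * a - w)
      have e2 := Int.lt_floor_add_one (l * a)
      linarith

open Classical in
lemma average_gapAbove_le {l r : ℕ} {s a : ℝ} (ha0 : 0 ≤ a) (ha1 : a ≤ 1) {R : ℝ} (hR : 0 ≤ R)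
    (hr : R ≤ r) :
    (1 / (Fintype.card (Fin r → Fin (l + 1)) : ℝ)) *
      (∑ c : Fin r → Fin (l + 1), if GapAbove s a c then (1 : ℝ) else 0) ≤
      Real.exp (-(R * ((l : ℝ) ^ (1 - s) * Real.log l - 1) / (l + 1))) := by
  set w := (l : ℝ) ^ (1 - s) * Real.log l with hw
  have hla : (l : ℝ) * a ≤ l := by nlinarith [(Nat.cast_nonneg l : (0 : ℝ) ≤ l)]
  have h0 : 0 ≤ l * a := by positivity
  rcases le_or_gt ((l : ℝ) + 1) (l * a + w) with h | h
  -- If the window reaches up to `l + 1`, the last boundary lies in it.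
  · have : ∀ c : Fin r → Fin (l + 1), ¬ GapAbove s a c := fun c hc =>
      hc ⟨Fin.last _, by rw [boundary_last]; push_cast; linarith,
        by rw [boundary_last]; push_cast; linarith⟩
    simp only [this, if_false, Finset.sum_const_zero, mul_zero]
    positivity
  · refine average_gap_le _ (fun v => l * a < ((v : ℕ) : ℝ) ∧ ((v : ℕ) : ℝ) ≤ l * a + w) ?_ hR hr ?_
    · intro c hc i hi
      obtain ⟨i', hi'⟩ := exists_boundary_eq c i
      exact hc ⟨i', by rw [hi']; exact hi⟩
    · have := le_card_window l (⌊l * a⌋ + 1) ⌊l * a + w⌋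
        (by have := Int.floor_nonneg.mpr h0; omega)
        (by
          have : ⌊l * a + w⌋ < (l : ℤ) + 1 := Int.floor_lt.mpr (by push_cast; linarith)
          omega)
        (fun v => l * a < ((v : ℕ) : ℝ) ∧ ((v : ℕ) : ℝ) ≤ l * a + w)
        (fun v h1 h2 => ⟨by
          have := Int.floor_lt.mp (Int.lt_iff_add_one_le.mpr h1)
          exact_mod_cast this, by exact_mod_cast Int.le_floor.mp h2⟩)
      have e1 := Int.floor_le (l * a)
      have e2 := Int.lt_floor_add_one (l * a + w)
      push_cast at this
      linarith

/-- Only the last clause of success involves the outcome, and `mem_bin_iff_of_close` carries it over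
from the number of hits to `l a`. -/
lemma success_of_inBins {d n r : ℕ} (B : TomographyBasis d) {s : ℝ}
    {ρ : Matrix (Fin d) (Fin d) ℂ} (hρ : IsState ρ) {b : Cuts d n r} {j : Outcomes d r}
    {x : Fin n → Bool} (hx : InBins b j x) (h1 : ∀ β, ¬ NearCut (expect (B.phi β) ρ) (b β))
    (h2 : ∀ β, ¬ GapBelow s (expect (B.phi β) ρ) (b β))
    (h3 : ∀ β, ¬ GapAbove s (expect (B.phi β) ρ) (b β))
    (h4 : ∀ β, ¬ Deviates B ρ β x) : Success B s ρ b j := by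
  intro β
  have hn : ∀ i, Real.sqrt (blockLen d n) * Real.log (blockLen d n) <
      |((b β i : ℕ) : ℝ) - blockLen d n * expect (B.phi β) ρ| := by
    simpa [NearCut] using h1 β
  exact ⟨hn, not_not.mp (h2 β), not_not.mp (h3 β),
    (mem_bin_iff_of_close (expect_le_one (isTest_phi B β) hρ) (expect_nonneg _ hρ.1) (b β) (j β)
      ((hits_le _ _).trans (card_block β).le) hn (not_le.mp (h4 β)).le).mp (hx β)⟩

/-- The other direction of `mem_bin_iff_of_close`: under success, only a large deviation can lead
out of the measured bins. This drives the disturbance bound. -/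
lemma inBins_of_success {d n r : ℕ} (B : TomographyBasis d) {s : ℝ}
    {ρ : Matrix (Fin d) (Fin d) ℂ} (hρ : IsState ρ) {b : Cuts d n r} {j : Outcomes d r}
    {x : Fin n → Bool} (hs : Success B s ρ b j) (h4 : ∀ β, ¬ Deviates B ρ β x) :
    InBins b j x := fun β =>
  (mem_bin_iff_of_close (expect_le_one (isTest_phi B β) hρ) (expect_nonneg _ hρ.1) (b β) (j β)
    ((hits_le _ _).trans (card_block β).le) (hs β).1 (not_le.mp (h4 β)).le).mpr (hs β).2.2.2

open Classical in
lemma failureProb_eq {d : ℕ} (B : TomographyBasis d) (s : ℝ) (n r : ℕ)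
    {ρ : Matrix (Fin d) (Fin d) ℂ} (hρ : IsState ρ) :
    failureProb B s n r ρ = ∑ b : Cuts d n r, (1 / (Fintype.card (Cuts d n r) : ℝ)) *
      ∑ x, resultWeight B ρ x * if Success B s ρ b fun β =>
        ⟨rank (b β) (hits (block d n β) x), Nat.lt_succ_of_le (rank_le _ _)⟩ then 0 else 1 := by
  unfold failureProb
  refine Finset.sum_congr rfl fun b _ => ?_
  rw [← sum_trace_outcomeProj B hρ b fun j => if Success B s ρ b j then 0 else 1]
  congr 1
  refine Finset.sum_congr rfl fun j _ => ?_
  split_ifs <;> simp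

/-- It takes care of the blocks that are too short for the asymptotic estimates. -/
lemma failureProb_le_one {d : ℕ} (B : TomographyBasis d) (s : ℝ) (n r : ℕ)
    {ρ : Matrix (Fin d) (Fin d) ℂ} (hρ : IsState ρ) : failureProb B s n r ρ ≤ 1 := by
  classical
  rw [failureProb_eq B s n r hρ, ← Finset.mul_sum]
  have h : ∀ b : Cuts d n r, (∑ x, resultWeight B ρ x * if Success B s ρ b fun β =>
      ⟨rank (b β) (hits (block d n β) x), Nat.lt_succ_of_le (rank_le _ _)⟩ then (0 : ℝ) else 1) ≤
      1 := fun b => by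
    refine le_trans (Finset.sum_le_sum fun x _ => ?_) (sum_resultWeight (n := n) B ρ).le
    refine mul_le_of_le_one_right (resultWeight_nonneg B hρ x) ?_
    split_ifs <;> norm_num
  have hc : (0 : ℝ) < Fintype.card (Cuts d n r) := by exact_mod_cast Fintype.card_pos
  calc _ ≤ (1 / (Fintype.card (Cuts d n r) : ℝ)) * ∑ _b : Cuts d n r, (1 : ℝ) :=
        mul_le_mul_of_nonneg_left (Finset.sum_le_sum fun b _ => h b) (by positivity)
    _ = 1 := by
        rw [Finset.sum_const, nsmul_eq_mul, mul_one, Finset.card_univ]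
        field_simp

open Classical in
-- Union bound over the blocks and the four causes of failure. Three of them concern the cut points
-- of one block, the fourth only the test results, so all other randomness averages out.
lemma failureProb_le_sum {d : ℕ} (B : TomographyBasis d) (s : ℝ) (n r : ℕ)
    {ρ : Matrix (Fin d) (Fin d) ℂ} (hρ : IsState ρ) :
    failureProb B s n r ρ ≤ ∑ β : Fin (numBlocks d),
      ((1 / (Fintype.card (Fin r → Fin (blockLen d n + 1)) : ℝ)) *
          (∑ c : Fin r → Fin (blockLen d n + 1),
            if NearCut (expect (B.phi β) ρ) c then (1 : ℝ) else 0) +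
        (1 / (Fintype.card (Fin r → Fin (blockLen d n + 1)) : ℝ)) *
          (∑ c : Fin r → Fin (blockLen d n + 1),
            if GapBelow s (expect (B.phi β) ρ) c then (1 : ℝ) else 0) +
        (1 / (Fintype.card (Fin r → Fin (blockLen d n + 1)) : ℝ)) *
          (∑ c : Fin r → Fin (blockLen d n + 1),
            if GapAbove s (expect (B.phi β) ρ) c then (1 : ℝ) else 0) +
        ∑ x : Fin n → Bool, resultWeight B ρ x * if Deviates B ρ β x then 1 else 0) := by
  rw [failureProb_eq B s n r hρ]
  set u := 1 / (Fintype.card (Cuts d n r) : ℝ) with hu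
  have hc : (0 : ℝ) < Fintype.card (Cuts d n r) := by exact_mod_cast Fintype.card_pos
  have hu0 : 0 ≤ u := by positivity
  have hu1 : ∑ _b : Cuts d n r, u = 1 := by
    rw [Finset.sum_const, nsmul_eq_mul, Finset.card_univ, hu]
    field_simp
  let g : Fin (numBlocks d) → (Fin r → Fin (blockLen d n + 1)) → ℝ := fun β c =>
    (if NearCut (expect (B.phi β) ρ) c then (1 : ℝ) else 0) +
    (if GapBelow s (expect (B.phi β) ρ) c then (1 : ℝ) else 0) +
    (if GapAbove s (expect (B.phi β) ρ) c then (1 : ℝ) else 0)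
  let e : Fin (numBlocks d) → (Fin n → Bool) → ℝ := fun β x => if Deviates B ρ β x then 1 else 0
  have hg : ∀ β c, 0 ≤ g β c := fun β c => by
    refine add_nonneg (add_nonneg ?_ ?_) ?_ <;> split_ifs <;> norm_num
  have he : ∀ β x, 0 ≤ e β x := fun β x => by simp only [e]; split_ifs <;> norm_num
  have key : ∀ (b : Cuts d n r) (x : Fin n → Bool), (if Success B s ρ b fun β =>
      ⟨rank (b β) (hits (block d n β) x), Nat.lt_succ_of_le (rank_le _ _)⟩ then (0 : ℝ) else 1) ≤
      ∑ β, (g β (b β) + e β x) := by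
    intro b x
    split_ifs with h
    · exact Finset.sum_nonneg fun β _ => add_nonneg (hg _ _) (he _ _)
    · obtain ⟨β, hβ⟩ : ∃ β, NearCut (expect (B.phi β) ρ) (b β) ∨
          GapBelow s (expect (B.phi β) ρ) (b β) ∨ GapAbove s (expect (B.phi β) ρ) (b β) ∨
          Deviates B ρ β x := by
        by_contra hcon
        push Not at hcon
        exact h (success_of_inBins B hρ ((inBins_iff _ _ _).mpr rfl) (fun β => (hcon β).1)
          (fun β => (hcon β).2.1) (fun β => (hcon β).2.2.1) fun β => (hcon β).2.2.2)
      refine le_trans ?_ (Finset.single_le_sum (f := fun β => g β (b β) + e β x)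
        (fun β _ => add_nonneg (hg _ _) (he _ _)) (Finset.mem_univ β))
      have i1 : ∀ (p : Prop), (0 : ℝ) ≤ if p then 1 else 0 := fun p => by split_ifs <;> norm_num
      simp only [g, e]
      rcases hβ with h | h | h | h <;> rw [if_pos h] <;>
        linarith [i1 (NearCut (expect (B.phi β) ρ) (b β)), i1 (Deviates B ρ β x),
          i1 (GapBelow s (expect (B.phi β) ρ) (b β)), i1 (GapAbove s (expect (B.phi β) ρ) (b β))]
  have step : ∀ b : Cuts d n r, u * (∑ x, resultWeight B ρ x * if Success B s ρ b fun β =>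
      ⟨rank (b β) (hits (block d n β) x), Nat.lt_succ_of_le (rank_le _ _)⟩ then (0 : ℝ) else 1) ≤
      ∑ β, (u * g β (b β) + u * ∑ x, resultWeight B ρ x * e β x) := by
    intro b
    rw [← Finset.sum_congr rfl fun β _ => mul_add u _ _, ← Finset.mul_sum]
    refine mul_le_mul_of_nonneg_left ?_ hu0
    refine (Finset.sum_le_sum fun x _ =>
      mul_le_mul_of_nonneg_left (key b x) (resultWeight_nonneg B hρ x)).trans (le_of_eq ?_)
    simp only [Finset.mul_sum]
    rw [Finset.sum_comm]
    refine Finset.sum_congr rfl fun β _ => ?_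
    simp only [mul_add, Finset.sum_add_distrib, ← Finset.sum_mul, sum_resultWeight, one_mul]
  refine (Finset.sum_le_sum fun b _ => step b).trans (le_of_eq ?_)
  rw [Finset.sum_comm]
  refine Finset.sum_congr rfl fun β _ => ?_
  -- The deviation does not depend on the cut points, and the other terms depend only on those of
  -- block `β`.
  rw [Finset.sum_add_distrib, ← Finset.mul_sum, ← Finset.sum_mul, hu1, one_mul, hu,
    average_marginal (V := Fin r → Fin (blockLen d n + 1)) β (g β)]
  simp only [g, e, Finset.sum_add_distrib, mul_add]

/-! ### Numerical estimates for the rates. -/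

lemma numBlocks_pos {d : ℕ} (hd : 2 ≤ d) : 0 < numBlocks d := by
  have : 2 ^ 2 ≤ d ^ 2 := Nat.pow_le_pow_left hd 2
  exact Nat.mul_pos (by omega) (by omega)

lemma lt_numBlocks_mul {d : ℕ} (hd : 2 ≤ d) (n : ℕ) : n < numBlocks d * (blockLen d n + 1) :=
  Nat.lt_mul_div_succ n (numBlocks_pos hd)

lemma blockLen_le (d n : ℕ) : blockLen d n ≤ n := Nat.div_le_self _ _

lemma half_le_log {l : ℕ} (hl : 2 ≤ l) : 1 / 2 ≤ Real.log l := by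
  have h : Real.log 2 ≤ Real.log l := Real.log_le_log (by norm_num) (by exact_mod_cast hl)
  linarith [Real.log_two_gt_d9]

lemma near_term_le {s : ℝ} {l : ℕ} (hl : 2 ≤ l) {r : ℕ} (hr : (r : ℝ) ≤ (l : ℝ) ^ s) :
    r * ((2 * (Real.sqrt l * Real.log l) + 1) / (l + 1)) ≤
      4 * ((l : ℝ) ^ (s - 1 / 2) * Real.log l) := by
  have hlp : (2 : ℝ) ≤ l := by exact_mod_cast hl
  have hlog := half_le_log hl
  have hs : 1 ≤ Real.sqrt l := Real.one_le_sqrt.mpr (by linarith)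
  have hss : Real.sqrt l ^ 2 = l := Real.sq_sqrt (by linarith)
  have e : (l : ℝ) ^ (s - 1 / 2) = (l : ℝ) ^ s / Real.sqrt l := by
    rw [Real.rpow_sub (by linarith), Real.sqrt_eq_rpow]
  -- For `l ≥ 2`, the summand `1` is absorbed because `ln l ≥ 1 / 2`.
  have h1 : (2 * (Real.sqrt l * Real.log l) + 1) / (l + 1) ≤ 4 * (Real.log l / Real.sqrt l) := by
    rw [mul_div_assoc', div_le_div_iff₀ (by linarith) (by linarith)]
    nlinarith
  calc _ ≤ (l : ℝ) ^ s * (4 * (Real.log l / Real.sqrt l)) :=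
        mul_le_mul hr h1 (by positivity) (by positivity)
    _ = _ := by rw [e]; ring

lemma inv_le_rate {s : ℝ} (hs : 0 < s) {l : ℕ} (hl : 2 ≤ l) :
    (l : ℝ)⁻¹ ≤ 2 * ((l : ℝ) ^ (s - 1 / 2) * Real.log l) := by
  have hlp : (2 : ℝ) ≤ l := by exact_mod_cast hl
  have hlog := half_le_log hl
  have h1 : (l : ℝ) ^ (-1 : ℝ) ≤ (l : ℝ) ^ (s - 1 / 2) :=
    Real.rpow_le_rpow_of_exponent_le (by linarith) (by linarith)
  rw [Real.rpow_neg_one] at h1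
  nlinarith [show (0 : ℝ) ≤ (l : ℝ) ^ (s - 1 / 2) by positivity]

/-- Multiplied out, the exponent is `l ln l` up to terms of order `l`, divided by `l + 1`; hence it
is `ln l - O(1)`, and the exponential is `O(1/l)`. -/
lemma gap_term_le {s : ℝ} (hs : 0 < s) (hs' : s < 1 / 2) {l : ℕ} (hl : 2 ≤ l) :
    Real.exp (-(((l : ℝ) ^ s - 1) * ((l : ℝ) ^ (1 - s) * Real.log l - 1) / (l + 1))) ≤
      2 * Real.exp (2 + 1 / s) * ((l : ℝ) ^ (s - 1 / 2) * Real.log l) := by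
  have hlp : (2 : ℝ) ≤ l := by exact_mod_cast hl
  have hl0 : (0 : ℝ) < l := by linarith
  have hlog := half_le_log hl
  have h1 : (l : ℝ) ^ s * (l : ℝ) ^ (1 - s) = l := by
    rw [← Real.rpow_add hl0]; simp
  have h2 : Real.log l ≤ (l : ℝ) ^ s / s := Real.log_le_rpow_div hl0.le hs
  have hp : (0 : ℝ) < (l : ℝ) ^ (1 - s) := by positivity
  have h3 : (l : ℝ) ^ (1 - s) * Real.log l ≤ l / s := by
    calc _ ≤ (l : ℝ) ^ (1 - s) * ((l : ℝ) ^ s / s) := mul_le_mul_of_nonneg_left h2 hp.le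
      _ = ((l : ℝ) ^ s * (l : ℝ) ^ (1 - s)) / s := by ring
      _ = _ := by rw [h1]
  have h4 : (l : ℝ) ^ s ≤ l := by
    simpa using Real.rpow_le_rpow_of_exponent_le (show (1 : ℝ) ≤ l by linarith)
      (show s ≤ 1 by linarith)
  have h5 : Real.log l ≤ l := (Real.log_le_sub_one_of_pos hl0).trans (by linarith)
  have h6 : 0 < 1 / s := by positivity
  -- The `2` pays for `l ^ s ≤ l` and `ln l ≤ l`, and `1 / s` pays for `l ^ (1 - s) ln l ≤ l / s`.
  have h7 : Real.log l - 2 - 1 / s ≤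
      ((l : ℝ) ^ s - 1) * ((l : ℝ) ^ (1 - s) * Real.log l - 1) / (l + 1) := by
    rw [le_div_iff₀ (by linarith)]
    have e1 : ((l : ℝ) ^ s - 1) * ((l : ℝ) ^ (1 - s) * Real.log l - 1) =
        ((l : ℝ) ^ s * (l : ℝ) ^ (1 - s)) * Real.log l - (l : ℝ) ^ s -
          (l : ℝ) ^ (1 - s) * Real.log l + 1 := by ring
    have e2 : (l : ℝ) / s = 1 / s * l := by ring
    rw [e1, h1]
    rw [e2] at h3
    nlinarith
  calc _ ≤ Real.exp (2 + 1 / s - Real.log l) := Real.exp_le_exp.mpr (by linarith)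
    _ = Real.exp (2 + 1 / s) * (l : ℝ)⁻¹ := by
        rw [Real.exp_sub, Real.exp_log hl0, div_eq_mul_inv]
    _ ≤ _ := by
        have := mul_le_mul_of_nonneg_left (inv_le_rate hs hl) (Real.exp_pos (2 + 1 / s)).le
        linarith

lemma numBins_sub_one_bounds {s : ℝ} (hs : 0 < s) {l : ℕ} (hl : 1 ≤ l) :
    ((numBins s l - 1 : ℕ) : ℝ) ≤ (l : ℝ) ^ s ∧ (l : ℝ) ^ s - 1 ≤ ((numBins s l - 1 : ℕ) : ℝ) := by
  have h1 : (1 : ℝ) ≤ (l : ℝ) ^ s := Real.one_le_rpow (by exact_mod_cast hl) hs.le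
  have h2 : 1 ≤ numBins s l := Nat.one_le_ceil_iff.mpr (by linarith)
  have h3 := Nat.le_ceil ((l : ℝ) ^ s)
  have h4 := Nat.ceil_lt_add_one (show (0 : ℝ) ≤ (l : ℝ) ^ s by linarith)
  rw [Nat.cast_sub h2]
  unfold numBins
  push_cast
  constructor <;> linarith

/-- The rate of failure of one block. -/
def failureConst (s : ℝ) : ℝ := 4 + 4 * Real.exp (2 + 1 / s) + 4 * Real.exp (4 / 3)

lemma failureProb_le_blockLen {d : ℕ} (B : TomographyBasis d) {s : ℝ} (hs : 0 < s)
    (hs' : s < 1 / 2) (n : ℕ) (hl : 2 ≤ blockLen d n) {ρ : Matrix (Fin d) (Fin d) ℂ}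
    (hρ : IsState ρ) :
    failureProb B s n (numBins s (blockLen d n) - 1) ρ ≤
      numBlocks d * (failureConst s *
        ((blockLen d n : ℝ) ^ (s - 1 / 2) * Real.log (blockLen d n))) := by
  classical
  set l := blockLen d n with hldef
  obtain ⟨r1, r2⟩ := numBins_sub_one_bounds hs (show 1 ≤ l by omega)
  have hR : 0 ≤ (l : ℝ) ^ s - 1 := by
    have : (1 : ℝ) ≤ (l : ℝ) ^ s :=
      Real.one_le_rpow (by exact_mod_cast (show 1 ≤ l by omega)) hs.le
    linarith
  refine (failureProb_le_sum B s n _ hρ).trans ?_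
  have key : ∀ β : Fin (numBlocks d), _ ≤ failureConst s * ((l : ℝ) ^ (s - 1 / 2) * Real.log l) :=
    fun β => by
    have ha0 := expect_nonneg (B.phi β) hρ.1
    have ha1 := expect_le_one (isTest_phi B β) hρ
    have t1 := (average_nearCut_le (r := numBins s l - 1) (show 1 ≤ l by omega)
      (expect (B.phi β) ρ)).trans (near_term_le hl r1)
    have t2 := (average_gapBelow_le (s := s) ha0 ha1 hR r2).trans (gap_term_le hs hs' hl)
    have t3 := (average_gapAbove_le (s := s) ha0 ha1 hR r2).trans (gap_term_le hs hs' hl)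
    have t4 := sum_deviates_le B hρ β (show 1 ≤ blockLen d n by omega)
    have hlp : (2 : ℝ) ≤ l := by exact_mod_cast hl
    have t5 : ((l : ℝ) ^ 2)⁻¹ ≤ (l : ℝ)⁻¹ := inv_anti₀ (by linarith) (by nlinarith)
    have t6 := mul_le_mul_of_nonneg_left (t5.trans (inv_le_rate hs hl))
      (show 0 ≤ 2 * Real.exp (4 / 3) by positivity)
    have t7 := t4.trans t6
    refine (add_le_add (add_le_add (add_le_add t1 t2) t3) t7).trans (le_of_eq ?_)
    rw [failureConst]; ring
  refine (Finset.sum_le_sum fun β _ => key β).trans ?_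
  simp

/-- Rates in the block length become rates in `n`, since `n < D (l + 1) ≤ 2 D l` with `D` the number
of blocks. -/
lemma rpow_blockLen_le {d : ℕ} (hd : 2 ≤ d) {n : ℕ} (hl : 1 ≤ blockLen d n) {e : ℝ}
    (he0 : 0 ≤ e) : (blockLen d n : ℝ) ^ (-e) ≤ (2 * numBlocks d) ^ e * (n : ℝ) ^ (-e) := by
  have hD : (0 : ℝ) < numBlocks d := by exact_mod_cast numBlocks_pos hd
  have hlp : (1 : ℝ) ≤ blockLen d n := by exact_mod_cast hl
  have hn : (1 : ℝ) ≤ n := by exact_mod_cast hl.trans (blockLen_le d n)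
  have h1 : (n : ℝ) < numBlocks d * (blockLen d n + 1) := by exact_mod_cast lt_numBlocks_mul hd n
  have h2 : (n : ℝ) / (2 * numBlocks d) ≤ blockLen d n := by
    rw [div_le_iff₀ (by positivity)]; nlinarith
  have h3 := Real.rpow_le_rpow_of_nonpos (z := -e) (by positivity) h2 (by linarith)
  refine h3.trans (le_of_eq ?_)
  rw [Real.div_rpow (by linarith) (by positivity), Real.rpow_neg (by positivity) e,
    Real.rpow_neg (by positivity : (0 : ℝ) ≤ 2 * numBlocks d) e]
  field_simp

lemma failureConst_pos (s : ℝ) : 0 < failureConst s := by unfold failureConst; positivity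

theorem failureProb_le {d : ℕ} (hd : 2 ≤ d) (B : TomographyBasis d) {s : ℝ} (hs : 0 < s)
    (hs' : s < 1 / 2) {n : ℕ} (hn : 2 ≤ n) {ρ : Matrix (Fin d) (Fin d) ℂ} (hρ : IsState ρ) :
    failureProb B s n (numBins s (blockLen d n) - 1) ρ ≤
      2 * numBlocks d ^ 2 * failureConst s * ((n : ℝ) ^ (s - 1 / 2) * Real.log n) := by
  have hD : (1 : ℝ) ≤ numBlocks d := by exact_mod_cast numBlocks_pos hd
  have hnr : (2 : ℝ) ≤ n := by exact_mod_cast hn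
  have hlogn := half_le_log hn
  rcases Nat.lt_or_ge (blockLen d n) 2 with hl | hl
  -- For a block length below `2` one has `n < 2 D`, and the constant is large enough to make the
  -- right-hand side at least `1`.
  · refine (failureProb_le_one B s n _ hρ).trans ?_
    have h1 : (n : ℝ) < numBlocks d * 2 := by
      have := lt_numBlocks_mul hd n
      exact_mod_cast this.trans_le (Nat.mul_le_mul_left _ (by omega))
    have h2 : (n : ℝ)⁻¹ ≤ (n : ℝ) ^ (s - 1 / 2) := by
      rw [← Real.rpow_neg_one]
      exact Real.rpow_le_rpow_of_exponent_le (by linarith) (by linarith)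
    have h3 : (2 * numBlocks d : ℝ)⁻¹ ≤ (n : ℝ)⁻¹ := inv_anti₀ (by linarith) (by linarith)
    have h4 : (2 * numBlocks d : ℝ)⁻¹ * (1 / 2) ≤ (n : ℝ) ^ (s - 1 / 2) * Real.log n :=
      mul_le_mul (h3.trans h2) hlogn (by norm_num) (by positivity)
    have h5 : 4 ≤ failureConst s := by
      unfold failureConst
      linarith [Real.exp_pos (2 + 1 / s), Real.exp_pos (4 / 3)]
    have h6 : 2 * (numBlocks d : ℝ) ^ 2 * failureConst s * ((2 * numBlocks d : ℝ)⁻¹ * (1 / 2)) =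
        numBlocks d * failureConst s / 2 := by field_simp
    have h7 := mul_le_mul_of_nonneg_left h4
      (show 0 ≤ 2 * (numBlocks d : ℝ) ^ 2 * failureConst s by positivity)
    rw [h6] at h7
    nlinarith
  · refine (failureProb_le_blockLen B hs hs' n hl hρ).trans ?_
    have h1 := rpow_blockLen_le hd (show 1 ≤ blockLen d n by omega) (e := 1 / 2 - s) (by linarith)
    rw [neg_sub] at h1
    have h2 : (2 * numBlocks d : ℝ) ^ (1 / 2 - s) ≤ 2 * numBlocks d := by
      simpa using Real.rpow_le_rpow_of_exponent_le (show (1 : ℝ) ≤ 2 * numBlocks d by linarith)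
        (show 1 / 2 - s ≤ 1 by linarith)
    have h3 : Real.log (blockLen d n) ≤ Real.log n :=
      Real.log_le_log (by exact_mod_cast (show 0 < blockLen d n by omega))
        (by exact_mod_cast blockLen_le d n)
    have hp : (0 : ℝ) ≤ (n : ℝ) ^ (s - 1 / 2) := by positivity
    have h4 := mul_le_mul (h1.trans (mul_le_mul_of_nonneg_right h2 hp)) h3
      (by have := half_le_log hl; linarith) (by positivity)
    have h5 := mul_le_mul_of_nonneg_left h4
      (mul_nonneg (by linarith : (0 : ℝ) ≤ numBlocks d) (failureConst_pos s).le)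
    linarith

/-! ### Disturbance -/

/-- For a projector, `⟨Φ|πΦ⟩ = ‖πΦ‖² = tr (π X)`; dividing by the norm leaves its square root. -/
lemma disturbance_eq {d n e : ℕ} {π : Op d n} (h1 : πᴴ = π) (h2 : π * π = π) {X : Op d n}
    {Φ : Matrix (Fin n → Fin d) (Fin e) ℂ} (hΦ : IsPurification Φ X) :
    disturbance π Φ = 1 - Real.sqrt (π * X).trace.re := by
  have e1 : (π * Φ)ᴴ * (π * Φ) = Φᴴ * (π * Φ) := by
    rw [Matrix.conjTranspose_mul, h1, Matrix.mul_assoc, ← Matrix.mul_assoc π π, h2]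
  have e2 : (Φᴴ * (π * Φ)).trace = (π * X).trace := by
    rw [Matrix.trace_mul_comm, Matrix.mul_assoc, hΦ]
  have e3 : 0 ≤ ((π * Φ)ᴴ * (π * Φ)).trace :=
    (Matrix.posSemidef_conjTranspose_mul_self _).trace_nonneg
  rw [e1, e2] at e3
  obtain ⟨h0, him⟩ := Complex.le_def.mp e3
  rw [disturbance, postMeasurement, e1, e2, Matrix.mul_smul, Matrix.trace_smul, e2, norm_smul,
    Complex.norm_real, Real.norm_of_nonneg (by positivity)]
  have e4 : (π * X).trace = ((π * X).trace.re : ℂ) := by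
    apply Complex.ext <;> simp [← him]
  have e5 : ‖(π * X).trace‖ = (π * X).trace.re := by
    rw [e4, Complex.norm_real, Real.norm_of_nonneg (by simpa using h0), Complex.ofReal_re]
  have e6 := Real.mul_self_sqrt (show 0 ≤ (π * X).trace.re by simpa using h0)
  rw [e5]
  -- For an outcome of probability zero, `0⁻¹ = 0` makes the normalized state `0`, which gives the
  -- same formula.
  rcases eq_or_ne (Real.sqrt (π * X).trace.re) 0 with h | h
  · simp [h]
  · congr 1
    rw [inv_mul_eq_div, div_eq_iff h, e6]

/-- For `l ≤ 1` the logarithm vanishes (also at `0`, by convention), so the window strictly above `l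
a` is empty. -/
lemma two_le_of_success {d n r : ℕ} (hd : 2 ≤ d) {B : TomographyBasis d} {s : ℝ}
    {ρ : Matrix (Fin d) (Fin d) ℂ} {b : Cuts d n r} {j : Outcomes d r}
    (h : Success B s ρ b j) : 2 ≤ blockLen d n := by
  by_contra hl
  obtain ⟨-, -, ⟨i, h1, h2⟩, -⟩ := h ⟨0, numBlocks_pos hd⟩
  have hlog : Real.log (blockLen d n) = 0 := by
    rcases (by omega : blockLen d n = 0 ∨ blockLen d n = 1) with h | h <;> simp [h]
  rw [hlog, mul_zero, add_zero] at h2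
  linarith

theorem disturbance_le {d : ℕ} (hd : 2 ≤ d) (B : TomographyBasis d) {s : ℝ}
    {n r : ℕ} {ρ : Matrix (Fin d) (Fin d) ℂ} (hρ : IsState ρ) {b : Cuts d n r}
    {j : Outcomes d r} (hsucc : Success B s ρ b j) {e : ℕ}
    {Φ : Matrix (Fin n → Fin d) (Fin e) ℂ} (hΦ : IsPurification Φ (tensorPower ρ n)) :
    disturbance (outcomeProj B b j) Φ ≤
      8 * numBlocks d ^ 3 * Real.exp (4 / 3) * (n : ℝ) ^ (-2 : ℝ) := by
  classical
  have hl := two_le_of_success hd hsucc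
  rw [disturbance_eq (outcomeProj_isHermitian B b j) (outcomeProj_mul_self B b j) hΦ,
    trace_outcomeProj B hρ]
  set p := ∑ x, if InBins b j x then resultWeight B ρ x else 0 with hp
  have p0 : 0 ≤ p := Finset.sum_nonneg fun x _ => by
    split_ifs; exacts [resultWeight_nonneg B hρ x, le_rfl]
  have p1 : p ≤ 1 := by
    refine le_trans (Finset.sum_le_sum fun x _ => ?_) (sum_resultWeight (n := n) B ρ).le
    split_ifs; exacts [le_rfl, resultWeight_nonneg B hρ x]
  -- A result outside of the measured bins has to deviate on some block.
  have h1 : 1 - p ≤ ∑ β, ∑ x : Fin n → Bool,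
      resultWeight B ρ x * if Deviates B ρ β x then 1 else 0 := by
    conv_lhs => rw [← sum_resultWeight (n := n) B ρ]
    rw [hp, ← Finset.sum_sub_distrib, Finset.sum_comm]
    refine Finset.sum_le_sum fun x _ => ?_
    have hw := resultWeight_nonneg B hρ x
    have hnn : ∀ β ∈ Finset.univ, (0 : ℝ) ≤
        resultWeight B ρ x * if Deviates B ρ β x then 1 else 0 := fun β _ =>
      mul_nonneg hw (by split_ifs <;> norm_num)
    split_ifs with hx
    · rw [sub_self]; exact Finset.sum_nonneg hnn
    · obtain ⟨β, hβ⟩ : ∃ β, Deviates B ρ β x := by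
        by_contra hcon
        push Not at hcon
        exact hx (inBins_of_success B hρ hsucc hcon)
      refine le_trans ?_ (Finset.single_le_sum hnn (Finset.mem_univ β))
      simp [hβ]
  have h2 : 1 - p ≤ numBlocks d * (2 * Real.exp (4 / 3) * ((blockLen d n : ℝ) ^ 2)⁻¹) := by
    refine h1.trans ((Finset.sum_le_sum fun β _ =>
      sum_deviates_le B hρ β (show 1 ≤ blockLen d n by omega)).trans ?_)
    simp
  have h3 := rpow_blockLen_le hd (show 1 ≤ blockLen d n by omega) (e := 2) (by norm_num)
  have h3' : ((blockLen d n : ℝ) ^ 2)⁻¹ ≤ (2 * numBlocks d) ^ 2 * (n : ℝ) ^ (-2 : ℝ) := by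
    rw [Real.rpow_neg (by positivity)] at h3
    exact_mod_cast h3
  -- Since `p ≤ 1`, the disturbance `1 - √p` is at most `1 - p`.
  have h4 : p ≤ Real.sqrt p := Real.le_sqrt_of_sq_le (by nlinarith)
  have h5 := mul_le_mul_of_nonneg_left h3'
    (show 0 ≤ (numBlocks d : ℝ) * (2 * Real.exp (4 / 3)) by positivity)
  linarith

/-! ### Trace distance -/

/-- Cauchy–Schwarz for the `d` singular values. -/
lemma traceNorm_le {d : ℕ} (A : Matrix (Fin d) (Fin d) ℂ) :
    traceNorm A ≤ Real.sqrt (d * (Aᴴ * A).trace.re) := by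
  set h := Matrix.isHermitian_conjTranspose_mul_self A with hh
  have h1 : (Aᴴ * A).trace.re = ∑ i, h.eigenvalues i := by
    rw [h.trace_eq_sum_eigenvalues]
    simp
  have h0 : ∀ i, 0 ≤ h.eigenvalues i := (Matrix.posSemidef_conjTranspose_mul_self A).eigenvalues_nonneg
  apply Real.le_sqrt_of_sq_le
  rw [traceNorm, h1]
  refine (sq_sum_le_card_mul_sum_sq (s := Finset.univ)
    (f := fun i => Real.sqrt (h.eigenvalues i))).trans (le_of_eq ?_)
  simp [Real.sq_sqrt (h0 _)]

/-- Dimension count: the `d ^ 2 - 1` orthonormal, hence independent, matrices `σ k` lie in the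
kernel of the trace, which has just this dimension over `ℂ`. -/
lemma TomographyBasis.exists_expansion {d : ℕ} (hd : 2 ≤ d) (B : TomographyBasis d)
    {Δ : Matrix (Fin d) (Fin d) ℂ} (hΔ : Δ.trace = 0) : ∃ g : Fin (d ^ 2 - 1) → ℂ,
      ∑ k, g k • B.σ k = Δ := by
  have htr : ∀ (g : Fin (d ^ 2 - 1) → ℂ) (j), (B.σ j * ∑ k, g k • B.σ k).trace = g j := by
    intro g j
    simp [Finset.mul_sum, Matrix.trace_sum, B.orthonormal]
  have hli : LinearIndependent ℂ B.σ := by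
    rw [Fintype.linearIndependent_iff]
    intro g hg j
    rw [← htr g j, hg]; simp
  let T := Matrix.traceLinearMap (Fin d) ℂ ℂ
  have hle : Submodule.span ℂ (Set.range B.σ) ≤ LinearMap.ker T := by
    rw [Submodule.span_le]
    rintro _ ⟨k, rfl⟩
    exact B.traceless k
  have hsurj : LinearMap.range T = ⊤ := by
    rw [LinearMap.range_eq_top]
    intro z
    refine ⟨Matrix.single ⟨0, by omega⟩ ⟨0, by omega⟩ z, ?_⟩
    simp [T]
  have hrank := LinearMap.finrank_range_add_finrank_ker T
  rw [hsurj, finrank_top, Module.finrank_self, Module.finrank_matrix, Module.finrank_self,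
    Fintype.card_fin] at hrank
  have heq : Submodule.span ℂ (Set.range B.σ) = LinearMap.ker T := by
    apply Submodule.eq_of_le_of_finrank_eq hle
    rw [finrank_span_eq_card hli, Fintype.card_fin, sq]
    omega
  have hmem : Δ ∈ Submodule.span ℂ (Set.range B.σ) := by
    rw [heq]; exact hΔ
  exact (Submodule.mem_span_range_iff_exists_fun ℂ).mp hmem

lemma TomographyBasis.trace_sigma_mul {d : ℕ} (B : TomographyBasis d) (k : Fin (d ^ 2 - 1))
    {A : Matrix (Fin d) (Fin d) ℂ} (hA : A.IsHermitian) :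
    (B.σ k * A).trace = ((∑ i, B.eig k i * expect (B.vec k i) A : ℝ) : ℂ) := by
  rw [B.spectral k, Finset.sum_mul, Matrix.trace_sum]
  push_cast
  refine Finset.sum_congr rfl fun i _ => ?_
  rw [Matrix.smul_mul, Matrix.trace_smul, trace_ketbra_mul_isHermitian _ hA, smul_eq_mul]

lemma TomographyBasis.expect_sigma {d : ℕ} (B : TomographyBasis d) (k : Fin (d ^ 2 - 1))
    (i : Fin d) : expect (B.vec k i) (B.σ k) = B.eig k i := by
  have h : ∀ i', ketbra (B.vec k i') *ᵥ B.vec k i = if i' = i then B.vec k i else 0 := by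
    intro i'
    rw [ketbra, Matrix.vecMulVec_mulVec, B.vec_orthonormal]
    split_ifs with h
    · subst h; simp
    · simp
  rw [expect, B.spectral k, Matrix.sum_mulVec, Finset.sum_congr rfl fun i' _ => by
    rw [Matrix.smul_mulVec, h i']]
  simp [B.vec_orthonormal]

/-- The squares of the eigenvalues add up to `tr (σ k)² = 1`. -/
lemma TomographyBasis.abs_eig_le {d : ℕ} (B : TomographyBasis d) (k : Fin (d ^ 2 - 1))
    (i : Fin d) : |B.eig k i| ≤ 1 := by
  have h1 := B.trace_sigma_mul k (B.hermitian k)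
  rw [B.orthonormal, if_pos rfl] at h1
  simp only [B.expect_sigma] at h1
  have h2 : ∑ i, B.eig k i * B.eig k i = 1 := by exact_mod_cast h1.symm
  have h3 : B.eig k i * B.eig k i ≤ 1 := by
    rw [← h2]
    exact Finset.single_le_sum (f := fun i => B.eig k i * B.eig k i)
      (fun i _ => mul_self_nonneg _) (Finset.mem_univ i)
  exact abs_le_of_sq_le_sq (by nlinarith) (by norm_num)

/-- The coefficients `tr (σ k Δ)` are combinations of the expectations with weights `|eig| ≤ 1`,
hence at most `d ε`. Parseval bounds the Frobenius norm, and `traceNorm_le` the trace norm. -/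
lemma TomographyBasis.traceNorm_le_of_expect {d : ℕ} (hd : 2 ≤ d) (B : TomographyBasis d)
    {Δ : Matrix (Fin d) (Fin d) ℂ} (hh : Δ.IsHermitian) (ht : Δ.trace = 0) {ε : ℝ} (hε : 0 ≤ ε)
    (h : ∀ β, |expect (B.phi β) Δ| ≤ ε) : traceNorm Δ ≤ d ^ 3 * ε := by
  obtain ⟨g, hg⟩ := B.exists_expansion hd ht
  have h1 : ∀ k, |∑ i, B.eig k i * expect (B.vec k i) Δ| ≤ d * ε := fun k => by
    refine (Finset.abs_sum_le_sum_abs _ _).trans ?_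
    have : ∀ i ∈ Finset.univ, |B.eig k i * expect (B.vec k i) Δ| ≤ ε := fun i _ => by
      rw [abs_mul]
      have h2 := h (finProdFinEquiv (i, k))
      rw [TomographyBasis.phi, Equiv.symm_apply_apply] at h2
      exact (mul_le_mul (B.abs_eig_le k i) h2 (abs_nonneg _) zero_le_one).trans (one_mul ε).le
    refine (Finset.sum_le_sum this).trans ?_
    simp
  have h2 : (Δᴴ * Δ).trace.re = ∑ k, (∑ i, B.eig k i * expect (B.vec k i) Δ) ^ 2 := by
    have h3 : ∀ k, (B.σ k * Δ).trace = g k := fun k => by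
      rw [← hg]
      simp [Finset.mul_sum, Matrix.trace_sum, B.orthonormal]
    have h4 : (Δ * Δ).trace = ∑ k, g k * (B.σ k * Δ).trace := by
      have : Δ * Δ = (∑ k, g k • B.σ k) * Δ := by rw [hg]
      rw [this, Finset.sum_mul, Matrix.trace_sum]
      simp
    rw [hh.eq, h4]
    simp only [← h3, B.trace_sigma_mul _ hh, ← Complex.ofReal_mul, ← Complex.ofReal_sum,
      Complex.ofReal_re, sq]
  have hd1 : (1 : ℝ) ≤ d := by exact_mod_cast (by omega : 1 ≤ d)
  have h5 : (Δᴴ * Δ).trace.re ≤ d ^ 2 * (d * ε) ^ 2 := by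
    rw [h2]
    refine (Finset.sum_le_sum fun k _ => sq_le_sq' (abs_le.mp (h1 k)).1 (abs_le.mp (h1 k)).2).trans ?_
    rw [Finset.sum_const, nsmul_eq_mul, Finset.card_univ, Fintype.card_fin]
    refine mul_le_mul_of_nonneg_right ?_ (by positivity)
    exact_mod_cast Nat.sub_le _ _
  refine (traceNorm_le Δ).trans ?_
  rw [Real.sqrt_le_left (by positivity)]
  calc _ ≤ (d : ℝ) * (d ^ 2 * (d * ε) ^ 2) := mul_le_mul_of_nonneg_left h5 (by linarith)
    -- The bound is really `d ^ (5/2) ε`; one more factor `d` under the root avoids the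
    -- half-integral power.
    _ ≤ d * (d * (d ^ 2 * (d * ε) ^ 2)) := by
        nlinarith [show (0 : ℝ) ≤ d * (d ^ 2 * (d * ε) ^ 2) by positivity]
    _ = _ := by ring

lemma expect_sub {d : ℕ} (φ : Fin d → ℂ) (A C : Matrix (Fin d) (Fin d) ℂ) :
    expect φ (A - C) = expect φ A - expect φ C := by
  simp [expect, Matrix.sub_mulVec, dotProduct_sub]

lemma solvesSDP_self {d n r : ℕ} {B : TomographyBasis d} {s : ℝ} {ρ : Matrix (Fin d) (Fin d) ℂ}
    (hρ : IsState ρ) {b : Cuts d n r} {j : Outcomes d r} (h : Success B s ρ b j) :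
    SolvesSDP B b j ρ :=
  ⟨hρ, fun β => ⟨(h β).2.2.2.1, (h β).2.2.2.2.le⟩⟩

/-- A boundary that is below a point cannot be above the lower end of the bin around that point.
With `binHi_le_boundary` this confines the measured bin between the boundaries near `l a`. -/
lemma le_binLo {l r : ℕ} (b : Fin r → Fin (l + 1)) (j : Fin (r + 1)) (i : Fin (r + 2)) {y : ℝ}
    (h1 : (boundary b i : ℝ) ≤ y) (h2 : y < binHi b j) : boundary b i ≤ binLo b j := by
  refine boundary_mono b ?_
  by_contra hij
  have : j.succ ≤ i := by
    rw [not_le] at hij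
    simp only [Fin.le_def, Fin.lt_def, Fin.val_succ, Fin.val_castSucc] at *
    omega
  have h3 : (binHi b j : ℝ) ≤ boundary b i := by exact_mod_cast boundary_mono b this
  linarith

lemma binHi_le_boundary {l r : ℕ} (b : Fin r → Fin (l + 1)) (j : Fin (r + 1)) (i : Fin (r + 2))
    {y : ℝ} (h1 : y < (boundary b i : ℝ)) (h2 : (binLo b j : ℝ) ≤ y) :
    binHi b j ≤ boundary b i := by
  refine boundary_mono b ?_
  by_contra hij
  have : i ≤ j.castSucc := by
    rw [not_le] at hij
    simp only [Fin.le_def, Fin.lt_def, Fin.val_succ, Fin.val_castSucc] at *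
    omega
  have h3 : (boundary b i : ℝ) ≤ binLo b j := by exact_mod_cast boundary_mono b this
  linarith

theorem traceNorm_sub_le {d : ℕ} (hd : 2 ≤ d) (B : TomographyBasis d) {s : ℝ} (hs : 0 < s)
    (hs' : s < 1 / 2) {n r : ℕ} {ρ τ : Matrix (Fin d) (Fin d) ℂ} (hρ : IsState ρ)
    {b : Cuts d n r} {j : Outcomes d r} (hsucc : Success B s ρ b j) (hτ : SolvesSDP B b j τ) :
    traceNorm (ρ - τ) ≤ 2 * d ^ 3 * numBlocks d * ((n : ℝ) ^ (-s) * Real.log n) := by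
  have hl := two_le_of_success hd hsucc
  have hlr : (2 : ℝ) ≤ blockLen d n := by exact_mod_cast hl
  have hD : (1 : ℝ) ≤ numBlocks d := by exact_mod_cast numBlocks_pos hd
  have hlog := half_le_log hl
  have h1 : ∀ β, |expect (B.phi β) (ρ - τ)| ≤
      (blockLen d n : ℝ) ^ (-s) * Real.log (blockLen d n) := by
    intro β
    obtain ⟨-, ⟨i1, p1, p2⟩, ⟨i2, q1, q2⟩, h3, h4⟩ := hsucc β
    obtain ⟨t1, t2⟩ := hτ.2 β
    -- The mean for `τ` lies in the closed bin, and the bin lies between two boundaries within `l ^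
    -- (1 - s) ln l` of the mean for `ρ`.
    have c1 : (boundary (b β) i1 : ℝ) ≤ binLo (b β) (j β) := by exact_mod_cast le_binLo _ _ _ p1 h4
    have c2 : (binHi (b β) (j β) : ℝ) ≤ boundary (b β) i2 := by
      exact_mod_cast binHi_le_boundary _ _ _ q1 h3
    have e : (blockLen d n : ℝ) ^ (1 - s) = blockLen d n * (blockLen d n : ℝ) ^ (-s) := by
      rw [sub_eq_add_neg, Real.rpow_add (by linarith), Real.rpow_one]
    rw [e, mul_assoc] at p2 q2
    have hp : (0 : ℝ) < blockLen d n := by linarith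
    rw [expect_sub, abs_le]
    constructor
    · refine le_of_mul_le_mul_left ?_ hp
      linarith
    · refine le_of_mul_le_mul_left ?_ hp
      linarith
  have hh : (ρ - τ).IsHermitian := hρ.1.1.sub hτ.1.1.1
  have ht : (ρ - τ).trace = 0 := by rw [Matrix.trace_sub, hρ.2, hτ.1.2, sub_self]
  refine (B.traceNorm_le_of_expect hd hh ht (by positivity) h1).trans ?_
  have h2 := rpow_blockLen_le hd (show 1 ≤ blockLen d n by omega) hs.le
  have h3 : (2 * numBlocks d : ℝ) ^ s ≤ 2 * numBlocks d := by
    simpa using Real.rpow_le_rpow_of_exponent_le (show (1 : ℝ) ≤ 2 * numBlocks d by linarith)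
      (show s ≤ 1 by linarith)
  have h4 : Real.log (blockLen d n) ≤ Real.log n :=
    Real.log_le_log (by linarith) (by exact_mod_cast blockLen_le d n)
  have hp : (0 : ℝ) ≤ (n : ℝ) ^ (-s) := by positivity
  have h5 := mul_le_mul (h2.trans (mul_le_mul_of_nonneg_right h3 hp)) h4
    (by linarith) (by positivity)
  have h6 := mul_le_mul_of_nonneg_left h5 (show (0 : ℝ) ≤ d ^ 3 by positivity)
  linarith

/-! ### Running time -/

lemma bits_le (x : ℕ) : bits x ≤ x + 1 := by
  have : Nat.size x ≤ x := Nat.size_le.mpr Nat.lt_two_pow_self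
  unfold bits; omega

/-- The arrays holding the estimate, which programs do not read. -/
def IsOutput (a : ℕ) : Prop := 3 ≤ a ∧ a ≤ 7

/-- Expressions that do not read the output arrays and use only the first `K` constants. -/
def Expr.Safe (K : ℕ) : Expr → Prop
  | .lit _ => True
  | .load a idx => ¬ IsOutput a ∧ idx.Safe K
  | .bin _ x y => x.Safe K ∧ y.Safe K
  | .const i q => (∃ k < K, i = .lit k) ∧ q.Safe K

/-- A bound for the value, given a bound for the memory cells. -/
def Expr.valBound : Expr → Polynomial ℕ
  | .lit c => .C c
  | .load _ _ => .X
  | .bin _ x y => x.valBound + y.valBound + x.valBound * y.valBound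
  | .const _ q => 2 * q.valBound + 1

/-- A bound for the cost, given a bound for the memory cells. -/
def Expr.costBound : Expr → Polynomial ℕ
  | .lit c => .C (bits c)
  | .load _ idx => idx.costBound + (idx.valBound + 1) + (.X + 1)
  | .bin _ x y => x.costBound + y.costBound + (x.valBound + 1) * (y.valBound + 1)
  | .const i q => i.costBound + q.costBound + (i.valBound + 1) + (q.valBound + 1) +
      (2 * q.valBound + 2)

/-- The first `K` constants are bounded by `2` or so. -/
def ConstsBounded (K : ℕ) (o : ℕ → ℕ → ℕ) : Prop := ∀ k < K, ∀ q, o k q ≤ 2 * q + 1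

/-- All memory cells outside of the output arrays are at most `x`. -/
def MemBounded (x : ℕ) (M : Mem) : Prop := ∀ a i, ¬ IsOutput a → M a i ≤ x

/-- The bound `x + y + x y` covers all five operations at once; constants need the bound `ho` on the
answers of `o`. -/
lemma Expr.eval_le {K : ℕ} {o : ℕ → ℕ → ℕ} (ho : ConstsBounded K o) {x : ℕ} {M : Mem}
    (hM : MemBounded x M) : ∀ e : Expr, e.Safe K → e.eval o M ≤ e.valBound.eval x
  | .lit c, _ => by simp [Expr.eval, Expr.valBound]
  | .load a idx, h => by simpa [Expr.eval, Expr.valBound] using hM _ _ h.1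
  | .bin f e e', h => by
      have h1 := Expr.eval_le ho hM e h.1
      have h2 := Expr.eval_le ho hM e' h.2
      have h3 := Nat.mul_le_mul h1 h2
      simp only [Expr.eval, Expr.valBound, Polynomial.eval_add, Polynomial.eval_mul]
      cases f <;> simp only [BinOp.eval]
      · omega
      · omega
      · omega
      · have := Nat.div_le_self (e.eval o M) (e'.eval o M); omega
      · have := Nat.mod_le (e.eval o M) (e'.eval o M); omega
  | .const i q, h => by
      have h1 := Expr.eval_le ho hM q h.2
      obtain ⟨⟨k, hk, rfl⟩, -⟩ := h
      have h2 := ho k hk (q.eval o M)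
      simp only [Expr.eval, Expr.valBound, Polynomial.eval_add, Polynomial.eval_mul,
        Polynomial.eval_one, Polynomial.eval_ofNat]
      omega

lemma Expr.cost_le {K : ℕ} {o : ℕ → ℕ → ℕ} (ho : ConstsBounded K o) {x : ℕ} {M : Mem}
    (hM : MemBounded x M) : ∀ e : Expr, e.Safe K → e.cost o M ≤ e.costBound.eval x
  | .lit c, _ => by simp [Expr.cost, Expr.costBound]
  | .load a idx, h => by
      have h1 := Expr.cost_le ho hM idx h.2
      have h2 := Expr.eval_le ho hM idx h.2
      have h3 := hM a (idx.eval o M) h.1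
      have h4 := bits_le (idx.eval o M)
      have h5 := bits_le (M a (idx.eval o M))
      simp only [Expr.cost, Expr.costBound, Polynomial.eval_add, Polynomial.eval_one,
        Polynomial.eval_X]
      omega
  | .bin f e e', h => by
      have h1 := Expr.cost_le ho hM e h.1
      have h2 := Expr.cost_le ho hM e' h.2
      have h3 := Nat.mul_le_mul
        ((bits_le (e.eval o M)).trans (Nat.add_le_add_right (Expr.eval_le ho hM e h.1) 1))
        ((bits_le (e'.eval o M)).trans (Nat.add_le_add_right (Expr.eval_le ho hM e' h.2) 1))
      simp only [Expr.cost, Expr.costBound, Polynomial.eval_add, Polynomial.eval_one,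
        Polynomial.eval_mul]
      omega
  | .const i q, h => by
      have h1 := Expr.cost_le ho hM q h.2
      have h2 := Expr.eval_le ho hM q h.2
      obtain ⟨⟨k, hk, rfl⟩, -⟩ := h
      have h3 := ho k hk (q.eval o M)
      have h4 := bits_le (q.eval o M)
      have h5 := bits_le (o k (q.eval o M))
      have h6 := bits_le k
      simp only [Expr.cost, Expr.costBound, Expr.eval, Expr.valBound, Polynomial.eval_add,
        Polynomial.eval_mul, Polynomial.eval_one, Polynomial.eval_ofNat, Polynomial.eval_C]
      omega

/-- The minimum of the value and of cell `2` of array `0`. -/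
def clamp (v : Expr) : Expr := .bin .sub v (.bin .sub v (.load 0 (.lit 2)))

/-- With truncated subtraction, `v - (v - c) = min v c`. -/
lemma clamp_eval (o : ℕ → ℕ → ℕ) (M : Mem) (v : Expr) :
    (clamp v).eval o M = min (v.eval o M) (M 0 2) := by
  simp only [clamp, Expr.eval, BinOp.eval]; omega

/-- A bound for cost and length of the value together. -/
def Expr.total (e : Expr) : Polynomial ℕ := e.costBound + (e.valBound + 1)

lemma Expr.total_le {K : ℕ} {o : ℕ → ℕ → ℕ} (ho : ConstsBounded K o) {x : ℕ} {M : Mem}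
    (hM : MemBounded x M) {e : Expr} (h : e.Safe K) :
    e.cost o M + bits (e.eval o M) ≤ e.total.eval x := by
  have h1 := Expr.cost_le ho hM e h
  have h2 := Expr.eval_le ho hM e h
  have h3 := bits_le (e.eval o M)
  simp only [Expr.total, Polynomial.eval_add, Polynomial.eval_one]
  omega

/-- Programs that write only clamped values, outside of the output arrays. -/
def Prog.Safe {d : ℕ} (K : ℕ) : Prog d → Prop
  | .skip => True
  | .assign a idx val => a ≠ 0 ∧ idx.Safe K ∧ val.Safe K ∧ (IsOutput a ∨ ∃ v, val = clamp v)
  | .seq P Q => P.Safe K ∧ Q.Safe K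
  | .ite e P Q => e.Safe K ∧ P.Safe K ∧ Q.Safe K
  | .loop e P => e.Safe K ∧ P.Safe K
  | .rand a idx bound => a ≠ 0 ∧ idx.Safe K ∧ bound.Safe K ∧ ∃ v, bound = clamp v
  | .measure a idx q => a ≠ 0 ∧ idx.Safe K ∧ q.Safe K
  | .perm _ _ t => ∀ i, (t i).Safe K
  | .ctrl _ _ _ e t => e.Safe K ∧ ∀ i, (t i).Safe K

/-- A bound for the running time, given a bound for the memory cells. -/
def Prog.timeBound {d : ℕ} : Prog d → Polynomial ℕ
  | .skip => 1
  | .assign _ idx val => idx.total + val.total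
  | .seq P Q => P.timeBound + Q.timeBound
  | .ite e P Q => 1 + e.total + P.timeBound + Q.timeBound
  | .loop e P => 1 + e.total + e.valBound * (1 + P.timeBound)
  | .rand _ idx bound => idx.total + bound.total
  | .measure _ idx q => idx.total + q.total
  | .perm _ _ t => 1 + ∑ i, (t i).total
  | .ctrl _ _ _ e t => 1 + e.total + ∑ i, (t i).total

lemma MemBounded.write {d N : ℕ} {x : ℕ} {c : Branch d N} (h : MemBounded x c.mem) {a i v : ℕ}
    (hv : IsOutput a ∨ v ≤ x) : MemBounded x (c.write a i v).mem := by
  intro a' i' ha'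
  simp only [Branch.write, Function.update_apply]
  split_ifs with h1
  · subst h1
    simp only [Function.update_apply]
    split_ifs
    · exact hv.resolve_left ha'
    · exact h _ _ ha'
  · exact h _ _ ha'

lemma write_mem_zero {d N : ℕ} (c : Branch d N) {a i v : ℕ} (ha : a ≠ 0) :
    (c.write a i v).mem 0 = c.mem 0 := by
  simp [Branch.write, Function.update_of_ne ha.symm]

@[simp] lemma tick_mem {d N : ℕ} (c : Branch d N) (t : ℕ) : (c.tick t).mem = c.mem := rfl
@[simp] lemma tick_time {d N : ℕ} (c : Branch d N) (t : ℕ) : (c.tick t).time = c.time + t := rfl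
@[simp] lemma tick_op {d N : ℕ} (c : Branch d N) (t : ℕ) : (c.tick t).op = c.op := rfl
@[simp] lemma tick_prob {d N : ℕ} (c : Branch d N) (t : ℕ) : (c.tick t).prob = c.prob := rfl
@[simp] lemma write_time {d N : ℕ} (c : Branch d N) (a i v : ℕ) :
    (c.write a i v).time = c.time := rfl
@[simp] lemma write_op {d N : ℕ} (c : Branch d N) (a i v : ℕ) : (c.write a i v).op = c.op := rfl
@[simp] lemma write_prob {d N : ℕ} (c : Branch d N) (a i v : ℕ) :
    (c.write a i v).prob = c.prob := rfl
@[simp] lemma act_mem {d N : ℕ} (c : Branch d N) (U : Op d N) : (c.act U).mem = c.mem := rfl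
@[simp] lemma act_time {d N : ℕ} (c : Branch d N) (U : Op d N) : (c.act U).time = c.time := rfl
@[simp] lemma act_op {d N : ℕ} (c : Branch d N) (U : Op d N) : (c.act U).op = U * c.op := rfl
@[simp] lemma act_prob {d N : ℕ} (c : Branch d N) (U : Op d N) : (c.act U).prob = c.prob := rfl

lemma mem_iterate_flatMap {α : Type*} (f : α → List α) (I : ℕ → α → Prop) :
    ∀ (N : ℕ) (L : List α), (∀ c ∈ L, I 0 c) →
      (∀ k < N, ∀ c, I k c → ∀ c' ∈ f c, I (k + 1) c') →
      ∀ c ∈ (fun L : List α => L.flatMap f)^[N] L, I N c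
  | 0, _, h0, _ => h0
  | N + 1, L, h0, hs => by
      intro c hc
      rw [Function.iterate_succ_apply', List.mem_flatMap] at hc
      obtain ⟨c', hc', hc⟩ := hc
      exact hs N (Nat.lt_succ_self N) c'
        (mem_iterate_flatMap f I N L h0 (fun k hk => hs k (hk.trans (Nat.lt_succ_self N))) c' hc')
        c hc

/-- Clamping keeps all cells that can be read below `x`, no matter how often loops repeat, so every
expression has the same polynomial cost bound each time it is evaluated. The arrays of the estimate
may hold larger numbers since they are never read. No safe program writes to array `0`, so the bound
in cell `2` persists; `d ≤ x` is for measured digits, which are written without clamping. -/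
theorem exec_time_le {d N K : ℕ} (B : TomographyBasis d) {o : ℕ → ℕ → ℕ}
    (ho : ConstsBounded K o) {x : ℕ} (hd : d ≤ x) : ∀ (P : Prog d), P.Safe K →
    ∀ c : Branch d N, MemBounded x c.mem → c.mem 0 2 = x → ∀ c' ∈ exec B o P c,
      MemBounded x c'.mem ∧ c'.mem 0 2 = x ∧ c'.time ≤ c.time + P.timeBound.eval x
  | .skip, _, c, hM, hx, c', hc' => by
      simp only [exec, List.mem_singleton] at hc'
      subst hc'
      exact ⟨hM, hx, by simp [Prog.timeBound]⟩
  | .assign a idx val, h, c, hM, hx, c', hc' => by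
      simp only [exec, List.mem_singleton] at hc'
      subst hc'
      obtain ⟨ha, hi, hv, hcl⟩ := h
      refine ⟨hM.write (hcl.imp_right ?_), ?_, ?_⟩
      · rintro ⟨v, rfl⟩
        rw [clamp_eval, hx]; exact min_le_right _ _
      · rw [tick_mem, write_mem_zero c ha, hx]
      · have h1 := Expr.total_le ho hM hi
        have h2 := Expr.total_le ho hM hv
        simp only [tick_time, write_time, Prog.timeBound, Polynomial.eval_add]
        omega
  | .seq P Q, h, c, hM, hx, c', hc' => by
      simp only [exec, List.mem_flatMap] at hc'
      obtain ⟨c1, hc1, hc'⟩ := hc'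
      obtain ⟨hM1, hx1, ht1⟩ := exec_time_le B ho hd P h.1 c hM hx c1 hc1
      obtain ⟨hM2, hx2, ht2⟩ := exec_time_le B ho hd Q h.2 c1 hM1 hx1 c' hc'
      refine ⟨hM2, hx2, ?_⟩
      simp only [Prog.timeBound, Polynomial.eval_add]
      omega
  | .ite e P Q, h, c, hM, hx, c', hc' => by
      have h1 := Expr.total_le ho hM h.1
      simp only [exec] at hc'
      split_ifs at hc' with he
      · obtain ⟨hM1, hx1, ht1⟩ := exec_time_le B ho hd P h.2.1 (c.tick _) hM hx c' hc'
        refine ⟨hM1, hx1, ?_⟩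
        simp only [Prog.timeBound, Polynomial.eval_add, Polynomial.eval_one, tick_time] at ht1 ⊢
        omega
      · obtain ⟨hM1, hx1, ht1⟩ := exec_time_le B ho hd Q h.2.2 (c.tick _) hM hx c' hc'
        refine ⟨hM1, hx1, ?_⟩
        simp only [Prog.timeBound, Polynomial.eval_add, Polynomial.eval_one, tick_time] at ht1 ⊢
        omega
  | .loop e P, h, c, hM, hx, c', hc' => by
      have h1 := Expr.total_le ho hM h.1
      have h2 := Expr.eval_le ho hM e h.1
      simp only [exec] at hc'
      have := mem_iterate_flatMap (fun c' => exec B o P (c'.tick 1))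
        (fun k c' => MemBounded x c'.mem ∧ c'.mem 0 2 = x ∧
          c'.time ≤ c.time + (1 + e.cost o c.mem) + k * (1 + P.timeBound.eval x))
        _ _ ?_ ?_ c' hc'
      · refine ⟨this.1, this.2.1, this.2.2.trans ?_⟩
        have h3 := Nat.mul_le_mul_right (1 + P.timeBound.eval x) h2
        simp only [Prog.timeBound, Polynomial.eval_add, Polynomial.eval_one, Polynomial.eval_mul]
        omega
      · intro c1 hc1
        rw [List.mem_singleton] at hc1
        subst hc1
        exact ⟨hM, hx, by simp⟩
      · rintro k - c1 ⟨hM1, hx1, ht1⟩ c2 hc2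
        obtain ⟨hM2, hx2, ht2⟩ := exec_time_le B ho hd P h.2 (c1.tick 1) hM1 hx1 c2 hc2
        refine ⟨hM2, hx2, ?_⟩
        rw [tick_time] at ht2
        rw [Nat.add_mul, Nat.one_mul]
        omega
  | .rand a idx bound, h, c, hM, hx, c', hc' => by
      simp only [exec, List.mem_map, List.mem_range] at hc'
      obtain ⟨v, hv, rfl⟩ := hc'
      obtain ⟨ha, hi, hb, u, rfl⟩ := h
      refine ⟨hM.write (Or.inr ?_), ?_, ?_⟩
      · rw [clamp_eval, hx] at hv
        have := min_le_right (u.eval o c.mem) x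
        omega
      · exact (congrFun (write_mem_zero c ha) 2).trans hx
      · have h1 := Expr.total_le ho hM hi
        have h2 := Expr.total_le ho hM hb
        simp only [tick_time, write_time, Prog.timeBound, Polynomial.eval_add]
        omega
  | .measure a idx q, h, c, hM, hx, c', hc' => by
      obtain ⟨ha, hi, hq⟩ := h
      have h1 := Expr.total_le ho hM hi
      have h2 := Expr.total_le ho hM hq
      simp only [exec] at hc'
      split_ifs at hc' with hN
      · simp only [List.mem_map] at hc'
        obtain ⟨v, -, rfl⟩ := hc'
        refine ⟨MemBounded.write (c := c.tick _) hM (Or.inr (by omega)), ?_, ?_⟩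
        · exact (congrFun (write_mem_zero (c.tick _) ha) 2).trans hx
        · simp only [tick_time, write_time, act_time, Prog.timeBound, Polynomial.eval_add]
          omega
      · rw [List.mem_singleton] at hc'
        subst hc'
        refine ⟨hM, hx, ?_⟩
        simp only [tick_time, Prog.timeBound, Polynomial.eval_add]
        omega
  | .perm k g t, h, c, hM, hx, c', hc' => by
      simp only [exec, List.mem_singleton] at hc'
      subst hc'
      refine ⟨hM, hx, ?_⟩
      have := Finset.sum_le_sum fun i (_ : i ∈ Finset.univ) => Expr.total_le ho hM (h i)
      simp only [tick_time, act_time, Prog.timeBound, Polynomial.eval_add, Polynomial.eval_one,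
        Polynomial.eval_finsetSum]
      omega
  | .ctrl β k g e t, h, c, hM, hx, c', hc' => by
      simp only [exec, List.mem_singleton] at hc'
      subst hc'
      refine ⟨hM, hx, ?_⟩
      have h1 := Expr.total_le ho hM h.1
      have := Finset.sum_le_sum fun i (_ : i ∈ Finset.univ) => Expr.total_le ho hM (h.2 i)
      simp only [tick_time, act_time, Prog.timeBound, Polynomial.eval_add, Polynomial.eval_one,
        Polynomial.eval_finsetSum]
      omega

/-- Coordinates of a unit vector have modulus at most `1`, so the queried number is at most `2 q`,
plus the error `1`. -/
lemma Approximates.constsBounded {d : ℕ} {o : ℕ → ℕ → ℕ} {B : TomographyBasis d}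
    (h : Approximates o B) : ConstsBounded (2 * (numBlocks d * d)) o := by
  have key : ∀ (β : Fin (numBlocks d)) (a : Fin d), ‖B.phi β a‖ ≤ 1 := by
    intro β a
    have h1 := B.phi_unit β
    have h2 : ∑ a, ‖B.phi β a‖ ^ 2 = 1 := by
      have : (∑ a, (‖B.phi β a‖ ^ 2 : ℝ) : ℂ) = 1 := by
        rw [← h1, dotProduct]
        refine Finset.sum_congr rfl fun a _ => ?_
        rw [Pi.star_apply, Complex.star_def, Complex.conj_mul']
        push_cast; rfl
      exact_mod_cast this
    have h3 : ‖B.phi β a‖ ^ 2 ≤ 1 := by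
      rw [← h2]
      exact Finset.single_le_sum (f := fun a => ‖B.phi β a‖ ^ 2) (fun _ _ => by positivity)
        (Finset.mem_univ a)
    nlinarith [norm_nonneg (B.phi β a)]
  intro k hk q
  have hd : 0 < d := by
    rcases Nat.eq_zero_or_pos d with h0 | h0
    · subst h0; simp at hk
    · exact h0
  have hdiv : k / 2 / d < numBlocks d := by
    rw [Nat.div_lt_iff_lt_mul hd]; omega
  obtain ⟨h1, h2⟩ := h ⟨k / 2 / d, hdiv⟩ ⟨k / 2 % d, Nat.mod_lt _ hd⟩ q
  have hn := key ⟨k / 2 / d, hdiv⟩ ⟨k / 2 % d, Nat.mod_lt _ hd⟩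
  have hre := (Complex.abs_re_le_norm _).trans hn
  have him := (Complex.abs_im_le_norm _).trans hn
  have hq : (0 : ℝ) ≤ q := Nat.cast_nonneg q
  -- The index `k` encodes the block and the coordinate in `k / 2`, and real or imaginary part in
  -- its parity.
  simp only [Nat.div_add_mod'] at h1 h2
  rw [← Nat.cast_le (α := ℝ)]
  push_cast
  rcases Nat.even_or_odd' k with ⟨m, rfl | rfl⟩
  · rw [show 2 * (2 * m / 2) = 2 * m by omega] at h1
    nlinarith [(abs_le.mp h1).2, (abs_le.mp hre).2]
  · rw [show 2 * ((2 * m + 1) / 2) + 1 = 2 * m + 1 by omega] at h2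
    nlinarith [(abs_le.mp h2).2, (abs_le.mp him).2]

/-! ### Deterministic programs -/

/-- Memory after an assignment. -/
def Mem.set (M : Mem) (a i v : ℕ) : Mem := Function.update M a (Function.update (M a) i v)

lemma Mem.set_apply (M : Mem) (a i v a' i' : ℕ) :
    M.set a i v a' i' = if a' = a ∧ i' = i then v else M a' i' := by
  unfold Mem.set
  by_cases h1 : a' = a
  · subst h1
    simp [Function.update_apply]
  · simp [h1]

lemma Mem.set_of_ne (M : Mem) {a i v a' : ℕ} (h : a' ≠ a) : M.set a i v a' = M a' :=
  Function.update_of_ne h _ _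

lemma write_mem {d N : ℕ} (c : Branch d N) (a i v : ℕ) : (c.write a i v).mem = c.mem.set a i v :=
  rfl

/-- The arrays that a program writes to. -/
def Prog.writes {d : ℕ} : Prog d → Finset ℕ
  | .skip => ∅
  | .assign a _ _ => {a}
  | .seq P Q => P.writes ∪ Q.writes
  | .ite _ P Q => P.writes ∪ Q.writes
  | .loop _ P => P.writes
  | .rand a _ _ => {a}
  | .measure a _ _ => {a}
  | .perm _ _ _ => ∅
  | .ctrl _ _ _ _ _ => ∅

theorem exec_frame {d N : ℕ} (B : TomographyBasis d) (o : ℕ → ℕ → ℕ) {a : ℕ} :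
    ∀ (P : Prog d), a ∉ P.writes → ∀ c : Branch d N, ∀ c' ∈ exec B o P c, c'.mem a = c.mem a
  | .skip, _, c, c', hc' => by
      simp only [exec, List.mem_singleton] at hc'
      subst hc'; rfl
  | .assign a' idx val, h, c, c', hc' => by
      simp only [exec, List.mem_singleton] at hc'
      subst hc'
      exact Mem.set_of_ne _ (by simpa [Prog.writes] using h)
  | .seq P Q, h, c, c', hc' => by
      simp only [exec, List.mem_flatMap] at hc'
      obtain ⟨c1, hc1, hc'⟩ := hc'
      simp only [Prog.writes, Finset.mem_union, not_or] at h
      rw [exec_frame B o Q h.2 c1 c' hc', exec_frame B o P h.1 c c1 hc1]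
  | .ite e P Q, h, c, c', hc' => by
      simp only [Prog.writes, Finset.mem_union, not_or] at h
      simp only [exec] at hc'
      split_ifs at hc' with he
      · exact exec_frame B o P h.1 (c.tick _) c' hc'
      · exact exec_frame B o Q h.2 (c.tick _) c' hc'
  | .loop e P, h, c, c', hc' => by
      simp only [exec] at hc'
      refine mem_iterate_flatMap (fun c' => exec B o P (c'.tick 1))
        (fun _ c' => c'.mem a = c.mem a) _ _ ?_ ?_ c' hc'
      · intro c1 hc1
        rw [List.mem_singleton] at hc1
        subst hc1; rfl
      · intro k _ c1 h1 c2 hc2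
        rw [exec_frame B o P h (c1.tick 1) c2 hc2, tick_mem, h1]
  | .rand a' idx bound, h, c, c', hc' => by
      simp only [exec, List.mem_map, List.mem_range] at hc'
      obtain ⟨v, hv, rfl⟩ := hc'
      exact Mem.set_of_ne _ (by simpa [Prog.writes] using h)
  | .measure a' idx q, h, c, c', hc' => by
      simp only [exec] at hc'
      split_ifs at hc' with hN
      · simp only [List.mem_map] at hc'
        obtain ⟨v, -, rfl⟩ := hc'
        exact Mem.set_of_ne _ (by simpa [Prog.writes] using h)
      · rw [List.mem_singleton] at hc'
        subst hc'; rfl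
  | .perm k g t, h, c, c', hc' => by
      simp only [exec, List.mem_singleton] at hc'
      subst hc'; rfl
  | .ctrl β k g e t, h, c, c', hc' => by
      simp only [exec, List.mem_singleton] at hc'
      subst hc'; rfl

/-- Programs that neither sample nor measure. -/
def Prog.Det {d : ℕ} : Prog d → Prop
  | .seq P Q => P.Det ∧ Q.Det
  | .ite _ P Q => P.Det ∧ Q.Det
  | .loop _ P => P.Det
  | .rand _ _ _ => False
  | .measure _ _ _ => False
  | _ => True

/-- The effect of a deterministic program on the memory and on the quantum state. -/
def run {d N : ℕ} {κ : Type} (B : TomographyBasis d) (o : ℕ → ℕ → ℕ) :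
    Prog d → Mem × Matrix (Fin N → Fin d) κ ℂ → Mem × Matrix (Fin N → Fin d) κ ℂ
  | .skip, s => s
  | .assign a idx val, s => (s.1.set a (idx.eval o s.1) (val.eval o s.1), s.2)
  | .seq P Q, s => run B o Q (run B o P s)
  | .ite e P Q, s => if e.eval o s.1 ≠ 0 then run B o P s else run B o Q s
  | .loop e P, s => (run B o P)^[e.eval o s.1] s
  | .rand _ _ _, s => s
  | .measure _ _ _, s => s
  | .perm _ g t, s => (s.1, applyAt N (permGate g) (fun i => (t i).eval o s.1) * s.2)
  | .ctrl β _ g e t, s => (s.1, applyAt N (ctrlGate (B.phi β) g)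
      (Fin.cons (α := fun _ => ℕ) (e.eval o s.1) fun i => (t i).eval o s.1) * s.2)

/-- There is only one branch. The matrix `J` stands for the preparation of the work qudits: only the
effect of a program on prepared states matters, so `op * J` is tracked instead of `op`. -/
theorem exec_det {d N : ℕ} {κ : Type} (B : TomographyBasis d) (o : ℕ → ℕ → ℕ)
    (J : Matrix (Fin N → Fin d) κ ℂ) : ∀ (P : Prog d), P.Det → ∀ c : Branch d N,
      ∃ c', exec B o P c = [c'] ∧ c'.prob = c.prob ∧
        (c'.mem, c'.op * J) = run B o P (c.mem, c.op * J)
  | .skip, _, c => ⟨_, rfl, rfl, rfl⟩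
  | .assign a idx val, _, c => ⟨_, rfl, rfl, rfl⟩
  | .seq P Q, h, c => by
      obtain ⟨c1, h1, p1, r1⟩ := exec_det B o J P h.1 c
      obtain ⟨c2, h2, p2, r2⟩ := exec_det B o J Q h.2 c1
      refine ⟨c2, ?_, p2.trans p1, ?_⟩
      · simp [exec, h1, h2]
      · rw [r2, r1]; rfl
  | .ite e P Q, h, c => by
      simp only [exec, run]
      split_ifs with he
      · exact exec_det B o J P h.1 (c.tick _)
      · exact exec_det B o J Q h.2 (c.tick _)
  | .loop e P, h, c => by
      simp only [exec, run]
      have key : ∀ (k : ℕ) (c1 : Branch d N), ∃ c',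
          (fun L : List (Branch d N) => L.flatMap fun c' => exec B o P (c'.tick 1))^[k] [c1] = [c'] ∧
          c'.prob = c1.prob ∧ (c'.mem, c'.op * J) = (run B o P)^[k] (c1.mem, c1.op * J) := by
        intro k
        induction k with
        | zero => exact fun c1 => ⟨c1, rfl, rfl, rfl⟩
        | succ k ih =>
          intro c1
          obtain ⟨c2, h2, p2, r2⟩ := exec_det B o J P h (c1.tick 1)
          obtain ⟨c3, h3, p3, r3⟩ := ih c2
          refine ⟨c3, ?_, p3.trans p2, ?_⟩
          · rw [Function.iterate_succ_apply]
            simp only [List.flatMap_cons, List.flatMap_nil, List.append_nil]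
            rw [h2, h3]
          · rw [r3, r2, Function.iterate_succ_apply]; rfl
      exact key _ (c.tick _)
  | .perm k g t, _, c => ⟨_, rfl, rfl, by simp [run, Matrix.mul_assoc]⟩
  | .ctrl β k g e t, _, c => ⟨_, rfl, rfl, by simp [run, Matrix.mul_assoc]⟩
  | .rand _ _ _, h, _ => h.elim
  | .measure _ _ _, h, _ => h.elim

theorem run_frame {d N : ℕ} {κ : Type} (B : TomographyBasis d) (o : ℕ → ℕ → ℕ) {a : ℕ} :
    ∀ (P : Prog d), a ∉ P.writes → ∀ s : Mem × Matrix (Fin N → Fin d) κ ℂ,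
      (run B o P s).1 a = s.1 a
  | .skip, _, s => rfl
  | .assign a' idx val, h, s => Mem.set_of_ne _ (by simpa [Prog.writes] using h)
  | .seq P Q, h, s => by
      simp only [Prog.writes, Finset.mem_union, not_or] at h
      rw [run, run_frame B o Q h.2, run_frame B o P h.1]
  | .ite e P Q, h, s => by
      simp only [Prog.writes, Finset.mem_union, not_or] at h
      rw [run]
      split_ifs with he
      · exact run_frame B o P h.1 s
      · exact run_frame B o Q h.2 s
  | .loop e P, h, s => by
      rw [run]
      generalize e.eval o s.1 = k
      induction k with
      | zero => rfl
      | succ k ih => rw [Function.iterate_succ_apply', run_frame B o P h, ih]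
  | .rand a' idx bound, h, s => rfl
  | .measure a' idx q, h, s => rfl
  | .perm k g t, h, s => rfl
  | .ctrl β k g e t, h, s => rfl

/-- Programs without quantum gates. -/
def Prog.Classical {d : ℕ} : Prog d → Prop
  | .seq P Q => P.Classical ∧ Q.Classical
  | .ite _ P Q => P.Classical ∧ Q.Classical
  | .loop _ P => P.Classical
  | .perm _ _ _ => False
  | .ctrl _ _ _ _ _ => False
  | _ => True

theorem run_classical {d N : ℕ} {κ : Type} (B : TomographyBasis d) (o : ℕ → ℕ → ℕ) :
    ∀ (P : Prog d), P.Classical → ∀ s : Mem × Matrix (Fin N → Fin d) κ ℂ,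
      (run B o P s).2 = s.2
  | .skip, _, s => rfl
  | .assign a' idx val, h, s => rfl
  | .seq P Q, h, s => by rw [run, run_classical B o Q h.2, run_classical B o P h.1]
  | .ite e P Q, h, s => by
      rw [run]
      split_ifs with he
      · exact run_classical B o P h.1 s
      · exact run_classical B o Q h.2 s
  | .loop e P, h, s => by
      rw [run]
      generalize e.eval o s.1 = k
      induction k with
      | zero => rfl
      | succ k ih => rw [Function.iterate_succ_apply', run_classical B o P h, ih]
  | .rand a' idx bound, h, s => rfl
  | .measure a' idx q, h, s => rfl

/-! ### Counting loops -/

/-- Assign a clamped value. -/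
def put {d : ℕ} (a : ℕ) (idx v : Expr) : Prog d := .assign a idx (clamp v)

/-- Repeat `P` as often as `e` says, counting in cell `0` of array `a`. -/
def forLoop {d : ℕ} (a : ℕ) (e : Expr) (P : Prog d) : Prog d :=
  .seq (put a (.lit 0) (.lit 0))
    (.loop e (.seq P (put a (.lit 0) (.bin .add (.load a (.lit 0)) (.lit 1)))))

lemma run_put {d N : ℕ} {κ : Type} (B : TomographyBasis d) (o : ℕ → ℕ → ℕ) (a : ℕ) (idx v : Expr)
    (s : Mem × Matrix (Fin N → Fin d) κ ℂ) (h : v.eval o s.1 ≤ s.1 0 2) :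
    run B o (put a idx v) s = (s.1.set a (idx.eval o s.1) (v.eval o s.1), s.2) := by
  rw [put, run, clamp_eval, min_eq_left h]

/-- The invariant rule for counting loops. The body must leave alone the counter and array `0`, and
`n` must not exceed the clamping bound in cell `2`, as otherwise the counter would stall. The step
may use that arrays outside of the body's writes still have their initial contents. -/
theorem run_forLoop {d N : ℕ} {κ : Type} (B : TomographyBasis d) (o : ℕ → ℕ → ℕ) {a : ℕ}
    {e : Expr} {P : Prog d} (I : ℕ → Mem × Matrix (Fin N → Fin d) κ ℂ → Prop)
    (s : Mem × Matrix (Fin N → Fin d) κ ℂ) {n : ℕ} (hn : n ≤ s.1 0 2)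
    (ha : a ≠ 0) (haP : a ∉ P.writes) (h0P : 0 ∉ P.writes)
    (he : e.eval o (s.1.set a 0 0) = n) (h0 : I 0 (s.1.set a 0 0, s.2))
    (hs : ∀ k < n, ∀ s', I k s' → s'.1 a 0 = k → (∀ a', a' ≠ a → a' ∉ P.writes → s'.1 a' = s.1 a') →
      I (k + 1) ((run B o P s').1.set a 0 (k + 1), (run B o P s').2)) :
    I n (run B o (forLoop a e P) s) := by
  have hput : run B o (put a (.lit 0) (.lit 0)) s = (s.1.set a 0 0, s.2) :=
    run_put B o a _ _ s (Nat.zero_le _)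
  rw [forLoop, run, hput, run, he]
  -- The induction has to carry the value of the counter and the unchanged arrays along with the
  -- invariant.
  suffices h : ∀ k ≤ n, I k ((run B o (.seq P (put a (.lit 0)
        (.bin .add (.load a (.lit 0)) (.lit 1)))))^[k] (s.1.set a 0 0, s.2)) ∧
      ((run B o (.seq P (put a (.lit 0)
        (.bin .add (.load a (.lit 0)) (.lit 1)))))^[k] (s.1.set a 0 0, s.2)).1 a 0 = k ∧
      ∀ a', a' ≠ a → a' ∉ P.writes → ((run B o (.seq P (put a (.lit 0)
        (.bin .add (.load a (.lit 0)) (.lit 1)))))^[k] (s.1.set a 0 0, s.2)).1 a' = s.1 a' from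
    (h n le_rfl).1
  intro k
  induction k with
  | zero => exact fun _ => ⟨h0, by simp [Mem.set_apply], fun a' ha' _ => Mem.set_of_ne _ ha'⟩
  | succ k ih =>
    intro hk
    obtain ⟨h1, h2, h3⟩ := ih (by omega)
    rw [Function.iterate_succ_apply']
    set s' := (run B o (.seq P (put a (.lit 0)
      (.bin .add (.load a (.lit 0)) (.lit 1)))))^[k] (s.1.set a 0 0, s.2)
    have e1 : (run B o P s').1 a 0 = k := by rw [run_frame B o P haP, h2]
    have e2 : (run B o P s').1 0 2 = s.1 0 2 := by
      rw [run_frame B o P h0P, h3 0 ha.symm h0P]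
    have e3 : run B o (.seq P (put a (.lit 0) (.bin .add (.load a (.lit 0)) (.lit 1)))) s' =
        ((run B o P s').1.set a 0 (k + 1), (run B o P s').2) := by
      rw [run, run_put]
      · simp [Expr.eval, BinOp.eval, e1]
      · simp only [Expr.eval, BinOp.eval, e1, e2]; omega
    rw [e3]
    refine ⟨hs k (by omega) s' h1 h2 h3, by simp [Mem.set_apply], fun a' ha' hP' => ?_⟩
    simp only [Mem.set_of_ne _ ha']
    rw [run_frame B o P hP', h3 a' ha' hP']

/-! ### Sums over branches -/

section Sums

variable {V : Type*} [AddCommMonoid V]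

/-- The sum of `H` over the branches of `P`. -/
def branchSum {d N : ℕ} (B : TomographyBasis d) (o : ℕ → ℕ → ℕ) (P : Prog d) (c : Branch d N)
    (H : Branch d N → V) : V := ((exec B o P c).map H).sum

lemma sum_map_flatMap {α β : Type*} (L : List α) (f : α → List β) (H : β → V) :
    ((L.flatMap f).map H).sum = (L.map fun a => ((f a).map H).sum).sum := by
  induction L with
  | nil => simp
  | cons a L ih => simp [List.flatMap_cons, ih]

lemma branchSum_seq {d N : ℕ} (B : TomographyBasis d) (o : ℕ → ℕ → ℕ) (P Q : Prog d)
    (c : Branch d N) (H : Branch d N → V) :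
    branchSum B o (.seq P Q) c H = branchSum B o P c fun c' => branchSum B o Q c' H := by
  simp only [branchSum, exec, sum_map_flatMap]

lemma branchSum_congr {d N : ℕ} {B : TomographyBasis d} {o : ℕ → ℕ → ℕ} {P : Prog d}
    {c : Branch d N} {H H' : Branch d N → V} (h : ∀ c' ∈ exec B o P c, H c' = H' c') :
    branchSum B o P c H = branchSum B o P c H' := by
  simp only [branchSum, List.map_congr_left h]

lemma branchSum_of_exec_eq {d N : ℕ} {B : TomographyBasis d} {o : ℕ → ℕ → ℕ} {P : Prog d}
    {c c' : Branch d N} (h : exec B o P c = [c']) (H : Branch d N → V) :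
    branchSum B o P c H = H c' := by
  simp [branchSum, h]

/-- A conservation law: if each step splits the weight `H k c` of a branch among its successors, the
total weight never changes. -/
lemma sum_iterate_flatMap {α : Type*} (f : α → List α) (n : ℕ) (I : ℕ → α → Prop) (H : ℕ → α → V)
    (hs : ∀ k < n, ∀ c, I k c →
      (∀ c' ∈ f c, I (k + 1) c') ∧ ((f c).map (H (k + 1))).sum = H k c) :
    ∀ L : List α, (∀ c ∈ L, I 0 c) →
      (((fun L : List α => L.flatMap f)^[n] L).map (H n)).sum = (L.map (H 0)).sum := by
  induction n generalizing I H with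
  | zero => intro L _; rfl
  | succ n ih =>
    intro L h0
    rw [Function.iterate_succ_apply,
      ih (fun k => I (k + 1)) (fun k => H (k + 1)) (fun k hk c hc => hs (k + 1) (by omega) c hc),
      sum_map_flatMap]
    · congr 1
      exact List.map_congr_left fun c hc => (hs 0 (by omega) c (h0 c hc)).2
    · intro c hc
      obtain ⟨c1, hc1, hc⟩ := List.mem_flatMap.mp hc
      exact (hs 0 (by omega) c1 (h0 c1 hc1)).1 c hc

/-- Functions of a branch that do not depend on the running time. -/
def TimeFree {d N : ℕ} {W : Type*} (H : Branch d N → W) : Prop :=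
  ∀ c c' : Branch d N, c.mem = c'.mem → c.prob = c'.prob → c.op = c'.op → H c = H c'

/-- `c` with a different memory. -/
def Branch.withMem {d N : ℕ} (c : Branch d N) (M : Mem) : Branch d N := { c with mem := M }

lemma TimeFree.tick {d N : ℕ} {W : Type*} {H : Branch d N → W} (h : TimeFree H) (c : Branch d N)
    (t : ℕ) : H (c.tick t) = H c := h _ _ rfl rfl rfl

lemma exec_put {d N : ℕ} (B : TomographyBasis d) (o : ℕ → ℕ → ℕ) (a : ℕ) (idx v : Expr)
    (c : Branch d N) (h : v.eval o c.mem ≤ c.mem 0 2) :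
    ∃ t, exec B o (put a idx v) c =
      [(c.withMem (c.mem.set a (idx.eval o c.mem) (v.eval o c.mem))).tick t] := by
  rw [put, exec, clamp_eval, min_eq_left h]
  exact ⟨_, rfl⟩

/-- The analogue of `run_forLoop` for branching programs: `I` holds on all branches, and the total
of `H k` is conserved. Choosing `H k` as the expected final contribution of a branch after `k`
rounds yields the branch sum at the end. Independence of time lets the ticks be dropped. -/
theorem branchSum_forLoop {d N : ℕ} (B : TomographyBasis d) (o : ℕ → ℕ → ℕ) {a : ℕ}
    {e : Expr} {P : Prog d} (I : ℕ → Branch d N → Prop) (H : ℕ → Branch d N → V)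
    (hI : ∀ k, TimeFree (I k)) (hH : ∀ k, TimeFree (H k))
    (c : Branch d N) {n : ℕ} (hn : n ≤ c.mem 0 2)
    (ha : a ≠ 0) (haP : a ∉ P.writes) (h0P : 0 ∉ P.writes)
    (he : e.eval o (c.mem.set a 0 0) = n) (h0 : I 0 (c.withMem (c.mem.set a 0 0)))
    (hs : ∀ k < n, ∀ c1, I k c1 → c1.mem a 0 = k →
      (∀ a', a' ≠ a → a' ∉ P.writes → c1.mem a' = c.mem a') →
      (∀ c2 ∈ exec B o P c1, I (k + 1) (c2.withMem (c2.mem.set a 0 (k + 1)))) ∧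
      branchSum B o P c1 (fun c2 => H (k + 1) (c2.withMem (c2.mem.set a 0 (k + 1)))) = H k c1) :
    (∀ c' ∈ exec B o (forLoop a e P) c, I n c') ∧
    branchSum B o (forLoop a e P) c (H n) = H 0 (c.withMem (c.mem.set a 0 0)) := by
  obtain ⟨t0, ht0⟩ := exec_put B o a (.lit 0) (.lit 0) c (Nat.zero_le _)
  simp only [Expr.eval] at ht0
  set body : Prog d := .seq P (put a (.lit 0) (.bin .add (.load a (.lit 0)) (.lit 1))) with hbody
  set c0 := (c.withMem (c.mem.set a 0 0)).tick t0 with hc0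
  let I' : ℕ → Branch d N → Prop := fun k c1 => I k c1 ∧ c1.mem a 0 = k ∧
    ∀ a', a' ≠ a → a' ∉ P.writes → c1.mem a' = c.mem a'
  have hstep : ∀ k < n, ∀ c1, I' k c1 →
      (∀ c' ∈ exec B o body (c1.tick 1), I' (k + 1) c') ∧
        ((exec B o body (c1.tick 1)).map (H (k + 1))).sum = H k c1 := by
    rintro k hk c1 ⟨h1, h2, h3⟩
    obtain ⟨g1, g2⟩ := hs k hk (c1.tick 1) (((hI k).tick c1 1).mpr h1) h2 h3
    have hinc : ∀ c2 ∈ exec B o P (c1.tick 1), ∃ t,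
        exec B o (put a (.lit 0) (.bin .add (.load a (.lit 0)) (.lit 1))) c2 =
          [(c2.withMem (c2.mem.set a 0 (k + 1))).tick t] := by
      intro c2 hc2
      have e1 : c2.mem a 0 = k := by rw [exec_frame B o P haP _ c2 hc2, tick_mem, h2]
      have e2 : c2.mem 0 2 = c.mem 0 2 := by
        rw [exec_frame B o P h0P _ c2 hc2, tick_mem, h3 0 ha.symm h0P]
      obtain ⟨t, ht⟩ := exec_put B o a (.lit 0) (.bin .add (.load a (.lit 0)) (.lit 1)) c2
        (by simp only [Expr.eval, BinOp.eval, e1, e2]; omega)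
      simp only [Expr.eval, BinOp.eval, e1] at ht
      exact ⟨t, ht⟩
    constructor
    · intro c' hc'
      rw [hbody, exec, List.mem_flatMap] at hc'
      obtain ⟨c2, hc2, hc'⟩ := hc'
      obtain ⟨t, ht⟩ := hinc c2 hc2
      rw [ht, List.mem_singleton] at hc'
      subst hc'
      refine ⟨((hI (k + 1)).tick _ t).mpr (g1 c2 hc2), by simp [Branch.withMem, Mem.set_apply],
        fun a' ha' hP' => ?_⟩
      simp only [tick_mem, Branch.withMem, Mem.set_of_ne _ ha']
      rw [exec_frame B o P hP' _ c2 hc2, tick_mem, h3 a' ha' hP']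
    · change branchSum B o body (c1.tick 1) (H (k + 1)) = _
      rw [hbody, branchSum_seq, ← (hH k).tick c1 1, ← g2]
      refine branchSum_congr fun c2 hc2 => ?_
      obtain ⟨t, ht⟩ := hinc c2 hc2
      rw [branchSum_of_exec_eq ht, (hH (k + 1)).tick]
  have hexec : exec B o (forLoop a e P) c =
      (fun L : List (Branch d N) => L.flatMap fun c' => exec B o body (c'.tick 1))^[n]
        [c0.tick (1 + e.cost o c0.mem)] := by
    have hm : c0.mem = c.mem.set a 0 0 := rfl
    rw [forLoop, exec, ht0]
    simp only [List.flatMap_cons, List.flatMap_nil, List.append_nil]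
    rw [exec, hm, he]
  have hI0 : ∀ c' ∈ [c0.tick (1 + e.cost o c0.mem)], I' 0 c' := by
    intro c' hc'
    rw [List.mem_singleton] at hc'
    subst hc'
    refine ⟨?_, by simp [hc0, Branch.withMem, Mem.set_apply], fun a' ha' _ => ?_⟩
    · rw [(hI 0).tick, hc0, (hI 0).tick]; exact h0
    · simp [hc0, Branch.withMem, Mem.set_of_ne _ ha']
  constructor
  · intro c' hc'
    rw [hexec] at hc'
    exact (mem_iterate_flatMap _ I' n _ hI0 (fun k hk c1 h1 => (hstep k hk c1 h1).1) c' hc').1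
  · rw [branchSum, hexec, sum_iterate_flatMap _ n I' H hstep _ hI0]
    simp only [List.map_cons, List.map_nil, List.sum_cons, List.sum_nil, add_zero]
    rw [(hH 0).tick, hc0, (hH 0).tick]

end Sums

/-! ### Work qudits in computational basis states -/

section Emb

variable {d n w : ℕ} {κ : Type}

/-- `A ⊗ |z⟩`: the work qudits are in the computational basis state `z`. -/
def emb (w : ℕ) (z : ℕ → Fin d) (A : Matrix (Fin n → Fin d) κ ℂ) :
    Matrix (Fin (n + w) → Fin d) κ ℂ :=
  Matrix.of fun x y =>
    if ∀ i : Fin w, x (Fin.natAdd n i) = z i then A (fun q => x (Fin.castAdd w q)) y else 0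

lemma emb_apply (z : ℕ → Fin d) (A : Matrix (Fin n → Fin d) κ ℂ) (x : Fin (n + w) → Fin d) (y : κ) :
    emb w z A x y =
      if ∀ i : Fin w, x (Fin.natAdd n i) = z i then A (fun q => x (Fin.castAdd w q)) y else 0 :=
  rfl

lemma emb_zero (z : ℕ → Fin d) : emb w z (0 : Matrix (Fin n → Fin d) κ ℂ) = 0 := by
  ext x y; simp [emb_apply]

lemma emb_sum {ι : Type*} (s : Finset ι) (z : ℕ → Fin d) (A : ι → Matrix (Fin n → Fin d) κ ℂ) :
    emb w z (∑ k ∈ s, A k) = ∑ k ∈ s, emb w z (A k) := by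
  ext x y
  simp only [emb_apply, Matrix.sum_apply]
  split_ifs <;> simp

lemma emb_mul {μ : Type} [Fintype κ] (z : ℕ → Fin d) (A : Matrix (Fin n → Fin d) κ ℂ)
    (R : Matrix κ μ ℂ) : emb w z (A * R) = emb w z A * R := by
  ext x y
  simp only [emb_apply, Matrix.mul_apply]
  split_ifs <;> simp

/-- The basis state that is `u` on the system and `z` on the work qudits. -/
def join (w : ℕ) (u : Fin n → Fin d) (z : ℕ → Fin d) : Fin (n + w) → Fin d :=
  Fin.append u fun i => z i

@[simp] lemma join_castAdd (u : Fin n → Fin d) (z : ℕ → Fin d) (q : Fin n) :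
    join w u z (Fin.castAdd w q) = u q := Fin.append_left _ _ _

@[simp] lemma join_natAdd (u : Fin n → Fin d) (z : ℕ → Fin d) (i : Fin w) :
    join w u z (Fin.natAdd n i) = z i := Fin.append_right _ _ _

lemma eq_join {x : Fin (n + w) → Fin d} {z : ℕ → Fin d}
    (h : ∀ i : Fin w, x (Fin.natAdd n i) = z i) : x = join w (fun q => x (Fin.castAdd w q)) z := by
  funext q
  refine Fin.addCases (fun q => ?_) (fun i => ?_) q
  · simp
  · simp [h]

lemma mul_emb_apply {μ : Type} (G : Matrix μ (Fin (n + w) → Fin d) ℂ) (z : ℕ → Fin d)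
    (A : Matrix (Fin n → Fin d) κ ℂ) (x : μ) (y : κ) :
    (G * emb w z A) x y = ∑ u, G x (join w u z) * A u y := by
  rw [Matrix.mul_apply]
  have hinj : Function.Injective fun u : Fin n → Fin d => join w u z := by
    intro u u' h
    funext q
    simpa using congrFun h (Fin.castAdd w q)
  rw [← Finset.sum_subset (Finset.subset_univ (Finset.univ.image fun u => join w u z)),
    Finset.sum_image (fun a _ b _ h => hinj h)]
  · refine Finset.sum_congr rfl fun u _ => ?_
    simp [emb_apply]
  · intro v _ hv
    rw [emb_apply, if_neg, mul_zero]
    intro h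
    exact hv (Finset.mem_image.mpr ⟨_, Finset.mem_univ _, (eq_join h).symm⟩)

/-- It reduces the action of a gate on prepared work qudits to its matrix entries in the columns
`join w u z`. -/
lemma eq_emb_of_apply {G : Op d (n + w)} {z z' : ℕ → Fin d}
    {S : Op d n} (h : ∀ x u, G x (join w u z) =
      if ∀ i : Fin w, x (Fin.natAdd n i) = z' i then S (fun q => x (Fin.castAdd w q)) u else 0)
    (A : Matrix (Fin n → Fin d) κ ℂ) : G * emb w z A = emb w z' (S * A) := by
  ext x y
  rw [mul_emb_apply, emb_apply, Matrix.mul_apply]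
  simp only [h]
  split_ifs <;> simp

/-- The initial embedding, with all work qudits in state `0`. -/
lemma withWork_eq {e : ℕ} (X : Op (e + 2) n) :
    withWork w X = emb w 0 (1 : Op (e + 2) n) * X * (emb w 0 (1 : Op (e + 2) n))ᴴ := by
  rw [← emb_mul, Matrix.one_mul]
  ext x y
  rw [Matrix.mul_apply]
  simp only [Matrix.conjTranspose_apply, emb_apply, withWork, Matrix.of_apply, Pi.zero_apply,
    Matrix.one_apply]
  by_cases hx : ∀ i : Fin w, x (Fin.natAdd n i) = 0
  · by_cases hy : ∀ i : Fin w, y (Fin.natAdd n i) = 0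
    · simp [hx, hy]
    · rw [if_neg]
      · simp [hy]
      · intro h
        exact hy fun i => Fin.ext (h i).2
  · rw [if_neg]
    · simp [hx]
    · intro h
      exact hx fun i => Fin.ext (h i).1

/-- Orthonormality of the computational basis states of the work qudits. -/
lemma conjTranspose_emb_mul_emb (z z' : ℕ → Fin d) (A : Op d n) :
    (emb w z (1 : Op d n))ᴴ * emb w z' A = if ∀ i < w, z i = z' i then A else 0 := by
  ext x y
  rw [mul_emb_apply]
  simp only [Matrix.conjTranspose_apply, emb_apply, join_natAdd]
  by_cases h : ∀ i < w, z i = z' i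
  · have h' : ∀ i : Fin w, z' i = z i := fun i => (h i i.2).symm
    simp only [h', implies_true, if_true, if_pos h]
    simp [Matrix.one_apply]
  · have h' : ¬ ∀ i : Fin w, z' i = z i := fun h' => h fun i hi => (h' ⟨i, hi⟩).symm
    simp [h', if_neg h]

/-! ### Gates -/

/-- A reversible gate on work cells maps basis states to basis states. The offset `n` arises because
the work qudits come after the system qudits; `hz` and `hz'` say that `z'` is `z` with `g` applied
to the cells `p`. -/
lemma permGate_apply_join {k : ℕ} (g : Equiv.Perm (Fin k → Fin d)) {t p : Fin k → ℕ}
    (ht : ∀ i, t i = n + p i) (hp : Function.Injective p) (hw : ∀ i, p i < w)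
    {z z' : ℕ → Fin d} (hz : ∀ i, z' (p i) = g (fun i => z (p i)) i)
    (hz' : ∀ a, (∀ i, p i ≠ a) → z' a = z a) (A : Matrix (Fin n → Fin d) κ ℂ) :
    applyAt (n + w) (permGate g) t * emb w z A = emb w z' A := by
  have hcond : Function.Injective t ∧ ∀ i, t i < n + w :=
    ⟨fun i j h => hp (by rw [ht, ht] at h; omega), fun i => by rw [ht]; have := hw i; omega⟩
  have htp : ∀ i, (⟨t i, hcond.2 i⟩ : Fin (n + w)) = Fin.natAdd n ⟨p i, hw i⟩ :=
    fun i => Fin.ext (ht i)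
  have := eq_emb_of_apply (G := applyAt (n + w) (permGate g) t) (z := z) (z' := z')
    (S := (1 : Op d n)) ?_ A
  · rw [this, Matrix.one_mul]
  intro x u
  rw [applyAt, dif_pos hcond]
  simp only [Matrix.of_apply, permGate, htp, join_natAdd, Matrix.one_apply]
  by_cases h1 : ∀ i : Fin w, x (Fin.natAdd n i) = z' i
  · rw [if_pos h1]
    have h2 : (fun i => x (Fin.natAdd n ⟨p i, hw i⟩)) = g fun i => z (p i) := by
      funext i; rw [h1, hz]
    rw [if_pos h2]
    refine if_congr ⟨fun h => ?_, fun h q hq => ?_⟩ rfl rfl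
    · funext q
      have := h (Fin.castAdd w q) fun i => by rw [ht]; simp; omega
      simpa using this
    · revert hq
      refine Fin.addCases (fun q _ => ?_) (fun i hi => ?_) q
      · simpa using congrFun h q
      · rw [join_natAdd, h1, hz']
        intro i' hi'
        exact hi i' (by rw [ht, hi']; simp)
  · rw [if_neg h1]
    -- If the gate has a nonzero entry here, then `x` is `z'` on the targets, and it is `z = z'` off
    -- the targets.
    split_ifs with h2 h3
    · exfalso
      apply h1
      intro i
      by_cases hi : ∃ i', p i' = i
      · obtain ⟨i', hi'⟩ := hi
        have := congrFun h3 i'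
        rw [← hi', hz, ← this]
        congr 1
        exact Fin.ext (by simp [hi'])
      · push Not at hi
        rw [hz' _ hi, h2 (Fin.natAdd n i) fun i' h => hi i' (by rw [ht] at h; simpa using h),
          join_natAdd]
    · rfl
    · rfl

/-- `V` applied to system qudit `q`. -/
def siteOp (q : Fin n) (V : Matrix (Fin d) (Fin d) ℂ) : Op d n :=
  prodOp fun q' => if q' = q then V else 1

lemma siteOp_apply (q : Fin n) (V : Matrix (Fin d) (Fin d) ℂ) (x y : Fin n → Fin d) :
    siteOp q V x y = if ∀ q', q' ≠ q → x q' = y q' then V (x q) (y q) else 0 := by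
  rw [siteOp, prodOp, Matrix.of_apply]
  split_ifs with h
  · rw [Finset.prod_eq_single q]
    · simp
    · intro q' _ hq'
      rw [if_neg hq', h q' hq', Matrix.one_apply_eq]
    · simp
  · push Not at h
    obtain ⟨q', hq', hne⟩ := h
    exact Finset.prod_eq_zero (Finset.mem_univ q') (by simp [hq', hne])

/-- The gate splits the state by the test on the controlling system qudit: the work qudits change to
`z'` on the positive part and stay `z` on the negative one. -/
lemma ctrlGate_mul_emb {k : ℕ} (φ : Fin d → ℂ) (g : Equiv.Perm (Fin k → Fin d)) (q : Fin n)
    {c : ℕ} (hc : c = q) {t p : Fin k → ℕ}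
    (ht : ∀ i, t i = n + p i) (hp : Function.Injective p) (hw : ∀ i, p i < w)
    {z z' : ℕ → Fin d} (hz : ∀ i, z' (p i) = g (fun i => z (p i)) i)
    (hz' : ∀ a, (∀ i, p i ≠ a) → z' a = z a) (A : Matrix (Fin n → Fin d) κ ℂ) :
    applyAt (n + w) (ctrlGate φ g) (Fin.cons (α := fun _ => ℕ) c t) * emb w z A =
      emb w z' (siteOp q (ketbra φ) * A) + emb w z (siteOp q (1 - ketbra φ) * A) := by
  have hcond : Function.Injective (Fin.cons (α := fun _ => ℕ) c t) ∧
      ∀ i, (Fin.cons (α := fun _ => ℕ) c t : Fin (k + 1) → ℕ) i < n + w := by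
    constructor
    · rw [Fin.cons_injective_iff]
      refine ⟨?_, fun i j h => hp (by rw [ht, ht] at h; omega)⟩
      rintro ⟨i, hi⟩
      rw [ht, hc] at hi
      omega
    · intro i
      refine Fin.cases ?_ (fun i => ?_) i
      · simp [hc]; omega
      · rw [Fin.cons_succ, ht]; have := hw i; omega
  have htp : ∀ i, (⟨t i, by simpa using hcond.2 i.succ⟩ : Fin (n + w)) =
      Fin.natAdd n ⟨p i, hw i⟩ := fun i => Fin.ext (ht i)
  have hcq : (⟨c, by simpa using hcond.2 0⟩ : Fin (n + w)) = Fin.castAdd w q := Fin.ext hc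
  ext x y
  rw [mul_emb_apply, Matrix.add_apply, emb_apply, emb_apply, Matrix.mul_apply, Matrix.mul_apply]
  have key : ∀ u, applyAt (n + w) (ctrlGate φ g) (Fin.cons (α := fun _ => ℕ) c t) x (join w u z) =
      (if ∀ i : Fin w, x (Fin.natAdd n i) = z' i then
        siteOp q (ketbra φ) (fun q => x (Fin.castAdd w q)) u else 0) +
      (if ∀ i : Fin w, x (Fin.natAdd n i) = z i then
        siteOp q (1 - ketbra φ) (fun q => x (Fin.castAdd w q)) u else 0) := by
    intro u
    -- Agreement away from the gate means agreement on the other system qudits and on the work cells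
    -- that are not targets.
    have hoff : (∀ r : Fin (n + w), (∀ i, (Fin.cons (α := fun _ => ℕ) c t : Fin (k + 1) → ℕ) i ≠ r) →
        x r = join w u z r) ↔ (∀ q', q' ≠ q → x (Fin.castAdd w q') = u q') ∧
          ∀ i : Fin w, (∀ i', p i' ≠ i) → x (Fin.natAdd n i) = z i := by
      constructor
      · intro h
        constructor
        · intro q' hq'
          have := h (Fin.castAdd w q') ?_
          · simpa using this
          · intro i
            refine Fin.cases ?_ (fun i => ?_) i
            · simp only [Fin.cons_zero, hc, Fin.val_castAdd]
              exact fun h => hq' (Fin.ext h.symm)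
            · simp only [Fin.cons_succ, ht, Fin.val_castAdd]; omega
        · intro i hi
          have := h (Fin.natAdd n i) ?_
          · simpa using this
          · intro i'
            refine Fin.cases ?_ (fun i' => ?_) i'
            · simp only [Fin.cons_zero, hc, Fin.val_natAdd]; omega
            · simp only [Fin.cons_succ, ht, Fin.val_natAdd]
              exact fun h => hi i' (by omega)
      · rintro ⟨h1, h2⟩ r
        refine Fin.addCases (fun q' hr => ?_) (fun i hr => ?_) r
        · rw [join_castAdd]
          refine h1 q' fun h => ?_
          exact hr 0 (by simp [hc, h])
        · rw [join_natAdd]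
          refine h2 i fun i' h => ?_
          exact hr i'.succ (by simp [ht, h])
    -- Once the other cells agree, being in a given work state is decided on the targets. This is
    -- used for `z'` and for `z`, one for each part of the gate.
    have hon : ∀ (v : Fin k → Fin d) (z1 : ℕ → Fin d), (∀ i, z1 (p i) = v i) →
        (∀ a, (∀ i, p i ≠ a) → z1 a = z a) →
        ((∀ i : Fin w, x (Fin.natAdd n i) = z1 i) ↔
          (∀ i : Fin w, (∀ i', p i' ≠ i) → x (Fin.natAdd n i) = z i) ∧
            (fun i => x (Fin.natAdd n ⟨p i, hw i⟩)) = v) := by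
      intro v z1 hv hz1
      constructor
      · intro h
        refine ⟨fun i hi => by rw [h, hz1 _ hi], ?_⟩
        funext i
        rw [h, ← hv]
      · rintro ⟨h1, h2⟩ i
        by_cases hi : ∃ i', p i' = i
        · obtain ⟨i', hi'⟩ := hi
          rw [← hi', hv, ← h2]
          congr 1
          exact Fin.ext (by simp [hi'])
        · push Not at hi
          rw [h1 i hi, hz1 _ hi]
    rw [applyAt, dif_pos hcond]
    simp only [Matrix.of_apply, ctrlGate, permGate, Matrix.one_apply]
    rw [if_congr hoff rfl rfl, if_congr (hon _ z' hz hz') rfl rfl,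
      if_congr (hon _ z (fun _ => rfl) fun _ _ => rfl) rfl rfl, siteOp_apply, siteOp_apply]
    have e1 : Fin.tail (fun i => x ⟨(Fin.cons (α := fun _ => ℕ) c t : Fin (k + 1) → ℕ) i,
        hcond.2 i⟩) = fun i => x (Fin.natAdd n ⟨p i, hw i⟩) := by
      funext i
      simp only [Fin.tail, Fin.cons_succ, htp]
    have e2 : Fin.tail (fun i => join w u z ⟨(Fin.cons (α := fun _ => ℕ) c t : Fin (k + 1) → ℕ) i,
        hcond.2 i⟩) = fun i => z (p i) := by
      funext i
      simp only [Fin.tail, Fin.cons_succ, htp, join_natAdd]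
    rw [e1, e2]
    simp only [Fin.cons_zero, hcq, join_castAdd]
    by_cases c1 : ∀ q', q' ≠ q → x (Fin.castAdd w q') = u q'
    · by_cases c2 : ∀ i : Fin w, (∀ i', p i' ≠ i) → x (Fin.natAdd n i) = z i
      · rw [if_pos ⟨c1, c2⟩, if_pos c1, if_pos c1]
        congr 1
        · by_cases c3 : (fun i => x (Fin.natAdd n ⟨p i, hw i⟩)) = g fun i => z (p i)
          · rw [if_pos c3, if_pos ⟨c2, c3⟩, mul_one]
          · rw [if_neg c3, if_neg fun h => c3 h.2, mul_zero]
        · by_cases c3 : (fun i => x (Fin.natAdd n ⟨p i, hw i⟩)) = fun i => z (p i)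
          · rw [if_pos c3, if_pos ⟨c2, c3⟩, mul_one]
          · rw [if_neg c3, if_neg fun h => c3 h.2, mul_zero]
      · rw [if_neg fun h => c2 h.2, if_neg fun h => c2 h.1, if_neg fun h => c2 h.1, add_zero]
    · rw [if_neg fun h => c1 h.1, if_neg c1, if_neg c1]
      simp
  simp only [key, add_mul, Finset.sum_add_distrib]
  congr 1 <;> split_ifs <;> simp

lemma siteOp_mul_bitProj {Φ : Fin n → Fin d → ℂ} (hΦ : ∀ q, IsTest (Φ q)) (x : Fin n → Bool)
    (q : Fin n) (b : Bool) :
    siteOp q (bitFactor (Φ q) b) * bitProj Φ x = if x q = b then bitProj Φ x else 0 := by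
  split_ifs with h
  · refine prodOp_mul_bitProj_eq_self hΦ _ _ fun q' => ?_
    by_cases hq : q' = q
    · subst hq; right; rw [if_pos rfl, h]
    · left; rw [if_neg hq]
  · refine prodOp_mul_bitProj_eq_zero hΦ _ _ q ?_
    rw [if_pos rfl]
    congr 1
    revert h; cases x q <;> cases b <;> simp

/-- A controlled gate acts classically on the joint projectors. -/
lemma ctrlGate_mul_emb_bitProj {k : ℕ} {Φ : Fin n → Fin d → ℂ} (hΦ : ∀ q, IsTest (Φ q))
    (x : Fin n → Bool) {φ : Fin d → ℂ} (g : Equiv.Perm (Fin k → Fin d)) (q : Fin n) (hφ : Φ q = φ)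
    {c : ℕ} (hc : c = q) {t p : Fin k → ℕ}
    (ht : ∀ i, t i = n + p i) (hp : Function.Injective p) (hw : ∀ i, p i < w)
    {z z' : ℕ → Fin d} (hz : ∀ i, z' (p i) = g (fun i => z (p i)) i)
    (hz' : ∀ a, (∀ i, p i ≠ a) → z' a = z a) (A : Matrix (Fin n → Fin d) κ ℂ) :
    applyAt (n + w) (ctrlGate φ g) (Fin.cons (α := fun _ => ℕ) c t) *
        emb w z (bitProj Φ x * A) =
      emb w (if x q then z' else z) (bitProj Φ x * A) := by
  rw [ctrlGate_mul_emb φ g q hc ht hp hw hz hz', ← Matrix.mul_assoc, ← Matrix.mul_assoc]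
  have h1 := siteOp_mul_bitProj hΦ x q true
  have h2 := siteOp_mul_bitProj hΦ x q false
  simp only [bitFactor, hφ, if_true, if_false, Bool.false_eq_true] at h1 h2
  rw [h1, h2]
  cases x q <;> simp [emb_zero]

lemma readProj_mul_emb {r : Fin (n + w)} {p : ℕ} (hr : (r : ℕ) = n + p) (v : Fin d)
    (z : ℕ → Fin d) (A : Matrix (Fin n → Fin d) κ ℂ) :
    readProj r v * emb w z A = if z p = v then emb w z A else 0 := by
  have hp : p < w := by have := r.2; omega
  have : r = Fin.natAdd n ⟨p, hp⟩ := Fin.ext hr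
  subst this
  ext x y
  rw [readProj, Matrix.diagonal_mul, emb_apply]
  by_cases h : ∀ i : Fin w, x (Fin.natAdd n i) = z i
  · rw [if_pos h, h ⟨p, hp⟩]
    split_ifs with hv <;> simp [emb_apply, h]
  · rw [if_neg h, mul_zero]
    split_ifs <;> simp [emb_apply, h]

end Emb

/-! ### Notation for expressions -/

instance : Add Expr := ⟨.bin .add⟩
instance : Sub Expr := ⟨.bin .sub⟩
instance : Mul Expr := ⟨.bin .mul⟩
instance : Div Expr := ⟨.bin .div⟩
instance : Mod Expr := ⟨.bin .mod⟩
instance (k : ℕ) : OfNat Expr k := ⟨.lit k⟩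

section

variable {o : ℕ → ℕ → ℕ} {M : Mem} {K : ℕ} (x y : Expr)

@[simp] lemma eval_add : (x + y).eval o M = x.eval o M + y.eval o M := rfl
@[simp] lemma eval_sub : (x - y).eval o M = x.eval o M - y.eval o M := rfl
@[simp] lemma eval_mul : (x * y).eval o M = x.eval o M * y.eval o M := rfl
@[simp] lemma eval_div : (x / y).eval o M = x.eval o M / y.eval o M := rfl
@[simp] lemma eval_mod : (x % y).eval o M = x.eval o M % y.eval o M := rfl
@[simp] lemma eval_zero : (0 : Expr).eval o M = 0 := rfl
@[simp] lemma eval_one : (1 : Expr).eval o M = 1 := rfl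
@[simp] lemma eval_lit (k : ℕ) : (Expr.lit k).eval o M = k := rfl
@[simp] lemma eval_load (a : ℕ) : (Expr.load a x).eval o M = M a (x.eval o M) := rfl
@[simp] lemma eval_const : (Expr.const x y).eval o M = o (x.eval o M) (y.eval o M) := rfl
@[simp] lemma safe_add : (x + y).Safe K ↔ x.Safe K ∧ y.Safe K := Iff.rfl
@[simp] lemma safe_sub : (x - y).Safe K ↔ x.Safe K ∧ y.Safe K := Iff.rfl
@[simp] lemma safe_mul : (x * y).Safe K ↔ x.Safe K ∧ y.Safe K := Iff.rfl
@[simp] lemma safe_div : (x / y).Safe K ↔ x.Safe K ∧ y.Safe K := Iff.rfl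
@[simp] lemma safe_zero : (0 : Expr).Safe K := trivial
@[simp] lemma safe_one : (1 : Expr).Safe K := trivial
@[simp] lemma safe_lit (k : ℕ) : (Expr.lit k).Safe K := trivial
@[simp] lemma safe_load (a : ℕ) : (Expr.load a x).Safe K ↔ ¬ IsOutput a ∧ x.Safe K := Iff.rfl
@[simp] lemma safe_clamp : (clamp x).Safe K ↔ x.Safe K := by
  simp [clamp, Expr.Safe, IsOutput]

end

@[simp] lemma safe_put {d K a : ℕ} {idx v : Expr} :
    (put a idx v : Prog d).Safe K ↔ a ≠ 0 ∧ idx.Safe K ∧ v.Safe K := by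
  simp only [put, Prog.Safe, safe_clamp]
  exact ⟨fun h => ⟨h.1, h.2.1, h.2.2.1⟩, fun h => ⟨h.1, h.2.1, h.2.2, Or.inr ⟨v, rfl⟩⟩⟩

@[simp] lemma safe_forLoop {d K a : ℕ} {e : Expr} {P : Prog d} :
    (forLoop a e P).Safe K ↔ a ≠ 0 ∧ ¬ IsOutput a ∧ e.Safe K ∧ P.Safe K := by
  simp only [forLoop, Prog.Safe, safe_put, Expr.Safe, true_and, and_true]
  tauto

@[simp] lemma writes_put {d a : ℕ} {idx v : Expr} : (put a idx v : Prog d).writes = {a} := rfl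

@[simp] lemma writes_forLoop {d a : ℕ} {e : Expr} {P : Prog d} :
    (forLoop a e P).writes = {a} ∪ P.writes := by
  ext x; simp [forLoop, Prog.writes]

@[simp] lemma det_put {d a : ℕ} {idx v : Expr} : (put a idx v : Prog d).Det := trivial

@[simp] lemma det_forLoop {d a : ℕ} {e : Expr} {P : Prog d} : (forLoop a e P).Det ↔ P.Det := by
  simp [forLoop, Prog.Det]

@[simp] lemma classical_put {d a : ℕ} {idx v : Expr} : (put a idx v : Prog d).Classical := trivial

@[simp] lemma classical_forLoop {d a : ℕ} {e : Expr} {P : Prog d} :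
    (forLoop a e P).Classical ↔ P.Classical := by
  simp [forLoop, Prog.Classical]

/-- The length of a block. -/
def lenE (d : ℕ) : Expr := .load 0 0 / .lit (numBlocks d)

/-- The number of cut points of a block. -/
def cutsE : Expr := .load 0 1 - 1

@[simp] lemma safe_lenE {d K : ℕ} : (lenE d).Safe K := by simp [lenE, IsOutput]
@[simp] lemma safe_cutsE {K : ℕ} : cutsE.Safe K := by simp [cutsE, IsOutput]

/-- The input in array `0`, and the bound for the memory cells. -/
structure Env (n m x : ℕ) (row : ℕ → ℕ) : Prop where
  size : row 0 = n
  bins : row 1 = m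
  bound : row 2 = x

lemma lenE_eval {d n m x : ℕ} {o : ℕ → ℕ → ℕ} {M : Mem} (h : Env n m x (M 0)) :
    (lenE d).eval o M = blockLen d n := by
  simp [lenE, h.size, blockLen]

lemma cutsE_eval {n m x : ℕ} {o : ℕ → ℕ → ℕ} {M : Mem} (h : Env n m x (M 0)) :
    cutsE.eval o M = m - 1 := by
  simp [cutsE, h.bins]

/-! ### Ranks -/

/-- The number of the `r` cut points of block `β` in the array `f` that are at most `t`. -/
def rankIn (f : ℕ → ℕ) (β r t : ℕ) : ℕ := ((Finset.range r).filter fun i => f (β * r + i) ≤ t).card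

lemma rankIn_eq_rank {d n r : ℕ} {M : Mem} {b : Cuts d n r}
    (h : ∀ (β : Fin (numBlocks d)) (i : Fin r), M 1 ((β : ℕ) * r + i) = (b β i : ℕ))
    (β : Fin (numBlocks d)) (t : ℕ) : rankIn (M 1) β r t = rank (b β) t := by
  rw [rankIn, rank]
  symm
  rw [← Finset.card_map Fin.valEmbedding]
  congr 1
  ext i
  simp only [Finset.mem_map, Finset.mem_filter, Finset.mem_univ, true_and, Fin.valEmbedding_apply,
    Finset.mem_range]
  constructor
  · rintro ⟨i, hi, rfl⟩
    exact ⟨i.2, by rwa [h]⟩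
  · rintro ⟨hi, h2⟩
    exact ⟨⟨i, hi⟩, by rw [← h]; exact h2, rfl⟩

/-- Tabulate the ranks for block `β` in array `20 + β`. -/
def rankProg {d : ℕ} (β : ℕ) : Prog d :=
  forLoop 9 (lenE d + 1) (.seq (put (20 + β) (.load 9 0) 0)
    (forLoop 10 cutsE (.ite (.load 9 0 + 1 - .load 1 (.lit β * cutsE + .load 10 0))
      (put (20 + β) (.load 9 0) (.load (20 + β) (.load 9 0) + 1)) .skip)))

/-- The outer invariant is that the table is right below `k`, the inner one that entry `k` counts
among the first `i` cut points. The branch condition `k + 1 - c` is truncated, so it is nonzero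
exactly when `c ≤ k`. -/
lemma rankProg_spec {d N n m x : ℕ} {κ : Type} (B : TomographyBasis d) (o : ℕ → ℕ → ℕ) (β : ℕ)
    (s : Mem × Matrix (Fin N → Fin d) κ ℂ) (hs : Env n m x (s.1 0))
    (hl : blockLen d n + 1 ≤ x) (hm : m - 1 ≤ x) :
    ∀ t < blockLen d n + 1,
      (run B o (rankProg β) s).1 (20 + β) t = rankIn (s.1 1) β (m - 1) t := by
  refine run_forLoop B o (P := _) (fun k s' => ∀ t < k,
    s'.1 (20 + β) t = rankIn (s.1 1) β (m - 1) t) s (by rw [hs.bound]; exact hl) (by norm_num)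
    ?_ ?_ ?_ (fun _ h => by omega) ?_
  · simp [Prog.writes]; omega
  · simp [Prog.writes]; omega
  · have h0 : s.1.set 9 0 0 0 = s.1 0 := Mem.set_of_ne _ (by norm_num)
    rw [eval_add, lenE_eval (h0 ▸ hs), eval_one]
  intro k hk s1 h1 h9 hfr t ht
  have f0 : s1.1 0 = s.1 0 := hfr 0 (by norm_num) (by simp [Prog.writes]; omega)
  have f1 : s1.1 1 = s.1 1 := hfr 1 (by norm_num) (by simp [Prog.writes]; omega)
  have hx : s1.1 0 2 = x := by rw [f0, hs.bound]
  dsimp only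
  rw [Mem.set_apply, if_neg (by omega), run, run_put _ _ _ _ _ _ (by simp)]
  simp only [eval_load, eval_zero, h9]
  set s2 : Mem × Matrix (Fin N → Fin d) κ ℂ := (s1.1.set (20 + β) k 0, s1.2) with hs2
  have g0 : s2.1 0 = s.1 0 := by rw [hs2, ← f0]; exact Mem.set_of_ne _ (by omega)
  have g1 : s2.1 1 = s.1 1 := by rw [hs2, ← f1]; exact Mem.set_of_ne _ (by omega)
  have g9 : s2.1 9 0 = k := by rw [hs2, ← h9]; exact congrFun (Mem.set_of_ne _ (by omega)) 0
  have key := run_forLoop B o (a := 10) (e := cutsE)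
    (P := .ite (.load 9 0 + 1 - .load 1 (.lit β * cutsE + .load 10 0))
      (put (20 + β) (.load 9 0) (.load (20 + β) (.load 9 0) + 1)) .skip)
    (fun i s' => (∀ t < k, s'.1 (20 + β) t = rankIn (s.1 1) β (m - 1) t) ∧
      s'.1 (20 + β) k = ((Finset.range i).filter fun i => s.1 1 (β * (m - 1) + i) ≤ k).card)
    s2 (n := m - 1) (by rw [g0, hs.bound]; exact hm) (by norm_num)
    (by simp [Prog.writes]; omega) (by simp [Prog.writes]; omega) ?_ ?_ ?_
  · rcases Nat.lt_succ_iff_lt_or_eq.mp ht with h | h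
    · exact key.1 t h
    · rw [h]; exact key.2
  · have h0 : s2.1.set 10 0 0 0 = s.1 0 := (Mem.set_of_ne _ (by norm_num)).trans g0
    exact cutsE_eval (h0 ▸ hs)
  · refine ⟨fun t ht => ?_, ?_⟩
    · rw [← h1 t ht]
      simp only [hs2, Mem.set_apply]
      rw [if_neg (by omega), if_neg (by omega)]
    · simp [hs2, Mem.set_apply]
  · rintro i hi s3 ⟨p1, p2⟩ h10 hfr3
    have e0 : s3.1 0 = s.1 0 := (hfr3 0 (by norm_num) (by simp [Prog.writes]; omega)).trans g0
    have e1 : s3.1 1 = s.1 1 := (hfr3 1 (by norm_num) (by simp [Prog.writes]; omega)).trans g1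
    have e9 : s3.1 9 0 = k :=
      (congrFun (hfr3 9 (by norm_num) (by simp [Prog.writes]; omega)) 0).trans g9
    have ec : cutsE.eval o s3.1 = m - 1 := cutsE_eval (e0 ▸ hs)
    have hcard : ((Finset.range i).filter fun i => s.1 1 (β * (m - 1) + i) ≤ k).card ≤ i := by
      simpa using Finset.card_filter_le (Finset.range i) fun i => s.1 1 (β * (m - 1) + i) ≤ k
    rw [run]
    simp only [eval_sub, eval_add, eval_load, eval_mul, eval_lit, eval_one, eval_zero, e9, h10, ec,
      e1]
    rw [Finset.range_add_one, Finset.filter_insert]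
    split_ifs with c1 c2 c2
    · rw [run_put _ _ _ _ _ _ (by simp [e9, e0, hs.bound, p2]; omega)]
      simp only [eval_add, eval_load, eval_zero, eval_one, e9, p2, Mem.set_apply]
      rw [Finset.card_insert_of_notMem (by simp)]
      refine ⟨fun t ht => ?_, ?_⟩
      · rw [if_neg (by omega), if_neg (by omega)]; exact p1 t ht
      · simp; omega
    · omega
    · omega
    · simp only [run, Mem.set_apply]
      refine ⟨fun t ht => ?_, ?_⟩
      · rw [if_neg (by omega)]; exact p1 t ht
      · rw [if_neg (by omega)]; exact p2

/-! ### Elementary gates -/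

/-- Exchange of `0` and `1`. -/
def notGate (e : ℕ) : Equiv.Perm (Fin 1 → Fin (e + 2)) :=
  Equiv.piCongrRight fun _ => Equiv.swap 0 1

/-- Exchange of two qudits. -/
def swapGate (d : ℕ) : Equiv.Perm (Fin 2 → Fin d) :=
  Equiv.arrowCongr (Equiv.swap 0 1) (Equiv.refl _)

/-- Exchange of `0` and `1` on the second qudit if the first is in state `1`. -/
def cnotGate (e : ℕ) : Equiv.Perm (Fin 2 → Fin (e + 2)) :=
  Function.Involutive.toPerm
    (fun x i => if i = 1 ∧ x 0 = 1 then Equiv.swap 0 1 (x i) else x i) fun x => by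
      funext i
      by_cases h : i = 1 ∧ x 0 = 1
      · obtain ⟨rfl, h⟩ := h
        simp [h]
      · simp [h]

lemma cnotGate_apply {e : ℕ} (x : Fin 2 → Fin (e + 2)) (i : Fin 2) :
    cnotGate e x i = if i = 1 ∧ x 0 = 1 then Equiv.swap 0 1 (x i) else x i := rfl

section Superposition

variable {e n w : ℕ} {κ : Type}

/-- The work qudits are in state `z x` if the joint test has result `x`. -/
def superpose (w : ℕ) (Φ : Fin n → Fin (e + 2) → ℂ) (z : (Fin n → Bool) → ℕ → Fin (e + 2))
    (A : Matrix (Fin n → Fin (e + 2)) κ ℂ) : Matrix (Fin (n + w) → Fin (e + 2)) κ ℂ :=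
  ∑ x, emb w (z x) (bitProj Φ x * A)

lemma superpose_const (Φ : Fin n → Fin (e + 2) → ℂ) (z : ℕ → Fin (e + 2))
    (A : Matrix (Fin n → Fin (e + 2)) κ ℂ) : superpose w Φ (fun _ => z) A = emb w z A := by
  rw [superpose, ← emb_sum, ← Matrix.sum_mul, sum_bitProj, Matrix.one_mul]

/-- It suffices to follow a gate on one joint projector at a time, where it acts classically on the
work qudits. -/
lemma mul_superpose {Φ : Fin n → Fin (e + 2) → ℂ} {z z' : (Fin n → Bool) → ℕ → Fin (e + 2)}
    {A : Matrix (Fin n → Fin (e + 2)) κ ℂ} {G : Op (e + 2) (n + w)}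
    (h : ∀ x, G * emb w (z x) (bitProj Φ x * A) = emb w (z' x) (bitProj Φ x * A)) :
    G * superpose w Φ z A = superpose w Φ z' A := by
  rw [superpose, Matrix.mul_sum]
  exact Finset.sum_congr rfl fun x _ => h x

lemma notGate_mul_emb {t : Fin 1 → ℕ} {p : ℕ} (ht : t 0 = n + p) (hp : p < w)
    {z z' : ℕ → Fin (e + 2)} (hz : z' p = Equiv.swap 0 1 (z p)) (hz' : ∀ a, a ≠ p → z' a = z a)
    (A : Matrix (Fin n → Fin (e + 2)) κ ℂ) :
    applyAt (n + w) (permGate (notGate e)) t * emb w z A = emb w z' A := by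
  refine permGate_apply_join (p := fun _ => p) _ (fun i => ?_) (fun i j _ => Subsingleton.elim _ _)
    (fun _ => hp) (fun i => ?_) (fun a ha => hz' a fun h => ha 0 h.symm) A
  · rw [Subsingleton.elim i 0, ht]
  · simp [notGate, hz]

lemma cnotGate_mul_emb {t : Fin 2 → ℕ} {p q : ℕ} (h0 : t 0 = n + p) (h1 : t 1 = n + q)
    (hpq : p ≠ q) (hp : p < w) (hq : q < w) {z z' : ℕ → Fin (e + 2)}
    (hz : z' q = if z p = 1 then Equiv.swap 0 1 (z q) else z q) (hz' : ∀ a, a ≠ q → z' a = z a)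
    (A : Matrix (Fin n → Fin (e + 2)) κ ℂ) :
    applyAt (n + w) (permGate (cnotGate e)) t * emb w z A = emb w z' A := by
  refine permGate_apply_join (p := ![p, q]) _ (fun i => ?_) ?_ (fun i => ?_) (fun i => ?_)
    (fun a ha => hz' a fun h => ha 1 (by simp [h])) A
  · fin_cases i <;> simp [h0, h1]
  · intro i j h
    fin_cases i <;> fin_cases j <;> simp_all
  · fin_cases i <;> simp [hp, hq]
  · fin_cases i
    · simp [cnotGate_apply, hz' p hpq]
    · simp [cnotGate_apply, hz]

/-- The joint projector fixes the result at the controlling site, so the swap either happens or does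
not. -/
lemma ctrlSwap_mul_emb {Φ : Fin n → Fin (e + 2) → ℂ} (hΦ : ∀ q, IsTest (Φ q)) (x : Fin n → Bool)
    {φ : Fin (e + 2) → ℂ} (s : Fin n) (hφ : Φ s = φ) {c : ℕ} (hc : c = s)
    {t : Fin 2 → ℕ} {p q : ℕ} (h0 : t 0 = n + p) (h1 : t 1 = n + q)
    (hpq : p ≠ q) (hp : p < w) (hq : q < w) (z : ℕ → Fin (e + 2))
    (A : Matrix (Fin n → Fin (e + 2)) κ ℂ) :
    applyAt (n + w) (ctrlGate φ (swapGate (e + 2))) (Fin.cons (α := fun _ => ℕ) c t) *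
        emb w z (bitProj Φ x * A) =
      emb w (if x s then z ∘ Equiv.swap p q else z) (bitProj Φ x * A) := by
  refine ctrlGate_mul_emb_bitProj (p := ![p, q]) hΦ x _ s hφ hc (fun i => ?_) ?_ (fun i => ?_)
    (fun i => ?_) (fun a ha => ?_) A
  · fin_cases i <;> simp [h0, h1]
  · intro i j h
    fin_cases i <;> fin_cases j <;> simp_all
  · fin_cases i <;> simp [hp, hq]
  · fin_cases i <;> simp [swapGate]
  · have h0 := ha 0
    have h1 := ha 1
    simp only [Matrix.cons_val_zero, Matrix.cons_val_one] at h0 h1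
    rw [Function.comp_apply, Equiv.swap_apply_of_ne_of_ne h0.symm h1.symm]

end Superposition

/-! ### The one-hot counter -/

/-- One cyclic shift of the cells `0, …, l`. -/
def shiftFwd {e : ℕ} (l : ℕ) (z : ℕ → Fin (e + 2)) : ℕ → Fin (e + 2) := fun a =>
  if a = 0 then z l else if a ≤ l then z (a - 1) else z a

/-- One cyclic shift of the cells `0, …, l`, backwards. -/
def shiftBwd {e : ℕ} (l : ℕ) (z : ℕ → Fin (e + 2)) : ℕ → Fin (e + 2) := fun a =>
  if a < l then z (a + 1) else if a = l then z 0 else z a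

/-- `1` on the cells in `S` and `0` elsewhere. -/
def hot {e : ℕ} (S : Finset ℕ) : ℕ → Fin (e + 2) := fun a => if a ∈ S then 1 else 0

/-- Counting by moving a single `1`; because of `t ≤ l` it never wraps around. -/
lemma shiftFwd_iterate_hot {e l : ℕ} : ∀ {t : ℕ}, t ≤ l →
    (shiftFwd l)^[t] (hot {0} : ℕ → Fin (e + 2)) = hot {t}
  | 0, _ => rfl
  | t + 1, ht => by
      rw [Function.iterate_succ_apply', shiftFwd_iterate_hot (by omega)]
      funext a
      simp only [shiftFwd, hot, Finset.mem_singleton]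
      split_ifs <;> first | rfl | omega

/-- The flag `f` lies beyond the counter cells, so undoing the count leaves it in place. -/
lemma shiftBwd_iterate_hot {e l f : ℕ} (hf : l < f) : ∀ {t : ℕ}, t ≤ l →
    (shiftBwd l)^[t] (hot {t, f} : ℕ → Fin (e + 2)) = hot {0, f}
  | 0, _ => rfl
  | t + 1, ht => by
      have : shiftBwd l (hot {t + 1, f} : ℕ → Fin (e + 2)) = hot {t, f} := by
        funext a
        simp only [shiftBwd, hot, Finset.mem_insert, Finset.mem_singleton]
        split_ifs <;> first | rfl | omega | grind
      rw [Function.iterate_succ_apply, this, shiftBwd_iterate_hot hf (by omega)]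

/-- The first `k` swaps of a cyclic shift. -/
def partFwd {e : ℕ} (l k : ℕ) (z : ℕ → Fin (e + 2)) : ℕ → Fin (e + 2) := fun a =>
  if a < l - k then z a else if a = l - k then z l else if a ≤ l then z (a - 1) else z a

/-- The first `k` swaps of a backward cyclic shift. -/
def partBwd {e : ℕ} (k : ℕ) (z : ℕ → Fin (e + 2)) : ℕ → Fin (e + 2) := fun a =>
  if a < k then z (a + 1) else if a = k then z 0 else z a

lemma partFwd_zero {e l : ℕ} (z : ℕ → Fin (e + 2)) : partFwd l 0 z = z := by
  funext a; simp only [partFwd]; split_ifs <;> first | rfl | omega | (congr 1; omega)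

/-- A cyclic shift is a product of `l` swaps of neighbours, so a loop over a two-qudit gate realizes
it. The forward shift starts with the top pair and the backward shift with the bottom pair. -/
lemma partFwd_succ {e l k : ℕ} (hk : k < l) (z : ℕ → Fin (e + 2)) :
    partFwd l (k + 1) z = partFwd l k z ∘ Equiv.swap (l - 1 - k) (l - k) := by
  funext a
  simp only [partFwd, Function.comp_apply, Equiv.swap_apply_def]
  split_ifs <;> first | rfl | omega | (congr 1; omega)

lemma partFwd_self {e l : ℕ} (z : ℕ → Fin (e + 2)) : partFwd l l z = shiftFwd l z := by
  funext a; simp only [partFwd, shiftFwd]; split_ifs <;> first | rfl | omega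

lemma partBwd_zero {e : ℕ} (z : ℕ → Fin (e + 2)) : partBwd 0 z = z := by
  funext a; simp only [partBwd]; split_ifs <;> first | rfl | omega | (congr 1; omega)

lemma partBwd_succ {e k : ℕ} (z : ℕ → Fin (e + 2)) :
    partBwd (k + 1) z = partBwd k z ∘ Equiv.swap k (k + 1) := by
  funext a
  simp only [partBwd, Function.comp_apply, Equiv.swap_apply_def]
  split_ifs <;> first | rfl | omega | (congr 1; omega)

lemma partBwd_self {e l : ℕ} (z : ℕ → Fin (e + 2)) : partBwd l z = shiftBwd l z := rfl

/-- The qudit of work cell `p`. -/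
def workE (p : Expr) : Expr := .load 0 0 + p

lemma workE_eval {n m x : ℕ} {o : ℕ → ℕ → ℕ} {M : Mem} (h : Env n m x (M 0)) (p : Expr) :
    (workE p).eval o M = n + p.eval o M := by
  simp [workE, h.size]

@[simp] lemma safe_workE {K : ℕ} {p : Expr} : (workE p).Safe K ↔ p.Safe K := by
  simp [workE, IsOutput]

/-- Shift the counter, controlled by the qudit of block `β` with number in cell `9`. -/
def shiftUpStep {e : ℕ} (β : Fin (numBlocks (e + 2))) : Prog (e + 2) :=
  forLoop 10 (lenE (e + 2)) (.ctrl β 2 (swapGate (e + 2)) (.lit β * lenE (e + 2) + .load 9 0)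
    ![workE (lenE (e + 2) - 1 - .load 10 0), workE (lenE (e + 2) - .load 10 0)])

/-- Shift the counter backwards, controlled by the qudit of block `β` with number in cell `9`. -/
def shiftDownStep {e : ℕ} (β : Fin (numBlocks (e + 2))) : Prog (e + 2) :=
  forLoop 10 (lenE (e + 2)) (.ctrl β 2 (swapGate (e + 2)) (.lit β * lenE (e + 2) + .load 9 0)
    ![workE (.load 10 0), workE (.load 10 0 + 1)])

lemma exists_site {d n : ℕ} (β : Fin (numBlocks d)) {k : ℕ} (hk : k < blockLen d n) :
    ∃ q : Fin n, (q : ℕ) = β * blockLen d n + k ∧ q ∈ block d n β := by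
  have h := succ_mul_blockLen_le n β
  rw [Nat.add_mul, Nat.one_mul] at h
  exact ⟨⟨β * blockLen d n + k, by omega⟩, rfl, mem_block.mpr
    ⟨by simp, by simp only [Nat.add_mul, Nat.one_mul]; omega⟩⟩

section Shifts

variable {e n w m X : ℕ} {κ : Type} (B : TomographyBasis (e + 2)) (o : ℕ → ℕ → ℕ)

lemma shiftUpStep_spec (β : Fin (numBlocks (e + 2)))
    (s : Mem × Matrix (Fin (n + w) → Fin (e + 2)) κ ℂ) (hs : Env n m X (s.1 0))
    (hX : blockLen (e + 2) n ≤ X) (hw : blockLen (e + 2) n < w) {k : ℕ} (hk : s.1 9 0 = k)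
    {q : Fin n} (hq : (q : ℕ) = β * blockLen (e + 2) n + k) (hqβ : q ∈ block (e + 2) n β)
    (z : (Fin n → Bool) → ℕ → Fin (e + 2)) (A : Matrix (Fin n → Fin (e + 2)) κ ℂ)
    (hA : s.2 = superpose w (B.siteVec n) z A) :
    (run B o (shiftUpStep β) s).2 = superpose w (B.siteVec n)
      (fun x => if x q then shiftFwd (blockLen (e + 2) n) (z x) else z x) A := by
  simp only [← partFwd_self]
  refine run_forLoop B o (a := 10) (P := _) (fun i s' => s'.2 = superpose w (B.siteVec n)
    (fun x => if x q then partFwd (blockLen (e + 2) n) i (z x) else z x) A) s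
    (by rw [hs.bound]; exact hX) (by norm_num) (by simp [Prog.writes]) (by simp [Prog.writes])
    ?_ ?_ ?_
  · have h0 : s.1.set 10 0 0 0 = s.1 0 := Mem.set_of_ne _ (by norm_num)
    exact lenE_eval (h0 ▸ hs)
  · simp only [partFwd_zero, ite_self, hA]
  · intro i hi s1 h1 h10 hfr
    have f0 : s1.1 0 = s.1 0 := hfr 0 (by norm_num) (by simp [Prog.writes])
    have f9 : s1.1 9 = s.1 9 := hfr 9 (by norm_num) (by simp [Prog.writes])
    have hE : Env n m X (s1.1 0) := f0 ▸ hs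
    simp only [run]
    rw [h1]
    refine mul_superpose fun x => ?_
    rw [ctrlSwap_mul_emb (B.isTest_siteVec n) x q (B.siteVec_of_mem hqβ)
      (p := blockLen (e + 2) n - 1 - i) (q := blockLen (e + 2) n - i)]
    · congr 1
      -- A positive result adds one more swap to the partial shift, a negative one changes nothing.
      split_ifs with hx
      · rw [partFwd_succ hi]
      · rfl
    · simp [lenE_eval hE, f9, hk, hq]
    · simp [workE_eval hE, lenE_eval hE, h10]
    · simp [workE_eval hE, lenE_eval hE, h10]
    · omega
    · omega
    · omega

lemma shiftDownStep_spec (β : Fin (numBlocks (e + 2)))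
    (s : Mem × Matrix (Fin (n + w) → Fin (e + 2)) κ ℂ) (hs : Env n m X (s.1 0))
    (hX : blockLen (e + 2) n ≤ X) (hw : blockLen (e + 2) n < w) {k : ℕ} (hk : s.1 9 0 = k)
    {q : Fin n} (hq : (q : ℕ) = β * blockLen (e + 2) n + k) (hqβ : q ∈ block (e + 2) n β)
    (z : (Fin n → Bool) → ℕ → Fin (e + 2)) (A : Matrix (Fin n → Fin (e + 2)) κ ℂ)
    (hA : s.2 = superpose w (B.siteVec n) z A) :
    (run B o (shiftDownStep β) s).2 = superpose w (B.siteVec n)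
      (fun x => if x q then shiftBwd (blockLen (e + 2) n) (z x) else z x) A := by
  simp only [← partBwd_self]
  refine run_forLoop B o (a := 10) (P := _) (fun i s' => s'.2 = superpose w (B.siteVec n)
    (fun x => if x q then partBwd i (z x) else z x) A) s
    (by rw [hs.bound]; exact hX) (by norm_num) (by simp [Prog.writes]) (by simp [Prog.writes])
    ?_ ?_ ?_
  · have h0 : s.1.set 10 0 0 0 = s.1 0 := Mem.set_of_ne _ (by norm_num)
    exact lenE_eval (h0 ▸ hs)
  · simp only [partBwd_zero, ite_self, hA]
  · intro i hi s1 h1 h10 hfr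
    have f0 : s1.1 0 = s.1 0 := hfr 0 (by norm_num) (by simp [Prog.writes])
    have f9 : s1.1 9 = s.1 9 := hfr 9 (by norm_num) (by simp [Prog.writes])
    have hE : Env n m X (s1.1 0) := f0 ▸ hs
    simp only [run]
    rw [h1]
    refine mul_superpose fun x => ?_
    rw [ctrlSwap_mul_emb (B.isTest_siteVec n) x q (B.siteVec_of_mem hqβ)
      (p := i) (q := i + 1)]
    · congr 1
      split_ifs with hx
      · rw [partBwd_succ]
      · rfl
    · simp [lenE_eval hE, f9, hk, hq]
    · simp [workE_eval hE, h10]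
    · simp [workE_eval hE, h10]
    · omega
    · omega
    · omega

/-- The first `k` positions of a block. -/
def blockPrefix (d n : ℕ) (β : Fin (numBlocks d)) (k : ℕ) : Finset (Fin n) :=
  (block d n β).filter fun q => (q : ℕ) < β * blockLen d n + k

lemma hits_blockPrefix_zero {d : ℕ} (β : Fin (numBlocks d)) (x : Fin n → Bool) :
    hits (blockPrefix d n β 0) x = 0 := by
  rw [hits, Finset.card_eq_zero, Finset.filter_eq_empty_iff]
  intro q hq
  rw [blockPrefix, Finset.mem_filter, mem_block] at hq
  omega

lemma hits_blockPrefix_succ {d : ℕ} (β : Fin (numBlocks d)) (x : Fin n → Bool) {k : ℕ}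
    {q : Fin n} (hq : (q : ℕ) = β * blockLen d n + k) (hqβ : q ∈ block d n β) :
    hits (blockPrefix d n β (k + 1)) x = hits (blockPrefix d n β k) x + if x q then 1 else 0 := by
  have h : blockPrefix d n β (k + 1) = insert q (blockPrefix d n β k) := by
    ext q'
    simp only [blockPrefix, Finset.mem_filter, Finset.mem_insert, Fin.ext_iff]
    constructor
    · rintro ⟨h1, h2⟩
      by_cases h3 : (q' : ℕ) = q
      · exact Or.inl h3
      · exact Or.inr ⟨h1, by omega⟩
    · rintro (h3 | ⟨h1, h2⟩)
      · rw [Fin.ext h3]; exact ⟨hqβ, by omega⟩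
      · exact ⟨h1, by omega⟩
  rw [hits, h, Finset.filter_insert]
  split_ifs
  · rw [Finset.card_insert_of_notMem]
    · rfl
    · simp [blockPrefix, hq]
  · rfl

lemma blockPrefix_self {d : ℕ} (β : Fin (numBlocks d)) :
    blockPrefix d n β (blockLen d n) = block d n β := by
  refine Finset.filter_true_of_mem fun q hq => ?_
  have := (mem_block.mp hq).2
  rwa [Nat.add_mul, Nat.one_mul] at this

/-- Apply a shift for every qudit of the block. -/
lemma shifts_spec (β : Fin (numBlocks (e + 2))) (f : (ℕ → Fin (e + 2)) → ℕ → Fin (e + 2))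
    {P : Prog (e + 2)} (hP : P.writes ⊆ {10})
    (hPf : ∀ (s : Mem × Matrix (Fin (n + w) → Fin (e + 2)) κ ℂ) (k : ℕ) (q : Fin n)
      (z : (Fin n → Bool) → ℕ → Fin (e + 2)) (A : Matrix (Fin n → Fin (e + 2)) κ ℂ),
      Env n m X (s.1 0) → s.1 9 0 = k → (q : ℕ) = β * blockLen (e + 2) n + k →
      q ∈ block (e + 2) n β → s.2 = superpose w (B.siteVec n) z A →
      (run B o P s).2 = superpose w (B.siteVec n) (fun x => if x q then f (z x) else z x) A)
    (s : Mem × Matrix (Fin (n + w) → Fin (e + 2)) κ ℂ) (hs : Env n m X (s.1 0))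
    (hX : blockLen (e + 2) n ≤ X)
    (z : (Fin n → Bool) → ℕ → Fin (e + 2)) (A : Matrix (Fin n → Fin (e + 2)) κ ℂ)
    (hA : s.2 = superpose w (B.siteVec n) z A) :
    (run B o (forLoop 9 (lenE (e + 2)) P) s).2 = superpose w (B.siteVec n)
      (fun x => f^[hits (block (e + 2) n β) x] (z x)) A := by
  simp only [← blockPrefix_self β]
  have hw : ∀ a, a ≠ 10 → a ∉ P.writes := fun a ha h => ha (by simpa using hP h)
  refine run_forLoop B o (a := 9) (P := _) (fun k s' => s'.2 = superpose w (B.siteVec n)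
    (fun x => f^[hits (blockPrefix (e + 2) n β k) x] (z x)) A) s
    (by rw [hs.bound]; exact hX) (by norm_num) (hw 9 (by norm_num)) (hw 0 (by norm_num)) ?_ ?_ ?_
  · have h0 : s.1.set 9 0 0 0 = s.1 0 := Mem.set_of_ne _ (by norm_num)
    exact lenE_eval (h0 ▸ hs)
  · simp only [hits_blockPrefix_zero, Function.iterate_zero, id, hA]
  · intro k hk s1 h1 h9 hfr
    have f0 : s1.1 0 = s.1 0 := hfr 0 (by norm_num) (hw 0 (by norm_num))
    obtain ⟨q, hq, hqβ⟩ := exists_site β hk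
    dsimp only
    -- Round `k` handles site `k` of the block, so the number of shifts is the number of hits in the
    -- prefix.
    rw [hPf s1 k q _ A (f0 ▸ hs) h9 hq hqβ h1]
    congr 1
    funext x
    rw [hits_blockPrefix_succ β x hq hqβ]
    split_ifs
    · rw [Function.iterate_succ_apply']
    · rfl

end Shifts

/-! ### Coherent computation of the bin -/

/-- Put the rank of the number of positive tests on block `β` into the flags, in one-hot form. -/
def flagBlock {e : ℕ} (β : Fin (numBlocks (e + 2))) : Prog (e + 2) :=
  .seq (.perm 1 (notGate e) ![workE 0])
    (.seq (forLoop 9 (lenE (e + 2)) (shiftUpStep β))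
      (.seq (forLoop 9 (lenE (e + 2) + 1) (.perm 2 (cnotGate e)
          ![workE (.load 9 0), workE (lenE (e + 2) + 1 + .load (20 + β) (.load 9 0))]))
        (.seq (forLoop 9 (lenE (e + 2)) (shiftDownStep β)) (.perm 1 (notGate e) ![workE 0]))))

/-- The work cell of flag `i`. -/
def flag (d n i : ℕ) : ℕ := blockLen d n + 1 + i

section Flags

variable {e n w m X : ℕ} {κ : Type} (B : TomographyBasis (e + 2)) (o : ℕ → ℕ → ℕ)

lemma notWork_spec (s : Mem × Matrix (Fin (n + w) → Fin (e + 2)) κ ℂ) (hs : Env n m X (s.1 0))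
    (p : Expr) {c : ℕ} (hc : p.eval o s.1 = c) (hw : c < w) {Φ : Fin n → Fin (e + 2) → ℂ}
    {z z' : (Fin n → Bool) → ℕ → Fin (e + 2)} {A : Matrix (Fin n → Fin (e + 2)) κ ℂ}
    (hz : ∀ x, z' x c = Equiv.swap 0 1 (z x c)) (hz' : ∀ x a, a ≠ c → z' x a = z x a)
    (hA : s.2 = superpose w Φ z A) :
    run B o (.perm 1 (notGate e) ![workE p]) s = (s.1, superpose w Φ z' A) := by
  rw [run, hA]
  congr 1
  refine mul_superpose fun x => ?_
  exact notGate_mul_emb (by simp [workE_eval hs, hc]) hw (hz x) (hz' x) _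

/-- In round `k` a controlled NOT goes from counter cell `k` to the flag of `f k`. It fires only
when `k` is the hot cell, so just the flag of `f (h x)` gets set. -/
lemma copy_spec (β : Fin (numBlocks (e + 2)))
    (s : Mem × Matrix (Fin (n + w) → Fin (e + 2)) κ ℂ) (hs : Env n m X (s.1 0))
    (hX : blockLen (e + 2) n + 1 ≤ X) {f : ℕ → ℕ} {r : ℕ} (hw : flag (e + 2) n r < w)
    (hf : ∀ t < blockLen (e + 2) n + 1, s.1 (20 + β) t = f t) (hfr : ∀ t, f t ≤ r)
    {Φ : Fin n → Fin (e + 2) → ℂ} {A : Matrix (Fin n → Fin (e + 2)) κ ℂ}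
    (h : (Fin n → Bool) → ℕ) (hh : ∀ x, h x ≤ blockLen (e + 2) n)
    (hA : s.2 = superpose w Φ (fun x => hot {h x}) A) :
    (run B o (forLoop 9 (lenE (e + 2) + 1) (.perm 2 (cnotGate e)
          ![workE (.load 9 0), workE (lenE (e + 2) + 1 + .load (20 + β) (.load 9 0))])) s).2 =
      superpose w Φ (fun x => hot {h x, flag (e + 2) n (f (h x))}) A := by
  have key := run_forLoop B o (a := 9) (e := lenE (e + 2) + 1) (P := .perm 2 (cnotGate e)
      ![workE (.load 9 0), workE (lenE (e + 2) + 1 + .load (20 + β) (.load 9 0))])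
    (fun k s' => s'.2 = superpose w Φ
      (fun x => if h x < k then hot {h x, flag (e + 2) n (f (h x))} else hot {h x}) A) s
    (n := blockLen (e + 2) n + 1)
    (by rw [hs.bound]; exact hX) (by norm_num) (by simp [Prog.writes]) (by simp [Prog.writes])
    ?_ ?_ ?_
  · rw [key]
    congr 1
    funext x
    rw [if_pos (by have := hh x; omega)]
  · have h0 : s.1.set 9 0 0 0 = s.1 0 := Mem.set_of_ne _ (by norm_num)
    rw [eval_add, lenE_eval (h0 ▸ hs), eval_one]
  · simp only [Nat.not_lt_zero, if_false, hA]
  · intro k hk s1 h1 h9 hfr1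
    have f0 : s1.1 0 = s.1 0 := hfr1 0 (by norm_num) (by simp [Prog.writes])
    have f20 : s1.1 (20 + β) = s.1 (20 + β) := hfr1 _ (by omega) (by simp [Prog.writes])
    have hE : Env n m X (s1.1 0) := f0 ▸ hs
    simp only [run]
    rw [h1]
    refine mul_superpose fun x => ?_
    have hr := hfr k
    unfold flag at hw ⊢
    refine cnotGate_mul_emb (p := k) (q := blockLen (e + 2) n + 1 + f k)
      ?_ ?_ ?_ ?_ ?_ ?_ ?_ _
    · simp [workE_eval hE, h9]
    · simp [workE_eval hE, lenE_eval hE, h9, f20, hf k hk]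
    · omega
    · omega
    · omega
    -- Before, at, or after the round in which the hot cell is met; flags start at cell `l + 1`, so
    -- a flag is never mistaken for a counter cell.
    · rcases lt_trichotomy (h x) k with h2 | h2 | h2
      · have h3 : h x < k + 1 := by omega
        simp only [h2, h3, if_true, hot, Finset.mem_insert, Finset.mem_singleton]
        have : k ≠ h x := by omega
        have h4 : k ≠ blockLen (e + 2) n + 1 + f (h x) := by omega
        simp [this, h4]
      · subst h2
        simp [hot]
        rw [if_neg (by omega)]
        simp
      · have h3 : ¬ h x < k + 1 := by omega
        have h4 : ¬ h x < k := by omega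
        simp only [h4, h3, if_false, hot, Finset.mem_singleton]
        have : k ≠ h x := by omega
        simp [this]
    · intro a ha
      rcases lt_trichotomy (h x) k with h2 | h2 | h2
      · rw [if_pos h2, if_pos (by omega)]
      · subst h2
        rw [if_pos (by omega), if_neg (by omega)]
        simp [hot, ha]
      · rw [if_neg (by omega), if_neg (by omega)]

/-- Compute, copy, uncompute. Without undoing the counter the work qudits would keep the exact
number of hits, which would amount to a finer measurement than that of the bin. -/
lemma flagBlock_spec (β : Fin (numBlocks (e + 2)))
    (s : Mem × Matrix (Fin (n + w) → Fin (e + 2)) κ ℂ) (hs : Env n m X (s.1 0))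
    (hX : blockLen (e + 2) n + 1 ≤ X) {f : ℕ → ℕ} {r : ℕ} (hw : flag (e + 2) n r < w)
    (hf : ∀ t < blockLen (e + 2) n + 1, s.1 (20 + β) t = f t) (hfr : ∀ t, f t ≤ r)
    {A : Matrix (Fin n → Fin (e + 2)) κ ℂ} (hA : s.2 = emb w 0 A) :
    (run B o (flagBlock β) s).2 = superpose w (B.siteVec n)
      (fun x => hot {flag (e + 2) n (f (hits (block (e + 2) n β) x))}) A := by
  have hwl : blockLen (e + 2) n + 1 < w := by unfold flag at hw; omega
  have hh : ∀ x, hits (block (e + 2) n β) x ≤ blockLen (e + 2) n := fun x =>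
    (hits_le _ _).trans (card_block β).le
  -- Flipping cell `0` turns the clean work qudits into the one-hot number zero.
  rw [flagBlock, run, notWork_spec B o s hs 0 (c := 0) rfl (by omega) (Φ := B.siteVec n)
    (z := fun _ => 0) (z' := fun _ => hot {0}) (A := A) (by simp [hot]) (by simp [hot])
    (by rw [superpose_const, hA])]
  set s1 : Mem × Matrix (Fin (n + w) → Fin (e + 2)) κ ℂ :=
    (s.1, superpose w (B.siteVec n) (fun _ => hot {0}) A) with hs1
  have h1 := shifts_spec B o β (shiftFwd (blockLen (e + 2) n)) (P := shiftUpStep β)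
    (by simp [shiftUpStep, Prog.writes])
    (fun s k q z A h1 h2 h3 h4 h5 =>
      shiftUpStep_spec (m := m) (X := X) B o β s h1 (by omega) (by omega) h2 h3 h4 z A h5)
    s1 hs (by omega) (fun _ => hot {0}) A rfl
  simp only [fun x => shiftFwd_iterate_hot (e := e) (hh x)] at h1
  rw [run]
  set s2 := run B o (forLoop 9 (lenE (e + 2)) (shiftUpStep β)) s1 with hs2
  have f2 : ∀ a, a ≠ 9 → a ≠ 10 → s2.1 a = s.1 a := fun a h9 h10 =>
    run_frame B o _ (by simp [shiftUpStep, Prog.writes, h9, h10]) s1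
  have h2 := copy_spec B o β s2 (by rw [f2 0 (by norm_num) (by norm_num)]; exact hs) hX hw
    (fun t ht => by rw [f2 _ (by omega) (by omega)]; exact hf t ht) hfr _ hh h1
  rw [run]
  set s3 := run B o (forLoop 9 (lenE (e + 2) + 1) (.perm 2 (cnotGate e)
    ![workE (.load 9 0), workE (lenE (e + 2) + 1 + .load (20 + β) (.load 9 0))])) s2 with hs3
  have f3 : s3.1 0 = s.1 0 := by
    rw [← f2 0 (by norm_num) (by norm_num)]
    exact run_frame B o _ (by simp [Prog.writes]) s2
  have h3 := shifts_spec B o β (shiftBwd (blockLen (e + 2) n)) (P := shiftDownStep β)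
    (by simp [shiftDownStep, Prog.writes])
    (fun s k q z A h1 h2 h3 h4 h5 =>
      shiftDownStep_spec (m := m) (X := X) B o β s h1 (by omega) (by omega) h2 h3 h4 z A h5)
    s3 (by rw [f3]; exact hs) (by omega) _ A h2
  simp only [fun x => shiftBwd_iterate_hot (e := e) (l := blockLen (e + 2) n)
    (f := flag (e + 2) n (f (hits (block (e + 2) n β) x))) (by unfold flag; omega) (hh x)] at h3
  rw [run]
  set s4 := run B o (forLoop 9 (lenE (e + 2)) (shiftDownStep β)) s3 with hs4
  have f4 : s4.1 0 = s.1 0 := by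
    rw [← f3]
    exact run_frame B o _ (by simp [shiftDownStep, Prog.writes]) s3
  -- After the backward shifts the hot cell is `0` again, whatever `x` is, so flipping it clears the
  -- counter.
  rw [notWork_spec B o s4 (by rw [f4]; exact hs) 0 (c := 0) rfl (by omega) (Φ := B.siteVec n)
    (z' := fun x => hot {flag (e + 2) n (f (hits (block (e + 2) n β) x))}) (A := A) ?_ ?_ h3]
  · intro x; simp [hot, flag]; omega
  · intro x a ha; simp [hot, ha]

/-- The projector onto the results whose number of hits has rank `i`. -/
def rankProj (β : Fin (numBlocks (e + 2))) (n : ℕ) (f : ℕ → ℕ) (i : ℕ) : Op (e + 2) n :=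
  ∑ x, if f (hits (block (e + 2) n β) x) = i then bitProj (B.siteVec n) x else 0

/-- The work state depends on `x` through the rank only, so the sum over results can be grouped by
rank. -/
lemma superpose_flag (β : Fin (numBlocks (e + 2))) {f : ℕ → ℕ} {r : ℕ} (hfr : ∀ t, f t ≤ r)
    (A : Matrix (Fin n → Fin (e + 2)) κ ℂ) :
    superpose w (B.siteVec n)
      (fun x => hot {flag (e + 2) n (f (hits (block (e + 2) n β) x))}) A =
    ∑ i ∈ Finset.range (r + 1), emb w (hot {flag (e + 2) n i}) (rankProj B β n f i * A) := by
  have h : ∀ i, rankProj B β n f i * A = ∑ x,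
      if f (hits (block (e + 2) n β) x) = i then bitProj (B.siteVec n) x * A else 0 := by
    intro i
    rw [rankProj, Matrix.sum_mul]
    refine Finset.sum_congr rfl fun x _ => ?_
    split_ifs <;> simp
  simp only [h, emb_sum]
  rw [Finset.sum_comm, superpose]
  refine Finset.sum_congr rfl fun x _ => ?_
  rw [Finset.sum_eq_single (f (hits (block (e + 2) n β) x))]
  · rw [if_pos rfl]
  · intro i _ hi
    rw [if_neg hi.symm, emb_zero]
  · intro hx
    exact absurd (Finset.mem_range.mpr (Nat.lt_succ_of_le (hfr _))) hx

/-- By `mem_bin_iff`, having rank `j` is the same as falling in bin `j`. -/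
lemma rankProj_eq_binProj {r : ℕ} (β : Fin (numBlocks (e + 2))) (b : Cuts (e + 2) n r)
    (j : Outcomes (e + 2) r) :
    rankProj B β n (rank (b β)) (j β) =
      binProj (block (e + 2) n β) (B.phi β) (b β) (j β) := by
  rw [← Matrix.mul_one (binProj _ _ _ _), ← sum_bitProj (B.siteVec n), Matrix.mul_sum, rankProj]
  refine Finset.sum_congr rfl fun x _ => ?_
  rw [binProj_block_mul_bitProj]
  refine if_congr ?_ rfl rfl
  rw [mem_bin_iff _ _ ((hits_le _ _).trans (card_block β).le)]

end Flags

/-! ### Reading out the bin -/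

/-- The qudit that holds the current flag. -/
def flagE (d : ℕ) : Expr := workE (lenE d + 1 + .load 9 0)

/-- Measure the current flag; if it is set, report it and reset it. -/
def readStep {e : ℕ} (β : ℕ) : Prog (e + 2) :=
  .seq (.measure 12 0 (flagE (e + 2)))
    (.ite (.load 12 0) (.seq (put 2 (.lit β) (.load 9 0)) (.perm 1 (notGate e) ![flagE (e + 2)]))
      .skip)

/-- Measure the flags one after the other. -/
def readout {e : ℕ} (β : ℕ) : Prog (e + 2) := forLoop 9 (cutsE + 1) (readStep β)

section Amp

variable {e n w m X : ℕ}

/-- The part of the operation of a branch that ends with the work qudits in the state `z`. -/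
def amp (z : ℕ → Fin (e + 2)) (c : Branch (e + 2) (n + w)) : Op (e + 2) n :=
  (emb w z (1 : Op (e + 2) n))ᴴ * (c.op * emb w 0 (1 : Op (e + 2) n))

/-- `Y X Y†`. -/
def sandwich (Y X : Op (e + 2) n) : Op (e + 2) n := Y * X * Yᴴ

@[simp] lemma sandwich_zero (X : Op (e + 2) n) : sandwich 0 X = 0 := by simp [sandwich]

/-- The states of different flags are orthogonal to each other and to the clean state, so `amp`
picks one summand. The flags below `k` have been read and are gone. -/
lemma amp_of_flags {c : Branch (e + 2) (n + w)} {k r : ℕ} {A0 : Op (e + 2) n}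
    {A : ℕ → Op (e + 2) n} (hw : flag (e + 2) n r < w)
    (h : c.op * emb w 0 (1 : Op (e + 2) n) = emb w 0 A0 +
      ∑ i ∈ Finset.Ico k (r + 1), emb w (hot {flag (e + 2) n i}) (A i)) :
    amp 0 c = A0 ∧ ∀ j ≤ r, amp (hot {flag (e + 2) n j}) c = if k ≤ j then A j else 0 := by
  unfold amp
  rw [h]
  have key : ∀ i ≤ r, ¬ ∀ a < w, (0 : ℕ → Fin (e + 2)) a = hot {flag (e + 2) n i} a := by
    intro i hi h2
    have := h2 (flag (e + 2) n i) (by unfold flag at *; omega)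
    simp [hot] at this
  constructor
  · rw [Matrix.mul_add, Matrix.mul_sum, conjTranspose_emb_mul_emb, if_pos (fun _ _ => rfl),
      Finset.sum_eq_zero, add_zero]
    intro i hi
    rw [conjTranspose_emb_mul_emb, if_neg (key i (by have := Finset.mem_Ico.mp hi; omega))]
  · intro j hj
    rw [Matrix.mul_add, Matrix.mul_sum, conjTranspose_emb_mul_emb,
      if_neg (fun h2 => key j hj fun a ha => (h2 a ha).symm), zero_add]
    have h2 : ∀ i ∈ Finset.Ico k (r + 1), (emb w (hot {flag (e + 2) n j}) (1 : Op (e + 2) n))ᴴ *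
        emb w (hot {flag (e + 2) n i}) (A i) = if i = j then A j else 0 := by
      intro i _
      rw [conjTranspose_emb_mul_emb]
      by_cases hij : i = j
      · subst hij; simp
      · rw [if_neg hij, if_neg]
        intro h2
        have := h2 (flag (e + 2) n j) (by unfold flag at *; omega)
        simp [hot, flag] at this
        omega
    rw [Finset.sum_congr rfl h2, Finset.sum_ite_eq']
    refine if_congr ?_ rfl rfl
    rw [Finset.mem_Ico]; omega

variable (B : TomographyBasis (e + 2)) (o : ℕ → ℕ → ℕ)

/-- Every nonzero digit `v` is treated as a set flag. Digits above `1` occur as branches as well,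
but `readStep_op` shows that they carry no amplitude. -/
lemma exec_readStep (β : ℕ) (c : Branch (e + 2) (n + w)) (hE : Env n m X (c.mem 0)) {k : ℕ}
    (hk : c.mem 9 0 = k) (hkX : k ≤ X) (hw : flag (e + 2) n k < w) :
    ∃ t : Fin (e + 2) → ℕ, exec B o (readStep β) c = (List.finRange (e + 2)).map fun v : Fin (e + 2) =>
      ⟨if v = 0 then c.mem.set 12 0 0 else (c.mem.set 12 0 v).set 2 β k, t v, c.prob,
        (if v = 0 then 1 else applyAt (n + w) (permGate (notGate e)) fun _ =>
          n + flag (e + 2) n k) * (readProj ⟨n + flag (e + 2) n k, by omega⟩ v * c.op)⟩ := by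
  have hq : (flagE (e + 2)).eval o c.mem = n + flag (e + 2) n k := by
    rw [flagE, workE_eval hE]; simp [lenE_eval hE, hk, flag]
  have hm : ∀ v : ℕ, Env n m X ((c.mem.set 12 0 v) 0) := fun v => by
    rw [Mem.set_of_ne _ (by norm_num)]; exact hE
  choose f hf using fun v : Fin (e + 2) => show ∃ t, exec B o (.ite (.load 12 0)
      (.seq (put 2 (.lit β) (.load 9 0)) (.perm 1 (notGate e) ![flagE (e + 2)])) .skip)
      (((c.tick ((0 : Expr).cost o c.mem + (flagE (e + 2)).cost o c.mem + bits 0 +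
        bits (n + flag (e + 2) n k))).write 12 0 v).act
          (readProj ⟨n + flag (e + 2) n k, by omega⟩ v)) =
      [⟨if v = 0 then c.mem.set 12 0 0 else (c.mem.set 12 0 v).set 2 β k, t, c.prob,
        (if v = 0 then 1 else applyAt (n + w) (permGate (notGate e)) fun _ =>
          n + flag (e + 2) n k) * (readProj ⟨n + flag (e + 2) n k, by omega⟩ v * c.op)⟩] from by
    set c1 := ((c.tick ((0 : Expr).cost o c.mem + (flagE (e + 2)).cost o c.mem + bits 0 +
        bits (n + flag (e + 2) n k))).write 12 0 v).act
          (readProj ⟨n + flag (e + 2) n k, by omega⟩ v) with hc1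
    have hmem : c1.mem = c.mem.set 12 0 v := rfl
    rw [exec]
    have hload : (Expr.load 12 0).eval o c1.mem = v := by
      rw [eval_load, eval_zero, hmem, Mem.set_apply, if_pos ⟨rfl, rfl⟩]
    simp only [hload]
    by_cases hv : v = 0
    · subst hv
      simp only [Fin.val_zero, ne_eq, not_true_eq_false, if_false, if_true, one_mul, exec]
      exact ⟨_, rfl⟩
    · have hv' : (v : ℕ) ≠ 0 := fun h => hv (Fin.ext h)
      rw [if_pos hv', exec]
      have h9 : (c.mem.set 12 0 v) 9 0 = k := by
        rw [Mem.set_of_ne _ (by norm_num)]; exact hk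
      obtain ⟨t, ht⟩ := exec_put B o 2 (.lit β) (.load 9 0)
        (c1.tick (1 + (Expr.load 12 0).cost o c1.mem))
        (by simp only [eval_load, eval_zero, tick_mem, hmem]; rw [h9, (hm v).bound]; exact hkX)
      rw [ht]
      simp only [List.flatMap_cons, List.flatMap_nil, List.append_nil, exec, hv, if_false]
      simp only [eval_load, eval_zero, tick_mem, hmem, h9, eval_lit, Branch.withMem]
      have hm2 : Env n m X (((c.mem.set 12 0 v).set 2 β k) 0) := by
        rw [Mem.set_of_ne _ (by norm_num)]; exact hm v
      have hq2 : ∀ i : Fin 1, (![flagE (e + 2)] i).eval o ((c.mem.set 12 0 v).set 2 β k) =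
          n + flag (e + 2) n k := by
        intro i
        have h92 : ((c.mem.set 12 0 v).set 2 β k) 9 0 = k := by
          rw [Mem.set_of_ne _ (by norm_num)]; exact h9
        fin_cases i
        simp [flagE, workE_eval hm2, lenE_eval hm2, h92, flag]
      simp only [hq2]
      exact ⟨_, rfl⟩
  refine ⟨f, ?_⟩
  rw [readStep, exec, exec]
  simp only [hq, eval_zero]
  rw [dif_pos (by omega), List.flatMap_map, List.flatMap_congr fun v _ => hf v]
  exact (List.map_eq_flatMap).symm

/-- Digit `0` removes the term of flag `k`, digit `1` isolates it, and all other digits annihilate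
the state. -/
lemma readStep_op {k r : ℕ} (hk : k ≤ r)
    {Ψ : Matrix (Fin (n + w) → Fin (e + 2)) (Fin n → Fin (e + 2)) ℂ} {A0 : Op (e + 2) n}
    {A : ℕ → Op (e + 2) n} (hlt : n + flag (e + 2) n k < n + w)
    (h : Ψ = emb w 0 A0 + ∑ i ∈ Finset.Ico k (r + 1), emb w (hot {flag (e + 2) n i}) (A i)) :
    (readProj ⟨n + flag (e + 2) n k, hlt⟩ 0 : Op (e + 2) (n + w)) * Ψ = emb w 0 A0 +
      ∑ i ∈ Finset.Ico (k + 1) (r + 1), emb w (hot {flag (e + 2) n i}) (A i) ∧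
    (readProj ⟨n + flag (e + 2) n k, hlt⟩ 1 : Op (e + 2) (n + w)) * Ψ = emb w (hot {flag (e + 2) n k}) (A k) ∧
    ∀ v : Fin (e + 2), v ≠ 0 → v ≠ 1 → (readProj ⟨n + flag (e + 2) n k, hlt⟩ v : Op (e + 2) (n + w)) * Ψ = 0 := by
  have h1 : ∀ v, (readProj ⟨n + flag (e + 2) n k, hlt⟩ v : Op (e + 2) (n + w)) * Ψ = (if 0 = v then emb w 0 A0 else 0) +
      ((if 1 = v then emb w (hot {flag (e + 2) n k}) (A k) else 0) +
        ∑ i ∈ Finset.Ico (k + 1) (r + 1),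
          if 0 = v then emb w (hot {flag (e + 2) n i}) (A i) else 0) := by
    intro v
    rw [h, Matrix.mul_add, readProj_mul_emb rfl, Matrix.mul_sum,
      Finset.sum_eq_sum_Ico_succ_bot (by omega), readProj_mul_emb rfl]
    congr 2
    · simp [hot]
    · refine Finset.sum_congr rfl fun i hi => ?_
      have := Finset.mem_Ico.mp hi
      have hne : flag (e + 2) n k ≠ flag (e + 2) n i := by unfold flag; omega
      rw [readProj_mul_emb rfl]
      simp [hot, hne]
  refine ⟨?_, ?_, fun v h0 h2 => ?_⟩
  · rw [h1]; simp
  · rw [h1]; simp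
  · rw [h1, if_neg h0.symm, if_neg h2.symm]; simp [h0.symm]

theorem readout_spec (β : ℕ) (c : Branch (e + 2) (n + w)) (hE : Env n m X (c.mem 0))
    (hX : m - 1 + 1 ≤ X) (hw : flag (e + 2) n (m - 1) < w) {A : ℕ → Op (e + 2) n}
    (hc : c.op * emb w 0 (1 : Op (e + 2) n) =
      ∑ i ∈ Finset.range (m - 1 + 1), emb w (hot {flag (e + 2) n i}) (A i)) :
    (∀ c' ∈ exec B o (readout β) c, (∃ A', c'.op * emb w 0 (1 : Op (e + 2) n) = emb w 0 A') ∧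
      ∀ β', β' ≠ β → c'.mem 2 β' = c.mem 2 β') ∧
    ∀ j ≤ m - 1, ∀ Y, branchSum B o (readout β) c (fun c' =>
      if c'.mem 2 β = j then (c'.prob : ℂ) • sandwich (amp 0 c') Y else 0) =
        (c.prob : ℂ) • sandwich (A j) Y := by
  set r := m - 1 with hr
  have main : ∀ j ≤ r, ∀ Y, (∀ c' ∈ exec B o (readout β) c,
      (∃ A', c'.op * emb w 0 (1 : Op (e + 2) n) = emb w 0 A') ∧
        ∀ β', β' ≠ β → c'.mem 2 β' = c.mem 2 β') ∧
      branchSum B o (readout β) c (fun c' =>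
        if c'.mem 2 β = j then (c'.prob : ℂ) • sandwich (amp 0 c') Y else 0) =
          (c.prob : ℂ) • sandwich (A j) Y := by
    intro j hj Y
    let I : ℕ → Branch (e + 2) (n + w) → Prop := fun k c1 =>
      (∃ (A0 : Op (e + 2) n) (A' : ℕ → Op (e + 2) n), c1.op * emb w 0 (1 : Op (e + 2) n) =
        emb w 0 A0 + ∑ i ∈ Finset.Ico k (r + 1), emb w (hot {flag (e + 2) n i}) (A' i)) ∧
      ∀ β', β' ≠ β → c1.mem 2 β' = c.mem 2 β'
    -- The conserved weight: what has been reported as `j` with clean work qudits, plus what is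
    -- still stored in flag `j` as long as this flag is unread.
    let H : ℕ → Branch (e + 2) (n + w) → Op (e + 2) n := fun k c1 =>
      (c1.prob : ℂ) • ((if c1.mem 2 β = j then sandwich (amp 0 c1) Y else 0) +
        if k ≤ j then sandwich (amp (hot {flag (e + 2) n j}) c1) Y else 0)
    have key := branchSum_forLoop B o (a := 9) (e := cutsE + 1) (P := readStep β) I H
      (fun k c1 c2 h1 h2 h3 => by simp only [I, h1, h3])
      (fun k c1 c2 h1 h2 h3 => by simp only [H, amp, h1, h2, h3]) c (n := r + 1)
      (by rw [hE.bound]; exact hX) (by norm_num)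
      (by simp [readStep, Prog.writes]) (by simp [readStep, Prog.writes]) ?_ ?_ ?_
    · constructor
      · intro c' hc'
        obtain ⟨⟨A0, A', h1⟩, h2⟩ := key.1 c' hc'
        exact ⟨⟨A0, by simpa using h1⟩, h2⟩
      · have h3 := key.2
        have h4 : H (r + 1) = fun c' =>
            if c'.mem 2 β = j then (c'.prob : ℂ) • sandwich (amp 0 c') Y else 0 := by
          funext c'
          simp only [H]
          rw [if_neg (show ¬ r + 1 ≤ j by omega), add_zero]
          split_ifs <;> simp
        rw [readout, ← h4, h3]
        -- At the start no amplitude is on the clean state, so it is irrelevant whether the report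
        -- cell happens to contain `j` already.
        obtain ⟨h5, h6⟩ := amp_of_flags (c := c.withMem (c.mem.set 9 0 0)) (k := 0) (A0 := 0) hw
          (by rw [emb_zero, zero_add, ← Finset.range_eq_Ico]; exact hc)
        simp only [H, h5, h6 j hj, Nat.zero_le, if_true, sandwich_zero, ite_self, zero_add]
        rfl
    · have h0 : c.mem.set 9 0 0 0 = c.mem 0 := Mem.set_of_ne _ (by norm_num)
      rw [eval_add, cutsE_eval (h0 ▸ hE), eval_one]
    · refine ⟨⟨0, A, ?_⟩, fun β' _ => ?_⟩
      · rw [emb_zero, zero_add, ← Finset.range_eq_Ico]; exact hc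
      · change c.mem.set 9 0 0 2 β' = _
        rw [Mem.set_of_ne _ (by norm_num)]
    · intro k hk c1 ⟨⟨A0, A', h1⟩, h2⟩ h9 hfr
      have hE1 : Env n m X (c1.mem 0) := by
        rw [hfr 0 (by norm_num) (by simp [readStep, Prog.writes])]; exact hE
      have hwk : flag (e + 2) n k < w := by unfold flag at *; omega
      obtain ⟨t, ht⟩ := exec_readStep B o β c1 hE1 h9 (by omega) hwk
      obtain ⟨r0, r1, r2⟩ := readStep_op (by omega) (by omega) h1
      have hnot : applyAt (n + w) (permGate (notGate e)) (fun _ => n + flag (e + 2) n k) *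
          emb w (hot {flag (e + 2) n k}) (A' k) = emb w 0 (A' k) :=
        notGate_mul_emb rfl hwk (by simp [hot]) (fun a ha => by simp [hot, ha]) _
      let f : Fin (e + 2) → Branch (e + 2) (n + w) := fun v =>
        (⟨if v = 0 then c1.mem.set 12 0 0 else (c1.mem.set 12 0 v).set 2 β k, t v, c1.prob,
        (if v = 0 then 1 else applyAt (n + w) (permGate (notGate e)) fun _ =>
          n + flag (e + 2) n k) * (readProj ⟨n + flag (e + 2) n k, by omega⟩ v * c1.op)⟩ :
            Branch (e + 2) (n + w))
      let g : Fin (e + 2) → Branch (e + 2) (n + w) := fun v =>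
        (f v).withMem ((f v).mem.set 9 0 (k + 1))
      have g0 : (g 0).op * emb w 0 (1 : Op (e + 2) n) = emb w 0 A0 +
          ∑ i ∈ Finset.Ico (k + 1) (r + 1), emb w (hot {flag (e + 2) n i}) (A' i) := by
        simp only [g, f, Branch.withMem, if_true, Matrix.one_mul, Matrix.mul_assoc]
        exact r0
      -- Digit `1` followed by the NOT gate gives clean work qudits; no other flag survives.
      have g1 : (g 1).op * emb w 0 (1 : Op (e + 2) n) = emb w 0 (A' k) +
          ∑ i ∈ Finset.Ico (k + 1) (r + 1),
            emb w (hot {flag (e + 2) n i}) (0 : Op (e + 2) n) := by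
        simp only [g, f, Branch.withMem, one_ne_zero, if_false, Matrix.mul_assoc, emb_zero,
          Finset.sum_const_zero, add_zero]
        rw [r1, hnot]
      have g2 : ∀ v, v ≠ 0 → v ≠ 1 → (g v).op * emb w 0 (1 : Op (e + 2) n) = emb w 0 0 +
          ∑ i ∈ Finset.Ico (k + 1) (r + 1),
            emb w (hot {flag (e + 2) n i}) (0 : Op (e + 2) n) := by
        intro v hv0 hv1
        simp only [g, f, Branch.withMem, hv0, if_false, Matrix.mul_assoc, emb_zero,
          Finset.sum_const_zero, add_zero]
        rw [r2 v hv0 hv1, Matrix.mul_zero]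
      have gm0 : (g 0).mem 2 = c1.mem 2 := by
        simp only [g, f, Branch.withMem, if_true]
        rw [Mem.set_of_ne _ (by norm_num), Mem.set_of_ne _ (by norm_num)]
      have gm1 : ∀ v, v ≠ 0 → (g v).mem 2 = ((c1.mem.set 12 0 v).set 2 β k) 2 := by
        intro v hv
        simp only [g, f, Branch.withMem, hv, if_false]
        rw [Mem.set_of_ne _ (by norm_num)]
      have gb : ∀ v, v ≠ 0 → ∀ β', (g v).mem 2 β' = if β' = β then k else c1.mem 2 β' := by
        intro v hv β'
        rw [gm1 v hv, Mem.set_apply, Mem.set_of_ne _ (by norm_num)]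
        simp
      constructor
      · intro c2 hc2
        rw [ht, List.mem_map] at hc2
        obtain ⟨v, -, rfl⟩ := hc2
        change I (k + 1) (g v)
        by_cases hv0 : v = 0
        · subst hv0
          exact ⟨⟨A0, A', g0⟩, fun β' hβ' => by rw [gm0]; exact h2 β' hβ'⟩
        · refine ⟨?_, fun β' hβ' => by rw [gb v hv0, if_neg hβ']; exact h2 β' hβ'⟩
          by_cases hv1 : v = 1
          · subst hv1; exact ⟨_, fun _ => 0, g1⟩
          · exact ⟨_, fun _ => 0, g2 v hv0 hv1⟩
      · rw [branchSum, ht, List.map_map, ← List.ofFn_eq_map, List.sum_ofFn]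
        change ∑ v, H (k + 1) (g v) = H k c1
        have hp : ∀ v, (g v).prob = c1.prob := fun v => rfl
        obtain ⟨a1, a2⟩ := amp_of_flags hw h1
        -- Only digits `0` and `1` contribute.
        rw [Fin.sum_univ_succ, Fin.sum_univ_succ, Finset.sum_eq_zero, add_zero]
        · obtain ⟨b1, b2⟩ := amp_of_flags hw g0
          obtain ⟨d1, d2⟩ := amp_of_flags hw g1
          simp only [Fin.succ_zero_eq_one, H, hp]
          rw [gm0, gb 1 one_ne_zero, if_pos rfl, a1, a2 j hj, b1, b2 j hj, d1, d2 j hj, ← smul_add]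
          congr 1
          rw [add_assoc]
          congr 1
          -- At `k = j` the weight moves from the flag to the report; in the other rounds each of
          -- the two parts is unchanged.
          rcases lt_trichotomy k j with h | h | h
          · simp [h.le, h.ne, Nat.succ_le_of_lt h]
          · subst h; simp
          · have h' : ¬ k + 1 ≤ j := by omega
            simp [h.ne', h', h.not_ge]
        · intro v _
          have hv1 : v.succ.succ ≠ 1 := by
            rw [← Fin.succ_zero_eq_one]
            exact fun h => Fin.succ_ne_zero _ (Fin.succ_injective _ h)
          obtain ⟨b1, b2⟩ := amp_of_flags hw (g2 v.succ.succ (Fin.succ_ne_zero _) hv1)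
          simp only [H]
          rw [b1, b2 j hj]
          simp
  exact ⟨(main 0 (Nat.zero_le _) 0).1, fun j hj Y => (main j hj Y).2⟩

end Amp

/-! ### Measuring the blocks -/

/-- Measure the bins of the given blocks. -/
def measureBlocks {e : ℕ} : List (Fin (numBlocks (e + 2))) → Prog (e + 2)
  | [] => .skip
  | β :: L => .seq (measureBlocks L) (.seq (flagBlock β) (readout β))

lemma writes_flagBlock {e : ℕ} (β : Fin (numBlocks (e + 2))) {a : ℕ} (h9 : a ≠ 9) (h10 : a ≠ 10) :
    a ∉ (flagBlock β).writes := by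
  simp [flagBlock, Prog.writes, shiftUpStep, shiftDownStep, h9, h10]

lemma det_flagBlock {e : ℕ} (β : Fin (numBlocks (e + 2))) : (flagBlock β).Det := by
  simp [flagBlock, Prog.Det, shiftUpStep, shiftDownStep]

lemma writes_measureBlocks {e : ℕ} {a : ℕ} (h2 : a ≠ 2) (h9 : a ≠ 9) (h10 : a ≠ 10)
    (h12 : a ≠ 12) : ∀ L : List (Fin (numBlocks (e + 2))), a ∉ (measureBlocks L).writes
  | [] => by simp [measureBlocks, Prog.writes]
  | β :: L => by
      have h1 := writes_measureBlocks h2 h9 h10 h12 L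
      have h3 := writes_flagBlock β h9 h10
      simp only [measureBlocks, Prog.writes, Finset.mem_union, not_or]
      exact ⟨h1, h3, by simp [readout, readStep, Prog.writes, h2, h9, h12]⟩

section Blocks

variable {e n w m X : ℕ}

lemma branchSum_sandwich {d N n : ℕ} {o : ℕ → ℕ → ℕ} (P : Prog d)
    (D : TomographyBasis d) (c : Branch d N) (F : Branch d N → Op (e + 2) n) (Q : Op (e + 2) n) :
    branchSum D o P c (fun c' => sandwich Q (F c')) = sandwich Q (branchSum D o P c F) := by
  unfold branchSum
  induction exec D o P c with
  | nil => simp [sandwich]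
  | cons a L ih => simp only [List.map_cons, List.sum_cons, ih]; simp [sandwich, Matrix.mul_add, Matrix.add_mul]

lemma sandwich_mul (Q A Y : Op (e + 2) n) : sandwich (Q * A) Y = sandwich Q (sandwich A Y) := by
  simp [sandwich, Matrix.mul_assoc]

lemma sandwich_smul (a : ℂ) (Q Y : Op (e + 2) n) : sandwich Q (a • Y) = a • sandwich Q Y := by
  simp [sandwich]

lemma amp_of_clean {c : Branch (e + 2) (n + w)} {A : Op (e + 2) n}
    (h : c.op * emb w 0 (1 : Op (e + 2) n) = emb w 0 A) : amp 0 c = A := by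
  rw [amp, h, conjTranspose_emb_mul_emb, if_pos fun _ _ => rfl]

/-- The list is processed from its tail, so the projector of the head multiplies from the left, as
in the product. Since the blocks are distinct, the readout of the head does not overwrite earlier
reports. -/
theorem measureBlocks_spec (B : TomographyBasis (e + 2)) (o : ℕ → ℕ → ℕ)
    (b : Cuts (e + 2) n (m - 1)) (c : Branch (e + 2) (n + w)) (hE : Env n m X (c.mem 0))
    (hl : blockLen (e + 2) n + 1 ≤ X) (hm : m - 1 + 1 ≤ X) (hw : flag (e + 2) n (m - 1) < w)
    (hb : ∀ (β : Fin (numBlocks (e + 2))), ∀ t < blockLen (e + 2) n + 1,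
      c.mem (20 + β) t = rank (b β) t)
    {A : Op (e + 2) n} (hc : c.op * emb w 0 (1 : Op (e + 2) n) = emb w 0 A) :
    ∀ L : List (Fin (numBlocks (e + 2))), L.Nodup →
      (∀ c' ∈ exec B o (measureBlocks L) c, ∃ A', c'.op * emb w 0 (1 : Op (e + 2) n) = emb w 0 A') ∧
      ∀ (j : Outcomes (e + 2) (m - 1)) (Y : Op (e + 2) n),
        branchSum B o (measureBlocks L) c (fun c' =>
          if ∀ β ∈ L, c'.mem 2 β = j β then (c'.prob : ℂ) • sandwich (amp 0 c') Y else 0) =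
        (c.prob : ℂ) • sandwich
          ((L.map fun β => binProj (block (e + 2) n β) (B.phi β) (b β) (j β)).prod * A) Y
  | [], _ => by
      constructor
      · intro c' hc'
        simp only [measureBlocks, exec, List.mem_singleton] at hc'
        subst hc'
        exact ⟨A, hc⟩
      · intro j Y
        simp only [measureBlocks, branchSum, exec, List.map_cons, List.map_nil, List.sum_cons,
          List.sum_nil, add_zero, List.not_mem_nil, false_implies, implies_true, if_true, tick_prob,
          List.prod_nil, Matrix.one_mul]
        rw [amp_of_clean (c := c.tick 1) hc]
  | β :: L, hL => by
      obtain ⟨ih1, ih2⟩ := measureBlocks_spec B o b c hE hl hm hw hb hc L (List.nodup_cons.mp hL).2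
      have hβ : β ∉ L := (List.nodup_cons.mp hL).1
      have step : ∀ c1 ∈ exec B o (measureBlocks L) c,
          (∀ c' ∈ exec B o (.seq (flagBlock β) (readout β)) c1,
            (∃ A', c'.op * emb w 0 (1 : Op (e + 2) n) = emb w 0 A') ∧
              ∀ β' : ℕ, β' ≠ β → c'.mem 2 β' = c1.mem 2 β') ∧
          ∀ (i : Fin (m - 1 + 1)) (Y : Op (e + 2) n),
            branchSum B o (.seq (flagBlock β) (readout β)) c1 (fun c' =>
              if c'.mem 2 β = i then (c'.prob : ℂ) • sandwich (amp 0 c') Y else 0) =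
            (c1.prob : ℂ) • sandwich (binProj (block (e + 2) n β) (B.phi β) (b β) i)
              (sandwich (amp 0 c1) Y) := by
        intro c1 hc1
        obtain ⟨A1, hA1⟩ := ih1 c1 hc1
        have fr : ∀ a, a ≠ 2 → a ≠ 9 → a ≠ 10 → a ≠ 12 → c1.mem a = c.mem a := fun a h2 h9 h10 h12 =>
          exec_frame B o _ (writes_measureBlocks h2 h9 h10 h12 L) c c1 hc1
        obtain ⟨c2, h1, h2, h3⟩ :=
          exec_det B o (emb w 0 (1 : Op (e + 2) n)) (flagBlock β) (det_flagBlock β) c1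
        have hE1 : Env n m X (c1.mem 0) := by
          rw [fr 0 (by norm_num) (by norm_num) (by norm_num) (by norm_num)]; exact hE
        have h4 := flagBlock_spec B o β (c1.mem, c1.op * emb w 0 (1 : Op (e + 2) n)) hE1 hl hw
          (f := rank (b β)) (fun t ht => by
            rw [← hb β t ht]
            exact congrFun (fr _ (by omega) (by omega) (by omega) (by omega)) t)
          (fun t => rank_le _ _) hA1
        rw [← h3, superpose_flag B β fun t => rank_le (b β) t] at h4
        have hm2 : ∀ a, a ≠ 9 → a ≠ 10 → c2.mem a = c1.mem a := fun a h9 h10 =>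
          exec_frame B o _ (writes_flagBlock β h9 h10) c1 c2 (by rw [h1]; simp)
        obtain ⟨g1, g2⟩ := readout_spec B o β c2
          (by rw [hm2 0 (by norm_num) (by norm_num)]; exact hE1) hm hw h4
        have hseq : exec B o (.seq (flagBlock β) (readout β)) c1 = exec B o (readout β) c2 := by
          simp [exec, h1]
        rw [hseq]
        refine ⟨fun c' hc' => ⟨(g1 c' hc').1, fun β' hβ' => ?_⟩, fun i Y => ?_⟩
        · rw [(g1 c' hc').2 β' hβ', hm2 2 (by norm_num) (by norm_num)]
        · rw [branchSum, hseq, ← branchSum, g2 i (Nat.lt_succ_iff.mp i.2) Y, h2,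
            amp_of_clean hA1, ← sandwich_mul]
          rw [← rankProj_eq_binProj B β b (fun _ => i)]
      constructor
      · intro c' hc'
        rw [measureBlocks, exec, List.mem_flatMap] at hc'
        obtain ⟨c1, hc1, hc'⟩ := hc'
        exact ((step c1 hc1).1 c' hc').1
      · intro j Y
        rw [measureBlocks, branchSum_seq, List.map_cons, List.prod_cons, Matrix.mul_assoc,
          sandwich_mul, ← sandwich_smul, ← ih2 j Y, ← branchSum_sandwich]
        refine branchSum_congr fun c1 hc1 => ?_
        obtain ⟨s1, s2⟩ := step c1 hc1
        have hcond : ∀ c' ∈ exec B o (.seq (flagBlock β) (readout β)) c1,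
            (∀ β' ∈ β :: L, c'.mem 2 β' = j β') ↔
              (∀ β' ∈ L, c1.mem 2 β' = j β') ∧ c'.mem 2 β = j β := by
          intro c' hc'
          simp only [List.forall_mem_cons]
          rw [and_comm]
          refine and_congr_left fun _ => ?_
          refine forall₂_congr fun β' hβ' => ?_
          rw [(s1 c' hc').2 β' fun h => hβ (Fin.ext h ▸ hβ')]
        by_cases hL1 : ∀ β' ∈ L, c1.mem 2 β' = j β'
        · rw [if_pos hL1, sandwich_smul, ← s2 (j β) Y]
          refine branchSum_congr fun c' hc' => ?_
          refine if_congr ?_ rfl rfl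
          rw [hcond c' hc']
          exact and_iff_right hL1
        · rw [if_neg hL1]
          have : branchSum B o (.seq (flagBlock β) (readout β)) c1 (fun c' =>
              if ∀ β' ∈ β :: L, c'.mem 2 β' = j β' then
                (c'.prob : ℂ) • sandwich (amp 0 c') Y else 0) =
              branchSum B o (.seq (flagBlock β) (readout β)) c1 (fun _ => (0 : Op (e + 2) n)) :=
            branchSum_congr fun c' hc' => if_neg fun h => hL1 ((hcond c' hc').mp h).1
          rw [this]
          simp [branchSum, sandwich]

end Blocks

/-! ### Drawing the cut points -/

/-- Draw the cut points of all blocks. -/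
def drawCuts {d : ℕ} : Prog d :=
  forLoop 8 (.lit (numBlocks d) * cutsE) (.rand 1 (.load 8 0) (clamp (lenE d)))

/-- Exactly one of the `l + 1` values drawn in each round agrees with `g`, so each round costs a
factor `1 / (l + 1)`. -/
theorem drawCuts_spec {d N n m X : ℕ} {V : Type*} [AddCommGroup V] [Module ℂ V]
    (B : TomographyBasis d) (o : ℕ → ℕ → ℕ) (c : Branch d N) (hE : Env n m X (c.mem 0))
    (hl : blockLen d n ≤ X) (hX : numBlocks d * (m - 1) ≤ X) (g : ℕ → ℕ)
    (hg : ∀ i < numBlocks d * (m - 1), g i ≤ blockLen d n) (F : V) :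
    (∀ c' ∈ exec B o drawCuts c, c'.op = c.op) ∧
    branchSum B o drawCuts c (fun c' =>
      if ∀ i < numBlocks d * (m - 1), c'.mem 1 i = g i then (c'.prob : ℂ) • F else 0) =
    ((c.prob : ℂ) / ((blockLen d n : ℂ) + 1) ^ (numBlocks d * (m - 1))) • F := by
  set K := numBlocks d * (m - 1) with hK
  set l := blockLen d n with hl'
  have hl0 : (l : ℂ) + 1 ≠ 0 := by exact_mod_cast Nat.succ_ne_zero l
  -- Branches that agree with `g` so far, weighted by the probability that the remaining draws agree
  -- too.
  let H : ℕ → Branch d N → V := fun k c1 => if ∀ i < k, c1.mem 1 i = g i then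
    ((c1.prob : ℂ) / ((l : ℂ) + 1) ^ (K - k)) • F else 0
  have key := branchSum_forLoop B o (a := 8) (e := .lit (numBlocks d) * cutsE)
    (P := .rand 1 (.load 8 0) (clamp (lenE d))) (fun _ c1 => c1.op = c.op) H
    (fun k c1 c2 h1 h2 h3 => by simp only [h3])
    (fun k c1 c2 h1 h2 h3 => by simp only [H, h1, h2]) c (n := K)
    (by rw [hE.bound]; exact hX) (by norm_num) (by simp [Prog.writes]) (by simp [Prog.writes])
    ?_ rfl ?_
  · refine ⟨key.1, ?_⟩
    have h2 := key.2
    have h3 : H K = fun c' => if ∀ i < K, c'.mem 1 i = g i then (c'.prob : ℂ) • F else 0 := by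
      funext c'
      simp [H]
    rw [drawCuts, ← h3, h2]
    simp [H, Branch.withMem]
  · have h0 : c.mem.set 8 0 0 0 = c.mem 0 := Mem.set_of_ne _ (by norm_num)
    rw [eval_mul, cutsE_eval (h0 ▸ hE), eval_lit]
  · intro k hk c1 h1 h8 hfr
    have hE1 : Env n m X (c1.mem 0) := by
      rw [hfr 0 (by norm_num) (by simp [Prog.writes])]; exact hE
    have hu : (clamp (lenE d)).eval o c1.mem = l := by
      rw [clamp_eval, lenE_eval hE1, hE1.bound, min_eq_left hl]
    constructor
    · intro c2 hc2
      simp only [exec, List.mem_map] at hc2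
      obtain ⟨v, -, rfl⟩ := hc2
      exact h1
    · simp only [branchSum, exec, hu, eval_load, eval_zero, h8, List.map_map]
      have hsum : ∀ f : ℕ → V, ((List.range (l + 1)).map f).sum =
          ∑ v ∈ Finset.range (l + 1), f v := fun f => by rw [← Multiset.sum_coe]; rfl
      rw [hsum]
      have hcond : ∀ v, (∀ i < k + 1, ((c1.mem.set 1 k v).set 8 0 (k + 1)) 1 i = g i) ↔
          (∀ i < k, c1.mem 1 i = g i) ∧ v = g k := by
        intro v
        rw [Mem.set_of_ne _ (by norm_num)]
        simp only [Mem.set_apply, true_and]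
        constructor
        · intro h
          refine ⟨fun i hi => ?_, by simpa using h k (by omega)⟩
          have := h i (by omega)
          rwa [if_neg (by omega)] at this
        · rintro ⟨h, rfl⟩ i hi
          split_ifs with hik
          · rw [hik]
          · exact h i (by omega)
      rw [Finset.sum_eq_single (g k)]
      · simp only [Function.comp_apply, H, Branch.withMem, tick_mem, write_mem, hcond, and_true]
        refine if_congr Iff.rfl ?_ rfl
        congr 1
        have h3 : K - k = K - (k + 1) + 1 := by omega
        rw [h3, pow_succ]
        push_cast
        field_simp
      · intro v _ hv
        simp only [Function.comp_apply, H, Branch.withMem, tick_mem, write_mem, hcond]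
        rw [if_neg fun h => hv h.2]
      · intro h
        exact absurd (Finset.mem_range.mpr (Nat.lt_succ_of_le (hg k hk))) h

/-! ### Approximate solutions of the semidefinite program -/

section Norms

attribute [local instance] Matrix.frobeniusNormedAddCommGroup Matrix.frobeniusNormedSpace

variable {d : ℕ}

/-- The square of the Frobenius norm. -/
def frobSq (A : Matrix (Fin d) (Fin d) ℂ) : ℝ := ∑ a, ∑ c, Complex.normSq (A a c)

/-- The square of the norm of `A† φ`. -/
def testSq (A : Matrix (Fin d) (Fin d) ℂ) (φ : Fin d → ℂ) : ℝ :=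
  ∑ c, Complex.normSq (∑ a, star (A a c) * φ a)

/-- A vector as a matrix with one column. -/
def colMat (φ : Fin d → ℂ) : Matrix (Fin d) Unit ℂ := Matrix.of fun a _ => φ a

/-! ### Frobenius norms and the perturbation of normalized quadratic forms. -/

lemma frobenius_norm_sq {ι κ : Type*} [Fintype ι] [Fintype κ] (A : Matrix ι κ ℂ) :
    ‖A‖ ^ 2 = ∑ a, ∑ c, Complex.normSq (A a c) := by
  rw [Matrix.frobenius_norm_def, ← Real.rpow_natCast, ← Real.rpow_mul]
  · norm_num
    simp only [Complex.normSq_eq_norm_sq]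
  · positivity

lemma frobSq_eq (A : Matrix (Fin d) (Fin d) ℂ) : frobSq A = ‖A‖ ^ 2 := (frobenius_norm_sq A).symm

lemma testSq_eq (A : Matrix (Fin d) (Fin d) ℂ) (φ : Fin d → ℂ) :
    testSq A φ = ‖Aᴴ * colMat φ‖ ^ 2 := by
  rw [frobenius_norm_sq]
  simp [testSq, Matrix.mul_apply, colMat]

lemma trace_mul_conjTranspose (A : Matrix (Fin d) (Fin d) ℂ) : (A * Aᴴ).trace = (frobSq A : ℂ) := by
  simp only [Matrix.trace, Matrix.diag, Matrix.mul_apply, Matrix.conjTranspose_apply, frobSq]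
  push_cast
  refine Finset.sum_congr rfl fun a _ => Finset.sum_congr rfl fun c _ => ?_
  exact Complex.mul_conj _

lemma expect_mul_conjTranspose (A : Matrix (Fin d) (Fin d) ℂ) (φ : Fin d → ℂ) :
    expect φ (A * Aᴴ) = testSq A φ := by
  have h : star φ ⬝ᵥ ((A * Aᴴ) *ᵥ φ) = star (Aᴴ *ᵥ φ) ⬝ᵥ (Aᴴ *ᵥ φ) := by
    rw [Matrix.star_mulVec, Matrix.conjTranspose_conjTranspose, ← Matrix.mulVec_mulVec,
      Matrix.dotProduct_mulVec]
  rw [expect, h, testSq, dotProduct, Complex.re_sum]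
  refine Finset.sum_congr rfl fun c _ => ?_
  simp only [Pi.star_apply, Matrix.mulVec, dotProduct, Matrix.conjTranspose_apply]
  rw [mul_comm]
  exact (congrArg Complex.re (Complex.mul_conj _)).trans (Complex.ofReal_re _)

lemma expect_smul (a : ℝ) (φ : Fin d → ℂ) (A : Matrix (Fin d) (Fin d) ℂ) :
    expect φ ((a : ℂ) • A) = a * expect φ A := by
  simp [expect, Matrix.smul_mulVec, dotProduct_smul]

lemma norm_colMat {φ : Fin d → ℂ} (hφ : ∑ a, Complex.normSq (φ a) = 1) : ‖colMat φ‖ = 1 := by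
  have h : ‖colMat φ‖ ^ 2 = 1 := by
    rw [frobenius_norm_sq, ← hφ]
    simp [colMat]
  exact (pow_eq_one_iff_of_nonneg (norm_nonneg _) two_ne_zero).mp h

lemma norm_conjTranspose_mul_colMat {φ : Fin d → ℂ} (hφ : ∑ a, Complex.normSq (φ a) = 1)
    (M : Matrix (Fin d) (Fin d) ℂ) : ‖Mᴴ * colMat φ‖ ≤ ‖M‖ := by
  have := Matrix.frobenius_norm_mul Mᴴ (colMat φ)
  rwa [Matrix.frobenius_norm_conjTranspose, norm_colMat hφ, mul_one] at this

/-- Put `x = u / (q F)` and `y = v / F ≤ 1`. Then `|x - y| ≤ ε` and `x + y ≤ 3`, because `x ≤ 1 + ε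
≤ 2`. -/
lemma sq_div_perturb {u v F q ε : ℝ} (hF : 0 < F) (hq : 0 < q) (hε : ε ≤ 1) (hu : 0 ≤ u)
    (hv : 0 ≤ v) (hvF : v ≤ F) (h : |u - q * v| ≤ F * (ε * q)) :
    |u ^ 2 / (q ^ 2 * F ^ 2) - v ^ 2 / F ^ 2| ≤ 3 * ε := by
  have hx0 : 0 ≤ u / (q * F) := by positivity
  have hy0 : 0 ≤ v / F := by positivity
  have hy1 : v / F ≤ 1 := (div_le_one hF).mpr hvF
  have hxy : |u / (q * F) - v / F| ≤ ε := by
    have : u / (q * F) - v / F = (u - q * v) / (q * F) := by field_simp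
    rw [this, abs_div, abs_of_pos (by positivity : 0 < q * F), div_le_iff₀ (by positivity)]
    linarith
  have e : u ^ 2 / (q ^ 2 * F ^ 2) - v ^ 2 / F ^ 2 =
      (u / (q * F) - v / F) * (u / (q * F) + v / F) := by field_simp; ring
  rw [e, abs_mul, abs_of_nonneg (by positivity : 0 ≤ u / (q * F) + v / F)]
  generalize u / (q * F) = x at *
  generalize v / F = y at *
  have hx1 : x ≤ 2 := by linarith [(abs_le.mp hxy).2]
  calc |x - y| * (x + y) ≤ |x - y| * 3 :=
        mul_le_mul_of_nonneg_left (by linarith) (abs_nonneg _)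
    _ ≤ 3 * ε := by linarith

/-- Normalizing by `F` instead of `K` costs a second `δ`: the roots differ by at most `2 δ / F ≤ 4 δ
/ K`, and their sum is at most `2`. -/
lemma sq_div_round {u v F K δ : ℝ} (hK : 0 < K) (hδ0 : 0 ≤ δ) (hδ : 2 * δ ≤ K) (hu : 0 ≤ u)
    (hv : 0 ≤ v) (hv1 : v ≤ 1) (huF : u ≤ F) (hF : |F - K| ≤ δ) (h : |u - K * v| ≤ δ) :
    |u ^ 2 / F ^ 2 - v ^ 2| ≤ 8 * δ / K := by
  have hFK : K / 2 ≤ F := by linarith [(abs_le.mp hF).1]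
  have hF0 : 0 < F := by linarith
  have hx0 : 0 ≤ u / F := by positivity
  have hx1 : u / F ≤ 1 := (div_le_one hF0).mpr huF
  have hxv : |u / F - v| ≤ 4 * δ / K := by
    have : u / F - v = ((u - K * v) - v * (F - K)) / F := by field_simp; ring
    rw [this, abs_div, abs_of_pos hF0, div_le_div_iff₀ hF0 hK]
    have h7 : |(u - K * v) - v * (F - K)| ≤ 2 * δ := by
      refine (abs_sub _ _).trans ?_
      rw [abs_mul, abs_of_nonneg hv]
      have : v * |F - K| ≤ 1 * δ := mul_le_mul hv1 hF (abs_nonneg _) zero_le_one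
      linarith
    calc _ ≤ 2 * δ * K := mul_le_mul_of_nonneg_right h7 hK.le
      _ = 4 * δ * (K / 2) := by ring
      _ ≤ 4 * δ * F := mul_le_mul_of_nonneg_left hFK (by linarith)
  have e : u ^ 2 / F ^ 2 - v ^ 2 = (u / F - v) * (u / F + v) := by field_simp; ring
  rw [e, abs_mul, abs_of_nonneg (by positivity : 0 ≤ u / F + v)]
  calc |u / F - v| * (u / F + v) ≤ |u / F - v| * 2 :=
        mul_le_mul_of_nonneg_left (by linarith) (abs_nonneg _)
    _ ≤ 4 * δ / K * 2 := by linarith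
    _ = 8 * δ / K := by ring

/-- The effect of replacing the eigenvector by an approximation `ψ` of `q φ`, by the reverse
triangle inequality. -/
lemma testSq_perturb {A : Matrix (Fin d) (Fin d) ℂ} (hA : 0 < frobSq A) {φ ψ : Fin d → ℂ}
    (hφ : ∑ a, Complex.normSq (φ a) = 1) {q ε : ℝ} (hq : 0 < q) (hε : ε ≤ 1)
    (hψ : ∑ a, Complex.normSq (ψ a - q * φ a) ≤ (ε * q) ^ 2) (hε0 : 0 ≤ ε) :
    |testSq A ψ / (q ^ 2 * frobSq A) - testSq A φ / frobSq A| ≤ 3 * ε := by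
  rw [frobSq_eq] at *
  rw [testSq_eq, testSq_eq]
  have hA' : 0 < ‖A‖ := by
    rcases (norm_nonneg A).eq_or_lt with h | h
    · rw [← h] at hA; norm_num at hA
    · exact h
  have h2 : ‖colMat ψ - (q : ℂ) • colMat φ‖ ≤ ε * q := by
    have h3 : ‖colMat ψ - (q : ℂ) • colMat φ‖ ^ 2 = ∑ a, Complex.normSq (ψ a - q * φ a) := by
      rw [frobenius_norm_sq]
      simp [colMat]
    rw [← h3] at hψ
    exact (sq_le_sq₀ (norm_nonneg _) (by positivity)).mp hψ
  have h4 : |‖Aᴴ * colMat ψ‖ - q * ‖Aᴴ * colMat φ‖| ≤ ‖A‖ * (ε * q) := by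
    have e1 : q * ‖Aᴴ * colMat φ‖ = ‖(q : ℂ) • (Aᴴ * colMat φ)‖ := by
      rw [norm_smul, Complex.norm_real, Real.norm_of_nonneg hq.le]
    rw [e1]
    refine (abs_norm_sub_norm_le _ _).trans ?_
    rw [← Matrix.mul_smul, ← Matrix.mul_sub]
    refine (Matrix.frobenius_norm_mul _ _).trans ?_
    rw [Matrix.frobenius_norm_conjTranspose]
    exact mul_le_mul_of_nonneg_left h2 hA'.le
  exact sq_div_perturb hA' hq hε (norm_nonneg _) (norm_nonneg _)
    (norm_conjTranspose_mul_colMat hφ A) h4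

/-- The effect of replacing the square root `R` of a state by a nearby multiple `A` of `R / K⁻¹`,
that is, by a matrix within `δ` of `K R`. -/
lemma testSq_round {A R : Matrix (Fin d) (Fin d) ℂ} (hR : frobSq R = 1) {K δ : ℝ}
    (hK : 0 < K) (hδ0 : 0 ≤ δ) (hδ : 2 * δ ≤ K)
    (hA : frobSq (A - (K : ℂ) • R) ≤ δ ^ 2) {φ : Fin d → ℂ}
    (hφ : ∑ a, Complex.normSq (φ a) = 1) :
    0 < frobSq A ∧ |testSq A φ / frobSq A - testSq R φ| ≤ 8 * δ / K := by
  rw [frobSq_eq] at *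
  rw [testSq_eq, testSq_eq]
  have hR1 : ‖R‖ = 1 := by nlinarith [norm_nonneg R]
  have hA1 : ‖A - (K : ℂ) • R‖ ≤ δ := (sq_le_sq₀ (norm_nonneg _) hδ0).mp hA
  have hKR : ‖(K : ℂ) • R‖ = K := by
    rw [norm_smul, Complex.norm_real, Real.norm_of_nonneg hK.le, hR1, mul_one]
  have hAK : |‖A‖ - K| ≤ δ := by
    have := abs_norm_sub_norm_le A ((K : ℂ) • R)
    rw [hKR] at this
    exact this.trans hA1
  have hApos : K / 2 ≤ ‖A‖ := by linarith [(abs_le.mp hAK).1]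
  have hA' : 0 < ‖A‖ := by linarith
  refine ⟨by positivity, ?_⟩
  have h4 : |‖Aᴴ * colMat φ‖ - K * ‖Rᴴ * colMat φ‖| ≤ δ := by
    have e1 : K * ‖Rᴴ * colMat φ‖ = ‖((K : ℂ) • R)ᴴ * colMat φ‖ := by
      rw [Matrix.conjTranspose_smul, Matrix.smul_mul, norm_smul, norm_star, Complex.norm_real,
        Real.norm_of_nonneg hK.le]
    rw [e1]
    refine (abs_norm_sub_norm_le _ _).trans ?_
    rw [← Matrix.sub_mul, ← Matrix.conjTranspose_sub]
    exact (norm_conjTranspose_mul_colMat hφ _).trans hA1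
  exact sq_div_round hK hδ0 hδ (norm_nonneg _) (norm_nonneg _)
    ((norm_conjTranspose_mul_colMat hφ R).trans hR1.le) (norm_conjTranspose_mul_colMat hφ A) hAK h4

end Norms

/-- `A A†`, up to normalization, passes a test for consistency with bins from `lo β` to `hi β`,
for approximations `ψ β` to `q` times the eigenvectors. -/
def Passes {d ν : ℕ} (ψ : Fin ν → Fin d → ℂ) (q l : ℕ) (lo hi : Fin ν → ℕ)
    (A : Matrix (Fin d) (Fin d) ℂ) : Prop :=
  0 < frobSq A ∧ ∀ β,
    (lo β = 0 ∨ (4 * lo β + 1) * (frobSq A * q ^ 2) ≤ 4 * l * testSq A (ψ β)) ∧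
    (l + 1 ≤ hi β ∨ 4 * l * testSq A (ψ β) ≤ (4 * hi β - 1) * (frobSq A * q ^ 2))

/-- The density matrix proportional to `A A†`. -/
def normalize {d : ℕ} (A : Matrix (Fin d) (Fin d) ℂ) : Matrix (Fin d) (Fin d) ℂ :=
  (((frobSq A)⁻¹ : ℝ) : ℂ) • (A * Aᴴ)

lemma isState_normalize {d : ℕ} {A : Matrix (Fin d) (Fin d) ℂ} (hA : 0 < frobSq A) :
    IsState (normalize A) := by
  constructor
  · exact (Matrix.posSemidef_self_mul_conjTranspose A).smul
      (Complex.zero_le_real.mpr (inv_nonneg.mpr hA.le))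
  · rw [normalize, Matrix.trace_smul, trace_mul_conjTranspose, smul_eq_mul, ← Complex.ofReal_mul,
      inv_mul_cancel₀ hA.ne', Complex.ofReal_one]

lemma expect_normalize {d : ℕ} (A : Matrix (Fin d) (Fin d) ℂ) (φ : Fin d → ℂ) :
    expect φ (normalize A) = testSq A φ / frobSq A := by
  rw [normalize, expect_smul, expect_mul_conjTranspose, inv_mul_eq_div]

lemma sum_normSq_phi {d : ℕ} (B : TomographyBasis d) (β : Fin (numBlocks d)) :
    ∑ a, Complex.normSq (B.phi β a) = 1 := by
  have h := B.phi_unit β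
  have h2 : ((∑ a, Complex.normSq (B.phi β a) : ℝ) : ℂ) = 1 := by
    rw [← h, dotProduct]
    push_cast
    exact Finset.sum_congr rfl fun a _ => Complex.normSq_eq_conj_mul_self
  exact_mod_cast h2

/-- The approximations to `q` times the eigenvectors. -/
def approxVec {d : ℕ} (o : ℕ → ℕ → ℕ) (q : ℕ) (β : Fin (numBlocks d)) (a : Fin d) : ℂ :=
  ⟨(o (2 * ((β : ℕ) * d + a)) q : ℝ) - q, (o (2 * ((β : ℕ) * d + a) + 1) q : ℝ) - q⟩

/-- The precision that is used for the eigenvectors. -/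
def precision (d l : ℕ) : ℕ := 24 * d * l

/-- The bound for the entries of the integer matrices. -/
def gridSize (d l : ℕ) : ℕ := 64 * d * l

lemma approx_expect {d l : ℕ} (hd : 2 ≤ d) (hl : 1 ≤ l) {B : TomographyBasis d} {o : ℕ → ℕ → ℕ}
    (ho : Approximates o B) (β : Fin (numBlocks d)) {A : Matrix (Fin d) (Fin d) ℂ}
    (hA : 0 < frobSq A) :
    |l * (testSq A (approxVec o (precision d l) β) / ((precision d l : ℝ) ^ 2 * frobSq A)) -
      l * expect (B.phi β) (normalize A)| ≤ 1 / 4 := by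
  have hd' : (2 : ℝ) ≤ d := by exact_mod_cast hd
  have hl' : (1 : ℝ) ≤ l := by exact_mod_cast hl
  have hq : (precision d l : ℝ) = 24 * d * l := by simp [precision]
  have hq0 : (0 : ℝ) < precision d l := by rw [hq]; positivity
  have hqq : (2 * d : ℝ) ≤ precision d l := by rw [hq]; nlinarith
  -- With errors at most `1` in `2 d` real coordinates, the squared error is at most `2 d ≤ (2 d) ^
  -- 2`, so `ε = 2 d / q` works. The precision `q = 24 d l` makes `3 ε l` equal to `1 / 4`.
  have h := testSq_perturb hA (sum_normSq_phi B β) (ψ := approxVec o (precision d l) β)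
    (q := precision d l) (ε := 2 * d / precision d l) hq0 ((div_le_one hq0).mpr hqq) ?_
    (by positivity)
  · rw [expect_normalize, ← mul_sub, abs_mul, abs_of_pos (by linarith : (0 : ℝ) < l)]
    calc _ ≤ (l : ℝ) * (3 * (2 * d / precision d l)) := mul_le_mul_of_nonneg_left h (by linarith)
      _ = 1 / 4 := by rw [hq]; field_simp; norm_num
  · rw [div_mul_cancel₀ _ hq0.ne']
    calc _ ≤ ∑ _a : Fin d, (2 : ℝ) := by
          refine Finset.sum_le_sum fun a _ => ?_
          obtain ⟨h1, h2⟩ := ho β a (precision d l)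
          simp only [approxVec, Complex.normSq_apply, Complex.sub_re, Complex.sub_im,
            Complex.re_ofReal_mul, Complex.im_ofReal_mul]
          have g1 := sq_le_one_iff_abs_le_one _ |>.mpr h1
          have g2 := sq_le_one_iff_abs_le_one _ |>.mpr h2
          nlinarith
      _ = 2 * d := by simp [mul_comm]
      _ ≤ (2 * d) ^ 2 := by nlinarith

/-- The test demands a margin of `1 / 4`, which compensates for the error in `approx_expect`. The
ends `0` and `l + 1` impose nothing, as `0 ≤ l ⟨φ|τ|φ⟩ ≤ l` for every state. -/
theorem solvesSDP_of_passes {d n r : ℕ} (hd : 2 ≤ d) {B : TomographyBasis d} {o : ℕ → ℕ → ℕ}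
    (ho : Approximates o B) (hl : 1 ≤ blockLen d n) {b : Cuts d n r} {j : Outcomes d r}
    {A : Matrix (Fin d) (Fin d) ℂ}
    (h : Passes (approxVec o (precision d (blockLen d n))) (precision d (blockLen d n))
      (blockLen d n) (fun β => binLo (b β) (j β)) (fun β => binHi (b β) (j β)) A) :
    SolvesSDP B b j (normalize A) := by
  obtain ⟨hA, h⟩ := h
  have hst := isState_normalize hA
  refine ⟨hst, fun β => ?_⟩
  have h1 := approx_expect hd hl ho β hA
  have hl' : (1 : ℝ) ≤ blockLen d n := by exact_mod_cast hl
  have hd' : (2 : ℝ) ≤ d := by exact_mod_cast hd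
  have hq0 : (0 : ℝ) < precision d (blockLen d n) := by simp [precision]; positivity
  have hp0 := expect_nonneg (B.phi β) hst.1
  have hp1 := expect_le_one (isTest_phi B β) hst
  rw [abs_le] at h1
  have hden : 0 < (precision d (blockLen d n) : ℝ) ^ 2 * frobSq A := by positivity
  obtain ⟨hlo, hhi⟩ := h β
  dsimp only at hlo hhi
  constructor
  · rcases hlo with hlo | hlo
    · rw [hlo, Nat.cast_zero]; positivity
    · have : (binLo (b β) (j β) : ℝ) + 1 / 4 ≤ blockLen d n *
          (testSq A (approxVec o (precision d (blockLen d n)) β) /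
            ((precision d (blockLen d n) : ℝ) ^ 2 * frobSq A)) := by
        rw [← mul_div_assoc, le_div_iff₀ hden]
        linarith
      linarith [h1.1, h1.2]
  · rcases hhi with hhi | hhi
    · have : ((blockLen d n + 1 : ℕ) : ℝ) ≤ binHi (b β) (j β) := by exact_mod_cast hhi
      push_cast at this
      nlinarith
    · have : blockLen d n * (testSq A (approxVec o (precision d (blockLen d n)) β) /
            ((precision d (blockLen d n) : ℝ) ^ 2 * frobSq A)) ≤
          (binHi (b β) (j β) : ℝ) - 1 / 4 := by
        rw [← mul_div_assoc, div_le_iff₀ hden]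
        linarith
      linarith [h1.1, h1.2]

/-- The Gaussian integers below the entries of `K R`. -/
def roundDown {d : ℕ} (K : ℕ) (R : Matrix (Fin d) (Fin d) ℂ) : Matrix (Fin d) (Fin d) ℂ :=
  Matrix.of fun a c => ⟨(⌊K * (R a c).re⌋ : ℝ), (⌊K * (R a c).im⌋ : ℝ)⟩

open scoped MatrixOrder Matrix.Norms.L2Operator in
lemma exists_eq_mul_conjTranspose {d : ℕ} {ρ : Matrix (Fin d) (Fin d) ℂ} (hρ : ρ.PosSemidef) :
    ∃ R : Matrix (Fin d) (Fin d) ℂ, ρ = R * Rᴴ := by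
  obtain ⟨S, hS⟩ := CStarAlgebra.nonneg_iff_eq_star_mul_self.mp hρ.nonneg
  exact ⟨Sᴴ, by rw [hS, Matrix.conjTranspose_conjTranspose, Matrix.star_eq_conjTranspose]⟩

/-- Take a square root `R` of `ρ` and round `K R`. The distance `3 / 4` to the cut points pays for
the rounding, for the approximate eigenvectors and for the margin of the test, `1 / 4` each. -/
theorem exists_passes {d n r : ℕ} (hd : 2 ≤ d) {B : TomographyBasis d} {o : ℕ → ℕ → ℕ}
    (ho : Approximates o B) {s : ℝ} {b : Cuts d n r} {j : Outcomes d r}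
    {ρ : Matrix (Fin d) (Fin d) ℂ} (hρ : IsState ρ) (hs : Success B s ρ b j) :
    ∃ R : Matrix (Fin d) (Fin d) ℂ, (∀ a c, |(R a c).re| ≤ 1 ∧ |(R a c).im| ≤ 1) ∧
      Passes (approxVec o (precision d (blockLen d n))) (precision d (blockLen d n))
      (blockLen d n) (fun β => binLo (b β) (j β)) (fun β => binHi (b β) (j β))
      (roundDown (gridSize d (blockLen d n)) R) := by
  have hl2 := two_le_of_success hd hs
  set l := blockLen d n with hl
  have hd' : (2 : ℝ) ≤ d := by exact_mod_cast hd
  have hl' : (2 : ℝ) ≤ l := by exact_mod_cast hl2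
  obtain ⟨R, hR⟩ := exists_eq_mul_conjTranspose hρ.1
  have hF : frobSq R = 1 := by
    have := hρ.2
    rw [hR, trace_mul_conjTranspose] at this
    exact_mod_cast this
  have hent : ∀ a c, Complex.normSq (R a c) ≤ 1 := by
    intro a c
    rw [← hF]
    refine le_trans ?_ (Finset.single_le_sum (f := fun a => ∑ c, Complex.normSq (R a c))
      (fun a _ => Finset.sum_nonneg fun c _ => Complex.normSq_nonneg _) (Finset.mem_univ a))
    exact Finset.single_le_sum (f := fun c => Complex.normSq (R a c))
      (fun c _ => Complex.normSq_nonneg _) (Finset.mem_univ c)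
  set K := gridSize d l with hK
  have hKr : (K : ℝ) = 64 * d * l := by simp [hK, gridSize]
  have hK0 : (0 : ℝ) < K := by rw [hKr]; positivity
  set A := roundDown K R with hA
  have hAR : frobSq (A - (K : ℂ) • R) ≤ (2 * d : ℝ) ^ 2 := by
    calc _ ≤ ∑ _a : Fin d, ∑ _c : Fin d, (2 : ℝ) := by
          refine Finset.sum_le_sum fun a _ => Finset.sum_le_sum fun c _ => ?_
          have key : ∀ x : ℝ, (⌊x⌋ - x) ^ 2 ≤ 1 := fun x => by
            rw [sq_le_one_iff_abs_le_one, abs_le]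
            constructor <;> linarith [Int.floor_le x, Int.lt_floor_add_one x]
          have g1 := key (K * (R a c).re)
          have g2 := key (K * (R a c).im)
          have e1 : ((A - (K : ℂ) • R) a c).re = ⌊K * (R a c).re⌋ - K * (R a c).re := by
            simp [hA, roundDown]
          have e2 : ((A - (K : ℂ) • R) a c).im = ⌊K * (R a c).im⌋ - K * (R a c).im := by
            simp [hA, roundDown]
          rw [Complex.normSq_apply, e1, e2]
          nlinarith
      _ ≤ (2 * d : ℝ) ^ 2 := by
          simp only [Finset.sum_const, Finset.card_univ, Fintype.card_fin, nsmul_eq_mul]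
          nlinarith
  -- The squared rounding error is at most `2 d ^ 2 ≤ (2 d) ^ 2`, so `δ = 2 d`; the grid size `K =
  -- 64 d l` makes `8 δ l / K` equal to `1 / 4`.
  have hround := fun β => testSq_round hF (K := K) (δ := 2 * d) hK0 (by positivity)
    (by rw [hKr]; nlinarith) (by exact_mod_cast hAR) (sum_normSq_phi B β)
  have hFA : 0 < frobSq A := (hround ⟨0, numBlocks_pos hd⟩).1
  refine ⟨R, fun a c => ?_, hFA, fun β => ?_⟩
  · have := hent a c
    rw [Complex.normSq_apply] at this
    constructor <;> rw [← sq_le_one_iff_abs_le_one] <;> nlinarith [sq_nonneg (R a c).re, sq_nonneg (R a c).im]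
  · obtain ⟨c1, -, -, c2, c3⟩ := hs β
    have hα : expect (B.phi β) ρ = testSq R (B.phi β) := by rw [hR, expect_mul_conjTranspose]
    rw [hα] at c1 c2 c3
    set α := testSq R (B.phi β) with hαdef
    have h1 := approx_expect hd (by omega : 1 ≤ l) ho β hFA
    rw [expect_normalize] at h1
    have h2 : |l * (testSq A (B.phi β) / frobSq A) - l * α| ≤ 1 / 4 := by
      rw [← mul_sub, abs_mul, abs_of_pos (by linarith : (0 : ℝ) < l)]
      calc _ ≤ (l : ℝ) * (8 * (2 * d) / K) :=
            mul_le_mul_of_nonneg_left (hround β).2 (by linarith)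
        _ = 1 / 4 := by rw [hKr]; field_simp; norm_num
    have hgap : (3 / 4 : ℝ) ≤ Real.sqrt l * Real.log l := by
      have g1 : (7 / 5 : ℝ) ≤ Real.sqrt l := Real.le_sqrt_of_sq_le (by norm_num; linarith)
      have g2 : Real.log 2 ≤ Real.log l := Real.log_le_log (by norm_num) hl'
      have g3 := Real.log_two_gt_d9
      nlinarith
    have hq0 : (0 : ℝ) < precision d l := by simp [precision]; positivity
    have hden : 0 < (precision d l : ℝ) ^ 2 * frobSq A := by positivity
    rw [abs_le] at h1 h2
    set N := testSq A (approxVec o (precision d l) β) with hN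
    constructor
    · rcases binLo_eq_zero_or (b β) (j β) with h | ⟨i, h⟩
      · exact Or.inl h
      · right
        have h3 := c1 i
        rw [← h, abs_sub_comm, abs_of_nonneg (by linarith)] at h3
        have : (binLo (b β) (j β) : ℝ) + 1 / 4 ≤ l * (N / ((precision d l : ℝ) ^ 2 * frobSq A)) := by
          linarith [h1.1, h1.2, h2.1, h2.2]
        rw [← mul_div_assoc, le_div_iff₀ hden] at this
        linarith
    · rcases binHi_eq_last_or (b β) (j β) with h | ⟨i, h⟩
      · exact Or.inl h.ge
      · right
        have h3 := c1 i
        rw [← h, abs_of_nonneg (by linarith)] at h3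
        have : l * (N / ((precision d l : ℝ) ^ 2 * frobSq A)) ≤ (binHi (b β) (j β) : ℝ) - 1 / 4 := by
          linarith [h1.1, h1.2, h2.1, h2.2]
        rw [← mul_div_assoc, div_le_iff₀ hden] at this
        linarith

@[simp] lemma eval_two (o : ℕ → ℕ → ℕ) (M : Mem) : (2 : Expr).eval o M = 2 := rfl
@[simp] lemma eval_four (o : ℕ → ℕ → ℕ) (M : Mem) : (4 : Expr).eval o M = 4 := rfl

/-! ### Arithmetic of signed and complex numbers in expressions -/

/-- The sum of a list of expressions. -/
def sumE : List Expr → Expr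
  | [] => 0
  | x :: L => x + sumE L

/-- The product of a list of expressions. -/
def prodE : List Expr → Expr
  | [] => 1
  | x :: L => x * prodE L

/-- The power of an expression. -/
def powE (x : Expr) : ℕ → Expr
  | 0 => 1
  | k + 1 => powE x k * x

/-- A difference of expressions. -/
structure ZExpr where
  pos : Expr
  neg : Expr

/-- A complex number given by expressions for the real and the imaginary part. -/
structure CExpr where
  re : ZExpr
  im : ZExpr

section

variable (o : ℕ → ℕ → ℕ) (M : Mem) (K : ℕ)

lemma sumE_eval (L : List Expr) : (sumE L).eval o M = (L.map fun x => x.eval o M).sum := by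
  induction L with
  | nil => rfl
  | cons x L ih => simp [sumE, ih]

lemma prodE_eval (L : List Expr) : (prodE L).eval o M = (L.map fun x => x.eval o M).prod := by
  induction L with
  | nil => rfl
  | cons x L ih => simp [prodE, ih]

@[simp] lemma powE_eval (x : Expr) (k : ℕ) : (powE x k).eval o M = x.eval o M ^ k := by
  induction k with
  | zero => rfl
  | succ k ih => simp [powE, ih, pow_succ]

variable {K} in
lemma safe_sumE {L : List Expr} (h : ∀ x ∈ L, x.Safe K) : (sumE L).Safe K := by
  induction L with
  | nil => simp [sumE]
  | cons x L ih =>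
    rw [List.forall_mem_cons] at h
    exact (safe_add _ _).mpr ⟨h.1, ih h.2⟩

variable {K} in
lemma safe_prodE {L : List Expr} (h : ∀ x ∈ L, x.Safe K) : (prodE L).Safe K := by
  induction L with
  | nil => simp [prodE]
  | cons x L ih =>
    rw [List.forall_mem_cons] at h
    exact (safe_mul _ _).mpr ⟨h.1, ih h.2⟩

variable {K} in
lemma safe_powE {x : Expr} (h : x.Safe K) (k : ℕ) : (powE x k).Safe K := by
  induction k with
  | zero => simp [powE]
  | succ k ih => exact (safe_mul _ _).mpr ⟨ih, h⟩

namespace ZExpr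

/-- The value of a difference. -/
def val (z : ZExpr) : ℝ := (z.pos.eval o M : ℝ) - z.neg.eval o M

/-- Both parts are safe. -/
def Safe (z : ZExpr) : Prop := z.pos.Safe K ∧ z.neg.Safe K

instance : Add ZExpr := ⟨fun x y => ⟨x.pos + y.pos, x.neg + y.neg⟩⟩
instance : Neg ZExpr := ⟨fun x => ⟨x.neg, x.pos⟩⟩
instance : Mul ZExpr := ⟨fun x y => ⟨x.pos * y.pos + x.neg * y.neg, x.pos * y.neg + x.neg * y.pos⟩⟩

/-- An expression as a difference. -/
def of (x : Expr) : ZExpr := ⟨x, 0⟩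

/-- A finite sum. -/
def sum {k : ℕ} (f : Fin k → ZExpr) : ZExpr :=
  ⟨sumE (List.ofFn fun i => (f i).pos), sumE (List.ofFn fun i => (f i).neg)⟩

variable (x y : ZExpr)

@[simp] lemma val_add : (x + y).val o M = x.val o M + y.val o M := by
  change ((x.pos + y.pos).eval o M : ℝ) - (x.neg + y.neg).eval o M = _
  simp only [val, eval_add]; push_cast; ring

@[simp] lemma val_neg : (-x).val o M = -x.val o M := by
  change (x.neg.eval o M : ℝ) - x.pos.eval o M = _
  simp only [val]; ring

@[simp] lemma val_mul : (x * y).val o M = x.val o M * y.val o M := by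
  change ((x.pos * y.pos + x.neg * y.neg).eval o M : ℝ) - (x.pos * y.neg + x.neg * y.pos).eval o M = _
  simp only [val, eval_add, eval_mul]; push_cast; ring

@[simp] lemma val_of (x : Expr) : (of x).val o M = x.eval o M := by simp [of, val]

@[simp] lemma val_sum {k : ℕ} (f : Fin k → ZExpr) : (sum f).val o M = ∑ i, (f i).val o M := by
  simp only [sum, val, sumE_eval, List.map_ofFn, List.sum_ofFn, Function.comp_apply]
  push_cast
  rw [Finset.sum_sub_distrib]

variable {K x y}

lemma safe_add' (hx : x.Safe K) (hy : y.Safe K) : (x + y).Safe K :=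
  ⟨⟨hx.1, hy.1⟩, ⟨hx.2, hy.2⟩⟩

lemma safe_neg' (hx : x.Safe K) : (-x).Safe K := ⟨hx.2, hx.1⟩

lemma safe_mul' (hx : x.Safe K) (hy : y.Safe K) : (x * y).Safe K :=
  ⟨⟨⟨hx.1, hy.1⟩, ⟨hx.2, hy.2⟩⟩, ⟨⟨hx.1, hy.2⟩, ⟨hx.2, hy.1⟩⟩⟩

lemma safe_of {x : Expr} (hx : x.Safe K) : (of x).Safe K := ⟨hx, trivial⟩

lemma safe_sum {k : ℕ} {f : Fin k → ZExpr} (h : ∀ i, (f i).Safe K) : (sum f).Safe K := by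
  constructor <;> refine safe_sumE fun x hx => ?_ <;> obtain ⟨i, rfl⟩ := List.mem_ofFn.mp hx
  exacts [(h i).1, (h i).2]

end ZExpr

/-- A comparison, as an expression with nonzero value if it holds. -/
def leE (x y : ZExpr) : Expr := y.pos + x.neg + 1 - (x.pos + y.neg)

/-- Moving the negative parts to the other side leaves a comparison of natural numbers, which
truncated subtraction can decide. -/
lemma leE_ne_zero (x y : ZExpr) : (leE x y).eval o M ≠ 0 ↔ x.val o M ≤ y.val o M := by
  simp only [leE, eval_sub, eval_add, eval_one, ZExpr.val]
  rw [sub_le_sub_iff, ← Nat.cast_add, ← Nat.cast_add, Nat.cast_le]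
  omega

lemma safe_leE {K : ℕ} {x y : ZExpr} (hx : x.Safe K) (hy : y.Safe K) : (leE x y).Safe K :=
  ⟨⟨⟨hy.1, hx.2⟩, trivial⟩, ⟨hx.1, hy.2⟩⟩

namespace CExpr

/-- The value of a complex expression. -/
def val (z : CExpr) : ℂ := ⟨z.re.val o M, z.im.val o M⟩

/-- All parts are safe. -/
def Safe (z : CExpr) : Prop := z.re.Safe K ∧ z.im.Safe K

instance : Mul CExpr := ⟨fun x y => ⟨x.re * y.re + -(x.im * y.im), x.re * y.im + x.im * y.re⟩⟩

/-- The complex conjugate. -/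
def conj (x : CExpr) : CExpr := ⟨x.re, -x.im⟩

/-- The square of the absolute value. -/
def normSq (x : CExpr) : ZExpr := x.re * x.re + x.im * x.im

/-- A finite sum. -/
def sum {k : ℕ} (f : Fin k → CExpr) : CExpr :=
  ⟨ZExpr.sum fun i => (f i).re, ZExpr.sum fun i => (f i).im⟩

variable (x y : CExpr)

@[simp] lemma val_mul : (x * y).val o M = x.val o M * y.val o M := by
  apply Complex.ext
  · change (x.re * y.re + -(x.im * y.im)).val o M = _
    simp [val, sub_eq_add_neg]
  · change (x.re * y.im + x.im * y.re).val o M = _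
    simp [val]

@[simp] lemma val_conj : (conj x).val o M = star (x.val o M) := by
  apply Complex.ext <;> simp [val, conj]

@[simp] lemma val_normSq : (normSq x).val o M = Complex.normSq (x.val o M) := by
  simp [normSq, val, Complex.normSq_apply]

@[simp] lemma val_sum {k : ℕ} (f : Fin k → CExpr) : (sum f).val o M = ∑ i, (f i).val o M := by
  apply Complex.ext
  · rw [Complex.re_sum]; simp [val, sum]
  · rw [Complex.im_sum]; simp [val, sum]

variable {K x y}

lemma safe_mul' (hx : x.Safe K) (hy : y.Safe K) : (x * y).Safe K :=
  ⟨ZExpr.safe_add' (ZExpr.safe_mul' hx.1 hy.1) (ZExpr.safe_neg' (ZExpr.safe_mul' hx.2 hy.2)),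
    ZExpr.safe_add' (ZExpr.safe_mul' hx.1 hy.2) (ZExpr.safe_mul' hx.2 hy.1)⟩

lemma safe_conj (hx : x.Safe K) : (conj x).Safe K := ⟨hx.1, ZExpr.safe_neg' hx.2⟩

lemma safe_normSq (hx : x.Safe K) : (normSq x).Safe K :=
  ZExpr.safe_add' (ZExpr.safe_mul' hx.1 hx.1) (ZExpr.safe_mul' hx.2 hx.2)

lemma safe_sum {k : ℕ} {f : Fin k → CExpr} (h : ∀ i, (f i).Safe K) : (sum f).Safe K :=
  ⟨ZExpr.safe_sum fun i => (h i).1, ZExpr.safe_sum fun i => (h i).2⟩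

end CExpr

end

/-! ### The test for solutions of the semidefinite program -/

/-- The number of possible values of a digit. -/
def gridBase (d l : ℕ) : ℕ := 2 * gridSize d l + 1

/-- The complex integer matrix that is encoded by `t`. -/
def candidate (d l t : ℕ) : Matrix (Fin d) (Fin d) ℂ := Matrix.of fun a c =>
  ⟨((t / gridBase d l ^ (2 * ((a : ℕ) * d + c)) % gridBase d l : ℕ) : ℝ) - gridSize d l,
    ((t / gridBase d l ^ (2 * ((a : ℕ) * d + c) + 1) % gridBase d l : ℕ) : ℝ) - gridSize d l⟩

/-- `gridSize`. -/
def gridSizeE (d : ℕ) : Expr := .lit (64 * d) * lenE d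

/-- `gridBase`. -/
def gridBaseE (d : ℕ) : Expr := 2 * gridSizeE d + 1

/-- `precision`. -/
def precisionE (d : ℕ) : Expr := .lit (24 * d) * lenE d

section Check

variable (d : ℕ) (t : Expr)

/-- An entry of the matrix encoded by `t`. -/
def entryE (a c : Fin d) : CExpr :=
  ⟨⟨t / powE (gridBaseE d) (2 * ((a : ℕ) * d + c)) % gridBaseE d, gridSizeE d⟩,
    ⟨t / powE (gridBaseE d) (2 * ((a : ℕ) * d + c) + 1) % gridBaseE d, gridSizeE d⟩⟩

/-- An approximate coordinate of an eigenvector. -/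
def vecE (β : Fin (numBlocks d)) (a : Fin d) : CExpr :=
  ⟨⟨.const (.lit (2 * ((β : ℕ) * d + a))) (precisionE d), precisionE d⟩,
    ⟨.const (.lit (2 * ((β : ℕ) * d + a) + 1)) (precisionE d), precisionE d⟩⟩

/-- An entry of `A A†`. -/
def gramE (a b : Fin d) : CExpr := .sum fun c => entryE d t a c * (entryE d t b c).conj

/-- `frobSq`. -/
def frobE : ZExpr := .sum fun a => .sum fun c => (entryE d t a c).normSq

/-- `testSq`. -/
def testE (β : Fin (numBlocks d)) : ZExpr :=
  .sum fun c => (CExpr.sum fun a => (entryE d t a c).conj * vecE d β a).normSq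

/-- The test for the bin of block `β`; its ends are in arrays `13` and `14`. -/
def checkBlockE (β : Fin (numBlocks d)) : Expr :=
  (1 - .load 13 (.lit β) +
    leE (.of (4 * .load 13 (.lit β) + 1) * (frobE d t * .of (precisionE d * precisionE d)))
      (.of (4 * lenE d) * testE d t β)) *
  (.load 14 (.lit β) - lenE d +
    leE (.of (4 * lenE d) * testE d t β)
      (⟨4 * .load 14 (.lit β), 1⟩ * (frobE d t * .of (precisionE d * precisionE d))))

/-- The test for consistency with all bins. -/
def checkE : Expr := leE (.of 1) (frobE d t) * prodE (List.ofFn fun β => checkBlockE d t β)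

variable {d t} {o : ℕ → ℕ → ℕ} {M : Mem} {l k : ℕ}

lemma gridSizeE_eval (hl : (lenE d).eval o M = l) : (gridSizeE d).eval o M = gridSize d l := by
  simp [gridSizeE, hl, gridSize]

lemma gridBaseE_eval (hl : (lenE d).eval o M = l) : (gridBaseE d).eval o M = gridBase d l := by
  simp [gridBaseE, gridSizeE_eval hl, gridBase]

lemma precisionE_eval (hl : (lenE d).eval o M = l) : (precisionE d).eval o M = precision d l := by
  simp [precisionE, hl, precision]

lemma entryE_val (hl : (lenE d).eval o M = l) (ht : t.eval o M = k) (a c : Fin d) :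
    (entryE d t a c).val o M = candidate d l k a c := by
  simp [entryE, CExpr.val, ZExpr.val, gridSizeE_eval hl, gridBaseE_eval hl, ht, candidate]

lemma vecE_val (hl : (lenE d).eval o M = l) (β : Fin (numBlocks d)) (a : Fin d) :
    (vecE d β a).val o M = approxVec o (precision d l) β a := by
  simp [vecE, CExpr.val, ZExpr.val, precisionE_eval hl, approxVec]

lemma gramE_val (hl : (lenE d).eval o M = l) (ht : t.eval o M = k) (a b : Fin d) :
    (gramE d t a b).val o M = (candidate d l k * (candidate d l k)ᴴ) a b := by
  simp [gramE, entryE_val hl ht, Matrix.mul_apply]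

lemma frobE_val (hl : (lenE d).eval o M = l) (ht : t.eval o M = k) :
    (frobE d t).val o M = frobSq (candidate d l k) := by
  simp [frobE, entryE_val hl ht, frobSq]

lemma testE_val (hl : (lenE d).eval o M = l) (ht : t.eval o M = k) (β : Fin (numBlocks d)) :
    (testE d t β).val o M = testSq (candidate d l k) (approxVec o (precision d l) β) := by
  simp [testE, entryE_val hl ht, vecE_val hl, testSq]

/-- The value is an integer, so strict positivity can be tested by the weak comparison that `leE`
offers. -/
lemma frobSq_candidate_pos : 0 < frobSq (candidate d l k) ↔ 1 ≤ frobSq (candidate d l k) := by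
  refine ⟨fun h => ?_, fun h => by linarith⟩
  obtain ⟨z, hz⟩ : ∃ z : ℤ, frobSq (candidate d l k) = z := by
    have key : ∀ x y : ℕ, ∀ K : ℕ, ∃ z : ℤ,
        Complex.normSq ⟨(x : ℝ) - K, (y : ℝ) - K⟩ = z := fun x y K =>
      ⟨(x - K) ^ 2 + (y - K) ^ 2, by rw [Complex.normSq_apply]; push_cast; ring⟩
    choose z hz using fun a c : Fin d => key (k / gridBase d l ^ (2 * ((a : ℕ) * d + c)) % gridBase d l)
      (k / gridBase d l ^ (2 * ((a : ℕ) * d + c) + 1) % gridBase d l) (gridSize d l)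
    refine ⟨∑ a, ∑ c, z a c, ?_⟩
    simp only [frobSq, candidate, Matrix.of_apply, hz]
    push_cast
    rfl
  rw [hz] at h ⊢
  exact_mod_cast h

lemma checkE_ne_zero (hl : (lenE d).eval o M = l) (ht : t.eval o M = k)
    {lo hi : Fin (numBlocks d) → ℕ} (hlo : ∀ β : Fin (numBlocks d), M 13 β = lo β)
    (hhi : ∀ β : Fin (numBlocks d), M 14 β = hi β) :
    (checkE d t).eval o M ≠ 0 ↔
      Passes (approxVec o (precision d l)) (precision d l) l lo hi (candidate d l k) := by
  rw [checkE, eval_mul, mul_ne_zero_iff, leE_ne_zero, ZExpr.val_of, frobE_val hl ht, prodE_eval,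
    List.map_ofFn, List.prod_ofFn, Finset.prod_ne_zero_iff, Passes, frobSq_candidate_pos]
  simp only [eval_one, Nat.cast_one, Finset.mem_univ, true_implies, Function.comp_apply]
  refine and_congr_right fun _ => forall_congr' fun β => ?_
  -- In natural numbers a nonzero sum is a disjunction and a nonzero product a conjunction.
  have hor : ∀ a b : ℕ, a + b ≠ 0 ↔ a ≠ 0 ∨ b ≠ 0 := fun a b => by omega
  rw [checkBlockE, eval_mul, mul_ne_zero_iff, eval_add, eval_add, hor, hor, leE_ne_zero,
    leE_ne_zero]
  have hdiff : (⟨4 * .load 14 (.lit β), 1⟩ : ZExpr).val o M = 4 * hi β - 1 := by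
    simp [ZExpr.val, hhi]
  simp only [ZExpr.val_mul, ZExpr.val_of, frobE_val hl ht, testE_val hl ht, eval_mul, eval_add,
    eval_sub, eval_load, eval_lit, eval_one, eval_four, precisionE_eval hl, hl, hlo, hhi, hdiff]
  push_cast
  rw [← sq]
  -- By truncation, `1 - lo` is nonzero only for `lo = 0`, and `hi - l` only for `hi ≥ l + 1`.
  refine and_congr (or_congr ?_ Iff.rfl) (or_congr ?_ Iff.rfl) <;> omega

/-- The rounded entries lie in `[-K, K]`. Shifted by `K` they are digits in base `2 K + 1`, so a
matrix is a number with `2 d ^ 2` digits, and the search space is polynomial in `l` for fixed `d`.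
-/
lemma exists_candidate (R : Matrix (Fin d) (Fin d) ℂ)
    (hR : ∀ a c, |(R a c).re| ≤ 1 ∧ |(R a c).im| ≤ 1) (l : ℕ) :
    ∃ k < gridBase d l ^ (2 * (d * d)), candidate d l k = roundDown (gridSize d l) R := by
  set K := gridSize d l with hK
  have hdig : ∀ x : ℝ, |x| ≤ 1 → ∃ v < gridBase d l, ((v : ℕ) : ℝ) - K = ⌊K * x⌋ := by
    intro x hx
    rw [abs_le] at hx
    have hK0 : (0 : ℝ) ≤ K := Nat.cast_nonneg _
    have h1 : -(K : ℤ) ≤ ⌊K * x⌋ := by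
      rw [Int.le_floor]; push_cast; nlinarith
    have h2 : ⌊K * x⌋ ≤ (K : ℤ) := by
      have : (⌊K * x⌋ : ℝ) ≤ K := (Int.floor_le _).trans (by nlinarith)
      exact_mod_cast this
    obtain ⟨v, hv⟩ := Int.eq_ofNat_of_zero_le (by omega : 0 ≤ ⌊K * x⌋ + K)
    refine ⟨v, by unfold gridBase; omega, ?_⟩
    have : ((⌊K * x⌋ + K : ℤ) : ℝ) = v := by rw [hv]; simp
    push_cast at this
    linarith
  choose u hu hu' using fun a c => hdig _ (hR a c).1
  choose v hv hv' using fun a c => hdig _ (hR a c).2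
  let f : Fin (2 * (d * d)) → Fin (gridBase d l) := fun i =>
    have hi : (i : ℕ) / 2 < d * d := by have := i.2; omega
    let p := finProdFinEquiv.symm (⟨i / 2, hi⟩ : Fin (d * d))
    if (i : ℕ) % 2 = 0 then ⟨u p.1 p.2, hu _ _⟩ else ⟨v p.1 p.2, hv _ _⟩
  have hf : ∀ (a c : Fin d) (ε : ℕ) (hε : ε < 2), ∃ h : 2 * ((a : ℕ) * d + c) + ε < 2 * (d * d),
      (f ⟨_, h⟩ : ℕ) = if ε = 0 then u a c else v a c := by
    intro a c ε hε
    have hac : (a : ℕ) * d + c < d * d := by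
      have h1 : ((a : ℕ) + 1) * d ≤ d * d := Nat.mul_le_mul_right d a.2
      have := c.2
      nlinarith
    refine ⟨by omega, ?_⟩
    have hp : finProdFinEquiv.symm (⟨(2 * ((a : ℕ) * d + c) + ε) / 2, by omega⟩ : Fin (d * d)) =
        (a, c) := by
      rw [Equiv.symm_apply_eq]
      ext
      simp only [finProdFinEquiv_apply_val]
      rw [mul_comm (d : ℕ)]
      omega
    simp only [f, hp]
    have hmod : (2 * ((a : ℕ) * d + c) + ε) % 2 = ε := by omega
    simp only [hmod]
    split_ifs <;> rfl
  refine ⟨finFunctionFinEquiv f, (finFunctionFinEquiv f).2, ?_⟩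
  have hget : ∀ i : Fin (2 * (d * d)), (finFunctionFinEquiv f : ℕ) / gridBase d l ^ (i : ℕ) % gridBase d l = f i := by
    intro i
    have := congrFun (finFunctionFinEquiv.symm_apply_apply f) i
    exact congrArg Fin.val this
  ext a c
  obtain ⟨h0, e0⟩ := hf a c 0 (by norm_num)
  obtain ⟨h1, e1⟩ := hf a c 1 (by norm_num)
  have g0 := (hget ⟨_, h0⟩).trans e0
  have g1 := (hget ⟨_, h1⟩).trans e1
  simp only [add_zero, if_true] at g0
  simp only [one_ne_zero, if_false] at g1
  simp only [candidate, roundDown, Matrix.of_apply, g0, g1]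
  rw [← hK, hu', hv']

end Check

/-! ### The classical programs -/

/-- Run `P i` for all `i` in the list. -/
def seqAll {d : ℕ} {ι : Type*} (P : ι → Prog d) : List ι → Prog d
  | [] => .skip
  | i :: L => .seq (P i) (seqAll P L)

lemma notMem_writes_seqAll {d a : ℕ} {ι : Type*} {P : ι → Prog d} (h : ∀ i, a ∉ (P i).writes) :
    ∀ L : List ι, a ∉ (seqAll P L).writes
  | [] => by simp [seqAll, Prog.writes]
  | i :: L => by
      simp only [seqAll, Prog.writes, Finset.mem_union, not_or]
      exact ⟨h i, notMem_writes_seqAll h L⟩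

lemma det_seqAll {d : ℕ} {ι : Type*} {P : ι → Prog d} (h : ∀ i, (P i).Det) :
    ∀ L : List ι, (seqAll P L).Det
  | [] => trivial
  | i :: L => ⟨h i, det_seqAll h L⟩

lemma classical_seqAll {d : ℕ} {ι : Type*} {P : ι → Prog d} (h : ∀ i, (P i).Classical) :
    ∀ L : List ι, (seqAll P L).Classical
  | [] => trivial
  | i :: L => ⟨h i, classical_seqAll h L⟩

lemma safe_seqAll {d K : ℕ} {ι : Type*} {P : ι → Prog d} (h : ∀ i, (P i).Safe K) :
    ∀ L : List ι, (seqAll P L).Safe K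
  | [] => trivial
  | i :: L => ⟨h i, safe_seqAll h L⟩

section

variable {d N n m X : ℕ} {κ : Type} (B : TomographyBasis d) (o : ℕ → ℕ → ℕ)

/-- The rule for a list of programs: `P i` establishes `Q i`, the others preserve it, and `I`
collects what all of them leave alone. -/
lemma run_seqAll {ι : Type*} {P : ι → Prog d} (I : Mem × Matrix (Fin N → Fin d) κ ℂ → Prop)
    (Q : ι → Mem × Matrix (Fin N → Fin d) κ ℂ → Prop) (hI : ∀ i s, I s → I (run B o (P i) s))
    (hQ : ∀ i s, I s → Q i (run B o (P i) s))
    (hQ' : ∀ i i', i' ≠ i → ∀ s, I s → Q i s → Q i (run B o (P i') s)) :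
    ∀ (L : List ι) (s), I s → I (run B o (seqAll P L) s) ∧
      ∀ i, i ∈ L ∨ Q i s → Q i (run B o (seqAll P L) s)
  | [], s, h => ⟨h, fun i hi => by simpa [seqAll, run] using hi⟩
  | i0 :: L, s, h => by
      obtain ⟨h1, h2⟩ := run_seqAll I Q hI hQ hQ' L (run B o (P i0) s) (hI i0 s h)
      refine ⟨h1, fun i hi => h2 i ?_⟩
      by_cases hi0 : i0 = i
      · subst hi0; exact Or.inr (hQ i0 s h)
      · rcases hi with hi | hi
        · exact Or.inl ((List.mem_cons.mp hi).resolve_left fun h => hi0 h.symm)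
        · exact Or.inr (hQ' i i0 hi0 s h hi)

/-- Tabulate the ranks for all blocks. -/
def rankTables : Prog d := seqAll (fun β : Fin (numBlocks d) => rankProg β) (List.finRange _)

lemma rankTables_spec (s : Mem × Matrix (Fin N → Fin d) κ ℂ) (hs : Env n m X (s.1 0))
    (hl : blockLen d n + 1 ≤ X) (hm : m - 1 ≤ X) (β : Fin (numBlocks d)) :
    ∀ t < blockLen d n + 1,
      (run B o rankTables s).1 (20 + β) t = rankIn (s.1 1) β (m - 1) t := by
  refine (run_seqAll B o (P := fun β : Fin (numBlocks d) => rankProg β)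
    (fun s' => s'.1 0 = s.1 0 ∧ s'.1 1 = s.1 1)
    (fun β s' => ∀ t < blockLen d n + 1, s'.1 (20 + β) t = rankIn (s.1 1) β (m - 1) t)
    ?_ ?_ ?_ (List.finRange _) s ⟨rfl, rfl⟩).2 β (Or.inl (List.mem_finRange β))
  · rintro i s' ⟨h0, h1⟩
    rw [run_frame B o _ (by simp [rankProg, Prog.writes]; omega),
      run_frame B o _ (by simp [rankProg, Prog.writes]; omega)]
    exact ⟨h0, h1⟩
  · rintro i s' ⟨h0, h1⟩
    rw [← h1]
    exact rankProg_spec B o i s' (h0 ▸ hs) hl hm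
  · rintro i i' hi s' - h t ht
    have hne : (i : ℕ) ≠ i' := fun h => hi (Fin.ext h.symm)
    rw [run_frame B o _ (by simp [rankProg, Prog.writes]; omega)]
    exact h t ht

/-- Count the entries below a threshold in the table of ranks of block `β`, into array `a`. -/
def countBelow (a : ℕ) (thr : Expr) (β : ℕ) : Prog d :=
  .seq (put a (.lit β) 0) (forLoop 9 (lenE d + 1)
    (.ite (thr - .load (20 + β) (.load 9 0)) (put a (.lit β) (.load a (.lit β) + 1)) .skip))

/-- The threshold may read only array `2`, which the loop does not change, so it is constant. The
truncated difference `θ - f t` is nonzero exactly when `f t < θ`. -/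
lemma countBelow_spec {a : ℕ} (ha0 : a ≠ 0) (ha9 : a ≠ 9) (ha20 : a < 20) {thr : Expr} {β θ : ℕ}
    (s : Mem × Matrix (Fin N → Fin d) κ ℂ)
    (hs : Env n m X (s.1 0)) (hl : blockLen d n + 1 ≤ X)
    (hthr : ∀ M : Mem, M 2 = s.1 2 → thr.eval o M = θ) (ha2 : a ≠ 2) {f : ℕ → ℕ}
    (hf : ∀ t < blockLen d n + 1, s.1 (20 + β) t = f t) :
    (run B o (countBelow a thr β) s).1 a β =
      ((Finset.range (blockLen d n + 1)).filter fun t => f t < θ).card ∧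
    ∀ β' ≠ β, (run B o (countBelow a thr β) s).1 a β' = s.1 a β' := by
  rw [countBelow, run, run_put _ _ _ _ _ _ (by simp)]
  simp only [eval_lit, eval_zero]
  set s1 : Mem × Matrix (Fin N → Fin d) κ ℂ := (s.1.set a β 0, s.2) with hs1
  have f1 : ∀ a', a' ≠ a → s1.1 a' = s.1 a' := fun a' h => Mem.set_of_ne _ h
  refine run_forLoop B o (fun k s' =>
    s'.1 a β = ((Finset.range k).filter fun t => f t < θ).card ∧
      ∀ β' ≠ β, s'.1 a β' = s.1 a β') s1
    (by rw [f1 0 ha0.symm, hs.bound]; exact hl) (by norm_num)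
    (by simp [Prog.writes]; omega) (by simp [Prog.writes]; omega) ?_ ?_ ?_
  · have h0 : s1.1.set 9 0 0 0 = s.1 0 := (Mem.set_of_ne _ (by norm_num)).trans (f1 0 ha0.symm)
    rw [eval_add, lenE_eval (h0 ▸ hs), eval_one]
  · change s1.1.set 9 0 0 a β = _ ∧ ∀ β' ≠ β, s1.1.set 9 0 0 a β' = _
    rw [Mem.set_of_ne _ ha9]
    refine ⟨by simp [hs1, Mem.set_apply], fun β' h => by simp [hs1, Mem.set_apply, h]⟩
  · intro k hk s2 ⟨h1, h1'⟩ h9 hfr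
    have g0 : s2.1 0 = s.1 0 :=
      (hfr 0 (by norm_num) (by simp [Prog.writes]; omega)).trans (f1 0 ha0.symm)
    have g2 : s2.1 2 = s.1 2 :=
      (hfr 2 (by norm_num) (by simp [Prog.writes]; omega)).trans (f1 2 ha2.symm)
    have g20 : s2.1 (20 + β) = s.1 (20 + β) :=
      (hfr _ (by omega) (by simp [Prog.writes]; omega)).trans (f1 _ (by omega))
    have hcard : ((Finset.range k).filter fun t => f t < θ).card ≤ k := by
      simpa using Finset.card_filter_le (Finset.range k) fun t => f t < θ
    change ((run B o _ s2).1.set 9 0 (k + 1)) a β = _ ∧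
      ∀ β' ≠ β, ((run B o _ s2).1.set 9 0 (k + 1)) a β' = _
    rw [Mem.set_of_ne _ ha9, run]
    simp only [eval_sub, hthr _ g2, eval_load, eval_zero, h9, g20, hf k hk]
    rw [Finset.range_add_one, Finset.filter_insert]
    split_ifs with c1 c2 c2
    · rw [run_put _ _ _ _ _ _ (by simp [h1, g0, hs.bound]; omega),
        Finset.card_insert_of_notMem (by simp)]
      exact ⟨by simp [Mem.set_apply, h1], fun β' h => by simp [Mem.set_apply, h, h1' β' h]⟩
    · omega
    · omega
    · exact ⟨h1, h1'⟩

/-- Compute the ends of all measured bins. -/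
def binEnds : Prog d := seqAll (fun β : Fin (numBlocks d) =>
  .seq (countBelow 13 (.load 2 (.lit β)) β) (countBelow 14 (.load 2 (.lit β) + 1) β))
    (List.finRange _)

lemma writes_countBelow (a : ℕ) (thr : Expr) (β : ℕ) :
    (countBelow a thr β : Prog d).writes = {a, 9} := by
  ext x
  simp [countBelow, Prog.writes]
  tauto

/-- By `boundary_eq_card`, the ends of bin `j` are the numbers of table entries below `j` and below
`j + 1`. -/
lemma binEnds_spec (s : Mem × Matrix (Fin N → Fin d) κ ℂ) (hs : Env n m X (s.1 0))
    (hl : blockLen d n + 1 ≤ X) (b : Cuts d n (m - 1)) (j : Outcomes d (m - 1))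
    (hb : ∀ (β : Fin (numBlocks d)), ∀ t < blockLen d n + 1, s.1 (20 + β) t = rank (b β) t)
    (hj : ∀ β : Fin (numBlocks d), s.1 2 β = j β) (β : Fin (numBlocks d)) :
    (run B o binEnds s).1 13 β = binLo (b β) (j β) ∧
      (run B o binEnds s).1 14 β = binHi (b β) (j β) := by
  have hwr : ∀ (β : Fin (numBlocks d)) (s' : Mem × Matrix (Fin N → Fin d) κ ℂ) (a : ℕ), a ≠ 9 →
      a ≠ 13 → a ≠ 14 → (run B o (.seq (countBelow 13 (.load 2 (.lit β)) β)
        (countBelow 14 (.load 2 (.lit β) + 1) β)) s').1 a = s'.1 a := by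
    intro β s' a h1 h2 h3
    refine run_frame B o _ ?_ _
    simp [Prog.writes, writes_countBelow, h1, h2, h3]
  refine (run_seqAll B o (P := fun β : Fin (numBlocks d) =>
      .seq (countBelow 13 (.load 2 (.lit β)) β) (countBelow 14 (.load 2 (.lit β) + 1) β))
    (fun s' => ∀ a, a ≠ 9 → a ≠ 13 → a ≠ 14 → s'.1 a = s.1 a)
    (fun β s' => s'.1 13 β = binLo (b β) (j β) ∧ s'.1 14 β = binHi (b β) (j β))
    ?_ ?_ ?_ (List.finRange _) s (fun _ _ _ _ => rfl)).2 β (Or.inl (List.mem_finRange β))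
  · intro i s' h a h1 h2 h3
    rw [hwr i s' a h1 h2 h3, h a h1 h2 h3]
  · intro i s' h
    have h2 : s'.1 2 = s.1 2 := h 2 (by norm_num) (by norm_num) (by norm_num)
    have h0 : s'.1 0 = s.1 0 := h 0 (by norm_num) (by norm_num) (by norm_num)
    have h20 : ∀ t < blockLen d n + 1, s'.1 (20 + i) t = rank (b i) t := fun t ht => by
      rw [h _ (by omega) (by omega) (by omega)]; exact hb i t ht
    rw [run]
    set s1 := run B o (countBelow 13 (.load 2 (.lit i)) i) s' with hs1
    have fr : ∀ a, a ≠ 13 → a ≠ 9 → s1.1 a = s'.1 a := fun a h1 h2 =>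
      run_frame B o _ (by simp [writes_countBelow, h1, h2]) s'
    constructor
    · rw [run_frame B o _ (by simp [writes_countBelow]), hs1, (countBelow_spec B o (by norm_num) (by norm_num) (by norm_num) s' (h0 ▸ hs) hl
        (θ := j i) (fun M hM => by rw [eval_load, eval_lit, hM, h2, hj]) (by norm_num) h20).1, binLo,
        boundary_eq_card]
      rfl
    · rw [(countBelow_spec B o (by norm_num) (by norm_num) (by norm_num) s1
        (by rw [fr 0 (by norm_num) (by norm_num), h0]; exact hs) hl
        (f := rank (b i)) (θ := j i + 1) (fun M hM => by
          rw [eval_add, eval_load, eval_lit, hM, fr 2 (by norm_num) (by norm_num), h2, hj, eval_one])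
        (by norm_num) (fun t ht => by rw [fr _ (by omega) (by omega)]; exact h20 t ht)).1, binHi,
        boundary_eq_card]
      rfl
  · intro i i' hi s' hI hQ
    have hne : (i : ℕ) ≠ i' := fun h => hi (Fin.ext h.symm)
    have h0 : s'.1 0 = s.1 0 := hI 0 (by norm_num) (by norm_num) (by norm_num)
    have hE : Env n m X (s'.1 0) := h0 ▸ hs
    rw [run]
    set s1 := run B o (countBelow 13 (.load 2 (.lit i')) i') s' with hs1
    have fr : ∀ a, a ≠ 13 → a ≠ 9 → s1.1 a = s'.1 a := fun a h1 h2 =>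
      run_frame B o _ (by simp [writes_countBelow, h1, h2]) s'
    constructor
    · rw [run_frame B o _ (by simp [writes_countBelow]), hs1,
        (countBelow_spec B o (by norm_num) (by norm_num) (by norm_num) s' hE hl (θ := s'.1 2 i')
          (fun M hM => by rw [eval_load, eval_lit, hM]) (by norm_num) (fun _ _ => rfl)).2 i hne]
      exact hQ.1
    · rw [(countBelow_spec B o (by norm_num) (by norm_num) (by norm_num) s1
        (by rw [fr 0 (by norm_num) (by norm_num)]; exact hE) hl (θ := s1.1 2 i' + 1)
          (fun M hM => by rw [eval_add, eval_load, eval_lit, hM, eval_one]) (by norm_num)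
          (fun _ _ => rfl)).2 i hne, fr 14 (by norm_num) (by norm_num)]
      exact hQ.2

/-- Search for a solution of the semidefinite program. -/
def search : Prog d := forLoop 15 (powE (gridBaseE d) (2 * (d * d)))
  (.ite (checkE d (.load 15 0)) (put 16 0 (.load 15 0)) .skip)

/-- Once a passing candidate has been met, cell `16 0` holds a passing one, namely the latest. What
it contained before does not matter. -/
lemma search_spec (s : Mem × Matrix (Fin N → Fin d) κ ℂ) (hs : Env n m X (s.1 0))
    (hX : gridBase d (blockLen d n) ^ (2 * (d * d)) ≤ X) {lo hi : Fin (numBlocks d) → ℕ}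
    (hlo : ∀ β : Fin (numBlocks d), s.1 13 β = lo β) (hhi : ∀ β : Fin (numBlocks d), s.1 14 β = hi β)
    (h : ∃ k < gridBase d (blockLen d n) ^ (2 * (d * d)),
      Passes (approxVec o (precision d (blockLen d n))) (precision d (blockLen d n)) (blockLen d n)
        lo hi (candidate d (blockLen d n) k)) :
    Passes (approxVec o (precision d (blockLen d n))) (precision d (blockLen d n)) (blockLen d n)
        lo hi (candidate d (blockLen d n) ((run B o search s).1 16 0)) := by
  refine run_forLoop B o (P := .ite (checkE d (.load 15 0)) (put 16 0 (.load 15 0)) .skip)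
    (fun i s' => (∃ k < i, Passes (approxVec o (precision d (blockLen d n)))
      (precision d (blockLen d n)) (blockLen d n) lo hi (candidate d (blockLen d n) k)) →
      Passes (approxVec o (precision d (blockLen d n))) (precision d (blockLen d n)) (blockLen d n)
        lo hi (candidate d (blockLen d n) (s'.1 16 0))) s
    (by rw [hs.bound]; exact hX) (by norm_num) (by simp [Prog.writes]) (by simp [Prog.writes])
    ?_ (fun ⟨k, hk, _⟩ => by omega) ?_ h
  · have h0 : s.1.set 15 0 0 0 = s.1 0 := Mem.set_of_ne _ (by norm_num)
    rw [powE_eval, gridBaseE_eval (lenE_eval (h0 ▸ hs))]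
  · rintro i hi' s' ih h15 hfr ⟨k, hk, hp⟩
    have g0 : s'.1 0 = s.1 0 := hfr 0 (by norm_num) (by simp [Prog.writes])
    have g13 : s'.1 13 = s.1 13 := hfr 13 (by norm_num) (by simp [Prog.writes])
    have g14 : s'.1 14 = s.1 14 := hfr 14 (by norm_num) (by simp [Prog.writes])
    have hE : Env n m X (s'.1 0) := g0 ▸ hs
    have hc := checkE_ne_zero (o := o) (M := s'.1) (t := .load 15 0) (k := i) (lenE_eval hE)
      (by rw [eval_load, eval_zero, h15]) (lo := lo) (hi := hi) (by rw [g13]; exact hlo)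
      (by rw [g14]; exact hhi)
    change Passes _ _ _ _ _ (candidate d _ (((run B o _ s').1.set 15 0 (i + 1)) 16 0))
    rw [Mem.set_of_ne _ (by norm_num), run]
    split_ifs with hch
    · rw [run_put _ _ _ _ _ _ (by rw [eval_load, eval_zero, h15, hE.bound]; omega)]
      simp only [Mem.set_apply, eval_zero, eval_load, h15, and_self, if_true]
      exact hc.mp hch
    · refine ih ⟨k, ?_, hp⟩
      rcases Nat.lt_succ_iff_lt_or_eq.mp hk with h | h
      · exact h
      · subst h; exact absurd (hc.mpr hp) hch

/-- Writing parts of the estimate does not affect the expressions for the remaining parts, since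
safe expressions do not read the output arrays. -/
lemma Expr.eval_congr_of_safe {K : ℕ} {M M' : Mem} (h : ∀ a, ¬ IsOutput a → M a = M' a) :
    ∀ e : Expr, e.Safe K → e.eval o M = e.eval o M'
  | .lit c, _ => rfl
  | .load a idx, hs => by
      rw [eval_load, eval_load, eval_congr_of_safe h idx hs.2, h a hs.1]
  | .bin f x y, hs => by
      rw [Expr.eval, Expr.eval, eval_congr_of_safe h x hs.1, eval_congr_of_safe h y hs.2]
  | .const i q, hs => by
      obtain ⟨⟨k, hk, rfl⟩, hq⟩ := hs
      rw [eval_const, eval_const, eval_congr_of_safe h q hq]; rfl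

/-! ### Safety of the expressions in the test and in the output. -/

section Safety

variable {K : ℕ} {t : Expr}

lemma safe_gridSizeE : (gridSizeE d).Safe K := by simp [gridSizeE]
lemma safe_gridBaseE : (gridBaseE d).Safe K := ⟨⟨trivial, safe_gridSizeE⟩, trivial⟩
lemma safe_precisionE : (precisionE d).Safe K := by simp [precisionE]

lemma safe_entryE (ht : t.Safe K) (a c : Fin d) : (entryE d t a c).Safe K :=
  ⟨⟨⟨⟨ht, safe_powE safe_gridBaseE _⟩, safe_gridBaseE⟩, safe_gridSizeE⟩,
    ⟨⟨⟨ht, safe_powE safe_gridBaseE _⟩, safe_gridBaseE⟩, safe_gridSizeE⟩⟩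

lemma safe_gramE (ht : t.Safe K) (a b : Fin d) : (gramE d t a b).Safe K :=
  CExpr.safe_sum fun _ => CExpr.safe_mul' (safe_entryE ht _ _) (CExpr.safe_conj (safe_entryE ht _ _))

lemma safe_frobE (ht : t.Safe K) : (frobE d t).Safe K :=
  ZExpr.safe_sum fun _ => ZExpr.safe_sum fun _ => CExpr.safe_normSq (safe_entryE ht _ _)

lemma safe_vecE (β : Fin (numBlocks d)) (a : Fin d) :
    (vecE d β a).Safe (2 * (numBlocks d * d)) := by
  have h : (β : ℕ) * d + a < numBlocks d * d := by
    have h1 : ((β : ℕ) + 1) * d ≤ numBlocks d * d := Nat.mul_le_mul_right d β.2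
    have := a.2
    nlinarith
  exact ⟨⟨⟨⟨_, by omega, rfl⟩, safe_precisionE⟩, safe_precisionE⟩,
    ⟨⟨⟨_, by omega, rfl⟩, safe_precisionE⟩, safe_precisionE⟩⟩

lemma safe_testE (ht : t.Safe (2 * (numBlocks d * d))) (β : Fin (numBlocks d)) :
    (testE d t β).Safe (2 * (numBlocks d * d)) :=
  ZExpr.safe_sum fun _ => CExpr.safe_normSq (CExpr.safe_sum fun _ =>
    CExpr.safe_mul' (CExpr.safe_conj (safe_entryE ht _ _)) (safe_vecE _ _))

lemma safe_checkE (ht : t.Safe (2 * (numBlocks d * d))) :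
    (checkE d t).Safe (2 * (numBlocks d * d)) := by
  have h1 : ∀ a, ¬ IsOutput a → ∀ i : ℕ, (Expr.load a (.lit i)).Safe (2 * (numBlocks d * d)) :=
    fun a ha i => ⟨ha, trivial⟩
  have h13 := h1 13 (by simp [IsOutput])
  have h14 := h1 14 (by simp [IsOutput])
  have hF := ZExpr.safe_mul' (safe_frobE (d := d) ht)
    (ZExpr.safe_of (x := precisionE d * precisionE d) ⟨safe_precisionE, safe_precisionE⟩)
  have hT := fun β => ZExpr.safe_mul' (ZExpr.safe_of (x := 4 * lenE d) ⟨trivial, safe_lenE⟩)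
    (safe_testE ht β)
  refine ⟨safe_leE (ZExpr.safe_of trivial) (safe_frobE ht), safe_prodE fun x hx => ?_⟩
  obtain ⟨β, rfl⟩ := List.mem_ofFn.mp hx
  refine ⟨⟨⟨trivial, h13 β⟩, safe_leE (ZExpr.safe_mul' (ZExpr.safe_of ⟨⟨trivial, h13 β⟩, trivial⟩) hF)
    (hT β)⟩, ⟨⟨h14 β, safe_lenE⟩, safe_leE (hT β) (ZExpr.safe_mul' ⟨⟨trivial, h14 β⟩, trivial⟩ hF)⟩⟩

end Safety

/-- Write one entry of the estimate. -/
def outputEntry (p : Fin d × Fin d) : Prog d :=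
  .seq (.assign 3 (.lit ((p.1 : ℕ) * d + p.2)) (gramE d (.load 16 0) p.1 p.2).re.pos)
    (.seq (.assign 4 (.lit ((p.1 : ℕ) * d + p.2)) (gramE d (.load 16 0) p.1 p.2).re.neg)
      (.seq (.assign 5 (.lit ((p.1 : ℕ) * d + p.2)) (gramE d (.load 16 0) p.1 p.2).im.pos)
        (.assign 6 (.lit ((p.1 : ℕ) * d + p.2)) (gramE d (.load 16 0) p.1 p.2).im.neg)))

/-- Write the estimate. -/
def output : Prog d :=
  .seq (seqAll outputEntry ((List.finRange d).product (List.finRange d)))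
    (.assign 7 0 ((frobE d (.load 16 0)).pos - (frobE d (.load 16 0)).neg))

lemma writes_outputEntry (p : Fin d × Fin d) {a : ℕ} (h : ¬ IsOutput a) :
    a ∉ (outputEntry p).writes := by
  unfold IsOutput at h
  simp [outputEntry, Prog.writes]
  omega

/-- The trace of `A A†` is the integer `frobSq A`, which serves as the common denominator; the
entries of `A A†` are the numerators. -/
lemma estimate_output (s : Mem × Matrix (Fin N → Fin d) κ ℂ) (hs : Env n m X (s.1 0)) :
    estimate d (run B o output s).1 = normalize (candidate d (blockLen d n) (s.1 16 0)) := by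
  set A := candidate d (blockLen d n) (s.1 16 0) with hA
  have hidx : ∀ p p' : Fin d × Fin d, (p.1 : ℕ) * d + p.2 = (p'.1 : ℕ) * d + p'.2 → p = p' := by
    intro p p' h
    have := finProdFinEquiv.injective (a₁ := p) (a₂ := p')
      (Fin.ext (by simp only [finProdFinEquiv_apply_val]; rw [mul_comm d, mul_comm d]; omega))
    exact this
  have hrun : ∀ (p : Fin d × Fin d) (s' : Mem × Matrix (Fin N → Fin d) κ ℂ),
      (∀ a, ¬ IsOutput a → s'.1 a = s.1 a) →
      run B o (outputEntry p) s' =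
        ((((s'.1.set 3 ((p.1 : ℕ) * d + p.2) ((gramE d (.load 16 0) p.1 p.2).re.pos.eval o s.1)).set 4
          ((p.1 : ℕ) * d + p.2) ((gramE d (.load 16 0) p.1 p.2).re.neg.eval o s.1)).set 5
          ((p.1 : ℕ) * d + p.2) ((gramE d (.load 16 0) p.1 p.2).im.pos.eval o s.1)).set 6
          ((p.1 : ℕ) * d + p.2) ((gramE d (.load 16 0) p.1 p.2).im.neg.eval o s.1), s'.2) := by
    intro p s' h
    have hg := safe_gramE (d := d) (K := 0) (t := .load 16 0) (by simp [IsOutput]) p.1 p.2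
    have key : ∀ (M : Mem), (∀ a, ¬ IsOutput a → M a = s.1 a) → ∀ e : Expr, e.Safe 0 →
        e.eval o M = e.eval o s.1 := fun M hM e he => Expr.eval_congr_of_safe o hM e he
    have hset : ∀ (M : Mem) (a i v : ℕ), IsOutput a → (∀ a, ¬ IsOutput a → M a = s.1 a) →
        ∀ a', ¬ IsOutput a' → M.set a i v a' = s.1 a' := by
      intro M a i v ha hM a' ha'
      have hne : a' ≠ a := by rintro rfl; exact ha' ha
      rw [Mem.set_of_ne _ hne, hM a' ha']
    have o3 : IsOutput 3 := by simp [IsOutput]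
    have o4 : IsOutput 4 := by simp [IsOutput]
    have o5 : IsOutput 5 := by simp [IsOutput]
    simp only [outputEntry, run, eval_lit]
    rw [key _ h _ hg.1.1, key _ (hset _ 3 _ _ o3 h) _ hg.1.2,
      key _ (hset _ 4 _ _ o4 (hset _ 3 _ _ o3 h)) _ hg.2.1,
      key _ (hset _ 5 _ _ o5 (hset _ 4 _ _ o4 (hset _ 3 _ _ o3 h))) _ hg.2.2]
  have h1 := run_seqAll B o (P := outputEntry)
    (fun s' => ∀ a, ¬ IsOutput a → s'.1 a = s.1 a)
    (fun p s' => s'.1 3 ((p.1 : ℕ) * d + p.2) = (gramE d (.load 16 0) p.1 p.2).re.pos.eval o s.1 ∧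
      s'.1 4 ((p.1 : ℕ) * d + p.2) = (gramE d (.load 16 0) p.1 p.2).re.neg.eval o s.1 ∧
      s'.1 5 ((p.1 : ℕ) * d + p.2) = (gramE d (.load 16 0) p.1 p.2).im.pos.eval o s.1 ∧
      s'.1 6 ((p.1 : ℕ) * d + p.2) = (gramE d (.load 16 0) p.1 p.2).im.neg.eval o s.1)
    ?_ ?_ ?_ ((List.finRange d).product (List.finRange d)) s (fun _ _ => rfl)
  · obtain ⟨hI, hQ⟩ := h1
    have hlen := lenE_eval (d := d) (o := o) hs
    have hload : (Expr.load 16 0).eval o s.1 = s.1 16 0 := rfl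
    have hF := safe_frobE (d := d) (K := 0) (t := .load 16 0) (by simp [IsOutput])
    have hFv := frobE_val hlen hload
    have hF0 : 0 ≤ frobSq A :=
      Finset.sum_nonneg fun _ _ => Finset.sum_nonneg fun _ _ => Complex.normSq_nonneg _
    rw [← hA, ZExpr.val] at hFv
    -- The squared norm is nonnegative, so the truncated subtraction that computes the denominator
    -- is exact.
    have hle : (frobE d (.load 16 0)).neg.eval o s.1 ≤ (frobE d (.load 16 0)).pos.eval o s.1 := by
      have : ((frobE d (.load 16 0)).neg.eval o s.1 : ℝ) ≤ (frobE d (.load 16 0)).pos.eval o s.1 := by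
        linarith
      exact_mod_cast this
    have hden : ((((frobE d (.load 16 0)).pos - (frobE d (.load 16 0)).neg).eval o
        (run B o (seqAll outputEntry ((List.finRange d).product (List.finRange d))) s).1 : ℕ) : ℂ) =
        (frobSq A : ℂ) := by
      rw [eval_sub, Expr.eval_congr_of_safe o hI _ hF.1, Expr.eval_congr_of_safe o hI _ hF.2,
        Nat.cast_sub hle, ← hFv]
      push_cast; rfl
    ext a c
    obtain ⟨q3, q4, q5, q6⟩ := hQ (a, c)
      (Or.inl (List.mem_product.mpr ⟨List.mem_finRange a, List.mem_finRange c⟩))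
    simp only [output, run, estimate, Matrix.of_apply, eval_zero]
    rw [Mem.set_of_ne _ (by norm_num), Mem.set_of_ne _ (by norm_num), Mem.set_of_ne _ (by norm_num),
      Mem.set_of_ne _ (by norm_num), Mem.set_apply, if_pos ⟨rfl, rfl⟩, hden, q3, q4, q5, q6,
      normalize, Matrix.smul_apply, ← gramE_val hlen hload a c, smul_eq_mul, Complex.ofReal_inv,
      inv_mul_eq_div]
    congr 1
    apply Complex.ext <;> simp [CExpr.val, ZExpr.val]
  · intro p s' h a ha
    rw [run_frame B o _ (writes_outputEntry p ha), h a ha]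
  · intro p s' h
    rw [hrun p s' h]
    simp [Mem.set_apply]
  · intro p p' hp s' h hq
    rw [hrun p' s' h]
    have hne : (p.1 : ℕ) * d + p.2 ≠ (p'.1 : ℕ) * d + p'.2 := fun h => hp (hidx _ _ h).symm
    simpa [Mem.set_apply, hne] using hq

end

/-! ### The program -/

/-- Compute the estimate from the measured bins. -/
def estimateProg {d : ℕ} : Prog d := .seq binEnds (.seq search output)

/-- Measure all blocks, and compute the estimate. -/
def measureProg {e : ℕ} : Prog (e + 2) :=
  .seq rankTables (.seq (measureBlocks (List.finRange _)) estimateProg)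

/-! ### What the classical parts of the program leave unchanged. -/

lemma det_rankTables {d : ℕ} : (rankTables : Prog d).Det :=
  det_seqAll (fun β => by simp [rankProg, Prog.Det]) _

lemma det_estimateProg {d : ℕ} : (estimateProg : Prog d).Det := by
  refine ⟨det_seqAll (fun β => ?_) _, ?_, det_seqAll (fun p => ?_) _, trivial⟩
  · simp [countBelow, Prog.Det]
  · simp [search, Prog.Det]
  · simp [outputEntry, Prog.Det]

lemma classical_rankTables {d : ℕ} : (rankTables : Prog d).Classical :=
  classical_seqAll (fun β => by simp [rankProg, Prog.Classical]) _

lemma classical_estimateProg {d : ℕ} : (estimateProg : Prog d).Classical := by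
  refine ⟨classical_seqAll (fun β => ?_) _, ?_, classical_seqAll (fun p => ?_) _, trivial⟩
  · simp [countBelow, Prog.Classical]
  · simp [search, Prog.Classical]
  · simp [outputEntry, Prog.Classical]

lemma writes_rankTables {d a : ℕ} (h : a < 9) : a ∉ (rankTables : Prog d).writes :=
  notMem_writes_seqAll (fun β => by simp [rankProg, Prog.writes]; omega) _

lemma writes_binEnds {d a : ℕ} (h9 : a ≠ 9) (h13 : a ≠ 13) (h14 : a ≠ 14) :
    a ∉ (binEnds : Prog d).writes :=
  notMem_writes_seqAll (fun β => by simp [Prog.writes, writes_countBelow, h9, h13, h14]) _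

lemma writes_search {d a : ℕ} (h15 : a ≠ 15) (h16 : a ≠ 16) : a ∉ (search : Prog d).writes := by
  simp [search, Prog.writes, h15, h16]

lemma writes_estimateProg {d a : ℕ} (h : a < 3) : a ∉ (estimateProg : Prog d).writes := by
  have h1 := writes_binEnds (d := d) (a := a) (by omega) (by omega) (by omega)
  have h2 := writes_search (d := d) (a := a) (by omega) (by omega)
  have h3 : a ∉ (seqAll (outputEntry (d := d)) ((List.finRange d).product (List.finRange d))).writes :=
    notMem_writes_seqAll (fun p => writes_outputEntry p (by unfold IsOutput; omega)) _
  simp only [estimateProg, output, Prog.writes, Finset.mem_union, not_or, Finset.mem_singleton]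
  exact ⟨h1, h2, h3, by omega⟩

section Program

variable {e n w m X : ℕ} (B : TomographyBasis (e + 2)) (o : ℕ → ℕ → ℕ)

/-- The memory cells are large enough. -/
structure BigEnough (d n m X : ℕ) : Prop where
  len : blockLen d n + 1 ≤ X
  cuts : m - 1 + 1 ≤ X
  draws : numBlocks d * (m - 1) ≤ X
  grid : gridBase d (blockLen d n) ^ (2 * (d * d)) ≤ X

/-- The rank tables and the estimate are computed by deterministic classical programs, which change
neither probabilities nor the quantum state. So the quantum action is that of `measureBlocks`. -/
theorem measureProg_spec (c : Branch (e + 2) (n + w)) (hE : Env n m X (c.mem 0))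
    (hX : BigEnough (e + 2) n m X) (hw : flag (e + 2) n (m - 1) < w) (hop : c.op = 1)
    (b : Cuts (e + 2) n (m - 1))
    (hb : ∀ (β : Fin (numBlocks (e + 2))) (i : Fin (m - 1)), c.mem 1 ((β : ℕ) * (m - 1) + i) = b β i) :
    (∀ c' ∈ exec B o measureProg c, ∃ A', c'.op * emb w 0 (1 : Op (e + 2) n) = emb w 0 A') ∧
    (∀ (j : Outcomes (e + 2) (m - 1)) (Y : Op (e + 2) n),
      branchSum B o measureProg c (fun c' => if ∀ β : Fin (numBlocks (e + 2)), c'.mem 2 β = j β then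
        (c'.prob : ℂ) • sandwich (amp 0 c') Y else 0) =
      (c.prob : ℂ) • sandwich (outcomeProj B b j) Y) ∧
    (Approximates o B → ∀ (j : Outcomes (e + 2) (m - 1)) (s : ℝ)
      (ρ : Matrix (Fin (e + 2)) (Fin (e + 2)) ℂ), IsState ρ → Success B s ρ b j →
      ∀ c' ∈ exec B o measureProg c, (∀ β : Fin (numBlocks (e + 2)), c'.mem 2 β = j β) →
        SolvesSDP B b j (estimate (e + 2) c'.mem)) := by
  set J := emb w 0 (1 : Op (e + 2) n) with hJ
  obtain ⟨c1, h1, p1, r1⟩ := exec_det B o J rankTables det_rankTables c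
  have op1 : c1.op * J = J := by
    have := congrArg Prod.snd r1
    rw [run_classical B o _ classical_rankTables, hop, Matrix.one_mul] at this
    exact this
  have hm1 : ∀ a < 9, c1.mem a = c.mem a := fun a ha =>
    exec_frame B o _ (writes_rankTables ha) c c1 (by rw [h1]; simp)
  have hE1 : Env n m X (c1.mem 0) := by rw [hm1 0 (by norm_num)]; exact hE
  have ht1 : ∀ (β : Fin (numBlocks (e + 2))), ∀ t < blockLen (e + 2) n + 1,
      c1.mem (20 + β) t = rank (b β) t := by
    intro β t ht
    have := rankTables_spec B o (c.mem, c.op * J) hE hX.len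
      ((Nat.le_succ _).trans hX.cuts) β t ht
    rw [← r1] at this
    exact this.trans (rankIn_eq_rank hb β t)
  obtain ⟨k1, k2⟩ := measureBlocks_spec B o b c1 hE1 hX.len hX.cuts hw ht1
    (A := 1) op1 (List.finRange _) (List.nodup_finRange _)
  have hpost : ∀ c2 : Branch (e + 2) (n + w), ∃ c3, exec B o estimateProg c2 = [c3] ∧
      c3.prob = c2.prob ∧ c3.op * J = c2.op * J ∧ c3.mem 2 = c2.mem 2 ∧
        c3.mem = (run B o estimateProg (c2.mem, c2.op * J)).1 := by
    intro c2
    obtain ⟨c3, h3, p3, r3⟩ := exec_det B o J estimateProg det_estimateProg c2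
    refine ⟨c3, h3, p3, ?_, ?_, congrArg Prod.fst r3⟩
    · have := congrArg Prod.snd r3
      rw [run_classical B o _ classical_estimateProg] at this
      exact this
    · exact exec_frame B o _ (writes_estimateProg (by norm_num)) c2 c3 (by rw [h3]; simp)
  have hexec : ∀ c' ∈ exec B o measureProg c, ∃ c2 ∈ exec B o (measureBlocks (List.finRange _)) c1,
      c' ∈ exec B o estimateProg c2 := by
    intro c' hc'
    rw [measureProg, exec, h1] at hc'
    simp only [List.flatMap_cons, List.flatMap_nil, List.append_nil] at hc'
    rw [exec, List.mem_flatMap] at hc'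
    exact hc'
  refine ⟨fun c' hc' => ?_, fun j Y => ?_, fun ho j s ρ hρ hs c' hc' hj => ?_⟩
  · obtain ⟨c2, hc2, hc'⟩ := hexec c' hc'
    obtain ⟨c3, h3, -, h4, -⟩ := hpost c2
    rw [h3, List.mem_singleton] at hc'
    rw [hc', h4]
    exact k1 c2 hc2
  · rw [measureProg, branchSum_seq, branchSum_of_exec_eq h1, branchSum_seq, ← p1]
    have := k2 j Y
    rw [Matrix.mul_one] at this
    rw [outcomeProj, ← this]
    refine branchSum_congr fun c2 _ => ?_
    obtain ⟨c3, h3, p3, o3, m3, -⟩ := hpost c2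
    rw [branchSum_of_exec_eq h3, m3, p3, amp, ← hJ, o3, hJ, ← amp]
    simp
  · obtain ⟨c2, hc2, hc'⟩ := hexec c' hc'
    obtain ⟨c3, h3, -, -, m3, r3⟩ := hpost c2
    rw [h3, List.mem_singleton] at hc'
    subst hc'
    have fr2 : ∀ a, a ≠ 2 → a ≠ 9 → a ≠ 10 → a ≠ 12 → c2.mem a = c1.mem a := fun a g1 g2 g3 g4 =>
      exec_frame B o _ (writes_measureBlocks g1 g2 g3 g4 _) c1 c2 hc2
    have hE2 : Env n m X (c2.mem 0) := by
      rw [fr2 0 (by norm_num) (by norm_num) (by norm_num) (by norm_num)]; exact hE1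
    rw [r3, estimateProg, run, run]
    set s2 : Mem × Matrix (Fin (n + w) → Fin (e + 2)) (Fin n → Fin (e + 2)) ℂ := (c2.mem, c2.op * J)
    have hends := binEnds_spec B o s2 hE2 hX.len b j
      (fun β t ht => by
        rw [← ht1 β t ht]
        exact congrFun (fr2 _ (by omega) (by omega) (by omega) (by omega)) t)
      (fun β => by rw [← hj β, m3])
    set s3 := run B o binEnds s2 with hs3
    have hE3 : Env n m X (s3.1 0) := by
      rw [hs3, run_frame B o _ (writes_binEnds (by norm_num) (by norm_num) (by norm_num))]; exact hE2
    have hl2 := two_le_of_success (by omega) hs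
    -- Success guarantees that some candidate passes; whichever passing one is found is a solution.
    have hsearch := search_spec B o s3 hE3 hX.grid (fun β => (hends β).1) (fun β => (hends β).2) (by
      obtain ⟨R, hR, hpass⟩ := exists_passes (by omega) ho hρ hs
      obtain ⟨k, hk, hkR⟩ := exists_candidate R hR (blockLen (e + 2) n)
      exact ⟨k, hk, by rw [hkR]; exact hpass⟩)
    set s4 := run B o search s3 with hs4
    have hE4 : Env n m X (s4.1 0) := by
      rw [hs4, run_frame B o _ (writes_search (by norm_num) (by norm_num))]; exact hE3
    rw [estimate_output B o s4 hE4]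
    exact solvesSDP_of_passes (by omega) ho (by omega) hsearch

end Program

/-- Gentle tomography, once the bound for the memory cells is computed. -/
def tomographyProg {e : ℕ} : Prog (e + 2) := .seq drawCuts measureProg

lemma card_cuts (d n r : ℕ) : Fintype.card (Cuts d n r) = (blockLen d n + 1) ^ (numBlocks d * r) := by
  simp only [Cuts, Fintype.card_fun, Fintype.card_fin]
  rw [← pow_mul, mul_comm]

/-- The cut points are drawn by a single loop over `numBlocks d * r` cells; this passes between that
numbering and pairs of block and cut point. -/
lemma exists_flat_cuts {d n r : ℕ} (b : Cuts d n r) :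
    ∃ g : ℕ → ℕ, (∀ i < numBlocks d * r, g i ≤ blockLen d n) ∧ ∀ f : ℕ → ℕ,
      (∀ i < numBlocks d * r, f i = g i) ↔
        ∀ (β : Fin (numBlocks d)) (i : Fin r), f ((β : ℕ) * r + i) = b β i := by
  let q : ∀ i : ℕ, i < numBlocks d * r → Fin (numBlocks d) × Fin r := fun i hi =>
    finProdFinEquiv.symm ⟨i, hi⟩
  have hq : ∀ (i : ℕ) (hi : i < numBlocks d * r), ((q i hi).1 : ℕ) * r + (q i hi).2 = i := by
    intro i hi
    have := congrArg Fin.val (finProdFinEquiv.apply_symm_apply (⟨i, hi⟩ : Fin (numBlocks d * r)))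
    rw [finProdFinEquiv_apply_val] at this
    change ((q i hi).2 : ℕ) + r * (q i hi).1 = i at this
    rw [mul_comm]; omega
  have hlt : ∀ (β : Fin (numBlocks d)) (i : Fin r), (β : ℕ) * r + i < numBlocks d * r := by
    intro β i
    have h1 : ((β : ℕ) + 1) * r ≤ numBlocks d * r := Nat.mul_le_mul_right r β.2
    have := i.2
    nlinarith
  refine ⟨fun i => if hi : i < numBlocks d * r then b (q i hi).1 (q i hi).2 else 0,
    fun i hi => ?_, fun f => ⟨fun h β i => ?_, fun h i hi => ?_⟩⟩
  · simp only [hi, dif_pos]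
    exact Nat.lt_succ_iff.mp (b _ _).2
  · rw [h _ (hlt β i)]
    dsimp only
    rw [dif_pos (hlt β i)]
    have : q _ (hlt β i) = (β, i) := by
      rw [Equiv.symm_apply_eq]
      ext
      rw [finProdFinEquiv_apply_val]
      simp only
      rw [mul_comm]; omega
    rw [this]
  · dsimp only
    rw [dif_pos hi, ← h, hq]

section

variable {e n w m X : ℕ} (B : TomographyBasis (e + 2)) (o : ℕ → ℕ → ℕ)

lemma withWork_sum_smul {d : ℕ} (L : List (ℂ × Op d n)) :
    (L.map fun p => p.1 • withWork w p.2).sum = withWork w (L.map fun p => p.1 • p.2).sum := by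
  have hz : withWork w (0 : Op d n) = 0 := by
    ext x y; simp [withWork]
  have ha : ∀ (z : ℂ) (A C : Op d n), z • withWork w A + withWork w C = withWork w (z • A + C) := by
    intro z A C
    ext x y
    simp only [withWork, Matrix.add_apply, Matrix.smul_apply, Matrix.of_apply]
    split_ifs <;> simp
  induction L with
  | nil => simp [hz]
  | cons p L ih => simp only [List.map_cons, List.sum_cons, ih, ha]

lemma withWork_smul {d : ℕ} (z : ℂ) (A : Op d n) : withWork w (z • A) = z • withWork w A := by
  have := withWork_sum_smul (w := w) [(z, A)]
  simpa using this.symm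

lemma sum_map_filter_ite {α V : Type*} [AddCommMonoid V] (L : List α) (p : α → Prop)
    [DecidablePred p] (f : α → V) :
    ((L.filter fun a => p a).map f).sum = (L.map fun a => if p a then f a else 0).sum := by
  induction L with
  | nil => rfl
  | cons a L ih =>
    by_cases h : p a <;> simp [h, ih]

open Classical in
-- Array `1` is final after the draws, so a report splits into the cut points, settled by
-- `drawCuts`, and the bins, settled by `measureProg`.
theorem tomographyProg_spec (c : Branch (e + 2) (n + w)) (hE : Env n m X (c.mem 0))
    (hX : BigEnough (e + 2) n m X) (hw : flag (e + 2) n (m - 1) < w) (hop : c.op = 1)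
    (hprob : c.prob = 1) (b : Cuts (e + 2) n (m - 1)) (j : Outcomes (e + 2) (m - 1)) :
    (∀ Y : Op (e + 2) n,
      (((exec B o tomographyProg c).filter fun c => Reports c.mem b j).map fun c =>
        (c.prob : ℂ) • (c.op * withWork w Y * c.opᴴ)).sum =
      (1 / (Fintype.card (Cuts (e + 2) n (m - 1)) : ℂ)) •
        withWork w (outcomeProj B b j * Y * (outcomeProj B b j)ᴴ)) ∧
    (Approximates o B → ∀ (s : ℝ) (ρ : Matrix (Fin (e + 2)) (Fin (e + 2)) ℂ), IsState ρ →
      Success B s ρ b j → ∀ c' ∈ exec B o tomographyProg c, Reports c'.mem b j →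
        SolvesSDP B b j (estimate (e + 2) c'.mem)) := by
  obtain ⟨g, hg, hgb⟩ := exists_flat_cuts b
  have hdraw := fun F : Op (e + 2) n => drawCuts_spec B o c hE
    ((Nat.le_succ _).trans hX.len) hX.draws g hg F
  have hE1 : ∀ c1 ∈ exec B o drawCuts c, Env n m X (c1.mem 0) := fun c1 hc1 => by
    rw [exec_frame B o _ (by simp [drawCuts, Prog.writes]) c c1 hc1]; exact hE
  have hop1 : ∀ c1 ∈ exec B o drawCuts c, c1.op = 1 := fun c1 hc1 => by
    rw [(hdraw 0).1 c1 hc1, hop]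
  have hw1 : 1 ∉ (measureProg : Prog (e + 2)).writes := by
    have h1 := writes_rankTables (d := e + 2) (a := 1) (by norm_num)
    have h2 := writes_measureBlocks (e := e) (a := 1) (by norm_num) (by norm_num) (by norm_num)
      (by norm_num) (List.finRange _)
    have h3 := writes_estimateProg (d := e + 2) (a := 1) (by norm_num)
    simp only [measureProg, Prog.writes, Finset.mem_union, not_or]
    exact ⟨h1, h2, h3⟩
  have hrep : ∀ c1 ∈ exec B o drawCuts c, ∀ c' ∈ exec B o measureProg c1,
      Reports c'.mem b j ↔ (∀ (β : Fin (numBlocks (e + 2))) (i : Fin (m - 1)),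
        c1.mem 1 ((β : ℕ) * (m - 1) + i) = b β i) ∧
          ∀ β : Fin (numBlocks (e + 2)), c'.mem 2 β = j β := by
    intro c1 hc1 c' hc'
    rw [Reports, exec_frame B o _ hw1 c1 c' hc']
  have hexec : ∀ c' ∈ exec B o tomographyProg c, ∃ c1 ∈ exec B o drawCuts c,
      c' ∈ exec B o measureProg c1 := by
    intro c' hc'
    rwa [tomographyProg, exec, List.mem_flatMap] at hc'
  refine ⟨fun Y => ?_, fun ho s ρ hρ hs c' hc' hr => ?_⟩
  -- A reporting branch returns the work qudits to `0`, so its action is determined by `amp 0` and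
  -- the sum can be taken on the system alone.
  · have hclean : ∀ c' ∈ exec B o tomographyProg c, Reports c'.mem b j →
        c'.op * withWork w Y * c'.opᴴ = withWork w (sandwich (amp 0 c') Y) := by
      intro c' hc' hr
      obtain ⟨c1, hc1, hc'⟩ := hexec c' hc'
      obtain ⟨A', hA'⟩ := (measureProg_spec B o c1 (hE1 c1 hc1) hX hw (hop1 c1 hc1) b
        ((hrep c1 hc1 c' hc').mp hr).1).1 c' hc'
      rw [amp_of_clean hA', withWork_eq, withWork_eq, sandwich]
      have h1 : emb w 0 A' = emb w 0 (1 : Op (e + 2) n) * A' := by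
        rw [← emb_mul, Matrix.one_mul]
      calc _ = (c'.op * emb w 0 (1 : Op (e + 2) n)) * Y *
            (c'.op * emb w 0 (1 : Op (e + 2) n))ᴴ := by
            simp only [Matrix.conjTranspose_mul, Matrix.mul_assoc]
        _ = _ := by
            rw [hA', h1]
            simp only [Matrix.conjTranspose_mul, Matrix.mul_assoc]
    have hmain : branchSum B o tomographyProg c (fun c' => if Reports c'.mem b j then
        (c'.prob : ℂ) • sandwich (amp 0 c') Y else 0) =
        (1 / (Fintype.card (Cuts (e + 2) n (m - 1)) : ℂ)) • sandwich (outcomeProj B b j) Y := by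
      rw [tomographyProg, branchSum_seq]
      have := (hdraw (sandwich (outcomeProj B b j) Y)).2
      rw [hprob] at this
      rw [card_cuts]
      push_cast
      rw [Complex.ofReal_one] at this
      rw [← this]
      refine branchSum_congr fun c1 hc1 => ?_
      by_cases h : ∀ (β : Fin (numBlocks (e + 2))) (i : Fin (m - 1)),
        c1.mem 1 ((β : ℕ) * (m - 1) + i) = b β i
      · rw [if_pos ((hgb _).mpr h), ← (measureProg_spec B o c1 (hE1 c1 hc1) hX hw (hop1 c1 hc1) b
          h).2.1 j Y]
        refine branchSum_congr fun c' hc' => if_congr ?_ rfl rfl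
        rw [hrep c1 hc1 c' hc']
        exact and_iff_right h
      · rw [if_neg (fun h2 => h ((hgb _).mp h2))]
        have h3 : branchSum B o measureProg c1 (fun c' => if Reports c'.mem b j then
            (c'.prob : ℂ) • sandwich (amp 0 c') Y else 0) =
            branchSum B o measureProg c1 (fun _ => (0 : Op (e + 2) n)) :=
          branchSum_congr fun c' hc' => if_neg fun hr => h ((hrep c1 hc1 c' hc').mp hr).1
        rw [h3]
        simp [branchSum]
    rw [branchSum, ← sum_map_filter_ite] at hmain
    rw [← sandwich, ← withWork_smul, ← hmain]
    have := withWork_sum_smul (w := w)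
      (((exec B o tomographyProg c).filter fun c => Reports c.mem b j).map fun c' =>
        ((c'.prob : ℂ), sandwich (amp 0 c') Y))
    simp only [List.map_map, Function.comp_def] at this
    rw [← this]
    congr 1
    refine List.map_congr_left fun c' hc' => ?_
    rw [List.mem_filter, decide_eq_true_iff] at hc'
    rw [hclean c' hc'.1 hc'.2]
  · obtain ⟨c1, hc1, hc'⟩ := hexec c' hc'
    have h := (hrep c1 hc1 c' hc').mp hr
    exact (measureProg_spec B o c1 (hE1 c1 hc1) hX hw (hop1 c1 hc1) b h.1).2.2 ho j s ρ hρ hs c' hc'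
      h.2

end

/-! ### Resources -/

/-- The bound for the memory cells, as a polynomial of the number of qudits. -/
def sizePoly (d : ℕ) : Polynomial ℕ :=
  .X + 2 + .C (numBlocks d) * .X + .C d + (.C (128 * d) * .X + 1) ^ (2 * (d * d))

/-- The bound for the memory cells. -/
def sizeE (d : ℕ) : Expr :=
  .load 0 0 + 2 + .lit (numBlocks d) * .load 0 0 + .lit d +
    powE (.lit (128 * d) * .load 0 0 + 1) (2 * (d * d))

/-- Gentle tomography. -/
def gentleProg (e : ℕ) : Prog (e + 2) := .seq (.assign 0 2 (sizeE (e + 2))) tomographyProg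

/-- A bound for the running time and for the number of work qudits. -/
def resourcePoly (e : ℕ) : Polynomial ℕ :=
  ((2 : Expr).total + (sizeE (e + 2)).total + (tomographyProg : Prog (e + 2)).timeBound +
    (2 * .X + 3)).comp (sizePoly (e + 2))

lemma safe_sizeE {d K : ℕ} : (sizeE d).Safe K := by
  have h : (powE (.lit (128 * d) * .load 0 0 + 1) (2 * (d * d))).Safe K :=
    safe_powE (by simp [IsOutput]) _
  have h2 : (2 : Expr).Safe K := trivial
  simp [sizeE, h, h2, IsOutput]

lemma sizeE_eval {d n : ℕ} {o : ℕ → ℕ → ℕ} {M : Mem} (h : M 0 0 = n) :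
    (sizeE d).eval o M = (sizePoly d).eval n := by
  simp [sizeE, sizePoly, h]

/-- As `0 < s < 1`, `l ^ s ≤ l`, including `0 ^ s = 0`; hence the number of bins is bounded by `n`,
as clamping requires. -/
lemma numBins_le {s : ℝ} (hs : 0 < s) (hs' : s < 1 / 2) (l : ℕ) : numBins s l ≤ l := by
  rw [numBins, Nat.ceil_le]
  rcases Nat.eq_zero_or_pos l with rfl | hl
  · rw [Nat.cast_zero, Real.zero_rpow hs.ne']
  · calc (l : ℝ) ^ s ≤ (l : ℝ) ^ (1 : ℝ) :=
          Real.rpow_le_rpow_of_exponent_le (by exact_mod_cast hl) (by linarith)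
      _ = l := Real.rpow_one _

lemma blockLen_le_self (d n : ℕ) : blockLen d n ≤ n := Nat.div_le_self _ _

lemma size_ge {d n : ℕ} : n + 2 ≤ (sizePoly d).eval n ∧ numBlocks d * n ≤ (sizePoly d).eval n ∧
    d ≤ (sizePoly d).eval n ∧ (128 * d * n + 1) ^ (2 * (d * d)) ≤ (sizePoly d).eval n := by
  simp only [sizePoly, Polynomial.eval_add, Polynomial.eval_mul, Polynomial.eval_pow,
    Polynomial.eval_C, Polynomial.eval_X, Polynomial.eval_one, Polynomial.eval_ofNat]
  refine ⟨by omega, by omega, by omega, by omega⟩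

lemma bigEnough_size {d n m : ℕ} (hm : m ≤ n) : BigEnough d n m ((sizePoly d).eval n) := by
  obtain ⟨h1, h2, h3, h4⟩ := size_ge (d := d) (n := n)
  have hl := blockLen_le_self d n
  refine ⟨by omega, by omega, ?_, ?_⟩
  · exact (Nat.mul_le_mul_left _ (by omega : m - 1 ≤ n)).trans h2
  · refine (Nat.pow_le_pow_left ?_ _).trans h4
    have : 64 * d * blockLen d n ≤ 64 * d * n := Nat.mul_le_mul_left _ hl
    rw [gridBase, gridSize]
    nlinarith

/-! ### Safety of the whole program. -/

section Safety

variable {d e : ℕ}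

lemma safe_drawCuts {K : ℕ} : (drawCuts : Prog d).Safe K := by
  simp [drawCuts, Prog.Safe, IsOutput]

lemma safe_rankTables {K : ℕ} : (rankTables : Prog d).Safe K :=
  safe_seqAll (fun β => by
    have : 20 + (β : ℕ) ≠ 0 := by omega
    have : ¬ (3 ≤ 20 + (β : ℕ) ∧ 20 + (β : ℕ) ≤ 7) := by omega
    simp [rankProg, Prog.Safe, IsOutput, *]) _

lemma safe_flagBlock {K : ℕ} (β : Fin (numBlocks (e + 2))) : (flagBlock β).Safe K := by
  have h20 : ¬ IsOutput (20 + β) := by unfold IsOutput; omega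
  have h9 : ¬ IsOutput 9 := by simp [IsOutput]
  have h10 : ¬ IsOutput 10 := by simp [IsOutput]
  simp [flagBlock, Prog.Safe, shiftUpStep, shiftDownStep, h20, h9, h10]

lemma safe_readout {K β : ℕ} : (readout β : Prog (e + 2)).Safe K := by
  simp [readout, readStep, Prog.Safe, flagE, IsOutput]

lemma safe_measureBlocks {K : ℕ} : ∀ L : List (Fin (numBlocks (e + 2))), (measureBlocks L).Safe K
  | [] => trivial
  | β :: L => ⟨safe_measureBlocks L, safe_flagBlock β, safe_readout⟩

lemma safe_binEnds {K : ℕ} : (binEnds : Prog d).Safe K :=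
  safe_seqAll (fun β => by
    have h20 : ¬ IsOutput (20 + β) := by unfold IsOutput; omega
    have h2 : ¬ IsOutput 2 := by simp [IsOutput]
    have h9 : ¬ IsOutput 9 := by simp [IsOutput]
    have h13 : ¬ IsOutput 13 := by simp [IsOutput]
    have h14 : ¬ IsOutput 14 := by simp [IsOutput]
    simp [countBelow, Prog.Safe, h20, h2, h9, h13, h14]) _

lemma safe_search : (search : Prog d).Safe (2 * (numBlocks d * d)) := by
  have h15 : (Expr.load 15 0).Safe (2 * (numBlocks d * d)) := by simp [IsOutput]
  have h := safe_checkE h15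
  have h2 := safe_powE (safe_gridBaseE (d := d) (K := 2 * (numBlocks d * d))) (2 * (d * d))
  simp [search, Prog.Safe, h, h2, IsOutput]

lemma safe_output {K : ℕ} : (output : Prog d).Safe K := by
  have h16 : (Expr.load 16 0).Safe K := by simp [IsOutput]
  have hF := safe_frobE (d := d) h16
  refine ⟨safe_seqAll (fun p => ?_) _, ⟨by norm_num, trivial, hF, Or.inl (by simp [IsOutput])⟩⟩
  have hg := safe_gramE (d := d) h16 p.1 p.2
  exact ⟨⟨by norm_num, trivial, hg.1.1, Or.inl (by simp [IsOutput])⟩,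
    ⟨by norm_num, trivial, hg.1.2, Or.inl (by simp [IsOutput])⟩,
    ⟨by norm_num, trivial, hg.2.1, Or.inl (by simp [IsOutput])⟩,
    ⟨by norm_num, trivial, hg.2.2, Or.inl (by simp [IsOutput])⟩⟩

lemma safe_tomographyProg :
    (tomographyProg : Prog (e + 2)).Safe (2 * (numBlocks (e + 2) * (e + 2))) :=
  ⟨safe_drawCuts, safe_rankTables, safe_measureBlocks _, safe_binEnds, safe_search, safe_output⟩

end Safety

/-- The initial assignment of the memory bound cannot be clamped by itself and is therefore not
safe; its cost is added separately to the bound of `exec_time_le`. -/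
theorem performs_gentleProg {e : ℕ} (B : TomographyBasis (e + 2)) {s : ℝ} (hs : 0 < s)
    (hs' : s < 1 / 2) {o : ℕ → ℕ → ℕ} (ho : Approximates o B) (n : ℕ) :
    Performs B s o (gentleProg e) n (numBins s (blockLen (e + 2) n)) ((resourcePoly e).eval n) := by
  set m := numBins s (blockLen (e + 2) n) with hm
  set T := (resourcePoly e).eval n with hT
  set x := (sizePoly (e + 2)).eval n with hx
  have hmn : m ≤ n := (numBins_le hs hs' _).trans (blockLen_le_self _ _)
  obtain ⟨g1, g2, g3, g4⟩ := size_ge (d := e + 2) (n := n)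
  rw [← hx] at g1 g2 g3 g4
  have hTx : T = (2 : Expr).total.eval x + (sizeE (e + 2)).total.eval x +
      (tomographyProg : Prog (e + 2)).timeBound.eval x + (2 * x + 3) := by
    simp only [hT, resourcePoly, Polynomial.eval_comp, Polynomial.eval_add, Polynomial.eval_mul,
      Polynomial.eval_X, Polynomial.eval_ofNat, ← hx]
  -- The summand `2 x + 3` in `T` provides enough work qudits for the counter and the flags.
  have hw : flag (e + 2) n (m - 1) < T := by
    have := blockLen_le_self (e + 2) n
    unfold flag
    omega
  set c0 : Branch (e + 2) (n + T) := start (e + 2) (n + T) n m with hc0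
  have hsz : (sizeE (e + 2)).eval o c0.mem = x := sizeE_eval rfl
  set c : Branch (e + 2) (n + T) := (c0.write 0 2 x).tick ((2 : Expr).cost o c0.mem +
    (sizeE (e + 2)).cost o c0.mem + bits 2 + bits x) with hc
  have hexec : exec B o (gentleProg e) c0 = exec B o tomographyProg c := by
    rw [gentleProg, exec, exec]
    simp only [hsz, eval_two, List.flatMap_cons, List.flatMap_nil, List.append_nil, hc]
  have hmem : ∀ a i, c.mem a i = if a = 0 ∧ i = 2 then x else c0.mem a i := fun a i =>
    Mem.set_apply _ _ _ _ _ _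
  have hE : Env n m x (c.mem 0) := ⟨by rw [hmem]; simp [hc0, start], by rw [hmem]; simp [hc0, start],
    by rw [hmem]; simp⟩
  -- The inputs `n` and `m ≤ n` are below the bound from the beginning.
  have hM0 : MemBounded x c0.mem := by
    intro a i _
    simp only [hc0, start]
    split_ifs <;> omega
  have hM : MemBounded x c.mem := by
    intro a i ha
    rw [hmem]
    split_ifs
    · exact le_rfl
    · exact hM0 a i ha
  have hcb := ho.constsBounded
  have hspec := tomographyProg_spec B o c hE (bigEnough_size hmn) hw rfl rfl
  refine ⟨fun c' hc' => ?_, fun b j Y => ?_, fun b j ρ hρ hsu c' hc' hr _ => ?_⟩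
  · rw [hexec] at hc'
    obtain ⟨-, -, h⟩ := exec_time_le B hcb g3 _ safe_tomographyProg c hM hE.bound c' hc'
    have h1 := Expr.total_le hcb hM0 (e := 2) trivial
    have h2 := Expr.total_le hcb hM0 (e := sizeE (e + 2)) safe_sizeE
    rw [hsz] at h2
    rw [eval_two] at h1
    have h3 : c.time = (2 : Expr).cost o c0.mem + (sizeE (e + 2)).cost o c0.mem + bits 2 + bits x := by
      simp [hc, hc0, start]
    omega
  · rw [hexec]
    convert (hspec b j).1 Y
  · rw [hexec] at hc'
    exact (hspec b j).2 ho s ρ hρ hsu c' hc' hr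

end GentleTomography

end

theorem proposition2 (d : ℕ) (hd : 2 ≤ d) (s : ℝ) (hs : 0 < s) (hs' : s < 1 / 2) :
    ∃ (C : ℝ) (p : Polynomial ℕ), 0 < C ∧ ∀ B : GentleTomography.TomographyBasis d,
      (∃ P : GentleTomography.Prog d,
        ∀ o : ℕ → ℕ → ℕ, GentleTomography.Approximates o B →
        ∀ n : ℕ, GentleTomography.Performs B s o P n
          (GentleTomography.numBins s (GentleTomography.blockLen d n)) (p.eval n)) ∧
      ∀ n : ℕ, 2 ≤ n → ∀ ρ : Matrix (Fin d) (Fin d) ℂ, GentleTomography.IsState ρ →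
        GentleTomography.failureProb B s n
            (GentleTomography.numBins s (GentleTomography.blockLen d n) - 1) ρ
          ≤ C * ((n : ℝ) ^ (s - 1 / 2) * Real.log n) ∧
        ∀ (b : GentleTomography.Cuts d n
              (GentleTomography.numBins s (GentleTomography.blockLen d n) - 1))
          (j : GentleTomography.Outcomes d
              (GentleTomography.numBins s (GentleTomography.blockLen d n) - 1)),
          GentleTomography.Success B s ρ b j →
          (∀ (e : ℕ) (Φ : Matrix (Fin n → Fin d) (Fin e) ℂ),
            GentleTomography.IsPurification Φ (GentleTomography.tensorPower ρ n) →
            GentleTomography.disturbance (GentleTomography.outcomeProj B b j) Φ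
              ≤ C * (n : ℝ) ^ (-2 : ℝ)) ∧
          (∃ τ, GentleTomography.SolvesSDP B b j τ) ∧
          ∀ τ, GentleTomography.SolvesSDP B b j τ →
            GentleTomography.traceNorm (ρ - τ) ≤ C * ((n : ℝ) ^ (-s) * Real.log n) := by
  open GentleTomography in
  -- Writing the dimension as `e + 2` provides the digits `0` and `1` of a qudit.
  obtain ⟨e, rfl⟩ := Nat.exists_eq_add_of_le' hd
  set C1 := 2 * (numBlocks (e + 2) : ℝ) ^ 2 * failureConst s
  set C2 := 8 * (numBlocks (e + 2) : ℝ) ^ 3 * Real.exp (4 / 3)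
  set C3 := 2 * ((e + 2 : ℕ) : ℝ) ^ 3 * numBlocks (e + 2)
  have h1 : 0 ≤ C1 := by have := failureConst_pos s; positivity
  have h2 : 0 ≤ C2 := by positivity
  have h3 : 0 ≤ C3 := by positivity
  -- One constant for the three bounds; it and the polynomial are chosen before `B`.
  refine ⟨C1 + C2 + C3 + 1, resourcePoly e, by positivity, fun B =>
    ⟨⟨gentleProg e, fun o ho n => performs_gentleProg B hs hs' ho n⟩, fun n hn ρ hρ => ?_⟩⟩
  have hlog : 0 ≤ Real.log n := Real.log_nonneg (by exact_mod_cast (by omega : 1 ≤ n))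
  refine ⟨(failureProb_le hd B hs hs' hn hρ).trans
    (mul_le_mul_of_nonneg_right (by linarith) (by positivity)), fun b j hsucc =>
    ⟨fun k Φ hΦ => (disturbance_le hd B hρ hsucc hΦ).trans
      (mul_le_mul_of_nonneg_right (by linarith) (by positivity)), ⟨ρ, solvesSDP_self hρ hsucc⟩,
    fun τ hτ => (traceNorm_sub_le hd B hs hs' hρ hsucc hτ).trans
      (mul_le_mul_of_nonneg_right (by linarith) (by positivity))⟩⟩
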